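/- Let $\mathcal C$ be a category with finite limits. We call a morphism $p:Y\to X$ a *cover* if it is an effective descent morphism, i.e. if the pullback functor $p^*:\mathcal C/X\to\mathcal C/Y$ is monadic. **The categories $Prin_{\mathbb C}(X)$.** For an internal category $\mathbb C$ in $\mathcal C$, with object of objects $\mathbb C_0$, let $c\mathbb C$ be its core (the internal groupoid of isomorphisms of $\mathbb C$), let $\mathbb C^{\uparrow}$ be its internal arrow category (objects: arrows of $\mathbb C$; arrows: commuting squares), and let $D_0,D_1:c(\mathbb C^{\uparrow})\to c\mathbb C$ be the domain and codomain functors. For an internal groupoid $\mathbb G$, a *principal $\mathbb G$-bundle* over $X$ is an object $P$ with a cover $P\to X$, an anchor map $P\to\mathbb G_0$ and a (right) action of $\mathbb G$ on $P$ over $X$ such that $(x,g)\mapsto(x,xg)$ is an isomorphism $P\times_{\mathbb G_0}\mathbb G_1\cong P\times_XP$; bundle maps over $X$ are the equivariant maps over $X$ that commute with the anchors. The *cocycle* of $P$ is the internal functor $\psi^P$ from the kernel-pair groupoid $P\times_XP\rightrightarrows P$ of $P\to X$ to $\mathbb G$ sending $(x,y)$ to the unique $g$ with $xg=y$. The principal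 $\mathbb G$-bundle *associated* with an internal functor $\psi:(Y\times_XY\rightrightarrows Y)\to\mathbb G$, for a cover $Y\to X$, is the bundle over $X$ (unique up to unique isomorphism) equipped with a section $s$ over $Y$, anchored by $\psi$ on objects, such that $s(y)\cdot\psi(y,z)=s(z)$. Write $\Sigma_{D_i}P$ for the $c\mathbb C$-bundle associated with $D_i\psi^P$, when $P$ is a principal $c(\mathbb C^\uparrow)$-bundle. - The objects of $Prin_{\mathbb C}(X)$ are the principal $c\mathbb C$-bundles over $X$. - A morphism $P_0\to P_1$ is represented by a principal $c(\mathbb C^{\uparrow})$-bundle $P$ over $X$ with bundle maps $\alpha_0:P_0\to\Sigma_{D_0}P$ and $\alpha_1:\Sigma_{D_1}P\to P_1$. - A 2-cell from $(P,\alpha_0,\alpha_1)$ to $(\tilde P,\tilde\alpha_0,\tilde\alpha_1)$ is a bundle map $\rho:P\to\tilde P$ over $X$ with $\Sigma_{D_0}\rho\circ\alpha_0=\tilde\alpha_0$ and $\tilde\alpha_1\circ\Sigma_{D_1}\rho=\alpha_1$. Two representatives with a 2-cell between them define the same morphism. - The composite of $(P,\alpha_0,\alpha_1):P_0\to P_1$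 and $(P',\alpha_0',\alpha_1'):P_1\to P_2$ is the bundle associated with the cocycle on $P\times_XP_1\times_XP'$ which is, on objects, the composite of $\psi^P\pi_1$, $\gamma$ and $\psi^{P'}\pi_3$, where $\gamma$ is the component of $\alpha_1$ followed by the inverse of the component of $\alpha'_0$; its structure maps are induced by $\alpha_0$ and $\alpha_1'$. Pulling back along morphisms of $\mathcal C$ makes $X\mapsto Prin_{\mathbb C}(X)$ a pseudo-functor $\mathcal C^{op}\to\mathfrak{CAT}$. A pseudo-functor $M:\mathcal C^{op}\to\mathfrak{CAT}$ is a *lax-geometric stack* if there are an internal category $\mathbb C$ in $\mathcal C$ and a pseudo-natural transformation $M\to Prin_{\mathbb C}(\_)$ all of whose components are equivalences of categories. It is a *stack* if for every cover $p:Y\to X$ the comparison functor from $M(X)$ to the category of objects of $M(Y)$ with descent data along $p$ is an equivalence. **Proposition.** A pseudo-functor $M:\mathcal C^{op}\to\mathfrak{CAT}$ is a lax-geometric stack if and only if it is a stack and there are an object $C_0$ of $\mathcal C$ and an object $C$ of $M(C_0)$ such that (i) for every object $X$ of $\mathcal C$ and every object $A$ of $M(X)$ there are a cover $p_A:Y\to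 X$, a morphism $q_A:Y\to C_0$ and an isomorphism $M(p_A)(A)\cong M(q_A)(C)$; (ii) there are an object $C_1$ of $\mathcal C$ and a bijection $$\mathcal C(X,C_1)\cong\{(f,\theta,g)\mid f,g:X\to C_0,\ \theta:M(f)(C)\to M(g)(C)\}$$ natural in $X$, where $h:Y\to X$ takes $(f,\theta,g)$ to $(fh,M(h)(\theta),gh)$, with $M(h)(\theta)$ transported along the coherence isomorphisms $M(fh)(C)\cong M(h)M(f)(C)$ and $M(h)M(g)(C)\cong M(gh)(C)$. -/

import Mathlib

open CategoryTheory CategoryTheory.Limits Opposite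
open scoped Bicategory

universe v u v₁ u₁ v₂ u₂

noncomputable section

namespace LaxGeometric

variable {𝒞 : Type u} [Category.{v} 𝒞] [HasFiniteLimits 𝒞]

attribute [local simp] pullback.lift_fst pullback.lift_snd pullback.lift_fst_assoc
  pullback.lift_snd_assoc prod.lift_fst prod.lift_snd prod.lift_fst_assoc prod.lift_snd_assoc

/-- A morphism `p : Y ⟶ X` is a cover if it is an effective descent morphism, i.e. if the pullback
functor from the category of objects over `X` to the category of objects over `Y` is monadic. -/
def IsCover {Y X : 𝒞} (p : Y ⟶ X) : Prop :=
  (Monad.comparison (Over.mapPullbackAdj p)).IsEquivalence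

namespace IsCover

/-- The pullback functor along a cover is monadic. -/
abbrev monadic {Y X : 𝒞} {p : Y ⟶ X} (hp : IsCover p) :
    MonadicRightAdjoint (Over.pullback p) where
  L := Over.map p
  adj := Over.mapPullbackAdj p
  eqv := hp

lemma of_beck {Y X : 𝒞} {p : Y ⟶ X}
    (h₁ : ∀ {A B : Over X} (f g : A ⟶ B) [(Over.pullback p).IsSplitPair f g], HasCoequalizer f g)
    (h₂ : ∀ {A B : Over X} (f g : A ⟶ B) [(Over.pullback p).IsSplitPair f g],
      PreservesColimit (parallelPair f g) (Over.pullback p))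
    (h₃ : ∀ {A B : Over X} (f g : A ⟶ B) [(Over.pullback p).IsSplitPair f g],
      ReflectsColimit (parallelPair f g) (Over.pullback p)) : IsCover p := by
  have : Monad.HasCoequalizerOfIsSplitPair (Over.pullback p) := ⟨h₁⟩
  have : Monad.PreservesColimitOfIsSplitPair (Over.pullback p) := ⟨h₂⟩
  have : Monad.ReflectsColimitOfIsSplitPair (Over.pullback p) := ⟨h₃⟩
  exact (Monad.monadicOfHasPreservesReflectsGSplitCoequalizers (Over.mapPullbackAdj p)).eqv

lemma bc_isPullback {X X' Y Y' A : 𝒞} {p : Y ⟶ X} {p' : Y' ⟶ X'} {h : X' ⟶ X} {h' : Y' ⟶ Y}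
    (sq : IsPullback h' p' p h) (a : A ⟶ X') :
    IsPullback (pullback.fst a p') (pullback.snd a p' ≫ h') (a ≫ h) p :=
  (IsPullback.of_hasPullback a p').paste_vert sq.flip

/-- Base change. -/
def bcIso {X X' Y Y' A : 𝒞} {p : Y ⟶ X} {p' : Y' ⟶ X'} {h : X' ⟶ X} {h' : Y' ⟶ Y}
    (sq : IsPullback h' p' p h) (a : A ⟶ X') : pullback a p' ≅ pullback (a ≫ h) p :=
  (bc_isPullback sq a).isoPullback

lemma bcIso_naturality {X X' Y Y' A B : 𝒞} {p : Y ⟶ X} {p' : Y' ⟶ X'} {h : X' ⟶ X} {h' : Y' ⟶ Y}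
    (sq : IsPullback h' p' p h) (a : A ⟶ X') (b : B ⟶ X') (f : A ⟶ B)
    (h₁ : (pullback.fst a p' ≫ f) ≫ b = pullback.snd a p' ≫ p')
    (h₂ : (pullback.fst (a ≫ h) p ≫ f) ≫ b ≫ h = pullback.snd (a ≫ h) p ≫ p) :
    pullback.lift (pullback.fst a p' ≫ f) (pullback.snd a p') h₁ ≫ (bcIso sq b).hom =
      (bcIso sq a).hom ≫
        pullback.lift (pullback.fst (a ≫ h) p ≫ f) (pullback.snd (a ≫ h) p) h₂ := by
  apply pullback.hom_ext <;> simp [bcIso]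

/-- Base change. -/
def bc {X X' Y Y' : 𝒞} {p : Y ⟶ X} {p' : Y' ⟶ X'} {h : X' ⟶ X} {h' : Y' ⟶ Y}
    (sq : IsPullback h' p' p h) :
    Over.pullback p' ⋙ Over.map h' ≅ Over.map h ⋙ Over.pullback p :=
  NatIso.ofComponents (fun A => Over.isoMk (bcIso sq A.hom)
    ((bc_isPullback sq A.hom).isoPullback_hom_snd))
    (fun {A B} f => by
      ext
      exact bcIso_naturality sq A.hom B.hom f.left _ _)

lemma preserves_reflects {Y X : 𝒞} {p : Y ⟶ X} (hp : IsCover p) {A B : Over X} (f g : A ⟶ B)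
    [(Over.pullback p).IsSplitPair f g] :
    HasCoequalizer f g ∧ PreservesColimit (parallelPair f g) (Over.pullback p) ∧
      ReflectsColimit (parallelPair f g) (Over.pullback p) := by
  let _ := hp.monadic
  let _ := Monad.createsGSplitCoequalizersOfMonadic (Over.pullback p) f g
  have : HasColimit (parallelPair f g ⋙ Over.pullback p) := by
    rw [hasColimit_iff_of_iso (diagramIsoParallelPair.{v} _)]
    exact inferInstanceAs <| HasCoequalizer ((Over.pullback p).map f) ((Over.pullback p).map g)
  exact ⟨hasColimit_of_created _ (Over.pullback p), inferInstance, inferInstance⟩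

lemma isSplitPair_of_iso {D₁ D₂ : Type*} [Category D₁] [Category D₂] {F G : D₁ ⥤ D₂} (e : F ≅ G)
    {A B : D₁} (f g : A ⟶ B) [F.IsSplitPair f g] : G.IsSplitPair f g := by
  obtain ⟨Z, π, ⟨s⟩⟩ := HasSplitCoequalizer.splittable (f := F.map f) (g := F.map g)
  refine ⟨Z, e.inv.app B ≫ π, ⟨⟨s.rightSection ≫ e.hom.app B,
    e.inv.app B ≫ s.leftSection ≫ e.hom.app A, ?_, ?_, ?_, ?_⟩⟩⟩
  · simp [s.condition]
  · simp
  · simp only [Category.assoc, ← e.hom.naturality, s.leftSection_bottom_assoc, Iso.inv_hom_id_app]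
  · simp only [Category.assoc, ← e.hom.naturality, s.leftSection_top_assoc]

lemma reflects_of_comp {J D₁ D₂ D₃ : Type*} [Category J] [Category D₁] [Category D₂] [Category D₃]
    (K : J ⥤ D₁) (F : D₁ ⥤ D₂) (G : D₂ ⥤ D₃) [ReflectsColimit K (F ⋙ G)]
    [PreservesColimit (K ⋙ F) G] : ReflectsColimit K F where
  reflects h := ⟨isColimitOfReflects (F ⋙ G) (isColimitOfPreserves G h)⟩

/-- Covers are stable under pullback. -/
lemma of_isPullback {X X' Y Y' : 𝒞} {p : Y ⟶ X} {p' : Y' ⟶ X'} {h : X' ⟶ X} {h' : Y' ⟶ Y}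
    (sq : IsPullback h' p' p h) (hp : IsCover p) : IsCover p' := by
  have key : ∀ {A B : Over X'} (f g : A ⟶ B) [(Over.pullback p').IsSplitPair f g],
      HasCoequalizer f g ∧ PreservesColimit (parallelPair f g) (Over.pullback p') ∧
      ReflectsColimit (parallelPair f g) (Over.pullback p') := by
    intro A B f g _
    have : (Over.pullback p' ⋙ Over.map h').IsSplitPair f g :=
      map_is_split_pair (Over.map h') _ _
    have s := isSplitPair_of_iso (bc sq) f g
    have : (Over.pullback p).IsSplitPair ((Over.map h).map f) ((Over.map h).map g) := s
    obtain ⟨k₁, k₂, k₃⟩ := preserves_reflects hp ((Over.map h).map f) ((Over.map h).map g)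
    let e : parallelPair f g ⋙ Over.map h ≅
      parallelPair ((Over.map h).map f) ((Over.map h).map g) := diagramIsoParallelPair _
    have k₁' : HasColimit (parallelPair f g ⋙ Over.map h) := hasColimit_of_iso e
    have k₂' : PreservesColimit (parallelPair f g ⋙ Over.map h) (Over.pullback p) :=
      preservesColimit_of_iso_diagram _ e.symm
    have k₃' : ReflectsColimit (parallelPair f g ⋙ Over.map h) (Over.pullback p) :=
      reflectsColimit_of_iso_diagram _ e.symm
    have : PreservesColimit (parallelPair f g) (Over.pullback p' ⋙ Over.map h') :=
      preservesColimit_of_natIso _ (bc sq).symm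
    have : PreservesColimitsOfSize.{0, 0} (Over.forget X) :=
      (Over.forgetAdjStar X).leftAdjoint_preservesColimits
    have : HasColimit ((parallelPair f g ⋙ Over.map h) ⋙ Over.forget X) := inferInstance
    have : HasColimit (parallelPair f g ⋙ Over.forget X') := this
    have R : ∀ {U V : 𝒞} (k : U ⟶ V), ReflectsColimitsOfSize.{0, 0} (Over.map k) := by
      intro U V k
      have : ReflectsColimitsOfSize.{0, 0} (Over.map k ⋙ Over.forget V) :=
        inferInstanceAs (ReflectsColimitsOfSize.{0, 0} (Over.forget U))
      have : PreservesColimitsOfSize.{0, 0} (Over.forget V) :=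
        (Over.forgetAdjStar V).leftAdjoint_preservesColimits
      exact ⟨⟨reflects_of_comp _ (Over.map k) (Over.forget V)⟩⟩
    have := R h
    have := R h'
    refine ⟨inferInstance, preservesColimit_of_reflects_of_preserves _ (Over.map h'), ?_⟩
    have : ReflectsColimit (parallelPair f g) (Over.pullback p' ⋙ Over.map h') :=
      reflectsColimit_of_natIso _ (bc sq).symm
    have : PreservesColimitsOfSize.{0, 0} (Over.map h') :=
      (Over.mapPullbackAdj h').leftAdjoint_preservesColimits
    exact reflects_of_comp _ (Over.pullback p') (Over.map h')
  exact of_beck (fun f g _ => (key f g).1) (fun f g _ => (key f g).2.1)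
    (fun f g _ => (key f g).2.2)

lemma preserves_of_comp {J D₁ D₂ D₃ : Type*} [Category J] [Category D₁] [Category D₂] [Category D₃]
    (K : J ⥤ D₁) (F : D₁ ⥤ D₂) (G : D₂ ⥤ D₃) [HasColimit K] [PreservesColimit K F]
    [PreservesColimit K (F ⋙ G)] : PreservesColimit (K ⋙ F) G :=
  preservesColimit_of_preserves_colimit_cocone (isColimitOfPreserves F (colimit.isColimit K))
    (isColimitOfPreserves (F ⋙ G) (colimit.isColimit K))

/-- The colimit of `K` exists and is stable under pullback. -/
def Stable {J : Type} [Category.{0} J] {X : 𝒞} (K : J ⥤ Over X) : Prop :=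
  HasColimit K ∧ ∀ {W : 𝒞} (h : W ⟶ X), PreservesColimit K (Over.pullback h)

lemma Stable.compMap {J : Type} [Category.{0} J] {X Y : 𝒞} {K : J ⥤ Over Y} (hK : Stable K)
    (g : Y ⟶ X) : Stable (K ⋙ Over.map g) := by
  have := hK.1
  have : PreservesColimitsOfSize.{0, 0} (Over.map g) :=
    (Over.mapPullbackAdj g).leftAdjoint_preservesColimits
  refine ⟨inferInstance, fun {W} h => ?_⟩
  have := hK.2 (pullback.fst g h)
  have : PreservesColimitsOfSize.{0, 0} (Over.map (pullback.snd g h)) :=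
    (Over.mapPullbackAdj _).leftAdjoint_preservesColimits
  have : PreservesColimit K (Over.map g ⋙ Over.pullback h) :=
    preservesColimit_of_natIso _ (bc (IsPullback.of_hasPullback g h).flip)
  exact preserves_of_comp K (Over.map g) (Over.pullback h)

lemma Stable.compPullback {J : Type} [Category.{0} J] {X Y : 𝒞} {K : J ⥤ Over X} (hK : Stable K)
    (g : Y ⟶ X) : Stable (K ⋙ Over.pullback g) := by
  have := hK.1
  have := hK.2 g
  refine ⟨inferInstance, fun {W} h => ?_⟩
  have := hK.2 (h ≫ g)
  have : PreservesColimit K (Over.pullback g ⋙ Over.pullback h) :=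
    preservesColimit_of_natIso _ (Over.pullbackComp h g)
  exact preserves_of_comp K (Over.pullback g) (Over.pullback h)

/-- Equal morphisms have isomorphic pullback functors. -/
def pullbackCongr {Y X : 𝒞} {f g : Y ⟶ X} (h : f = g) : Over.pullback f ≅ Over.pullback g :=
  eqToIso (by subst h; rfl)

lemma stable_of_split {Z Y : 𝒞} {f : Z ⟶ Y} (hf : IsCover f) {A B : Over Y} (a b : A ⟶ B)
    [(Over.pullback f).IsSplitPair a b] : Stable (parallelPair a b) := by
  obtain ⟨k₁, k₂, k₃⟩ := preserves_reflects hf a b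
  refine ⟨k₁, fun {W} h => ?_⟩
  let f' := pullback.snd f h
  let h' := pullback.fst f h
  have hf' : IsCover f' := of_isPullback (IsPullback.of_hasPullback f h) hf
  have : (Over.pullback f ⋙ Over.pullback h').IsSplitPair a b :=
    map_is_split_pair (Over.pullback h') _ _
  let e : Over.pullback f ⋙ Over.pullback h' ≅ Over.pullback h ⋙ Over.pullback f' :=
    (Over.pullbackComp h' f).symm ≪≫ pullbackCongr pullback.condition ≪≫
      Over.pullbackComp f' h
  have s := isSplitPair_of_iso e a b
  have : (Over.pullback f').IsSplitPair ((Over.pullback h).map a) ((Over.pullback h).map b) := s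
  obtain ⟨l₁, l₂, l₃⟩ :=
    preserves_reflects hf' ((Over.pullback h).map a) ((Over.pullback h).map b)
  let e₁ : parallelPair a b ⋙ Over.pullback h ≅
    parallelPair ((Over.pullback h).map a) ((Over.pullback h).map b) := diagramIsoParallelPair _
  let e₂ : parallelPair a b ⋙ Over.pullback f ≅
    parallelPair ((Over.pullback f).map a) ((Over.pullback f).map b) := diagramIsoParallelPair _
  have : ReflectsColimit (parallelPair a b ⋙ Over.pullback h) (Over.pullback f') :=
    reflectsColimit_of_iso_diagram _ e₁.symm
  have : PreservesColimit (parallelPair a b ⋙ Over.pullback f) (Over.pullback h') := by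
    have : PreservesColimit (parallelPair ((Over.pullback f).map a) ((Over.pullback f).map b))
      (Over.pullback h') := inferInstance
    exact preservesColimit_of_iso_diagram _ e₂.symm
  have : PreservesColimit (parallelPair a b) (Over.pullback h ⋙ Over.pullback f') :=
    preservesColimit_of_natIso _ e
  exact preservesColimit_of_reflects_of_preserves (Over.pullback h) (Over.pullback f')

/-- Covers are closed under composition. -/
lemma comp {X Y Z : 𝒞} {f : Z ⟶ Y} {g : Y ⟶ X} (hf : IsCover f) (hg : IsCover g) :
    IsCover (f ≫ g) := by
  have key : ∀ {A B : Over X} (a b : A ⟶ B) [(Over.pullback (f ≫ g)).IsSplitPair a b],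
      HasCoequalizer a b ∧ PreservesColimit (parallelPair a b) (Over.pullback (f ≫ g)) ∧
      ReflectsColimit (parallelPair a b) (Over.pullback (f ≫ g)) := by
    intro A B a b _
    have s := isSplitPair_of_iso (Over.pullbackComp f g) a b
    have : (Over.pullback f).IsSplitPair ((Over.pullback g).map a) ((Over.pullback g).map b) := s
    obtain ⟨k₁, k₂, k₃⟩ :=
      preserves_reflects hf ((Over.pullback g).map a) ((Over.pullback g).map b)
    let e : parallelPair a b ⋙ Over.pullback g ≅
      parallelPair ((Over.pullback g).map a) ((Over.pullback g).map b) := diagramIsoParallelPair _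
    have st' := stable_of_split hf ((Over.pullback g).map a) ((Over.pullback g).map b)
    have st : Stable (parallelPair a b ⋙ Over.pullback g) :=
      ⟨hasColimit_of_iso e, fun h => by
        have := st'.2 h
        exact preservesColimit_of_iso_diagram _ e.symm⟩
    have k₂' : PreservesColimit (parallelPair a b ⋙ Over.pullback g) (Over.pullback f) :=
      preservesColimit_of_iso_diagram _ e.symm
    have k₃' : ReflectsColimit (parallelPair a b ⋙ Over.pullback g) (Over.pullback f) :=
      reflectsColimit_of_iso_diagram _ e.symm
    let _ := hg.monadic
    have : PreservesColimitsOfSize.{0, 0} (Over.map g) :=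
      (Over.mapPullbackAdj g).leftAdjoint_preservesColimits
    have p₁ : PreservesColimit (parallelPair a b ⋙ Over.pullback g)
        (Over.map g ⋙ Over.pullback g) := by
      have := (st.compMap g).2 g
      infer_instance
    have p₂ : PreservesColimit ((parallelPair a b ⋙ Over.pullback g) ⋙
        (Over.map g ⋙ Over.pullback g)) (Over.map g ⋙ Over.pullback g) := by
      have : PreservesColimit (((parallelPair a b ⋙ Over.pullback g) ⋙
        (Over.map g ⋙ Over.pullback g)) ⋙ Over.map g) (Over.pullback g) :=
        (((st.compMap g).compPullback g).compMap g).2 g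
      infer_instance
    let cr : CreatesColimit (parallelPair a b) (Over.pullback g) :=
      @monadicCreatesColimitOfPreservesColimit _ _ _ _ _ _ (Over.pullback g) (parallelPair a b)
        hg.monadic p₁ p₂
    have := st.1
    have h₁ : HasCoequalizer a b := hasColimit_of_created _ (Over.pullback g)
    have : PreservesColimit (parallelPair a b) (Over.pullback g ⋙ Over.pullback f) :=
      inferInstance
    have : ReflectsColimit (parallelPair a b) (Over.pullback g ⋙ Over.pullback f) :=
      inferInstance
    exact ⟨h₁, preservesColimit_of_natIso _ (Over.pullbackComp f g).symm,
      reflectsColimit_of_natIso _ (Over.pullbackComp f g).symm⟩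
  exact of_beck (fun f g _ => (key f g).1) (fun f g _ => (key f g).2.1)
    (fun f g _ => (key f g).2.2)

/-- A morphism out of the domain of a cover that identifies the points of the fibres
descends along the cover, in a unique way. -/
lemma existsUnique_desc {X Y Z : 𝒞} {p : Y ⟶ X} (hp : IsCover p) (m : Y ⟶ Z)
    (hm : ∀ {T : 𝒞} (a b : T ⟶ Y), a ≫ p = b ≫ p → a ≫ m = b ≫ m) : ∃! n : X ⟶ Z, p ≫ n = m := by
  let adj := Over.mapPullbackAdj p
  let O : Over X := Over.mk (𝟙 X)
  have sp : (Over.pullback p).IsSplitPair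
      ((Over.map p).map ((Over.pullback p).map (adj.counit.app O)))
      (adj.counit.app ((Over.map p).obj ((Over.pullback p).obj O))) :=
    Monad.MonadicityInternal.main_pair_G_split adj ((Monad.comparison adj).obj O)
  obtain ⟨k₁, k₂, k₃⟩ := preserves_reflects hp
    ((Over.map p).map ((Over.pullback p).map (adj.counit.app O)))
    (adj.counit.app ((Over.map p).obj ((Over.pullback p).obj O)))
  have hc := Monad.MonadicityInternal.counitCoequalizerOfReflectsCoequalizer (adj := adj) O
  let q : pullback (𝟙 X) p ⟶ Y := pullback.snd (𝟙 X) p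
  have hq : q ≫ p = pullback.fst (𝟙 X) p := by simp [q, ← pullback.condition]
  let q' : Y ⟶ pullback (𝟙 X) p := pullback.lift p (𝟙 Y) (by simp)
  have hq' : q' ≫ q = 𝟙 Y := by simp [q, q']
  have hq'' : q ≫ q' = 𝟙 _ := by apply pullback.hom_ext <;> simp [q, q', ← pullback.condition]
  let t : (Over.map p).obj ((Over.pullback p).obj O) ⟶ Over.mk (prod.fst : X ⨯ Z ⟶ X) :=
    Over.homMk (prod.lift (q ≫ p) (q ≫ m)) (prod.lift_fst _ _)
  have eL : ∀ w, (adj.counit.app w).left = pullback.fst w.hom p := fun w => by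
    simp [adj]
  have ht : (Over.map p).map ((Over.pullback p).map (adj.counit.app O)) ≫ t =
      adj.counit.app ((Over.map p).obj ((Over.pullback p).obj O)) ≫ t := by
    have h₁ : ∀ {T : 𝒞} (a b : T ⟶ pullback (𝟙 X) p), a ≫ q ≫ p = b ≫ q ≫ p →
        a ≫ prod.lift (q ≫ p) (q ≫ m) = b ≫ prod.lift (q ≫ p) (q ≫ m) := by
      intro T a b h
      have := hm (a ≫ q) (b ≫ q) (by simpa using h)
      apply Limits.prod.hom_ext
      · simpa using h
      · simpa using this
    ext1
    refine h₁ _ _ ?_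
    exact (Over.w ((Over.map p).map ((Over.pullback p).map (adj.counit.app O)))).trans
      (Over.w (adj.counit.app ((Over.map p).obj ((Over.pullback p).obj O)))).symm
  have hd : adj.counit.app O ≫ hc.desc (Cofork.ofπ t ht) = t :=
    hc.fac (Cofork.ofπ t ht) WalkingParallelPair.one
  obtain ⟨n₀, hn₀⟩ : ∃ n₀ : X ⟶ X ⨯ Z, (hc.desc (Cofork.ofπ t ht)).left = n₀ := ⟨_, rfl⟩
  have hd' : pullback.fst (𝟙 X) p ≫ n₀ = prod.lift (q ≫ p) (q ≫ m) := by
    rw [← hn₀]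
    exact (congrArg (fun k : pullback (𝟙 X) p ⟶ X => k ≫ _) (eL O).symm).trans
      (congrArg (fun k => k.left) hd)
  refine ⟨n₀ ≫ prod.snd, ?_, ?_⟩
  · have : q ≫ p ≫ n₀ ≫ prod.snd = q ≫ m := by
      rw [← Category.assoc, hq, ← Category.assoc, hd', prod.lift_snd]
    have := congrArg (fun k => q' ≫ k) this
    simpa only [← Category.assoc, hq', Category.id_comp] using this
  · intro n hn
    let n₁ : O ⟶ Over.mk (prod.fst : X ⨯ Z ⟶ X) :=
      Over.homMk (prod.lift (𝟙 X) n) (prod.lift_fst _ _)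
    have h₂ : adj.counit.app O ≫ n₁ = t := by
      ext1
      have : pullback.fst (𝟙 X) p ≫ prod.lift (𝟙 X) n = prod.lift (q ≫ p) (q ≫ m) := by
        rw [← hq]
        apply Limits.prod.hom_ext <;> simp [hn]
      exact (congrArg (fun k : pullback (𝟙 X) p ⟶ X => k ≫ _) (eL O)).trans this
    have h₃ : n₁ = hc.desc (Cofork.ofπ t ht) :=
      hc.uniq (Cofork.ofπ t ht) n₁ (by
        rintro (_ | _)
        · have := congrArg (fun k => (Over.map p).map ((Over.pullback p).map
            (adj.counit.app O)) ≫ k) h₂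
          exact (Category.assoc _ _ _).trans this
        · exact h₂)
    rw [← hn₀, ← h₃]
    exact (prod.lift_snd _ _).symm

end IsCover
end LaxGeometric

end

noncomputable section

namespace LaxGeometric

variable {𝒞 : Type u} [Category.{v} 𝒞] [HasFiniteLimits 𝒞]

attribute [local simp] pullback.lift_fst pullback.lift_snd pullback.lift_fst_assoc
  pullback.lift_snd_assoc prod.lift_fst prod.lift_snd prod.lift_fst_assoc prod.lift_snd_assoc

variable (𝒞) in
/-- A category internal to `𝒞`. The unit and associativity laws are stated for generalised
elements `T ⟶ arr`. Composition is written in diagrammatic order. -/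
structure InternalCategory where
  /-- the object of objects -/
  obj : 𝒞
  /-- the object of arrows -/
  arr : 𝒞
  dom : arr ⟶ obj
  cod : arr ⟶ obj
  ident : obj ⟶ arr
  /-- composition of composable pairs -/
  comp : pullback cod dom ⟶ arr
  ident_dom : ident ≫ dom = 𝟙 obj
  ident_cod : ident ≫ cod = 𝟙 obj
  comp_dom : comp ≫ dom = pullback.fst cod dom ≫ dom
  comp_cod : comp ≫ cod = pullback.snd cod dom ≫ cod
  id_comp : ∀ {T : 𝒞} (f : T ⟶ arr) (h : (f ≫ dom ≫ ident) ≫ cod = f ≫ dom),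
    pullback.lift (f ≫ dom ≫ ident) f h ≫ comp = f
  comp_id : ∀ {T : 𝒞} (f : T ⟶ arr) (h : f ≫ cod = (f ≫ cod ≫ ident) ≫ dom),
    pullback.lift f (f ≫ cod ≫ ident) h ≫ comp = f
  assoc : ∀ {T : 𝒞} (f g k : T ⟶ arr) (h₁ : f ≫ cod = g ≫ dom) (h₂ : g ≫ cod = k ≫ dom)
    (h₃ : (pullback.lift f g h₁ ≫ comp) ≫ cod = k ≫ dom)
    (h₄ : f ≫ cod = (pullback.lift g k h₂ ≫ comp) ≫ dom),
    pullback.lift (pullback.lift f g h₁ ≫ comp) k h₃ ≫ comp =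
      pullback.lift f (pullback.lift g k h₂ ≫ comp) h₄ ≫ comp

namespace InternalCategory

variable (𝔸 : InternalCategory 𝒞)

attribute [local simp] ident_dom ident_cod

/-- Composition of generalised elements. -/
def mul {T : 𝒞} (f g : T ⟶ 𝔸.arr) (h : f ≫ 𝔸.cod = g ≫ 𝔸.dom) : T ⟶ 𝔸.arr :=
  pullback.lift f g h ≫ 𝔸.comp

variable {𝔸} {T T' : 𝒞}

@[simp] lemma ident_dom' {Z : 𝒞} (k : 𝔸.obj ⟶ Z) : 𝔸.ident ≫ 𝔸.dom ≫ k = k := by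
  rw [← Category.assoc, ident_dom, Category.id_comp]

@[simp] lemma ident_cod' {Z : 𝒞} (k : 𝔸.obj ⟶ Z) : 𝔸.ident ≫ 𝔸.cod ≫ k = k := by
  rw [← Category.assoc, ident_cod, Category.id_comp]

@[simp] lemma mul_dom (f g : T ⟶ 𝔸.arr) (h) : 𝔸.mul f g h ≫ 𝔸.dom = f ≫ 𝔸.dom := by
  simp [mul, comp_dom]

@[simp] lemma mul_cod (f g : T ⟶ 𝔸.arr) (h) : 𝔸.mul f g h ≫ 𝔸.cod = g ≫ 𝔸.cod := by
  simp [mul, comp_cod]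

@[simp] lemma mul_dom' (f g : T ⟶ 𝔸.arr) (h) {Z : 𝒞} (k : 𝔸.obj ⟶ Z) :
    𝔸.mul f g h ≫ 𝔸.dom ≫ k = f ≫ 𝔸.dom ≫ k := by
  rw [← Category.assoc, mul_dom, Category.assoc]

@[simp] lemma mul_cod' (f g : T ⟶ 𝔸.arr) (h) {Z : 𝒞} (k : 𝔸.obj ⟶ Z) :
    𝔸.mul f g h ≫ 𝔸.cod ≫ k = g ≫ 𝔸.cod ≫ k := by
  rw [← Category.assoc, mul_cod, Category.assoc]

lemma comp_mul (k : T' ⟶ T) (f g : T ⟶ 𝔸.arr) (h) :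
    k ≫ 𝔸.mul f g h = 𝔸.mul (k ≫ f) (k ≫ g) (by simp [h]) := by
  rw [mul, mul, ← Category.assoc]
  congr 1
  apply pullback.hom_ext <;> simp

lemma mul_congr {f g f' g' : T ⟶ 𝔸.arr} (hf : f = f') (hg : g = g') (h) :
    𝔸.mul f g h = 𝔸.mul f' g' (by rw [← hf, ← hg, h]) := by
  subst hf hg; rfl

lemma mul_mul_eq (f g k : T ⟶ 𝔸.arr) (h₁ : f ≫ 𝔸.cod = g ≫ 𝔸.dom)
    (h₂ : 𝔸.mul f g h₁ ≫ 𝔸.cod = k ≫ 𝔸.dom) :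
    𝔸.mul (𝔸.mul f g h₁) k h₂ = 𝔸.mul f (𝔸.mul g k (by simpa using h₂)) (by simpa using h₁) :=
  𝔸.assoc f g k _ _ _ _

lemma ident_mul (x : T ⟶ 𝔸.obj) (f : T ⟶ 𝔸.arr) (h : (x ≫ 𝔸.ident) ≫ 𝔸.cod = f ≫ 𝔸.dom) :
    𝔸.mul (x ≫ 𝔸.ident) f h = f := by
  have : x = f ≫ 𝔸.dom := by simpa using h
  subst this
  exact (mul_congr (Category.assoc _ _ _) rfl _).trans (𝔸.id_comp f (by simp))

lemma mul_ident (x : T ⟶ 𝔸.obj) (f : T ⟶ 𝔸.arr) (h : f ≫ 𝔸.cod = (x ≫ 𝔸.ident) ≫ 𝔸.dom) :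
    𝔸.mul f (x ≫ 𝔸.ident) h = f := by
  have : x = f ≫ 𝔸.cod := by simpa using h.symm
  subst this
  exact (mul_congr rfl (Category.assoc _ _ _) _).trans (𝔸.comp_id f (by simp))

lemma comp_eq_mul : 𝔸.comp = 𝔸.mul (pullback.fst _ _) (pullback.snd _ _) pullback.condition := by
  simp [mul]

variable (𝔸) in
/-- `f` and `g` are mutually inverse arrows. -/
structure Inverse (f g : T ⟶ 𝔸.arr) : Prop where
  dom : f ≫ 𝔸.dom = g ≫ 𝔸.cod
  cod : f ≫ 𝔸.cod = g ≫ 𝔸.dom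
  mul_inv : 𝔸.mul f g cod = f ≫ 𝔸.dom ≫ 𝔸.ident
  inv_mul : 𝔸.mul g f dom.symm = f ≫ 𝔸.cod ≫ 𝔸.ident

lemma Inverse.ext {f g g' : T ⟶ 𝔸.arr} (h : 𝔸.Inverse f g) (h' : 𝔸.Inverse f g') : g = g' := by
  have h₁ : 𝔸.mul g (𝔸.mul f g' h'.cod) (by simp [h.dom]) = g := by
    rw [mul_congr rfl (h'.mul_inv.trans (Category.assoc _ _ _).symm), mul_ident]
  have h₂ : 𝔸.mul (𝔸.mul g f h.dom.symm) g' (by simp [h'.cod]) = g' := by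
    rw [mul_congr (h.inv_mul.trans (Category.assoc _ _ _).symm) rfl, ident_mul]
  exact h₁.symm.trans ((mul_mul_eq g f g' h.dom.symm _).symm.trans h₂)

lemma Inverse.precomp {f g : T ⟶ 𝔸.arr} (h : 𝔸.Inverse f g) (k : T' ⟶ T) :
    𝔸.Inverse (k ≫ f) (k ≫ g) where
  dom := by simp [h.dom]
  cod := by simp [h.cod]
  mul_inv := by rw [← comp_mul k f g h.cod, h.mul_inv]; simp
  inv_mul := by rw [← comp_mul k g f h.dom.symm, h.inv_mul]; simp

lemma Inverse.mul {f g f' g' : T ⟶ 𝔸.arr} (h : 𝔸.Inverse f g) (h' : 𝔸.Inverse f' g')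
    (w : f ≫ 𝔸.cod = f' ≫ 𝔸.dom) :
    𝔸.Inverse (𝔸.mul f f' w) (𝔸.mul g' g (by rw [← h'.dom, ← w, h.cod])) where
  dom := by simp [h.dom]
  cod := by simp [h'.cod]
  mul_inv := by
    have e : 𝔸.mul f' (𝔸.mul g' g (by rw [← h'.dom, ← w, h.cod])) (by simp [h'.cod]) = g := by
      rw [← mul_mul_eq f' g' g h'.cod (by simp [← h'.dom, ← w, h.cod]), mul_congr (h'.mul_inv.trans (Category.assoc _ _ _).symm) rfl,
        ident_mul]
    rw [mul_mul_eq, mul_congr rfl e, h.mul_inv]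
    simp
  inv_mul := by
    have e : 𝔸.mul g (𝔸.mul f f' w) (by simp [h.dom]) = f' := by
      rw [← mul_mul_eq g f f' h.dom.symm (by simp [w]), mul_congr (h.inv_mul.trans (Category.assoc _ _ _).symm) rfl,
        ident_mul]
    rw [mul_mul_eq, mul_congr rfl e, h'.inv_mul]
    simp

variable (𝔸) in
/-- Pairs of arrows in opposite directions. -/
abbrev oppositePairs : 𝒞 := pullback (prod.lift 𝔸.dom 𝔸.cod) (prod.lift 𝔸.cod 𝔸.dom)

variable (𝔸) in
lemma oppositePairs_dom : (pullback.fst (prod.lift 𝔸.dom 𝔸.cod) (prod.lift 𝔸.cod 𝔸.dom)) ≫ 𝔸.dom =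
    (pullback.snd (prod.lift 𝔸.dom 𝔸.cod) (prod.lift 𝔸.cod 𝔸.dom)) ≫ 𝔸.cod := by
  have := congrArg (fun k => k ≫ prod.fst)
    (pullback.condition (f := prod.lift 𝔸.dom 𝔸.cod) (g := prod.lift 𝔸.cod 𝔸.dom))
  simpa using this

variable (𝔸) in
lemma oppositePairs_cod : (pullback.fst (prod.lift 𝔸.dom 𝔸.cod) (prod.lift 𝔸.cod 𝔸.dom)) ≫ 𝔸.cod =
    (pullback.snd (prod.lift 𝔸.dom 𝔸.cod) (prod.lift 𝔸.cod 𝔸.dom)) ≫ 𝔸.dom := by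
  have := congrArg (fun k => k ≫ prod.snd)
    (pullback.condition (f := prod.lift 𝔸.dom 𝔸.cod) (g := prod.lift 𝔸.cod 𝔸.dom))
  simpa using this

variable (𝔸) in
/-- The object of pairs of mutually inverse arrows of `𝔸`, i.e. of isomorphisms. -/
abbrev isoArr : 𝒞 :=
  equalizer (X := 𝔸.oppositePairs)
    (prod.lift (𝔸.mul (pullback.fst _ _) (pullback.snd _ _) 𝔸.oppositePairs_cod)
      (𝔸.mul (pullback.snd _ _) (pullback.fst _ _) 𝔸.oppositePairs_dom.symm))
    (prod.lift (pullback.fst _ _ ≫ 𝔸.dom ≫ 𝔸.ident) (pullback.fst _ _ ≫ 𝔸.cod ≫ 𝔸.ident))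

variable (𝔸) in
/-- The arrow underlying an isomorphism. -/
def isoHom : 𝔸.isoArr ⟶ 𝔸.arr := equalizer.ι _ _ ≫ pullback.fst _ _

variable (𝔸) in
/-- The arrow underlying the inverse of an isomorphism. -/
def isoInv : 𝔸.isoArr ⟶ 𝔸.arr := equalizer.ι _ _ ≫ pullback.snd _ _

variable (𝔸) in
lemma isoInverse : 𝔸.Inverse 𝔸.isoHom 𝔸.isoInv := by
  have h₁ : 𝔸.isoHom ≫ 𝔸.dom = 𝔸.isoInv ≫ 𝔸.cod := by
    simp [isoHom, isoInv, oppositePairs_dom]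
  have h₂ : 𝔸.isoHom ≫ 𝔸.cod = 𝔸.isoInv ≫ 𝔸.dom := by
    simp [isoHom, isoInv, oppositePairs_cod]
  refine ⟨h₁, h₂, ?_, ?_⟩
  · have := congrArg (fun k => k ≫ prod.fst) (equalizer.condition (X := 𝔸.oppositePairs)
      (prod.lift (𝔸.mul (pullback.fst _ _) (pullback.snd _ _) 𝔸.oppositePairs_cod)
      (𝔸.mul (pullback.snd _ _) (pullback.fst _ _) 𝔸.oppositePairs_dom.symm))
      (prod.lift (pullback.fst _ _ ≫ 𝔸.dom ≫ 𝔸.ident) (pullback.fst _ _ ≫ 𝔸.cod ≫ 𝔸.ident)))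
    simp only [Category.assoc, prod.lift_fst, comp_mul] at this
    exact this.trans (by simp [isoHom])
  · have := congrArg (fun k => k ≫ prod.snd) (equalizer.condition (X := 𝔸.oppositePairs)
      (prod.lift (𝔸.mul (pullback.fst _ _) (pullback.snd _ _) 𝔸.oppositePairs_cod)
      (𝔸.mul (pullback.snd _ _) (pullback.fst _ _) 𝔸.oppositePairs_dom.symm))
      (prod.lift (pullback.fst _ _ ≫ 𝔸.dom ≫ 𝔸.ident) (pullback.fst _ _ ≫ 𝔸.cod ≫ 𝔸.ident)))
    simp only [Category.assoc, prod.lift_snd, comp_mul] at this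
    exact this.trans (by simp [isoHom])

/-- The generalised element of `isoArr` given by a pair of mutually inverse arrows. -/
def isoLift (f g : T ⟶ 𝔸.arr) (h : 𝔸.Inverse f g) : T ⟶ 𝔸.isoArr :=
  equalizer.lift (pullback.lift f g
    (by apply Limits.prod.hom_ext <;> simp [h.dom, h.cod]) : T ⟶ 𝔸.oppositePairs) (by
    apply Limits.prod.hom_ext
    · simp only [Category.assoc, prod.lift_fst, comp_mul]
      refine (mul_congr (pullback.lift_fst _ _ _) (pullback.lift_snd _ _ _) _).trans ?_
      simp [h.mul_inv]
    · simp only [Category.assoc, prod.lift_snd, comp_mul]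
      refine (mul_congr (pullback.lift_snd _ _ _) (pullback.lift_fst _ _ _) _).trans ?_
      simp [h.inv_mul])

@[simp] lemma isoLift_hom (f g : T ⟶ 𝔸.arr) (h) : isoLift f g h ≫ 𝔸.isoHom = f := by
  simp [isoLift, isoHom]

@[simp] lemma isoLift_inv (f g : T ⟶ 𝔸.arr) (h) : isoLift f g h ≫ 𝔸.isoInv = g := by
  simp [isoLift, isoInv]

lemma iso_ext {f g : T ⟶ 𝔸.isoArr} (h : f ≫ 𝔸.isoHom = g ≫ 𝔸.isoHom) : f = g := by
  have h' : f ≫ 𝔸.isoInv = g ≫ 𝔸.isoInv :=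
    Inverse.ext (f := f ≫ 𝔸.isoHom) (𝔸.isoInverse.precomp f)
      (by rw [h]; exact 𝔸.isoInverse.precomp g)
  apply equalizer.hom_ext
  apply pullback.hom_ext
  · simpa [isoHom] using h
  · simpa [isoInv] using h'

end InternalCategory
end LaxGeometric

end

noncomputable section

namespace LaxGeometric

variable {𝒞 : Type u} [Category.{v} 𝒞] [HasFiniteLimits 𝒞]

attribute [local simp] pullback.lift_fst pullback.lift_snd pullback.lift_fst_assoc
  pullback.lift_snd_assoc prod.lift_fst prod.lift_snd prod.lift_fst_assoc prod.lift_snd_assoc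

namespace InternalCategory

variable {𝔸 : InternalCategory 𝒞} {T T' : 𝒞}

attribute [local simp] ident_dom ident_cod

lemma Inverse.symm {f g : T ⟶ 𝔸.arr} (h : 𝔸.Inverse f g) : 𝔸.Inverse g f where
  dom := h.cod.symm
  cod := h.dom.symm
  mul_inv := by rw [h.inv_mul, ← Category.assoc, h.cod, Category.assoc]
  inv_mul := by rw [h.mul_inv, ← Category.assoc, h.dom, Category.assoc]

variable (𝔸) in
lemma inverse_ident : 𝔸.Inverse 𝔸.ident 𝔸.ident where
  dom := by simp
  cod := by simp
  mul_inv := by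
    have := ident_mul (𝟙 𝔸.obj) 𝔸.ident (by simp)
    simpa using this
  inv_mul := by
    have := ident_mul (𝟙 𝔸.obj) 𝔸.ident (by simp)
    simpa using this

variable (𝔸) in
/-- Composition of isomorphisms. -/
def isoComp : pullback (𝔸.isoHom ≫ 𝔸.cod) (𝔸.isoHom ≫ 𝔸.dom) ⟶ 𝔸.isoArr :=
  isoLift _ _ ((𝔸.isoInverse.precomp
      (pullback.fst (𝔸.isoHom ≫ 𝔸.cod) (𝔸.isoHom ≫ 𝔸.dom))).mul
    (𝔸.isoInverse.precomp (pullback.snd (𝔸.isoHom ≫ 𝔸.cod) (𝔸.isoHom ≫ 𝔸.dom)))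
    (by simp [pullback.condition]))

variable (𝔸) in
lemma isoComp_hom : 𝔸.isoComp ≫ 𝔸.isoHom =
    𝔸.mul (pullback.fst (𝔸.isoHom ≫ 𝔸.cod) (𝔸.isoHom ≫ 𝔸.dom) ≫ 𝔸.isoHom)
      (pullback.snd (𝔸.isoHom ≫ 𝔸.cod) (𝔸.isoHom ≫ 𝔸.dom) ≫ 𝔸.isoHom)
      (by simp [pullback.condition]) :=
  isoLift_hom _ _ _

variable (𝔸) in
/-- The core groupoid of `𝔸`: the same objects, the isomorphisms of `𝔸` as arrows. -/
abbrev core : InternalCategory 𝒞 where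
  obj := 𝔸.obj
  arr := 𝔸.isoArr
  dom := 𝔸.isoHom ≫ 𝔸.dom
  cod := 𝔸.isoHom ≫ 𝔸.cod
  ident := isoLift 𝔸.ident 𝔸.ident 𝔸.inverse_ident
  comp := 𝔸.isoComp
  ident_dom := by rw [← Category.assoc, isoLift_hom, ident_dom]
  ident_cod := by rw [← Category.assoc, isoLift_hom, ident_cod]
  comp_dom := by rw [← Category.assoc, isoComp_hom, mul_dom, Category.assoc]
  comp_cod := by rw [← Category.assoc, isoComp_hom, mul_cod, Category.assoc]
  id_comp f h := by
    apply iso_ext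
    rw [Category.assoc, isoComp_hom, comp_mul]
    refine (mul_congr (f' := (f ≫ 𝔸.isoHom ≫ 𝔸.dom) ≫ 𝔸.ident) (g' := f ≫ 𝔸.isoHom)
      ?_ ?_ _).trans (ident_mul _ _ _)
    · simp
    · simp
  comp_id f h := by
    apply iso_ext
    rw [Category.assoc, isoComp_hom, comp_mul]
    refine (mul_congr (f' := f ≫ 𝔸.isoHom) (g' := (f ≫ 𝔸.isoHom ≫ 𝔸.cod) ≫ 𝔸.ident)
      ?_ ?_ _).trans (mul_ident _ _ _)
    · simp
    · simp
  assoc f g k h₁ h₂ h₃ h₄ := by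
    apply iso_ext
    simp only [Category.assoc, isoComp_hom, comp_mul, pullback.lift_fst_assoc,
      pullback.lift_snd_assoc, mul_mul_eq]

lemma core_mul_isoHom (f g : T ⟶ 𝔸.isoArr) (h : f ≫ 𝔸.core.cod = g ≫ 𝔸.core.dom) :
    𝔸.core.mul f g h ≫ 𝔸.isoHom =
      𝔸.mul (f ≫ 𝔸.isoHom) (g ≫ 𝔸.isoHom) (by simpa [core] using h) := by
  refine (Category.assoc _ _ _).trans ?_
  refine (congrArg (fun k => pullback.lift f g h ≫ k) 𝔸.isoComp_hom).trans ?_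
  rw [comp_mul]
  exact mul_congr (pullback.lift_fst_assoc _ _ _ _) (pullback.lift_snd_assoc _ _ _ _) _

lemma comp_eq' (k : T ⟶ pullback 𝔸.cod 𝔸.dom) : k ≫ 𝔸.comp =
    𝔸.mul (k ≫ pullback.fst _ _) (k ≫ pullback.snd _ _) (by simp [pullback.condition]) := by
  rw [mul]
  congr 1
  apply pullback.hom_ext <;> simp

variable (𝔸) in
/-- The object of commuting squares of `𝔸`: pairs of composable pairs with the same composite. -/
abbrev sqArr : 𝒞 := pullback 𝔸.comp 𝔸.comp

variable (𝔸) in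
/-- The left side of a square. -/
def sqDom : 𝔸.sqArr ⟶ 𝔸.arr := pullback.fst _ _ ≫ pullback.fst _ _

variable (𝔸) in
/-- The bottom side of a square. -/
def sqBot : 𝔸.sqArr ⟶ 𝔸.arr := pullback.fst _ _ ≫ pullback.snd _ _

variable (𝔸) in
/-- The top side of a square. -/
def sqTop : 𝔸.sqArr ⟶ 𝔸.arr := pullback.snd _ _ ≫ pullback.fst _ _

variable (𝔸) in
/-- The right side of a square. -/
def sqCod : 𝔸.sqArr ⟶ 𝔸.arr := pullback.snd _ _ ≫ pullback.snd _ _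

variable (𝔸) in
lemma sqDom_cod : 𝔸.sqDom ≫ 𝔸.cod = 𝔸.sqBot ≫ 𝔸.dom := by
  simp [sqDom, sqBot, pullback.condition]

variable (𝔸) in
lemma sqTop_cod : 𝔸.sqTop ≫ 𝔸.cod = 𝔸.sqCod ≫ 𝔸.dom := by
  simp [sqTop, sqCod, pullback.condition]

variable (𝔸) in
lemma sq_comm : 𝔸.mul 𝔸.sqDom 𝔸.sqBot 𝔸.sqDom_cod = 𝔸.mul 𝔸.sqTop 𝔸.sqCod 𝔸.sqTop_cod := by
  have h := pullback.condition (f := 𝔸.comp) (g := 𝔸.comp)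
  rw [comp_eq', comp_eq'] at h
  exact h

variable (𝔸) in
lemma sqDom_dom : 𝔸.sqDom ≫ 𝔸.dom = 𝔸.sqTop ≫ 𝔸.dom := by
  have := congrArg (fun k => k ≫ 𝔸.dom) 𝔸.sq_comm
  simpa using this

variable (𝔸) in
lemma sqBot_cod : 𝔸.sqBot ≫ 𝔸.cod = 𝔸.sqCod ≫ 𝔸.cod := by
  have := congrArg (fun k => k ≫ 𝔸.cod) 𝔸.sq_comm
  simpa using this

lemma sqLift_aux (a v w b : T ⟶ 𝔸.arr) (h₁ : a ≫ 𝔸.cod = v ≫ 𝔸.dom)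
    (h₂ : w ≫ 𝔸.cod = b ≫ 𝔸.dom) (h : 𝔸.mul a v h₁ = 𝔸.mul w b h₂) :
    pullback.lift a v h₁ ≫ 𝔸.comp = pullback.lift w b h₂ ≫ 𝔸.comp := h

/-- The commuting square with left side `a`, bottom `v`, top `w`, right side `b`. -/
def sqLift (a v w b : T ⟶ 𝔸.arr) (h₁ : a ≫ 𝔸.cod = v ≫ 𝔸.dom) (h₂ : w ≫ 𝔸.cod = b ≫ 𝔸.dom)
    (h : 𝔸.mul a v h₁ = 𝔸.mul w b h₂) : T ⟶ 𝔸.sqArr :=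
  pullback.lift (pullback.lift a v h₁) (pullback.lift w b h₂) (sqLift_aux a v w b h₁ h₂ h)

section

variable (a v w b : T ⟶ 𝔸.arr) (h₁ : a ≫ 𝔸.cod = v ≫ 𝔸.dom) (h₂ : w ≫ 𝔸.cod = b ≫ 𝔸.dom)
    (h : 𝔸.mul a v h₁ = 𝔸.mul w b h₂)

@[simp] lemma sqLift_dom : sqLift a v w b h₁ h₂ h ≫ 𝔸.sqDom = a := by simp [sqLift, sqDom]
@[simp] lemma sqLift_bot : sqLift a v w b h₁ h₂ h ≫ 𝔸.sqBot = v := by simp [sqLift, sqBot]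
@[simp] lemma sqLift_top : sqLift a v w b h₁ h₂ h ≫ 𝔸.sqTop = w := by simp [sqLift, sqTop]
@[simp] lemma sqLift_cod : sqLift a v w b h₁ h₂ h ≫ 𝔸.sqCod = b := by simp [sqLift, sqCod]

end

lemma sq_ext {s t : T ⟶ 𝔸.sqArr} (h₁ : s ≫ 𝔸.sqDom = t ≫ 𝔸.sqDom)
    (h₂ : s ≫ 𝔸.sqBot = t ≫ 𝔸.sqBot) (h₃ : s ≫ 𝔸.sqTop = t ≫ 𝔸.sqTop)
    (h₄ : s ≫ 𝔸.sqCod = t ≫ 𝔸.sqCod) : s = t := by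
  apply pullback.hom_ext <;> apply pullback.hom_ext
  · simpa [sqDom] using h₁
  · simpa [sqBot] using h₂
  · simpa [sqTop] using h₃
  · simpa [sqCod] using h₄

lemma sq_comm' (s : T ⟶ 𝔸.sqArr) : 𝔸.mul (s ≫ 𝔸.sqDom) (s ≫ 𝔸.sqBot) (by simp [sqDom_cod]) =
    𝔸.mul (s ≫ 𝔸.sqTop) (s ≫ 𝔸.sqCod) (by simp [sqTop_cod]) := by
  rw [← comp_mul s _ _ 𝔸.sqDom_cod, ← comp_mul s _ _ 𝔸.sqTop_cod, sq_comm]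

/-- Pasting of commuting squares. -/
lemma sq_paste {a b c v v' w w' : T ⟶ 𝔸.arr} {h₁ h₂ h₃ h₄}
    (s : 𝔸.mul a v h₁ = 𝔸.mul w b h₂) (t : 𝔸.mul b v' h₃ = 𝔸.mul w' c h₄)
    (hv : v ≫ 𝔸.cod = v' ≫ 𝔸.dom) (hw : w ≫ 𝔸.cod = w' ≫ 𝔸.dom) :
    𝔸.mul a (𝔸.mul v v' hv) (by simpa using h₁) = 𝔸.mul (𝔸.mul w w' hw) c (by simpa using h₄) := by
  rw [← mul_mul_eq a v v' h₁ (by simpa using hv), mul_congr s rfl, mul_mul_eq, mul_congr rfl t,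
    mul_mul_eq]

variable (𝔸) in
/-- Composition of commuting squares. -/
def sqComp : pullback 𝔸.sqCod 𝔸.sqDom ⟶ 𝔸.sqArr :=
  sqLift
    (pullback.fst 𝔸.sqCod 𝔸.sqDom ≫ 𝔸.sqDom)
    (𝔸.mul (pullback.fst 𝔸.sqCod 𝔸.sqDom ≫ 𝔸.sqBot) (pullback.snd 𝔸.sqCod 𝔸.sqDom ≫ 𝔸.sqBot)
      (by simp only [Category.assoc, sqBot_cod, ← sqDom_cod]
          simp only [← Category.assoc, pullback.condition]))
    (𝔸.mul (pullback.fst 𝔸.sqCod 𝔸.sqDom ≫ 𝔸.sqTop) (pullback.snd 𝔸.sqCod 𝔸.sqDom ≫ 𝔸.sqTop)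
      (by simp only [Category.assoc, sqTop_cod, ← sqDom_dom]
          simp only [← Category.assoc, pullback.condition]))
    (pullback.snd 𝔸.sqCod 𝔸.sqDom ≫ 𝔸.sqCod)
    (by simp [sqDom_cod]) (by simp [sqTop_cod])
    (sq_paste (sq_comm' (pullback.fst 𝔸.sqCod 𝔸.sqDom))
      ((mul_congr pullback.condition.symm rfl (by simp [← sqDom_cod])).symm.trans
        (sq_comm' (pullback.snd 𝔸.sqCod 𝔸.sqDom))) _ _)

variable (𝔸) in
@[simp] lemma sqComp_dom : 𝔸.sqComp ≫ 𝔸.sqDom = pullback.fst _ _ ≫ 𝔸.sqDom := sqLift_dom ..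

variable (𝔸) in
@[simp] lemma sqComp_cod : 𝔸.sqComp ≫ 𝔸.sqCod = pullback.snd _ _ ≫ 𝔸.sqCod := sqLift_cod ..

variable (𝔸) in
lemma sqComp_bot : 𝔸.sqComp ≫ 𝔸.sqBot =
    𝔸.mul (pullback.fst 𝔸.sqCod 𝔸.sqDom ≫ 𝔸.sqBot) (pullback.snd 𝔸.sqCod 𝔸.sqDom ≫ 𝔸.sqBot)
      (by simp only [Category.assoc, sqBot_cod, ← sqDom_cod]
          simp only [← Category.assoc, pullback.condition]) := sqLift_bot ..

variable (𝔸) in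
lemma sqComp_top : 𝔸.sqComp ≫ 𝔸.sqTop =
    𝔸.mul (pullback.fst 𝔸.sqCod 𝔸.sqDom ≫ 𝔸.sqTop) (pullback.snd 𝔸.sqCod 𝔸.sqDom ≫ 𝔸.sqTop)
      (by simp only [Category.assoc, sqTop_cod, ← sqDom_dom]
          simp only [← Category.assoc, pullback.condition]) := sqLift_top ..

variable (𝔸) in
/-- The arrow category of `𝔸`: its objects are the arrows of `𝔸`, its arrows are the
commuting squares of `𝔸`. -/
abbrev arrow : InternalCategory 𝒞 where
  obj := 𝔸.arr
  arr := 𝔸.sqArr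
  dom := 𝔸.sqDom
  cod := 𝔸.sqCod
  ident := sqLift (𝟙 _) (𝔸.cod ≫ 𝔸.ident) (𝔸.dom ≫ 𝔸.ident) (𝟙 _) (by simp) (by simp)
    (by rw [mul_ident, ident_mul])
  comp := 𝔸.sqComp
  ident_dom := by simp
  ident_cod := by simp
  comp_dom := by simp
  comp_cod := by simp
  id_comp f h := by
    apply sq_ext
    · simp
    · simp only [Category.assoc, sqComp_bot, comp_mul, pullback.lift_fst_assoc,
        pullback.lift_snd_assoc]
      refine (mul_congr (f' := (f ≫ 𝔸.sqDom ≫ 𝔸.cod) ≫ 𝔸.ident) (by simp) rfl _).trans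
        (ident_mul _ _ _)
    · simp only [Category.assoc, sqComp_top, comp_mul, pullback.lift_fst_assoc,
        pullback.lift_snd_assoc]
      refine (mul_congr (f' := (f ≫ 𝔸.sqDom ≫ 𝔸.dom) ≫ 𝔸.ident) (by simp) rfl _).trans
        (ident_mul _ _ _)
    · simp
  comp_id f h := by
    apply sq_ext
    · simp
    · simp only [Category.assoc, sqComp_bot, comp_mul, pullback.lift_fst_assoc,
        pullback.lift_snd_assoc]
      refine (mul_congr (g' := (f ≫ 𝔸.sqCod ≫ 𝔸.cod) ≫ 𝔸.ident) rfl (by simp) _).trans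
        (mul_ident _ _ _)
    · simp only [Category.assoc, sqComp_top, comp_mul, pullback.lift_fst_assoc,
        pullback.lift_snd_assoc]
      refine (mul_congr (g' := (f ≫ 𝔸.sqCod ≫ 𝔸.dom) ≫ 𝔸.ident) rfl (by simp) _).trans
        (mul_ident _ _ _)
    · simp
  assoc f g k h₁ h₂ h₃ h₄ := by
    apply sq_ext
    · simp
    · simp only [Category.assoc, sqComp_bot, comp_mul, pullback.lift_fst_assoc,
        pullback.lift_snd_assoc, mul_mul_eq]
    · simp only [Category.assoc, sqComp_top, comp_mul, pullback.lift_fst_assoc,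
        pullback.lift_snd_assoc, mul_mul_eq]
    · simp

lemma arrow_mul_top (f g : T ⟶ 𝔸.sqArr) (h : f ≫ 𝔸.arrow.cod = g ≫ 𝔸.arrow.dom) :
    𝔸.arrow.mul f g h ≫ 𝔸.sqTop = 𝔸.mul (f ≫ 𝔸.sqTop) (g ≫ 𝔸.sqTop)
      (by simp only [Category.assoc, sqTop_cod, ← sqDom_dom, ← reassoc_of% h]) := by
  refine (Category.assoc _ _ _).trans ?_
  refine (congrArg (fun k => pullback.lift f g h ≫ k) 𝔸.sqComp_top).trans ?_
  rw [comp_mul]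
  exact mul_congr (pullback.lift_fst_assoc _ _ _ _) (pullback.lift_snd_assoc _ _ _ _) _

lemma arrow_mul_bot (f g : T ⟶ 𝔸.sqArr) (h : f ≫ 𝔸.arrow.cod = g ≫ 𝔸.arrow.dom) :
    𝔸.arrow.mul f g h ≫ 𝔸.sqBot = 𝔸.mul (f ≫ 𝔸.sqBot) (g ≫ 𝔸.sqBot)
      (by simp only [Category.assoc, sqBot_cod, ← sqDom_cod, ← reassoc_of% h]) := by
  refine (Category.assoc _ _ _).trans ?_
  refine (congrArg (fun k => pullback.lift f g h ≫ k) 𝔸.sqComp_bot).trans ?_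
  rw [comp_mul]
  exact mul_congr (pullback.lift_fst_assoc _ _ _ _) (pullback.lift_snd_assoc _ _ _ _) _

end InternalCategory

/-- An internal functor. -/
structure InternalFunctor (𝔸 𝔹 : InternalCategory 𝒞) where
  obj : 𝔸.obj ⟶ 𝔹.obj
  arr : 𝔸.arr ⟶ 𝔹.arr
  dom : arr ≫ 𝔹.dom = 𝔸.dom ≫ obj
  cod : arr ≫ 𝔹.cod = 𝔸.cod ≫ obj
  ident : 𝔸.ident ≫ arr = obj ≫ 𝔹.ident
  comp : ∀ {T : 𝒞} (f g : T ⟶ 𝔸.arr) (h : f ≫ 𝔸.cod = g ≫ 𝔸.dom)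
    (h' : (f ≫ arr) ≫ 𝔹.cod = (g ≫ arr) ≫ 𝔹.dom),
    𝔸.mul f g h ≫ arr = 𝔹.mul (f ≫ arr) (g ≫ arr) h'

namespace InternalFunctor

open InternalCategory

variable {𝔸 𝔹 𝔻 : InternalCategory 𝒞}

/-- Composition of internal functors. -/
def andThen (F : InternalFunctor 𝔸 𝔹) (G : InternalFunctor 𝔹 𝔻) : InternalFunctor 𝔸 𝔻 where
  obj := F.obj ≫ G.obj
  arr := F.arr ≫ G.arr
  dom := by rw [Category.assoc, G.dom, ← Category.assoc, F.dom, Category.assoc]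
  cod := by rw [Category.assoc, G.cod, ← Category.assoc, F.cod, Category.assoc]
  ident := by rw [← Category.assoc, F.ident, Category.assoc, G.ident, Category.assoc]
  comp f g h h' := by
    have e : (f ≫ F.arr) ≫ 𝔹.cod = (g ≫ F.arr) ≫ 𝔹.dom := by
      rw [Category.assoc, Category.assoc, F.cod, F.dom, ← Category.assoc, h, Category.assoc]
    rw [← Category.assoc, F.comp f g h e, G.comp _ _ e (by simpa using h')]
    exact mul_congr (Category.assoc _ _ _) (Category.assoc _ _ _) _

lemma inverse (F : InternalFunctor 𝔸 𝔹) {T : 𝒞} {f g : T ⟶ 𝔸.arr} (h : 𝔸.Inverse f g) :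
    𝔹.Inverse (f ≫ F.arr) (g ≫ F.arr) where
  dom := by rw [Category.assoc, Category.assoc, F.dom, F.cod, ← Category.assoc, h.dom,
    Category.assoc]
  cod := by rw [Category.assoc, Category.assoc, F.dom, F.cod, ← Category.assoc, h.cod,
    Category.assoc]
  mul_inv := by
    rw [← F.comp f g h.cod, h.mul_inv]
    simp only [Category.assoc, F.ident, reassoc_of% F.dom]
  inv_mul := by
    rw [← F.comp g f h.dom.symm, h.inv_mul]
    simp only [Category.assoc, F.ident, reassoc_of% F.cod]

/-- The functor induced on core groupoids. -/
def core (F : InternalFunctor 𝔸 𝔹) : InternalFunctor 𝔸.core 𝔹.core where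
  obj := F.obj
  arr := isoLift _ _ (F.inverse 𝔸.isoInverse)
  dom := by
    change isoLift _ _ (F.inverse 𝔸.isoInverse) ≫ 𝔹.isoHom ≫ 𝔹.dom =
      (𝔸.isoHom ≫ 𝔸.dom) ≫ F.obj
    rw [← Category.assoc, isoLift_hom, Category.assoc, F.dom, Category.assoc]
  cod := by
    change isoLift _ _ (F.inverse 𝔸.isoInverse) ≫ 𝔹.isoHom ≫ 𝔹.cod =
      (𝔸.isoHom ≫ 𝔸.cod) ≫ F.obj
    rw [← Category.assoc, isoLift_hom, Category.assoc, F.cod, Category.assoc]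
  ident := by
    apply iso_ext
    change (isoLift 𝔸.ident 𝔸.ident 𝔸.inverse_ident ≫ isoLift _ _ (F.inverse 𝔸.isoInverse)) ≫
      𝔹.isoHom = (F.obj ≫ isoLift 𝔹.ident 𝔹.ident 𝔹.inverse_ident) ≫ 𝔹.isoHom
    rw [Category.assoc, isoLift_hom, ← Category.assoc, isoLift_hom, F.ident, Category.assoc,
      isoLift_hom]
  comp f g h h' := by
    apply iso_ext
    rw [core_mul_isoHom, Category.assoc, isoLift_hom, ← Category.assoc, core_mul_isoHom,
      F.comp]
    · exact mul_congr (by rw [Category.assoc, Category.assoc, isoLift_hom])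
        (by rw [Category.assoc, Category.assoc, isoLift_hom]) _
    · have e : (f ≫ 𝔸.isoHom) ≫ 𝔸.cod = (g ≫ 𝔸.isoHom) ≫ 𝔸.dom := by
        simpa [InternalCategory.core] using h
      rw [Category.assoc _ F.arr, Category.assoc _ F.arr, F.cod, F.dom, ← Category.assoc, e,
        Category.assoc _ 𝔸.dom]

variable (𝔸) in
/-- The domain functor of the arrow category. -/
def D₀ : InternalFunctor 𝔸.arrow 𝔸 where
  obj := 𝔸.dom
  arr := 𝔸.sqTop
  dom := 𝔸.sqDom_dom.symm
  cod := 𝔸.sqTop_cod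
  ident := by simp
  comp _ _ _ _ := arrow_mul_top _ _ _

variable (𝔸) in
/-- The codomain functor of the arrow category. -/
def D₁ : InternalFunctor 𝔸.arrow 𝔸 where
  obj := 𝔸.cod
  arr := 𝔸.sqBot
  dom := 𝔸.sqDom_cod.symm
  cod := 𝔸.sqBot_cod
  ident := by simp
  comp _ _ _ _ := arrow_mul_bot _ _ _

end InternalFunctor
end LaxGeometric

end

noncomputable section

namespace LaxGeometric

variable {𝒞 : Type u} [Category.{v} 𝒞] [HasFiniteLimits 𝒞]

attribute [local simp] pullback.lift_fst pullback.lift_snd pullback.lift_fst_assoc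
  pullback.lift_snd_assoc prod.lift_fst prod.lift_snd prod.lift_fst_assoc prod.lift_snd_assoc

attribute [local simp] InternalCategory.ident_dom InternalCategory.ident_cod

open InternalCategory

lemma IsCover.cancel {X Y Z : 𝒞} {p : Y ⟶ X} (hp : IsCover p) {a b : X ⟶ Z}
    (h : p ≫ a = p ≫ b) : a = b :=
  (hp.existsUnique_desc (p ≫ b) (fun x y e => by
    rw [← Category.assoc, e, Category.assoc])).unique h rfl

/-- A principal bundle over `X` for an internal groupoid `𝔾` (the definition does not refer to
inverses, so it is given for any internal category): an object `total` over `X` with a right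
action of `𝔾` along `anchor`, such that `proj` is a cover, the action preserves the fibres of
`proj`, and `(x, g) ↦ (x, x · g)` identifies `total ×_{𝔾.obj} 𝔾.arr` with `total ×_X total`. -/
structure PrincipalBundle (𝔾 : InternalCategory 𝒞) (X : 𝒞) where
  total : 𝒞
  proj : total ⟶ X
  anchor : total ⟶ 𝔾.obj
  action : pullback anchor 𝔾.dom ⟶ total
  action_proj : action ≫ proj = pullback.fst anchor 𝔾.dom ≫ proj
  action_anchor : action ≫ anchor = pullback.snd anchor 𝔾.dom ≫ 𝔾.cod
  action_ident : ∀ {T : 𝒞} (x : T ⟶ total) (h : x ≫ anchor = (x ≫ anchor ≫ 𝔾.ident) ≫ 𝔾.dom),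
    pullback.lift x (x ≫ anchor ≫ 𝔾.ident) h ≫ action = x
  action_comp : ∀ {T : 𝒞} (x : T ⟶ total) (g k : T ⟶ 𝔾.arr) (h₁ : x ≫ anchor = g ≫ 𝔾.dom)
    (h₂ : g ≫ 𝔾.cod = k ≫ 𝔾.dom) (h₃ : (pullback.lift x g h₁ ≫ action) ≫ anchor = k ≫ 𝔾.dom)
    (h₄ : x ≫ anchor = 𝔾.mul g k h₂ ≫ 𝔾.dom),
    pullback.lift (pullback.lift x g h₁ ≫ action) k h₃ ≫ action =
      pullback.lift x (𝔾.mul g k h₂) h₄ ≫ action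
  isCover : IsCover proj
  isPullback : IsPullback (pullback.fst anchor 𝔾.dom) action proj proj

namespace PrincipalBundle

variable {𝔾 : InternalCategory 𝒞} {X : 𝒞} (P Q R : PrincipalBundle 𝔾 X) {T T' : 𝒞}

/-- The action on generalised elements. -/
def act (x : T ⟶ P.total) (g : T ⟶ 𝔾.arr) (h : x ≫ P.anchor = g ≫ 𝔾.dom) : T ⟶ P.total :=
  pullback.lift x g h ≫ P.action

variable {P Q R}

@[simp] lemma act_proj (x : T ⟶ P.total) (g : T ⟶ 𝔾.arr) (h) :
    P.act x g h ≫ P.proj = x ≫ P.proj := by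
  simp [act, action_proj]

@[simp] lemma act_anchor (x : T ⟶ P.total) (g : T ⟶ 𝔾.arr) (h) :
    P.act x g h ≫ P.anchor = g ≫ 𝔾.cod := by
  simp [act, action_anchor]

lemma comp_act (k : T' ⟶ T) (x : T ⟶ P.total) (g : T ⟶ 𝔾.arr) (h) :
    k ≫ P.act x g h = P.act (k ≫ x) (k ≫ g) (by simp [h]) := by
  rw [act, act, ← Category.assoc]
  congr 1
  apply pullback.hom_ext <;> simp

lemma act_congr {x x' : T ⟶ P.total} {g g' : T ⟶ 𝔾.arr} (hx : x = x') (hg : g = g') (h) :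
    P.act x g h = P.act x' g' (by rw [← hx, ← hg, h]) := by
  subst hx hg; rfl

lemma act_ident (x : T ⟶ P.total) (y : T ⟶ 𝔾.obj) (h : x ≫ P.anchor = (y ≫ 𝔾.ident) ≫ 𝔾.dom) :
    P.act x (y ≫ 𝔾.ident) h = x := by
  have : y = x ≫ P.anchor := by simpa using h.symm
  subst this
  exact (act_congr rfl (Category.assoc _ _ _) _).trans (P.action_ident x (by simp))

lemma act_act (x : T ⟶ P.total) (g k : T ⟶ 𝔾.arr) (h₁ : x ≫ P.anchor = g ≫ 𝔾.dom)
    (h₂ : P.act x g h₁ ≫ P.anchor = k ≫ 𝔾.dom) :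
    P.act (P.act x g h₁) k h₂ =
      P.act x (𝔾.mul g k (by simpa using h₂)) (by simpa using h₁) :=
  P.action_comp x g k _ _ _ _

variable (P) in
/-- The unique arrow of `𝔾` that takes `x` to `y`, for `x` and `y` in the same fibre. -/
def div (x y : T ⟶ P.total) (h : x ≫ P.proj = y ≫ P.proj) : T ⟶ 𝔾.arr :=
  P.isPullback.lift x y h ≫ pullback.snd P.anchor 𝔾.dom

@[simp] lemma div_dom (x y : T ⟶ P.total) (h) : P.div x y h ≫ 𝔾.dom = x ≫ P.anchor := by
  rw [div, Category.assoc, ← pullback.condition, ← Category.assoc, P.isPullback.lift_fst]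

lemma act_div (x y : T ⟶ P.total) (h) : P.act x (P.div x y h) (by simp) = y := by
  have : pullback.lift x (P.div x y h) (by simp) = P.isPullback.lift x y h := by
    apply pullback.hom_ext <;> simp [div]
  rw [act, this, P.isPullback.lift_snd]

@[simp] lemma div_cod (x y : T ⟶ P.total) (h) : P.div x y h ≫ 𝔾.cod = y ≫ P.anchor := by
  have := congrArg (fun k => k ≫ P.anchor) (act_div x y h)
  simpa using this

lemma div_eq_of_act {x y : T ⟶ P.total} {g : T ⟶ 𝔾.arr} (h : x ≫ P.anchor = g ≫ 𝔾.dom)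
    (e : P.act x g h = y) : P.div x y (by rw [← e]; simp) = g := by
  have : P.isPullback.lift x y (by rw [← e]; simp) = pullback.lift x g h := by
    apply P.isPullback.hom_ext
    · simp
    · simpa [act] using e.symm
  rw [div, this, pullback.lift_snd]

lemma comp_div (k : T' ⟶ T) (x y : T ⟶ P.total) (h) :
    k ≫ P.div x y h = P.div (k ≫ x) (k ≫ y) (by simp [h]) := by
  symm
  apply div_eq_of_act
  rw [← comp_act k x _ (by simp), act_div]

lemma div_congr {x y x' y' : T ⟶ P.total} (hx : x = x') (hy : y = y') (h) :
    P.div x y h = P.div x' y' (by rw [← hx, ← hy, h]) := by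
  subst hx hy; rfl

lemma div_self (x : T ⟶ P.total) (h) : P.div x x h = (x ≫ P.anchor) ≫ 𝔾.ident :=
  div_eq_of_act (by simp) (act_ident x _ _)

lemma div_mul_div (x y z : T ⟶ P.total) (h₁ h₂) (h₃) :
    𝔾.mul (P.div x y h₁) (P.div y z h₂) h₃ = P.div x z (h₁.trans h₂) := by
  symm
  apply div_eq_of_act
  rw [← act_act _ _ _ (by simp) (by simp), act_congr (act_div x y h₁) rfl, act_div]

lemma div_act (x : T ⟶ P.total) (g : T ⟶ 𝔾.arr) (h) (h') : P.div x (P.act x g h) h' = g :=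
  div_eq_of_act h rfl

lemma isPullback_of_existsUnique {E : 𝒞} {p : E ⟶ X} {q : E ⟶ 𝔾.obj} {a : pullback q 𝔾.dom ⟶ E}
    (h : a ≫ p = pullback.fst q 𝔾.dom ≫ p)
    (d : ∀ {T : 𝒞} (x y : T ⟶ E), x ≫ p = y ≫ p →
      ∃ g : T ⟶ 𝔾.arr, ∃ h : x ≫ q = g ≫ 𝔾.dom, pullback.lift x g h ≫ a = y)
    (e : ∀ {T : 𝒞} (x : T ⟶ E) (g g' : T ⟶ 𝔾.arr) (h : x ≫ q = g ≫ 𝔾.dom)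
      (h' : x ≫ q = g' ≫ 𝔾.dom), pullback.lift x g h ≫ a = pullback.lift x g' h' ≫ a → g = g') :
    IsPullback (pullback.fst q 𝔾.dom) a p p := by
  refine ⟨⟨h.symm⟩, ⟨PullbackCone.IsLimit.mk _
    (fun s => pullback.lift s.fst (d s.fst s.snd s.condition).choose
      (d s.fst s.snd s.condition).choose_spec.choose) ?_ ?_ ?_⟩⟩
  · intro s; simp
  · intro s; exact (d s.fst s.snd s.condition).choose_spec.choose_spec
  · intro s m h₁ h₂
    apply pullback.hom_ext
    · simpa using h₁
    · rw [pullback.lift_snd]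
      have hm : m = pullback.lift s.fst (m ≫ pullback.snd _ _)
          (by rw [← h₁, Category.assoc, Category.assoc, pullback.condition]) := by
        apply pullback.hom_ext
        · simpa using h₁
        · simp
      apply e s.fst
      rw [← hm, h₂, (d s.fst s.snd s.condition).choose_spec.choose_spec]

variable (P) in
lemma exists_local (t : T ⟶ X) :
    ∃ (T' : 𝒞) (c : T' ⟶ T) (x : T' ⟶ P.total), IsCover c ∧ x ≫ P.proj = c ≫ t :=
  ⟨_, pullback.fst t P.proj, pullback.snd t P.proj,
    IsCover.of_isPullback (IsPullback.of_hasPullback t P.proj).flip P.isCover,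
    pullback.condition.symm⟩

variable (P Q) in
/-- A map of principal bundles over `X`. -/
@[ext]
structure Hom where
  hom : P.total ⟶ Q.total
  proj : hom ≫ Q.proj = P.proj
  anchor : hom ≫ Q.anchor = P.anchor
  act : ∀ {T : 𝒞} (x : T ⟶ P.total) (g : T ⟶ 𝔾.arr) (h : x ≫ P.anchor = g ≫ 𝔾.dom)
    (h' : (x ≫ hom) ≫ Q.anchor = g ≫ 𝔾.dom), P.act x g h ≫ hom = Q.act (x ≫ hom) g h'

namespace Hom

attribute [local simp] proj anchor

lemma div (φ : Hom P Q) (x y : T ⟶ P.total) (h) (h') :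
    Q.div (x ≫ φ.hom) (y ≫ φ.hom) h' = P.div x y h := by
  refine div_eq_of_act (by simp) ?_
  rw [← φ.act x _ (by simp), act_div]

variable (P) in
/-- The identity. -/
def id : Hom P P := ⟨𝟙 _, by simp, by simp, fun x g h h' => by
  rw [Category.comp_id, act_congr (Category.comp_id x) rfl]⟩

/-- Composition. -/
def comp (φ : Hom P Q) (ψ : Hom Q R) : Hom P R where
  hom := φ.hom ≫ ψ.hom
  proj := by simp
  anchor := by simp
  act x g h h' := by
    rw [← Category.assoc, φ.act x g h (by simpa using h), ψ.act _ _ _ (by simpa using h)]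
    exact act_congr (Category.assoc _ _ _) rfl _

/-- A morphism over `X` that is compatible with division is a bundle map. -/
def ofDiv (f : P.total ⟶ Q.total) (hp : f ≫ Q.proj = P.proj)
    (ha : f ≫ Q.anchor = P.anchor)
    (hd : ∀ {T : 𝒞} (x y : T ⟶ P.total) (h : x ≫ P.proj = y ≫ P.proj)
      (h' : (x ≫ f) ≫ Q.proj = (y ≫ f) ≫ Q.proj), Q.div (x ≫ f) (y ≫ f) h' = P.div x y h) :
    Hom P Q where
  hom := f
  proj := hp
  anchor := ha
  act x g h h' := by
    have e := hd x (P.act x g h) (by simp) (by simp [hp])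
    rw [div_act] at e
    rw [← act_div (x ≫ f) (P.act x g h ≫ f) (by simp [hp])]
    exact act_congr rfl e _

/-- Bundle maps are invertible. -/
lemma exists_inverse (φ : Hom P Q) :
    ∃ ψ : Hom Q P, φ.comp ψ = Hom.id P ∧ ψ.comp φ = Hom.id Q := by
  have hc : IsCover (pullback.snd P.proj Q.proj) :=
    IsCover.of_isPullback (IsPullback.of_hasPullback P.proj Q.proj) P.isCover
  let x := pullback.fst P.proj Q.proj
  let y := pullback.snd P.proj Q.proj
  have hxy : x ≫ P.proj = y ≫ Q.proj := pullback.condition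
  let d := Q.div (x ≫ φ.hom) y (by simp [hxy])
  have hd : x ≫ P.anchor = d ≫ 𝔾.dom := by simp [d]
  have key : ∀ {S : 𝒞} (a b : S ⟶ pullback P.proj Q.proj), a ≫ y = b ≫ y →
      a ≫ P.act x d hd = b ≫ P.act x d hd := by
    intro S a b hab
    have hp : (a ≫ x) ≫ P.proj = (b ≫ x) ≫ P.proj := by
      rw [Category.assoc, Category.assoc, hxy, ← Category.assoc, hab, Category.assoc]
    rw [comp_act, comp_act, act_congr (act_div (b ≫ x) (a ≫ x) hp.symm).symm rfl, act_act]
    refine act_congr rfl ?_ _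
    simp only [d, comp_div]
    rw [mul_congr (φ.div (b ≫ x) (a ≫ x) hp.symm (by simpa using hp.symm)).symm
      (div_congr (Category.assoc _ _ _).symm rfl _), div_mul_div]
    exact div_congr (Category.assoc _ _ _) hab _
  obtain ⟨f, hf, -⟩ := hc.existsUnique_desc (P.act x d hd) key
  have hf' : ∀ {S : 𝒞} (a : S ⟶ P.total) (b : S ⟶ Q.total) (h : a ≫ P.proj = b ≫ Q.proj),
      b ≫ f = P.act a (Q.div (a ≫ φ.hom) b (by simp [h])) (by simp) := by
    intro S a b h
    have e : b = pullback.lift a b h ≫ y := by simp [y]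
    conv_lhs => rw [e]
    rw [Category.assoc, hf, comp_act]
    refine act_congr (by simp [x]) ?_ _
    simp only [d, comp_div]
    exact div_congr (by simp [x]) (by simp [y]) _
  have h₁ : φ.hom ≫ f = 𝟙 _ := by
    rw [hf' (𝟙 _) φ.hom (by simp), act_congr (g' := P.div (𝟙 _) (𝟙 _) rfl) rfl, act_div]
    rw [← φ.div (𝟙 _) (𝟙 _) rfl (by simp)]
    exact div_congr rfl (by simp) _
  have h₂ : f ≫ φ.hom = 𝟙 _ := by
    apply hc.cancel
    rw [← Category.assoc, hf, φ.act _ _ _ (by simp [d]), act_div]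
    simp [y]
  have hp : f ≫ P.proj = Q.proj := by
    rw [← φ.proj, ← Category.assoc, h₂, Category.id_comp]
  have ha : f ≫ P.anchor = Q.anchor := by
    rw [← φ.anchor, ← Category.assoc, h₂, Category.id_comp]
  refine ⟨ofDiv f hp ha ?_, Hom.ext h₁, Hom.ext h₂⟩
  intro S a b h h'
  rw [← φ.div _ _ h' (by simp [hp, h])]
  exact div_congr (by simp [h₂]) (by simp [h₂]) _

/-- The inverse of a bundle map. -/
def inv (φ : Hom P Q) : Hom Q P := φ.exists_inverse.choose

lemma hom_inv (φ : Hom P Q) : φ.hom ≫ φ.inv.hom = 𝟙 _ :=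
  congrArg Hom.hom φ.exists_inverse.choose_spec.1

lemma inv_hom (φ : Hom P Q) : φ.inv.hom ≫ φ.hom = 𝟙 _ :=
  congrArg Hom.hom φ.exists_inverse.choose_spec.2

end Hom

end PrincipalBundle

/-- The internal groupoid `Y ×_X Y ⇉ Y` of a morphism `e : Y ⟶ X`. -/
abbrev kernelPair {Y X : 𝒞} (e : Y ⟶ X) : InternalCategory 𝒞 where
  obj := Y
  arr := pullback e e
  dom := pullback.fst e e
  cod := pullback.snd e e
  ident := pullback.lift (𝟙 Y) (𝟙 Y) rfl
  comp := pullback.lift (pullback.fst _ _ ≫ pullback.fst e e) (pullback.snd _ _ ≫ pullback.snd e e)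
    (by
      rw [Category.assoc, Category.assoc, pullback.condition (f := e), pullback.condition_assoc,
        pullback.condition (f := e)])
  ident_dom := by simp
  ident_cod := by simp
  comp_dom := by simp
  comp_cod := by simp
  id_comp f h := by apply pullback.hom_ext <;> simp
  comp_id f h := by apply pullback.hom_ext <;> simp
  assoc f g k h₁ h₂ h₃ h₄ := by apply pullback.hom_ext <;> simp

namespace PrincipalBundle

variable {𝔾 : InternalCategory 𝒞} {X : 𝒞} (P Q R : PrincipalBundle 𝔾 X) {T T' : 𝒞}

/-- The cocycle of a principal bundle `P` over `X`: the internal functor from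
`P ×_X P ⇉ P` to `𝔾` that sends `(x, y)` to the arrow of `𝔾` that takes `x` to `y`. -/
def cocycle : InternalFunctor (kernelPair P.proj) 𝔾 where
  obj := P.anchor
  arr := P.div (pullback.fst _ _) (pullback.snd _ _) pullback.condition
  dom := by simp
  cod := by simp
  ident := by
    rw [comp_div, div_congr (y' := 𝟙 _) (pullback.lift_fst _ _ _) (pullback.lift_snd _ _ _),
      div_self]
    simp
  comp f g h h' := by
    rw [comp_div, mul_congr (comp_div _ _ _ _) (comp_div _ _ _ _)]
    rw [mul_congr rfl (div_congr h.symm rfl _), div_mul_div]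
    exact div_congr (by simp [InternalCategory.mul]) (by simp [InternalCategory.mul]) _

/-- Exhibits `Q` as the principal bundle associated with a cocycle `ψ` on `e : Y ⟶ X`: a section
of `Q` over `Y` whose transition functions are given by `ψ`. -/
structure Associated {Y : 𝒞} {e : Y ⟶ X} (ψ : InternalFunctor (kernelPair e) 𝔾) where
  sec : Y ⟶ Q.total
  proj : sec ≫ Q.proj = e
  anchor : sec ≫ Q.anchor = ψ.obj
  act : ∀ {T : 𝒞} (y z : T ⟶ Y) (h : y ≫ e = z ≫ e)
    (h' : (y ≫ sec) ≫ Q.anchor = (pullback.lift y z h ≫ ψ.arr) ≫ 𝔾.dom),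
    Q.act (y ≫ sec) (pullback.lift y z h ≫ ψ.arr) h' = z ≫ sec

variable {P Q R}

lemma Associated.div {Y : 𝒞} {e : Y ⟶ X} {ψ : InternalFunctor (kernelPair e) 𝔾}
    (σ : Q.Associated ψ) (y z : T ⟶ Y) (h : y ≫ e = z ≫ e) (h') :
    Q.div (y ≫ σ.sec) (z ≫ σ.sec) h' = pullback.lift y z h ≫ ψ.arr :=
  div_eq_of_act (by rw [Category.assoc, σ.anchor, Category.assoc, ψ.dom]; simp)
    (σ.act y z h _)

end PrincipalBundle
end LaxGeometric

end

noncomputable section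

namespace LaxGeometric

variable {𝒞 : Type u} [Category.{v} 𝒞] [HasFiniteLimits 𝒞]

attribute [local simp] pullback.lift_fst pullback.lift_snd pullback.lift_fst_assoc
  pullback.lift_snd_assoc prod.lift_fst prod.lift_snd prod.lift_fst_assoc prod.lift_snd_assoc

attribute [local simp] InternalCategory.ident_dom InternalCategory.ident_cod

open InternalCategory

variable {𝔸 : InternalCategory 𝒞} {X T T' : 𝒞}

namespace PrincipalBundle

section tr

variable {P Q : PrincipalBundle 𝔸.core X}

variable (P) in
/-- The arrow of `𝔸` underlying the isomorphism that takes `x` to `y`. -/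
def tr (x y : T ⟶ P.total) (h : x ≫ P.proj = y ≫ P.proj) : T ⟶ 𝔸.arr :=
  P.div x y h ≫ 𝔸.isoHom

@[simp] lemma tr_dom (x y : T ⟶ P.total) (h) : P.tr x y h ≫ 𝔸.dom = x ≫ P.anchor :=
  (Category.assoc _ _ _).trans (P.div_dom x y h)

@[simp] lemma tr_cod (x y : T ⟶ P.total) (h) : P.tr x y h ≫ 𝔸.cod = y ≫ P.anchor :=
  (Category.assoc _ _ _).trans (P.div_cod x y h)

lemma comp_tr (k : T' ⟶ T) (x y : T ⟶ P.total) (h) :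
    k ≫ P.tr x y h = P.tr (k ≫ x) (k ≫ y) (by simp [h]) := by
  rw [tr, tr, ← comp_div k x y h, Category.assoc]

lemma tr_congr {x y x' y' : T ⟶ P.total} (hx : x = x') (hy : y = y') (h) :
    P.tr x y h = P.tr x' y' (by rw [← hx, ← hy, h]) := by
  subst hx hy; rfl

lemma tr_self (x : T ⟶ P.total) (h) : P.tr x x h = (x ≫ P.anchor) ≫ 𝔸.ident := by
  rw [tr, div_self, Category.assoc]
  exact congrArg (fun k => (x ≫ P.anchor) ≫ k) (isoLift_hom _ _ 𝔸.inverse_ident)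

lemma tr_mul_tr (x y z : T ⟶ P.total) (h₁ h₂) (h₃) :
    𝔸.mul (P.tr x y h₁) (P.tr y z h₂) h₃ = P.tr x z (h₁.trans h₂) := by
  have := core_mul_isoHom (P.div x y h₁) (P.div y z h₂) (by rw [div_cod, div_dom])
  rw [div_mul_div] at this
  exact this.symm

lemma tr_mul_tr_mul (x y z : T ⟶ P.total) (h₁ h₂) (g : T ⟶ 𝔸.arr) (h₃) (h₄) :
    𝔸.mul (P.tr x y h₁) (𝔸.mul (P.tr y z h₂) g h₃) h₄ =
      𝔸.mul (P.tr x z (h₁.trans h₂)) g (by simpa using h₃) := by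
  rw [← mul_mul_eq _ _ _ (by simp) (by simpa using h₃), mul_congr (tr_mul_tr x y z h₁ h₂ _) rfl]

lemma tr_self_mul (x : T ⟶ P.total) (h) (g : T ⟶ 𝔸.arr) (h') : 𝔸.mul (P.tr x x h) g h' = g := by
  rw [mul_congr (tr_self x h) rfl, ident_mul]

lemma mul_tr_self (x : T ⟶ P.total) (h) (g : T ⟶ 𝔸.arr) (h') : 𝔸.mul g (P.tr x x h) h' = g := by
  rw [mul_congr rfl (tr_self x h), mul_ident]

lemma Hom.tr (φ : Hom P Q) (x y : T ⟶ P.total) (h) (h') :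
    Q.tr (x ≫ φ.hom) (y ≫ φ.hom) h' = P.tr x y h := by
  rw [PrincipalBundle.tr, PrincipalBundle.tr, φ.div x y h h']

end tr

section arrow

variable {P : PrincipalBundle 𝔸.arrow.core X}

variable (P) in
/-- The top side of the square that takes `x` to `y`. -/
def top (x y : T ⟶ P.total) (h : x ≫ P.proj = y ≫ P.proj) : T ⟶ 𝔸.arr :=
  P.div x y h ≫ 𝔸.arrow.isoHom ≫ 𝔸.sqTop

variable (P) in
/-- The bottom side of the square that takes `x` to `y`. -/
def bot (x y : T ⟶ P.total) (h : x ≫ P.proj = y ≫ P.proj) : T ⟶ 𝔸.arr :=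
  P.div x y h ≫ 𝔸.arrow.isoHom ≫ 𝔸.sqBot

lemma div_sqDom (x y : T ⟶ P.total) (h) :
    (P.div x y h ≫ 𝔸.arrow.isoHom) ≫ 𝔸.sqDom = x ≫ P.anchor :=
  (Category.assoc _ _ _).trans (P.div_dom x y h)

lemma div_sqCod (x y : T ⟶ P.total) (h) :
    (P.div x y h ≫ 𝔸.arrow.isoHom) ≫ 𝔸.sqCod = y ≫ P.anchor :=
  (Category.assoc _ _ _).trans (P.div_cod x y h)

@[simp] lemma top_dom (x y : T ⟶ P.total) (h) :
    P.top x y h ≫ 𝔸.dom = (x ≫ P.anchor) ≫ 𝔸.dom := by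
  rw [← div_sqDom x y h, Category.assoc _ _ 𝔸.dom, sqDom_dom, top]; simp only [Category.assoc]

@[simp] lemma top_cod (x y : T ⟶ P.total) (h) :
    P.top x y h ≫ 𝔸.cod = (y ≫ P.anchor) ≫ 𝔸.dom := by
  rw [← div_sqCod x y h, Category.assoc _ _ 𝔸.dom, ← sqTop_cod, top]; simp only [Category.assoc]

@[simp] lemma bot_dom (x y : T ⟶ P.total) (h) :
    P.bot x y h ≫ 𝔸.dom = (x ≫ P.anchor) ≫ 𝔸.cod := by
  rw [← div_sqDom x y h, Category.assoc _ _ 𝔸.cod, sqDom_cod, bot]; simp only [Category.assoc]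

@[simp] lemma bot_cod (x y : T ⟶ P.total) (h) :
    P.bot x y h ≫ 𝔸.cod = (y ≫ P.anchor) ≫ 𝔸.cod := by
  rw [← div_sqCod x y h, Category.assoc _ _ 𝔸.cod, ← sqBot_cod, bot]; simp only [Category.assoc]

lemma anchor_mul_bot (x y : T ⟶ P.total) (h) :
    𝔸.mul (x ≫ P.anchor) (P.bot x y h) (by simp) =
      𝔸.mul (P.top x y h) (y ≫ P.anchor) (by simp) := by
  have := sq_comm' (P.div x y h ≫ 𝔸.arrow.isoHom)
  rw [mul_congr (div_sqDom x y h) (Category.assoc _ _ _),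
    mul_congr (Category.assoc _ _ _) (div_sqCod x y h)] at this
  exact this

lemma Associated.tr₀ {S : PrincipalBundle 𝔸.core X}
    (σ : S.Associated (P.cocycle.andThen (InternalFunctor.D₀ 𝔸).core)) (x y : T ⟶ P.total)
    (h) (h') : S.tr (x ≫ σ.sec) (y ≫ σ.sec) h' = P.top x y h := by
  rw [tr, σ.div x y h h', top]
  have e : pullback.lift x y h ≫ P.cocycle.arr = P.div x y h :=
    (comp_div _ _ _ _).trans (div_congr (by simp) (by simp) _)
  rw [← e]
  simp [InternalFunctor.andThen, InternalFunctor.core, InternalFunctor.D₀]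

lemma Associated.tr₁ {S : PrincipalBundle 𝔸.core X}
    (σ : S.Associated (P.cocycle.andThen (InternalFunctor.D₁ 𝔸).core)) (x y : T ⟶ P.total)
    (h) (h') : S.tr (x ≫ σ.sec) (y ≫ σ.sec) h' = P.bot x y h := by
  rw [tr, σ.div x y h h', bot]
  have e : pullback.lift x y h ≫ P.cocycle.arr = P.div x y h :=
    (comp_div _ _ _ _).trans (div_congr (by simp) (by simp) _)
  rw [← e]
  simp [InternalFunctor.andThen, InternalFunctor.core, InternalFunctor.D₁]

end arrow

end PrincipalBundle

open PrincipalBundle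

/-- A representative of a morphism `P₀ ⟶ P₁` of principal bundles: a principal bundle for the core
of the arrow category, together with bundle maps `P₀ ⟶ S₀` and `S₁ ⟶ P₁`, where `S₀` and `S₁` are
the principal bundles associated with the cocycle of `bundle` composed with the domain and
codomain functors. -/
structure PreHom (P₀ P₁ : PrincipalBundle 𝔸.core X) where
  bundle : PrincipalBundle 𝔸.arrow.core X
  S₀ : PrincipalBundle 𝔸.core X
  S₁ : PrincipalBundle 𝔸.core X
  σ₀ : S₀.Associated (bundle.cocycle.andThen (InternalFunctor.D₀ 𝔸).core)
  σ₁ : S₁.Associated (bundle.cocycle.andThen (InternalFunctor.D₁ 𝔸).core)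
  α₀ : P₀.Hom S₀
  α₁ : S₁.Hom P₁

/-- A 2-cell between representatives: a bundle map `ρ` which, together with the maps `ρ₀` and `ρ₁`
that it induces on the associated bundles, is compatible with the structure maps. -/
structure TwoCell {P₀ P₁ : PrincipalBundle 𝔸.core X} (m m' : PreHom P₀ P₁) where
  ρ : m.bundle.Hom m'.bundle
  ρ₀ : m.S₀.Hom m'.S₀
  ρ₁ : m.S₁.Hom m'.S₁
  sec₀ : m.σ₀.sec ≫ ρ₀.hom = ρ.hom ≫ m'.σ₀.sec
  sec₁ : m.σ₁.sec ≫ ρ₁.hom = ρ.hom ≫ m'.σ₁.sec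
  comm₀ : m.α₀.comp ρ₀ = m'.α₀
  comm₁ : ρ₁.comp m'.α₁ = m.α₁

/-- The morphisms from `P₀` to `P₁`: representatives up to 2-cells. -/
def Arrow (P₀ P₁ : PrincipalBundle 𝔸.core X) : Type max u v :=
  Quot fun m m' : PreHom P₀ P₁ => Nonempty (TwoCell m m')

/-- Equivariant families of arrows of `𝔸`; a convenient description of `Arrow`. -/
structure Theta (P Q : PrincipalBundle 𝔸.core X) where
  val : pullback P.proj Q.proj ⟶ 𝔸.arr
  dom : val ≫ 𝔸.dom = pullback.fst _ _ ≫ P.anchor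
  cod : val ≫ 𝔸.cod = pullback.snd _ _ ≫ Q.anchor
  equivariant : ∀ {T : 𝒞} (x x' : T ⟶ P.total) (y y' : T ⟶ Q.total) (h : x ≫ P.proj = y ≫ Q.proj)
    (h' : x' ≫ P.proj = y' ≫ Q.proj) (hx : x ≫ P.proj = x' ≫ P.proj)
    (hy : y ≫ Q.proj = y' ≫ Q.proj) (h₁) (h₂),
    𝔸.mul (P.tr x x' hx) (pullback.lift x' y' h' ≫ val) h₁ =
      𝔸.mul (pullback.lift x y h ≫ val) (Q.tr y y' hy) h₂

namespace Theta

variable {P Q R S : PrincipalBundle 𝔸.core X}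

/-- The value of an equivariant family at generalised elements. -/
def app (θ : Theta P Q) (x : T ⟶ P.total) (y : T ⟶ Q.total) (h : x ≫ P.proj = y ≫ Q.proj) :
    T ⟶ 𝔸.arr := pullback.lift x y h ≫ θ.val

section

variable (θ : Theta P Q)

@[simp] lemma app_dom (x : T ⟶ P.total) (y : T ⟶ Q.total) (h) :
    θ.app x y h ≫ 𝔸.dom = x ≫ P.anchor := by
  rw [app, Category.assoc, θ.dom]; simp

@[simp] lemma app_cod (x : T ⟶ P.total) (y : T ⟶ Q.total) (h) :
    θ.app x y h ≫ 𝔸.cod = y ≫ Q.anchor := by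
  rw [app, Category.assoc, θ.cod]; simp

lemma comp_app (k : T' ⟶ T) (x : T ⟶ P.total) (y : T ⟶ Q.total) (h) :
    k ≫ θ.app x y h = θ.app (k ≫ x) (k ≫ y) (by simp [h]) := by
  rw [app, app, ← Category.assoc]
  congr 1
  apply pullback.hom_ext <;> simp

lemma app_congr {x x' : T ⟶ P.total} {y y' : T ⟶ Q.total} (hx : x = x') (hy : y = y') (h) :
    θ.app x y h = θ.app x' y' (by rw [← hx, ← hy, h]) := by
  subst hx hy; rfl

lemma app_eq (x x' : T ⟶ P.total) (y y' : T ⟶ Q.total) (h : x ≫ P.proj = y ≫ Q.proj)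
    (h' : x' ≫ P.proj = y' ≫ Q.proj) (hx : x ≫ P.proj = x' ≫ P.proj) :
    θ.app x y h = 𝔸.mul (P.tr x x' hx)
      (𝔸.mul (θ.app x' y' h') (Q.tr y' y (by rw [← h, ← h', hx])) (by simp)) (by simp) := by
  have e := θ.equivariant x x' y y' h h' hx (by rw [← h, ← h', hx])
    (by rw [tr_cod]; exact (θ.app_dom x' y' h').symm) (by rw [tr_dom]; exact θ.app_cod x y h)
  rw [← mul_mul_eq _ _ _ (by simp) (by simp)]
  refine Eq.trans ?_ (mul_congr e.symm rfl (by simp [θ.cod]))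
  rw [mul_mul_eq, mul_congr rfl (tr_mul_tr _ _ _ _ _ _), mul_tr_self]
  rfl

lemma tr_mul_app (x x' : T ⟶ P.total) (y : T ⟶ Q.total) (h : x' ≫ P.proj = y ≫ Q.proj)
    (hx : x ≫ P.proj = x' ≫ P.proj) (h') :
    𝔸.mul (P.tr x x' hx) (θ.app x' y h) h' = θ.app x y (hx.trans h) := by
  rw [θ.app_eq x x' y y (hx.trans h) h hx, mul_congr rfl (mul_tr_self _ _ _ _)]

lemma app_mul_tr (x : T ⟶ P.total) (y y' : T ⟶ Q.total) (h : x ≫ P.proj = y ≫ Q.proj)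
    (hy : y ≫ Q.proj = y' ≫ Q.proj) (h') :
    𝔸.mul (θ.app x y h) (Q.tr y y' hy) h' = θ.app x y' (h.trans hy) := by
  rw [θ.app_eq x x y' y (h.trans hy) h rfl, tr_self_mul]

lemma val_eq : θ.val = θ.app (pullback.fst _ _) (pullback.snd _ _) pullback.condition := by
  simp [app]

end

lemma ext_app {θ θ' : Theta P Q} {W : 𝒞} {e : W ⟶ X} (he : IsCover e) (x : W ⟶ P.total)
    (y : W ⟶ Q.total) (hx : x ≫ P.proj = e) (hy : y ≫ Q.proj = e)
    (H : θ.app x y (hx.trans hy.symm) = θ'.app x y (hx.trans hy.symm)) : θ = θ' := by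
  have : θ.val = θ'.val := by
    let t : pullback P.proj Q.proj ⟶ X := pullback.fst _ _ ≫ P.proj
    have ht : pullback.snd P.proj Q.proj ≫ Q.proj = t := pullback.condition.symm
    have hc : IsCover (pullback.fst t e) :=
      IsCover.of_isPullback (IsPullback.of_hasPullback t e).flip he
    apply hc.cancel
    have c := pullback.condition (f := t) (g := e)
    rw [val_eq, val_eq, comp_app, comp_app]
    have h₁ : (pullback.snd t e ≫ x) ≫ P.proj = (pullback.snd t e ≫ y) ≫ Q.proj := by
      simp [hx, hy]
    have h₂ : (pullback.fst t e ≫ pullback.fst _ _) ≫ P.proj =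
        (pullback.snd t e ≫ x) ≫ P.proj := by
      rw [Category.assoc, Category.assoc, hx, ← c]
    rw [θ.app_eq _ _ _ _ _ h₁ h₂, θ'.app_eq _ _ _ _ _ h₁ h₂]
    refine mul_congr rfl (mul_congr ?_ rfl _) _
    rw [← comp_app _ _ _ _ (hx.trans hy.symm), ← comp_app _ _ _ _ (hx.trans hy.symm), H]
  cases θ; cases θ'; cases this; rfl

/-- Equivariant families can be given locally. -/
lemma exists_app {W : 𝒞} {e : W ⟶ X} (he : IsCover e) (x : W ⟶ P.total)
    (y : W ⟶ Q.total) (hx : x ≫ P.proj = e) (hy : y ≫ Q.proj = e) (t : W ⟶ 𝔸.arr)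
    (h₀ : t ≫ 𝔸.dom = x ≫ P.anchor) (h₁ : t ≫ 𝔸.cod = y ≫ Q.anchor)
    (H : ∀ {T : 𝒞} (w w' : T ⟶ W) (_ : w ≫ e = w' ≫ e) (hx') (hy') (h₂) (h₃),
      𝔸.mul (P.tr (w ≫ x) (w' ≫ x) hx') (w' ≫ t) h₂ =
        𝔸.mul (w ≫ t) (Q.tr (w ≫ y) (w' ≫ y) hy') h₃) :
    ∃ θ : Theta P Q, θ.app x y (hx.trans hy.symm) = t := by
  let q : pullback P.proj Q.proj ⟶ X := pullback.fst _ _ ≫ P.proj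
  have hc : IsCover (pullback.fst q e) :=
    IsCover.of_isPullback (IsPullback.of_hasPullback q e).flip he
  let F : ∀ {T : 𝒞} (a : T ⟶ P.total) (b : T ⟶ Q.total) (w : T ⟶ W)
      (_ : a ≫ P.proj = w ≫ e) (_ : b ≫ Q.proj = w ≫ e), T ⟶ 𝔸.arr := fun a b w ha hb =>
    𝔸.mul (P.tr a (w ≫ x) (by rw [Category.assoc, hx, ha]))
      (𝔸.mul (w ≫ t) (Q.tr (w ≫ y) b (by rw [Category.assoc, hy, hb])) (by simp [h₁]))
      (by simp [h₀])
  have F_congr : ∀ {T : 𝒞} (a a' : T ⟶ P.total) (b b' : T ⟶ Q.total) (w w' : T ⟶ W)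
      (ha) (hb), a = a' → b = b' → w = w' → ∀ ha' hb', F a b w ha hb = F a' b' w' ha' hb' := by
    rintro T a _ b _ w _ ha hb rfl rfl rfl _ _; rfl
  have comp_F : ∀ {T T' : 𝒞} (k : T' ⟶ T) (a : T ⟶ P.total) (b : T ⟶ Q.total) (w : T ⟶ W)
      (ha) (hb) (ha') (hb'), k ≫ F a b w ha hb = F (k ≫ a) (k ≫ b) (k ≫ w) ha' hb' := by
    intro T T' k a b w ha hb ha' hb'
    simp only [F, comp_mul, comp_tr, Category.assoc]
  have F_dom : ∀ {T : 𝒞} (a : T ⟶ P.total) (b : T ⟶ Q.total) (w : T ⟶ W) (ha) (hb),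
      F a b w ha hb ≫ 𝔸.dom = a ≫ P.anchor := by
    intros; simp [F]
  have F_cod : ∀ {T : 𝒞} (a : T ⟶ P.total) (b : T ⟶ Q.total) (w : T ⟶ W) (ha) (hb),
      F a b w ha hb ≫ 𝔸.cod = b ≫ Q.anchor := by
    intros; simp [F]
  have F_indep : ∀ {T : 𝒞} (a : T ⟶ P.total) (b : T ⟶ Q.total) (w w' : T ⟶ W) (ha) (hb) (ha')
      (hb'), F a b w ha hb = F a b w' ha' hb' := by
    intro T a b w w' ha hb ha' hb'
    have hw : w ≫ e = w' ≫ e := ha.symm.trans ha'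
    have ex : (w ≫ x) ≫ P.proj = (w' ≫ x) ≫ P.proj := by simp [hx, hw]
    have ey : (w ≫ y) ≫ Q.proj = (w' ≫ y) ≫ Q.proj := by simp [hy, hw]
    have := H w w' hw ex ey (by simp [h₀]) (by simp [h₁])
    simp only [F]
    rw [mul_congr rfl (mul_congr rfl (tr_mul_tr (w ≫ y) (w' ≫ y) b ey
      (by simp [hy, hb']) (by simp)).symm _)]
    rw [mul_congr rfl (mul_mul_eq _ _ _ (by simp [h₁]) (by simp)).symm,
      mul_congr rfl (mul_congr this.symm rfl _), mul_congr rfl (mul_mul_eq _ _ _ _ _),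
      tr_mul_tr_mul]
  have F_equiv : ∀ {T : 𝒞} (a a' : T ⟶ P.total) (b b' : T ⟶ Q.total) (w : T ⟶ W) (ha) (hb) (ha')
      (hb') (h₂) (h₃) (h₄) (h₅), 𝔸.mul (P.tr a a' h₂) (F a' b' w ha' hb') h₃ =
        𝔸.mul (F a b w ha hb) (Q.tr b b' h₄) h₅ := by
    intro T a a' b b' w ha hb ha' hb' h₂ h₃ h₄ h₅
    simp only [F]
    rw [tr_mul_tr_mul, mul_mul_eq, mul_congr rfl (mul_mul_eq _ _ _ _ _),
      mul_congr rfl (mul_congr rfl (tr_mul_tr _ _ _ _ _ _) _)]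
  have ca : (pullback.fst q e ≫ pullback.fst _ _) ≫ P.proj = pullback.snd q e ≫ e :=
    (Category.assoc _ _ _).trans pullback.condition
  have cb : (pullback.fst q e ≫ pullback.snd _ _) ≫ Q.proj = pullback.snd q e ≫ e :=
    (Category.assoc _ _ _).trans ((congrArg (fun k => pullback.fst q e ≫ k)
      pullback.condition.symm).trans ((Category.assoc _ _ _).symm.trans ca))
  obtain ⟨val, hval, -⟩ := hc.existsUnique_desc (F _ _ _ ca cb) (by
      intro S a b hab
      have ha : (a ≫ pullback.fst q e ≫ pullback.fst _ _) ≫ P.proj =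
          (a ≫ pullback.snd q e) ≫ e := by rw [Category.assoc, ca, Category.assoc]
      have ha' : (a ≫ pullback.fst q e ≫ pullback.snd _ _) ≫ Q.proj =
          (a ≫ pullback.snd q e) ≫ e := by rw [Category.assoc, cb, Category.assoc]
      have hb : (b ≫ pullback.fst q e ≫ pullback.fst _ _) ≫ P.proj =
          (b ≫ pullback.snd q e) ≫ e := by rw [Category.assoc, ca, Category.assoc]
      have hb' : (b ≫ pullback.fst q e ≫ pullback.snd _ _) ≫ Q.proj =
          (b ≫ pullback.snd q e) ≫ e := by rw [Category.assoc, cb, Category.assoc]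
      have e₁ : a ≫ pullback.fst q e ≫ pullback.fst _ _ =
        b ≫ pullback.fst q e ≫ pullback.fst _ _ := by rw [reassoc_of% hab]
      have e₂ : a ≫ pullback.fst q e ≫ pullback.snd _ _ =
        b ≫ pullback.fst q e ≫ pullback.snd _ _ := by rw [reassoc_of% hab]
      rw [comp_F a _ _ _ ca cb ha ha', comp_F b _ _ _ ca cb hb hb',
        F_congr _ _ _ _ _ _ ha ha' e₁ e₂ rfl (by rw [← e₁, ha]) (by rw [← e₂, ha'])]
      exact F_indep _ _ _ _ (by rw [← e₁, ha]) (by rw [← e₂, ha']) hb hb')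
  have key : ∀ {T : 𝒞} (a : T ⟶ P.total) (b : T ⟶ Q.total) (w : T ⟶ W) (ha) (hb) (hab),
      pullback.lift a b hab ≫ val = F a b w ha hb := by
    intro T a b w ha hb hab
    have l : pullback.lift a b hab =
        pullback.lift (pullback.lift a b hab) w (by simp [q, ha]) ≫ pullback.fst q e := by simp
    rw [l, Category.assoc, hval,
      comp_F _ _ _ _ ca cb (by simp [ha]) (by simp [hb])]
    exact F_congr _ _ _ _ _ _ (by simp [ha]) (by simp [hb]) (by simp) (by simp) (by simp) ha hb
  refine ⟨⟨val, ?_, ?_, ?_⟩, ?_⟩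
  · apply hc.cancel
    rw [← Category.assoc, hval, F_dom _ _ _ ca cb, Category.assoc]
  · apply hc.cancel
    rw [← Category.assoc, hval, F_cod _ _ _ ca cb, Category.assoc]
  · intro T a a' b b' h h' ha hb h₂ h₃
    have hc' : IsCover (pullback.fst (a ≫ P.proj) e) :=
      IsCover.of_isPullback (IsPullback.of_hasPullback (a ≫ P.proj) e).flip he
    have d := pullback.condition (f := a ≫ P.proj) (g := e)
    apply hc'.cancel
    have l : ∀ (a : T ⟶ P.total) (b : T ⟶ Q.total) (h : a ≫ P.proj = b ≫ Q.proj) {S : 𝒞}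
        (k : S ⟶ T),
        k ≫ pullback.lift a b h = pullback.lift (k ≫ a) (k ≫ b) (by simp [h]) := by
      intros; apply pullback.hom_ext <;> simp
    rw [comp_mul, comp_mul]
    have q₁ : (pullback.fst (a ≫ P.proj) e ≫ a) ≫ P.proj = pullback.snd (a ≫ P.proj) e ≫ e :=
      (Category.assoc _ _ _).trans d
    have q₂ : (pullback.fst (a ≫ P.proj) e ≫ b) ≫ Q.proj = pullback.snd (a ≫ P.proj) e ≫ e := by
      rw [Category.assoc, ← h, d]
    have q₃ : (pullback.fst (a ≫ P.proj) e ≫ a') ≫ P.proj = pullback.snd (a ≫ P.proj) e ≫ e := by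
      rw [Category.assoc, ← ha, d]
    have q₄ : (pullback.fst (a ≫ P.proj) e ≫ b') ≫ Q.proj = pullback.snd (a ≫ P.proj) e ≫ e := by
      rw [Category.assoc, ← hb, ← h, d]
    refine Eq.trans ?_ ((F_equiv _ _ _ _ _ q₁ q₂ q₃ q₄
      (by simp [ha]) (by simp [F_dom]) (by simp [hb]) (by simp [F_cod])).trans ?_)
    · refine mul_congr (comp_tr _ _ _ _) ?_ _
      rw [← Category.assoc, l, key _ _ _ q₃ q₄]
    · refine mul_congr ?_ (comp_tr _ _ _ _).symm _
      rw [← Category.assoc (pullback.fst (a ≫ P.proj) e), l, key _ _ _ q₁ q₂]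
  · refine (key x y (𝟙 _) (by simp [hx]) (by simp [hy]) _).trans ?_
    simp only [F]
    rw [mul_congr rfl (mul_congr (Category.id_comp _) (tr_congr (Category.id_comp y) rfl _) _),
      mul_congr (tr_congr rfl (Category.id_comp x) _) rfl, tr_self_mul, mul_tr_self]

end Theta
end LaxGeometric

end

noncomputable section

namespace LaxGeometric

variable {𝒞 : Type u} [Category.{v} 𝒞] [HasFiniteLimits 𝒞]

attribute [local simp] pullback.lift_fst pullback.lift_snd pullback.lift_fst_assoc
  pullback.lift_snd_assoc prod.lift_fst prod.lift_snd prod.lift_fst_assoc prod.lift_snd_assoc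

attribute [local simp] InternalCategory.ident_dom InternalCategory.ident_cod

open InternalCategory PrincipalBundle

variable {𝔸 : InternalCategory 𝒞} {X T T' : 𝒞}

/-! ### Functors into the core of the arrow category -/

namespace InternalCategory

lemma coreSq_ext {s t : T ⟶ 𝔸.arrow.isoArr}
    (h₁ : s ≫ 𝔸.arrow.isoHom ≫ 𝔸.sqDom = t ≫ 𝔸.arrow.isoHom ≫ 𝔸.sqDom)
    (h₂ : s ≫ 𝔸.arrow.isoHom ≫ 𝔸.sqCod = t ≫ 𝔸.arrow.isoHom ≫ 𝔸.sqCod)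
    (h₃ : s ≫ (InternalFunctor.D₀ 𝔸).core.arr = t ≫ (InternalFunctor.D₀ 𝔸).core.arr)
    (h₄ : s ≫ (InternalFunctor.D₁ 𝔸).core.arr = t ≫ (InternalFunctor.D₁ 𝔸).core.arr) : s = t := by
  apply iso_ext
  apply sq_ext
  · simpa only [Category.assoc] using h₁
  · have := congrArg (fun k => k ≫ 𝔸.isoHom) h₄
    simpa [InternalFunctor.core, InternalFunctor.D₁] using this
  · have := congrArg (fun k => k ≫ 𝔸.isoHom) h₃
    simpa [InternalFunctor.core, InternalFunctor.D₀] using this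
  · simpa only [Category.assoc] using h₂

lemma exists_coreSq (a a' : T ⟶ 𝔸.arr) (p q : T ⟶ 𝔸.isoArr)
    (h₁ : a ≫ 𝔸.cod = (q ≫ 𝔸.isoHom) ≫ 𝔸.dom) (h₂ : (p ≫ 𝔸.isoHom) ≫ 𝔸.cod = a' ≫ 𝔸.dom)
    (h : 𝔸.mul a (q ≫ 𝔸.isoHom) h₁ = 𝔸.mul (p ≫ 𝔸.isoHom) a' h₂) :
    ∃ s : T ⟶ 𝔸.arrow.isoArr, s ≫ 𝔸.arrow.isoHom ≫ 𝔸.sqDom = a ∧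
      s ≫ 𝔸.arrow.isoHom ≫ 𝔸.sqCod = a' ∧ s ≫ (InternalFunctor.D₀ 𝔸).core.arr = p ∧
      s ≫ (InternalFunctor.D₁ 𝔸).core.arr = q := by
  have ip := 𝔸.isoInverse.precomp p
  have iq := 𝔸.isoInverse.precomp q
  have d : a ≫ 𝔸.dom = (p ≫ 𝔸.isoHom) ≫ 𝔸.dom := by
    simpa using congrArg (fun k => k ≫ 𝔸.dom) h
  have c : (q ≫ 𝔸.isoHom) ≫ 𝔸.cod = a' ≫ 𝔸.cod := by
    simpa using congrArg (fun k => k ≫ 𝔸.cod) h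
  have k₁ : a' ≫ 𝔸.cod = (q ≫ 𝔸.isoInv) ≫ 𝔸.dom := by rw [← c, iq.cod]
  have k₂ : (p ≫ 𝔸.isoInv) ≫ 𝔸.cod = a ≫ 𝔸.dom := by rw [d, ip.dom]
  have k : 𝔸.mul a' (q ≫ 𝔸.isoInv) k₁ = 𝔸.mul (p ≫ 𝔸.isoInv) a k₂ := by
    have e₁ : 𝔸.mul (p ≫ 𝔸.isoInv) (𝔸.mul a (q ≫ 𝔸.isoHom) h₁) (by simpa using k₂) = a' := by
      rw [mul_congr rfl h, ← mul_mul_eq _ _ _ ip.dom.symm (by simpa using h₂),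
        mul_congr (ip.inv_mul.trans (Category.assoc _ _ _).symm) rfl, ident_mul]
    rw [mul_congr e₁.symm rfl, mul_mul_eq, mul_congr rfl (mul_mul_eq _ _ _ _ _),
      mul_congr rfl (mul_congr rfl (iq.mul_inv.trans (Category.assoc _ _ _).symm) _),
      mul_congr rfl (mul_ident _ _ _)]
  let s := sqLift a (q ≫ 𝔸.isoHom) (p ≫ 𝔸.isoHom) a' h₁ h₂ h
  let s' := sqLift a' (q ≫ 𝔸.isoInv) (p ≫ 𝔸.isoInv) a k₁ k₂ k
  have hs : 𝔸.arrow.Inverse s s' := by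
    have sd : s ≫ 𝔸.sqDom = a := sqLift_dom ..
    have sc : s ≫ 𝔸.sqCod = a' := sqLift_cod ..
    have sd' : s' ≫ 𝔸.sqDom = a' := sqLift_dom ..
    have sc' : s' ≫ 𝔸.sqCod = a := sqLift_cod ..
    have e₁ : s ≫ 𝔸.sqDom = s' ≫ 𝔸.sqCod := sd.trans sc'.symm
    have e₂ : s ≫ 𝔸.sqCod = s' ≫ 𝔸.sqDom := sc.trans sd'.symm
    refine ⟨e₁, e₂, ?_, ?_⟩
    · apply sq_ext
      · exact (mul_dom (𝔸 := 𝔸.arrow) s s' e₂).trans (by simp)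
      · rw [arrow_mul_bot, mul_congr (sqLift_bot ..) (sqLift_bot ..), iq.mul_inv]
        simp only [Category.assoc, sqLift_bot, reassoc_of% sd]
        simp only [Category.assoc] at h₁
        rw [reassoc_of% h₁]
      · rw [arrow_mul_top, mul_congr (sqLift_top ..) (sqLift_top ..), ip.mul_inv]
        simp only [Category.assoc, sqLift_top, reassoc_of% sd]
        simp only [Category.assoc] at d
        rw [reassoc_of% d]
      · refine (mul_cod (𝔸 := 𝔸.arrow) s s' e₂).trans ?_
        simp only [Category.assoc, sqLift_cod, Category.comp_id]
        exact e₁.symm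
    · apply sq_ext
      · refine (mul_dom (𝔸 := 𝔸.arrow) s' s e₁.symm).trans ?_
        simp only [Category.assoc, sqLift_dom, Category.comp_id]
        exact e₂.symm
      · rw [arrow_mul_bot, mul_congr (sqLift_bot ..) (sqLift_bot ..), iq.inv_mul]
        simp only [Category.assoc, sqLift_bot, reassoc_of% sc]
        simp only [Category.assoc] at c
        rw [← reassoc_of% c]
      · rw [arrow_mul_top, mul_congr (sqLift_top ..) (sqLift_top ..), ip.inv_mul]
        simp only [Category.assoc, sqLift_top, reassoc_of% sc]
        simp only [Category.assoc] at h₂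
        rw [← reassoc_of% h₂]
      · exact (mul_cod (𝔸 := 𝔸.arrow) s' s e₁.symm).trans (by simp)
  refine ⟨isoLift s s' hs, ?_, ?_, ?_, ?_⟩
  · rw [← Category.assoc, isoLift_hom, sqLift_dom]
  · rw [← Category.assoc, isoLift_hom, sqLift_cod]
  · apply iso_ext
    simp only [InternalFunctor.core, InternalFunctor.D₀, Category.assoc, isoLift_hom]
    rw [← Category.assoc, isoLift_hom, sqLift_top]
  · apply iso_ext
    simp only [InternalFunctor.core, InternalFunctor.D₁, Category.assoc, isoLift_hom]
    rw [← Category.assoc, isoLift_hom, sqLift_bot]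

end InternalCategory

lemma exists_toArrowCore {𝔻 : InternalCategory 𝒞} (F₀ F₁ : InternalFunctor 𝔻 𝔸.core)
    (t : 𝔻.obj ⟶ 𝔸.arr) (h₁ : (𝔻.dom ≫ t) ≫ 𝔸.cod = (F₁.arr ≫ 𝔸.isoHom) ≫ 𝔸.dom)
    (h₂ : (F₀.arr ≫ 𝔸.isoHom) ≫ 𝔸.cod = (𝔻.cod ≫ t) ≫ 𝔸.dom)
    (h : 𝔸.mul (𝔻.dom ≫ t) (F₁.arr ≫ 𝔸.isoHom) h₁ = 𝔸.mul (F₀.arr ≫ 𝔸.isoHom) (𝔻.cod ≫ t) h₂)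
    (k₀ : t ≫ 𝔸.dom = F₀.obj) (k₁ : t ≫ 𝔸.cod = F₁.obj) :
    ∃ F : InternalFunctor 𝔻 𝔸.arrow.core, F.obj = t ∧
      F.arr ≫ (InternalFunctor.D₀ 𝔸).core.arr = F₀.arr ∧
      F.arr ≫ (InternalFunctor.D₁ 𝔸).core.arr = F₁.arr := by
  obtain ⟨s, s₁, s₂, s₃, s₄⟩ := exists_coreSq _ _ _ _ h₁ h₂ h
  refine ⟨⟨t, s, s₁, s₂, ?_, ?_⟩, rfl, s₃, s₄⟩
  · apply coreSq_ext
    · have := 𝔸.arrow.core.ident_dom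
      simp only [Category.assoc, s₁]
      rw [← Category.assoc, ident_dom, Category.id_comp]
      exact ((congrArg (fun k => t ≫ k) this).trans (Category.comp_id t)).symm
    · have := 𝔸.arrow.core.ident_cod
      simp only [Category.assoc, s₂]
      rw [← Category.assoc, ident_cod, Category.id_comp]
      exact ((congrArg (fun k => t ≫ k) this).trans (Category.comp_id t)).symm
    · rw [Category.assoc, s₃, F₀.ident, Category.assoc, (InternalFunctor.D₀ 𝔸).core.ident, ← k₀]
      exact Category.assoc _ _ _
    · rw [Category.assoc, s₄, F₁.ident, Category.assoc, (InternalFunctor.D₁ 𝔸).core.ident, ← k₁]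
      exact Category.assoc _ _ _
  · intro T f g hfg h'
    apply coreSq_ext
    · rw [Category.assoc, s₁]
      refine Eq.trans ?_ (𝔸.arrow.core.mul_dom (f ≫ s) (g ≫ s) h').symm
      rw [← Category.assoc, mul_dom, Category.assoc, Category.assoc]
      exact congrArg (fun k => f ≫ k) s₁.symm
    · rw [Category.assoc, s₂]
      refine Eq.trans ?_ (𝔸.arrow.core.mul_cod (f ≫ s) (g ≫ s) h').symm
      rw [← Category.assoc, mul_cod, Category.assoc, Category.assoc]
      exact congrArg (fun k => g ≫ k) s₂.symm
    · have e : ((f ≫ s) ≫ (InternalFunctor.D₀ 𝔸).core.arr) ≫ 𝔸.core.cod =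
          ((g ≫ s) ≫ (InternalFunctor.D₀ 𝔸).core.arr) ≫ 𝔸.core.dom := by
        rw [Category.assoc f, Category.assoc g, s₃, Category.assoc, Category.assoc, F₀.cod, F₀.dom,
          ← Category.assoc, hfg, Category.assoc]
      rw [(InternalFunctor.D₀ 𝔸).core.comp _ _ h' e, Category.assoc, s₃,
        F₀.comp f g hfg (by simpa only [Category.assoc, s₃] using e)]
      exact mul_congr (by rw [Category.assoc, s₃]) (by rw [Category.assoc, s₃]) _
    · have e : ((f ≫ s) ≫ (InternalFunctor.D₁ 𝔸).core.arr) ≫ 𝔸.core.cod =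
          ((g ≫ s) ≫ (InternalFunctor.D₁ 𝔸).core.arr) ≫ 𝔸.core.dom := by
        rw [Category.assoc f, Category.assoc g, s₄, Category.assoc, Category.assoc, F₁.cod, F₁.dom,
          ← Category.assoc, hfg, Category.assoc]
      rw [(InternalFunctor.D₁ 𝔸).core.comp _ _ h' e, Category.assoc, s₄,
        F₁.comp f g hfg (by simpa only [Category.assoc, s₄] using e)]
      exact mul_congr (by rw [Category.assoc, s₄]) (by rw [Category.assoc, s₄]) _

/-- An internal natural transformation `t : F₀ ⟶ F₁` between functors into the core of `𝔸` (its
components are arrows of `𝔸`), seen as a functor into the core of the arrow category: it is given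
by `t` on objects and by the naturality squares of `t`, with top `F₀` and bottom `F₁`, on arrows. -/
def InternalFunctor.ofNatTrans {𝔻 : InternalCategory 𝒞} (F₀ F₁ : InternalFunctor 𝔻 𝔸.core)
    (t : 𝔻.obj ⟶ 𝔸.arr) (h₁ : (𝔻.dom ≫ t) ≫ 𝔸.cod = (F₁.arr ≫ 𝔸.isoHom) ≫ 𝔸.dom)
    (h₂ : (F₀.arr ≫ 𝔸.isoHom) ≫ 𝔸.cod = (𝔻.cod ≫ t) ≫ 𝔸.dom)
    (h : 𝔸.mul (𝔻.dom ≫ t) (F₁.arr ≫ 𝔸.isoHom) h₁ = 𝔸.mul (F₀.arr ≫ 𝔸.isoHom) (𝔻.cod ≫ t) h₂)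
    (k₀ : t ≫ 𝔸.dom = F₀.obj) (k₁ : t ≫ 𝔸.cod = F₁.obj) : InternalFunctor 𝔻 𝔸.arrow.core :=
  (exists_toArrowCore F₀ F₁ t h₁ h₂ h k₀ k₁).choose

section

variable {𝔻 : InternalCategory 𝒞} (F₀ F₁ : InternalFunctor 𝔻 𝔸.core) (t : 𝔻.obj ⟶ 𝔸.arr)
  (h₁ h₂) (h : 𝔸.mul (𝔻.dom ≫ t) (F₁.arr ≫ 𝔸.isoHom) h₁ =
    𝔸.mul (F₀.arr ≫ 𝔸.isoHom) (𝔻.cod ≫ t) h₂)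
  (k₀ : t ≫ 𝔸.dom = F₀.obj) (k₁ : t ≫ 𝔸.cod = F₁.obj)

lemma InternalFunctor.ofNatTrans_obj : (ofNatTrans F₀ F₁ t h₁ h₂ h k₀ k₁).obj = t :=
  (exists_toArrowCore F₀ F₁ t h₁ h₂ h k₀ k₁).choose_spec.1

lemma InternalFunctor.ofNatTrans_D₀ :
    (ofNatTrans F₀ F₁ t h₁ h₂ h k₀ k₁).arr ≫ (InternalFunctor.D₀ 𝔸).core.arr = F₀.arr :=
  (exists_toArrowCore F₀ F₁ t h₁ h₂ h k₀ k₁).choose_spec.2.1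

lemma InternalFunctor.ofNatTrans_D₁ :
    (ofNatTrans F₀ F₁ t h₁ h₂ h k₀ k₁).arr ≫ (InternalFunctor.D₁ 𝔸).core.arr = F₁.arr :=
  (exists_toArrowCore F₀ F₁ t h₁ h₂ h k₀ k₁).choose_spec.2.2

end

end LaxGeometric

end

noncomputable section

namespace LaxGeometric

variable {𝒞 : Type u} [Category.{v} 𝒞] [HasFiniteLimits 𝒞]

attribute [local simp] pullback.lift_fst pullback.lift_snd pullback.lift_fst_assoc
  pullback.lift_snd_assoc prod.lift_fst prod.lift_snd prod.lift_fst_assoc prod.lift_snd_assoc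

attribute [local simp] InternalCategory.ident_dom InternalCategory.ident_cod

open InternalCategory PrincipalBundle

variable {𝔸 : InternalCategory 𝒞} {X T T' : 𝒞}
namespace PreHom

variable {P₀ P₁ P₂ : PrincipalBundle 𝔸.core X} (m : PreHom P₀ P₁) (m' : PreHom P₁ P₂)

/-- The map from the bundle of a morphism to its source. -/
def src : m.bundle.total ⟶ P₀.total := m.σ₀.sec ≫ m.α₀.inv.hom

/-- The map from the bundle of a morphism to its target. -/
def tgt : m.bundle.total ⟶ P₁.total := m.σ₁.sec ≫ m.α₁.hom

@[simp] lemma src_proj : m.src ≫ P₀.proj = m.bundle.proj := by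
  rw [src, Category.assoc, Hom.proj, m.σ₀.proj]

@[simp] lemma tgt_proj : m.tgt ≫ P₁.proj = m.bundle.proj := by
  rw [tgt, Category.assoc, Hom.proj, m.σ₁.proj]

@[simp] lemma src_anchor : m.src ≫ P₀.anchor = m.bundle.anchor ≫ 𝔸.dom := by
  rw [src, Category.assoc, Hom.anchor, m.σ₀.anchor]; rfl

@[simp] lemma tgt_anchor : m.tgt ≫ P₁.anchor = m.bundle.anchor ≫ 𝔸.cod := by
  rw [tgt, Category.assoc, Hom.anchor, m.σ₁.anchor]; rfl

lemma sec₀_proj : m.σ₀.sec ≫ m.S₀.proj = m.bundle.proj := m.σ₀.proj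

lemma sec₁_proj : m.σ₁.sec ≫ m.S₁.proj = m.bundle.proj := m.σ₁.proj

lemma sec₀_anchor : m.σ₀.sec ≫ m.S₀.anchor = m.bundle.anchor ≫ 𝔸.dom := m.σ₀.anchor

lemma sec₁_anchor : m.σ₁.sec ≫ m.S₁.anchor = m.bundle.anchor ≫ 𝔸.cod := m.σ₁.anchor

lemma tr_src (w w' : T ⟶ m.bundle.total) (h) (h') :
    P₀.tr (w ≫ m.src) (w' ≫ m.src) h' = m.bundle.top w w' h := by
  have e : (w ≫ m.σ₀.sec) ≫ m.S₀.proj = (w' ≫ m.σ₀.sec) ≫ m.S₀.proj := by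
    rw [Category.assoc, Category.assoc, m.σ₀.proj, h]
  rw [← m.σ₀.tr₀ w w' h e, ← m.α₀.inv.tr _ _ e (by simpa [src] using h')]
  exact tr_congr (by simp [src]) (by simp [src]) _

lemma tr_tgt (w w' : T ⟶ m.bundle.total) (h) (h') :
    P₁.tr (w ≫ m.tgt) (w' ≫ m.tgt) h' = m.bundle.bot w w' h := by
  have e : (w ≫ m.σ₁.sec) ≫ m.S₁.proj = (w' ≫ m.σ₁.sec) ≫ m.S₁.proj := by
    rw [Category.assoc, Category.assoc, m.σ₁.proj, h]
  rw [← m.σ₁.tr₁ w w' h e, ← m.α₁.tr _ _ e (by simpa [tgt] using h')]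
  exact tr_congr (by simp [tgt]) (by simp [tgt]) _

/-- The equivariant family of a morphism. -/
lemma exists_theta : ∃ θ : Theta P₀ P₁, θ.app m.src m.tgt (by simp) = m.bundle.anchor := by
  refine Theta.exists_app m.bundle.isCover m.src m.tgt (by simp) (by simp) m.bundle.anchor
    (by simp) (by simp) ?_
  intro T w w' h hx hy h₂ h₃
  rw [mul_congr (m.tr_src w w' h hx) rfl, mul_congr rfl (m.tr_tgt w w' h hy), anchor_mul_bot]

/-- The equivariant family of a morphism. -/
def theta : Theta P₀ P₁ := m.exists_theta.choose

lemma theta_app (w : T ⟶ m.bundle.total) (h) :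
    m.theta.app (w ≫ m.src) (w ≫ m.tgt) h = w ≫ m.bundle.anchor := by
  rw [← Theta.comp_app _ w m.src m.tgt (by simp), theta, m.exists_theta.choose_spec]

/-! ### Composition -/

/-- `P ×_X P₁ ×_X P'` for the bundles `P` of `m` and `P'` of `m'`. -/
abbrev tripleTotal : 𝒞 :=
  pullback (pullback.fst m.bundle.proj P₁.proj ≫ m.bundle.proj) m'.bundle.proj

/-- The first projection. -/
def triple₁ : m.tripleTotal m' ⟶ m.bundle.total := pullback.fst _ _ ≫ pullback.fst _ _

/-- The second projection. -/
def triple₂ : m.tripleTotal m' ⟶ P₁.total := pullback.fst _ _ ≫ pullback.snd _ _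

/-- The third projection. -/
def triple₃ : m.tripleTotal m' ⟶ m'.bundle.total := pullback.snd _ _

/-- The projection to `X`. -/
def tripleProj : m.tripleTotal m' ⟶ X := m.triple₁ m' ≫ m.bundle.proj

lemma triple₁_proj : m.triple₁ m' ≫ m.bundle.proj = m.tripleProj m' := rfl

lemma triple₂_proj : m.triple₂ m' ≫ P₁.proj = m.tripleProj m' := by
  rw [tripleProj, triple₂, triple₁, Category.assoc, Category.assoc]
  exact congrArg (fun k => pullback.fst _ _ ≫ k) pullback.condition.symm

lemma triple₃_proj : m.triple₃ m' ≫ m'.bundle.proj = m.tripleProj m' := by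
  rw [tripleProj, triple₃, triple₁, ← pullback.condition, Category.assoc]

attribute [local simp] triple₁_proj triple₂_proj triple₃_proj sec₀_proj sec₁_proj sec₀_anchor
  sec₁_anchor Hom.proj Hom.anchor

lemma tripleProj_isCover : IsCover (m.tripleProj m') := by
  have e : m.tripleProj m' = pullback.fst _ _ ≫ pullback.fst _ _ ≫ m.bundle.proj :=
    Category.assoc _ _ _
  rw [e]
  refine IsCover.comp ?_ (IsCover.comp ?_ m.bundle.isCover)
  · exact IsCover.of_isPullback (IsPullback.of_hasPullback _ _).flip m'.bundle.isCover
  · exact IsCover.of_isPullback (IsPullback.of_hasPullback _ _).flip P₁.isCover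

/-- The natural isomorphism that glues `m` and `m'`: at `(w, y, w')` it is the component of the
structure map `α₁` of `m` at `(w, y)` followed by the inverse of the component of the structure
map `α₀` of `m'` at `(y, w')`. -/
def glue : m.tripleTotal m' ⟶ 𝔸.arr :=
  𝔸.mul (P₁.tr (m.triple₁ m' ≫ m.σ₁.sec ≫ m.α₁.hom) (m.triple₂ m') (by simp))
    (m'.S₀.tr (m.triple₂ m' ≫ m'.α₀.hom) (m.triple₃ m' ≫ m'.σ₀.sec) (by simp)) (by simp)

@[simp] lemma glue_dom : m.glue m' ≫ 𝔸.dom = m.triple₁ m' ≫ m.bundle.anchor ≫ 𝔸.cod := by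
  simp [glue]

@[simp] lemma glue_cod : m.glue m' ≫ 𝔸.cod = m.triple₃ m' ≫ m'.bundle.anchor ≫ 𝔸.dom := by
  simp [glue]

lemma glue_eq : m.glue m' = P₁.tr (m.triple₁ m' ≫ m.tgt) (m.triple₃ m' ≫ m'.src) (by simp) := by
  rw [← tr_mul_tr _ (m.triple₂ m') _ (by simp) (by simp) (by simp)]
  refine mul_congr rfl ?_ _
  rw [← m'.α₀.inv.tr _ _ (by simp) (by simp)]
  refine tr_congr ?_ (by simp [src]) _
  rw [Category.assoc, Hom.hom_inv, Category.comp_id]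

/-- The object part of the composite cocycle. -/
def compObj : m.tripleTotal m' ⟶ 𝔸.arr :=
  𝔸.mul (m.triple₁ m' ≫ m.bundle.anchor)
    (𝔸.mul (m.glue m') (m.triple₃ m' ≫ m'.bundle.anchor) (by simp)) (by simp)

@[simp] lemma compObj_dom :
    m.compObj m' ≫ 𝔸.dom = m.triple₁ m' ≫ m.bundle.anchor ≫ 𝔸.dom := by
  simp [compObj]

@[simp] lemma compObj_cod :
    m.compObj m' ≫ 𝔸.cod = m.triple₃ m' ≫ m'.bundle.anchor ≫ 𝔸.cod := by
  simp [compObj]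

end PreHom

/-- The functor between kernel pairs induced by a morphism over `X`. -/
def kernelPairMap {X Y Z : 𝒞} {e : Y ⟶ X} {e' : Z ⟶ X} (f : Y ⟶ Z) (h : f ≫ e' = e) :
    InternalFunctor (kernelPair e) (kernelPair e') where
  obj := f
  arr := pullback.lift (pullback.fst _ _ ≫ f) (pullback.snd _ _ ≫ f)
    (by rw [Category.assoc, Category.assoc, h, pullback.condition])
  dom := by simp
  cod := by simp
  ident := by apply pullback.hom_ext <;> simp
  comp a b hab h' := by apply pullback.hom_ext <;> simp [InternalCategory.mul]

lemma kernelPairMap_cocycle {𝔾 : InternalCategory 𝒞} (P : PrincipalBundle 𝔾 X) {Y : 𝒞} {e : Y ⟶ X}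
    (f : Y ⟶ P.total) (h : f ≫ P.proj = e) (y z : T ⟶ Y) (hyz) (h') :
    pullback.lift y z hyz ≫ ((kernelPairMap f h).andThen P.cocycle).arr =
      P.div (y ≫ f) (z ≫ f) h' := by
  change pullback.lift y z hyz ≫ pullback.lift _ _ _ ≫ P.div _ _ _ = _
  rw [comp_div, comp_div]
  exact div_congr (by simp) (by simp) _

namespace PreHom

variable {P₀ P₁ P₂ : PrincipalBundle 𝔸.core X} (m : PreHom P₀ P₁) (m' : PreHom P₁ P₂)

/-- The domain of the composite cocycle. -/
def compDom : InternalFunctor (kernelPair (m.tripleProj m')) 𝔸.core :=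
  ((kernelPairMap (m.triple₁ m') (m.triple₁_proj m')).andThen m.bundle.cocycle).andThen
    (InternalFunctor.D₀ 𝔸).core

/-- The codomain of the composite cocycle. -/
def compCod : InternalFunctor (kernelPair (m.tripleProj m')) 𝔸.core :=
  ((kernelPairMap (m.triple₃ m') (m.triple₃_proj m')).andThen m'.bundle.cocycle).andThen
    (InternalFunctor.D₁ 𝔸).core

lemma compDom_obj : (m.compDom m').obj = m.triple₁ m' ≫ m.bundle.anchor ≫ 𝔸.dom :=
  Category.assoc _ _ _

lemma compCod_obj : (m.compCod m').obj = m.triple₃ m' ≫ m'.bundle.anchor ≫ 𝔸.cod :=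
  Category.assoc _ _ _

lemma compDom_arr (y z : T ⟶ m.tripleTotal m') (h) (h') :
    pullback.lift y z h ≫ (m.compDom m').arr ≫ 𝔸.isoHom =
      m.bundle.top (y ≫ m.triple₁ m') (z ≫ m.triple₁ m') h' := by
  rw [top, ← kernelPairMap_cocycle m.bundle (m.triple₁ m') (m.triple₁_proj m') y z h h']
  simp [compDom, InternalFunctor.andThen, InternalFunctor.core, InternalFunctor.D₀]

lemma compCod_arr (y z : T ⟶ m.tripleTotal m') (h) (h') :
    pullback.lift y z h ≫ (m.compCod m').arr ≫ 𝔸.isoHom =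
      m'.bundle.bot (y ≫ m.triple₃ m') (z ≫ m.triple₃ m') h' := by
  rw [bot, ← kernelPairMap_cocycle m'.bundle (m.triple₃ m') (m.triple₃_proj m') y z h h']
  simp [compCod, InternalFunctor.andThen, InternalFunctor.core, InternalFunctor.D₁]

lemma compObj_eq (y : T ⟶ m.tripleTotal m') (h₁) (h₂) (h₃) : y ≫ m.compObj m' =
    𝔸.mul (m.theta.app (y ≫ m.triple₁ m' ≫ m.src) (y ≫ m.triple₃ m' ≫ m'.src) h₁)
      (m'.theta.app (y ≫ m.triple₃ m' ≫ m'.src) (y ≫ m.triple₃ m' ≫ m'.tgt) h₂) h₃ := by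
  have e₁ : 𝔸.mul (m.triple₁ m' ≫ m.bundle.anchor) (m.glue m') (by simp) =
      m.theta.app (m.triple₁ m' ≫ m.src) (m.triple₃ m' ≫ m'.src)
        (by simp [triple₁_proj, triple₃_proj]) := by
    rw [mul_congr (m.theta_app (m.triple₁ m') (by simp)).symm (m.glue_eq m'), Theta.app_mul_tr]
  rw [compObj, ← mul_mul_eq _ _ _ (by simp) (by simp), mul_congr e₁
    (m'.theta_app (m.triple₃ m') (by simp)).symm, comp_mul, mul_congr (Theta.comp_app ..)
    (Theta.comp_app ..)]

end PreHom

namespace Theta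

variable {P Q R S : PrincipalBundle 𝔸.core X}

lemma app_mul_app (θ : Theta P Q) (θ' : Theta Q R) (x : T ⟶ P.total) (y y' : T ⟶ Q.total)
    (z : T ⟶ R.total) (h₁) (h₂) (h₃) (k₁) (k₂) (k₃) :
    𝔸.mul (θ.app x y h₁) (θ'.app y z h₂) h₃ = 𝔸.mul (θ.app x y' k₁) (θ'.app y' z k₂) k₃ := by
  rw [mul_congr (θ.app_mul_tr x y' y k₁ (by rw [← h₁, k₁]) (by simp)).symm rfl, mul_mul_eq,
    mul_congr rfl (tr_mul_app ..)]

end Theta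

namespace PreHom

variable {P₀ P₁ P₂ : PrincipalBundle 𝔸.core X} (m : PreHom P₀ P₁) (m' : PreHom P₁ P₂)

attribute [local simp] triple₁_proj triple₂_proj triple₃_proj

lemma compObj_nat (y z : T ⟶ m.tripleTotal m') (h : y ≫ m.tripleProj m' = z ≫ m.tripleProj m')
    (h₁) (h₂) (h₃) (h₄) :
    𝔸.mul (y ≫ m.compObj m') (m'.bundle.bot (y ≫ m.triple₃ m') (z ≫ m.triple₃ m') h₁) h₂ =
      𝔸.mul (m.bundle.top (y ≫ m.triple₁ m') (z ≫ m.triple₁ m') h₃) (z ≫ m.compObj m') h₄ := by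
  rw [mul_congr rfl (m'.tr_tgt (y ≫ m.triple₃ m') (z ≫ m.triple₃ m') h₁ (by simp [h])).symm,
    mul_congr (m.tr_src (y ≫ m.triple₁ m') (z ≫ m.triple₁ m') h₃ (by simp [h])).symm rfl]
  rw [mul_congr (m.compObj_eq m' y (by simp) (by simp) (by simp)) rfl,
    mul_congr rfl (m.compObj_eq m' z (by simp) (by simp) (by simp))]
  refine (mul_mul_eq _ _ _ _ _).trans (Eq.trans ?_ (mul_mul_eq _ _ _ (by simp) (by simp)))
  simp only [Category.assoc, Theta.app_mul_tr, Theta.tr_mul_app]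
  exact Theta.app_mul_app ..

/-- The composite cocycle on `P ×_X P₁ ×_X P'`. -/
def compCocycle : InternalFunctor (kernelPair (m.tripleProj m')) 𝔸.arrow.core :=
  InternalFunctor.ofNatTrans (m.compDom m') (m.compCod m') (m.compObj m')
    (by
      have := (m.compCod m').dom
      refine Eq.trans ?_ (this.symm.trans (Category.assoc _ _ _).symm)
      rw [Category.assoc, compObj_cod, compCod_obj])
    (by
      have := (m.compDom m').cod
      refine (Category.assoc _ _ _).trans (this.trans ?_)
      rw [Category.assoc, compObj_dom, compDom_obj])
    (by
      have e₁ := m.compDom_arr m' (pullback.fst _ _) (pullback.snd _ _) pullback.condition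
        (by simp [pullback.condition])
      have e₂ := m.compCod_arr m' (pullback.fst _ _) (pullback.snd _ _) pullback.condition
        (by simp [pullback.condition])
      have l : pullback.lift (pullback.fst (m.tripleProj m') (m.tripleProj m')) (pullback.snd _ _)
          pullback.condition = 𝟙 _ := by apply pullback.hom_ext <;> simp
      rw [l, Category.id_comp] at e₁ e₂
      rw [mul_congr rfl e₂, mul_congr e₁ rfl]
      exact m.compObj_nat m' _ _ pullback.condition _ _ _ _)
    ((m.compObj_dom m').trans (m.compDom_obj m').symm)
    ((m.compObj_cod m').trans (m.compCod_obj m').symm)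

lemma compCocycle_obj : (m.compCocycle m').obj = m.compObj m' :=
  InternalFunctor.ofNatTrans_obj ..

lemma compCocycle_D₀ :
    (m.compCocycle m').arr ≫ (InternalFunctor.D₀ 𝔸).core.arr = (m.compDom m').arr :=
  InternalFunctor.ofNatTrans_D₀ ..

lemma compCocycle_D₁ :
    (m.compCocycle m').arr ≫ (InternalFunctor.D₁ 𝔸).core.arr = (m.compCod m').arr :=
  InternalFunctor.ofNatTrans_D₁ ..

/-- Exhibits `m''` as a composite of `m` and `m'`: its bundle is associated with the composite
cocycle, its structure maps are those of `m` and `m'`, up to the canonical identification of its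
domain with the domain of `m` and of its codomain with the codomain of `m'`. -/
structure Composite (m'' : PreHom P₀ P₂) where
  assoc : m''.bundle.Associated (m.compCocycle m')
  κ₀ : m.S₀.Hom m''.S₀
  κ₁ : m''.S₁.Hom m'.S₁
  sec₀ : m.triple₁ m' ≫ m.σ₀.sec ≫ κ₀.hom = assoc.sec ≫ m''.σ₀.sec
  sec₁ : assoc.sec ≫ m''.σ₁.sec ≫ κ₁.hom = m.triple₃ m' ≫ m'.σ₁.sec
  comm₀ : m.α₀.comp κ₀ = m''.α₀
  comm₁ : κ₁.comp m'.α₁ = m''.α₁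

end PreHom

end LaxGeometric

end

noncomputable section

namespace LaxGeometric

variable {𝒞 : Type u} [Category.{v} 𝒞] [HasFiniteLimits 𝒞]

attribute [local simp] pullback.lift_fst pullback.lift_snd pullback.lift_fst_assoc
  pullback.lift_snd_assoc prod.lift_fst prod.lift_snd prod.lift_fst_assoc prod.lift_snd_assoc

attribute [local simp] InternalCategory.ident_dom InternalCategory.ident_cod

open InternalCategory PrincipalBundle

variable {𝔸 : InternalCategory 𝒞} {X T T' : 𝒞}
lemma InternalCategory.Inverse.cancel {p q a b : T ⟶ 𝔸.arr} (h : 𝔸.Inverse p q) {h₁ h₂}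
    (e : 𝔸.mul p a h₁ = 𝔸.mul p b h₂) : a = b := by
  have hb := congrArg (fun k => k ≫ 𝔸.dom) e
  have key : ∀ (c : T ⟶ 𝔸.arr) (hc : p ≫ 𝔸.cod = c ≫ 𝔸.dom),
      𝔸.mul q (𝔸.mul p c hc) (by simp [h.dom]) = c := by
    intro c hc
    rw [← mul_mul_eq _ _ _ h.dom.symm (by simp [hc]),
      mul_congr (h.inv_mul.trans (Category.assoc _ _ _).symm) rfl, ident_mul]
  rw [← key a h₁, mul_congr rfl e, key b h₂]

namespace Theta

variable {P Q R S : PrincipalBundle 𝔸.core X}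

lemma act₀ (θ : Theta P Q) (x : T ⟶ P.total) (y : T ⟶ Q.total) (h : x ≫ P.proj = y ≫ Q.proj)
    (g : T ⟶ 𝔸.arrow.isoArr) (hg : θ.app x y h = g ≫ 𝔸.arrow.isoHom ≫ 𝔸.sqDom) :
    x ≫ P.anchor = (g ≫ (InternalFunctor.D₀ 𝔸).core.arr) ≫ 𝔸.core.dom := by
  rw [Category.assoc, (InternalFunctor.D₀ 𝔸).core.dom, ← θ.app_dom x y h, hg]
  simp only [Category.assoc]; rfl

lemma act₁ (θ : Theta P Q) (x : T ⟶ P.total) (y : T ⟶ Q.total) (h : x ≫ P.proj = y ≫ Q.proj)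
    (g : T ⟶ 𝔸.arrow.isoArr) (hg : θ.app x y h = g ≫ 𝔸.arrow.isoHom ≫ 𝔸.sqDom) :
    y ≫ Q.anchor = (g ≫ (InternalFunctor.D₁ 𝔸).core.arr) ≫ 𝔸.core.dom := by
  rw [Category.assoc, (InternalFunctor.D₁ 𝔸).core.dom, ← θ.app_cod x y h, hg]
  simp only [Category.assoc]; rfl

lemma D₀_hom : (InternalFunctor.D₀ 𝔸).core.arr ≫ 𝔸.isoHom = 𝔸.arrow.isoHom ≫ 𝔸.sqTop :=
  isoLift_hom _ _ ((InternalFunctor.D₀ 𝔸).inverse 𝔸.arrow.isoInverse)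

lemma D₁_hom : (InternalFunctor.D₁ 𝔸).core.arr ≫ 𝔸.isoHom = 𝔸.arrow.isoHom ≫ 𝔸.sqBot :=
  isoLift_hom _ _ ((InternalFunctor.D₁ 𝔸).inverse 𝔸.arrow.isoInverse)

lemma app_act (θ : Theta P Q) (x : T ⟶ P.total) (y : T ⟶ Q.total) (h : x ≫ P.proj = y ≫ Q.proj)
    (g : T ⟶ 𝔸.arrow.isoArr) (hg : θ.app x y h = g ≫ 𝔸.arrow.isoHom ≫ 𝔸.sqDom) (h') :
    θ.app (P.act x _ (θ.act₀ x y h g hg)) (Q.act y _ (θ.act₁ x y h g hg)) h' =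
      g ≫ 𝔸.arrow.isoHom ≫ 𝔸.sqCod := by
  have s := sq_comm' (g ≫ 𝔸.arrow.isoHom)
  have t₀ : P.tr x (P.act x _ (θ.act₀ x y h g hg)) (by simp) =
      (g ≫ 𝔸.arrow.isoHom) ≫ 𝔸.sqTop := by
    rw [tr, div_act, Category.assoc, D₀_hom, Category.assoc]
  have t₁ : Q.tr y (Q.act y _ (θ.act₁ x y h g hg)) (by simp) =
      (g ≫ 𝔸.arrow.isoHom) ≫ 𝔸.sqBot := by
    rw [tr, div_act, Category.assoc, D₁_hom, Category.assoc]
  have e₀ := θ.tr_mul_app x _ (Q.act y _ (θ.act₁ x y h g hg)) h'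
    (act_proj x _ (θ.act₀ x y h g hg)).symm (by simp)
  have e₁ := θ.app_mul_tr x y (Q.act y _ (θ.act₁ x y h g hg)) h
    (act_proj y _ (θ.act₁ x y h g hg)).symm (by simp)
  rw [mul_congr t₀ rfl] at e₀
  rw [mul_congr (hg.trans (Category.assoc _ _ _).symm) t₁, s] at e₁
  have := e₀.trans e₁.symm
  have i := ((InternalFunctor.D₀ 𝔸).inverse 𝔸.arrow.isoInverse).precomp g
  rw [← Category.assoc] at i
  exact (Inverse.cancel i this).trans (Category.assoc _ _ _)

/-- The action of the core of the arrow category on `P ×_X Q`. -/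
def action (θ : Theta P Q) : pullback θ.val 𝔸.arrow.core.dom ⟶ pullback P.proj Q.proj :=
  pullback.lift
    (P.act (pullback.fst θ.val 𝔸.arrow.core.dom ≫ pullback.fst _ _)
      (pullback.snd θ.val 𝔸.arrow.core.dom ≫ (InternalFunctor.D₀ 𝔸).core.arr)
      (θ.act₀ _ (pullback.fst θ.val 𝔸.arrow.core.dom ≫ pullback.snd _ _)
        (by simp [pullback.condition]) _
        (by rw [← θ.comp_app _ _ _ pullback.condition, ← θ.val_eq]; exact pullback.condition)))
    (Q.act (pullback.fst θ.val 𝔸.arrow.core.dom ≫ pullback.snd _ _)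
      (pullback.snd θ.val 𝔸.arrow.core.dom ≫ (InternalFunctor.D₁ 𝔸).core.arr)
      (θ.act₁ (pullback.fst θ.val 𝔸.arrow.core.dom ≫ pullback.fst _ _) _
        (by simp [pullback.condition]) _
        (by rw [← θ.comp_app _ _ _ pullback.condition, ← θ.val_eq]; exact pullback.condition)))
    (by simp [pullback.condition])

section action

variable (θ : Theta P Q) (x : T ⟶ pullback P.proj Q.proj) (g : T ⟶ 𝔸.arrow.core.arr)
  (h : x ≫ θ.val = g ≫ 𝔸.arrow.core.dom)

lemma val_eq' (x : T ⟶ pullback P.proj Q.proj) (h' : (x ≫ pullback.fst _ _) ≫ P.proj = _) :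
    θ.app (x ≫ pullback.fst _ _) (x ≫ pullback.snd _ _) h' = x ≫ θ.val := by
  rw [← θ.comp_app _ _ _ pullback.condition, ← θ.val_eq]

lemma action_aux₀ (h : x ≫ θ.val = g ≫ 𝔸.arrow.core.dom) :
    (x ≫ pullback.fst P.proj Q.proj) ≫ P.anchor =
      (g ≫ (InternalFunctor.D₀ 𝔸).core.arr) ≫ 𝔸.core.dom :=
  θ.act₀ _ (x ≫ pullback.snd _ _) (by simp [pullback.condition]) g ((θ.val_eq' _ _).trans h)

lemma action_aux₁ (h : x ≫ θ.val = g ≫ 𝔸.arrow.core.dom) :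
    (x ≫ pullback.snd P.proj Q.proj) ≫ Q.anchor =
      (g ≫ (InternalFunctor.D₁ 𝔸).core.arr) ≫ 𝔸.core.dom :=
  θ.act₁ (x ≫ pullback.fst _ _) _ (by simp [pullback.condition]) g ((θ.val_eq' _ _).trans h)

lemma action_fst : (pullback.lift x g h ≫ θ.action) ≫ pullback.fst _ _ =
    P.act (x ≫ pullback.fst _ _) (g ≫ (InternalFunctor.D₀ 𝔸).core.arr) (θ.action_aux₀ x g h) := by
  rw [Category.assoc, action, pullback.lift_fst, comp_act]
  exact act_congr (by simp) (by simp) _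

lemma action_snd : (pullback.lift x g h ≫ θ.action) ≫ pullback.snd _ _ =
    Q.act (x ≫ pullback.snd _ _) (g ≫ (InternalFunctor.D₁ 𝔸).core.arr) (θ.action_aux₁ x g h) := by
  rw [Category.assoc, action, pullback.lift_snd, comp_act]
  exact act_congr (by simp) (by simp) _

lemma action_cod (y : T ⟶ pullback P.proj Q.proj) (hy : pullback.lift x g h ≫ θ.action = y) :
    y ≫ θ.val = g ≫ 𝔸.arrow.core.cod := by
  rw [← hy, ← θ.val_eq' _ (by simp [pullback.condition])]
  refine (θ.app_congr (θ.action_fst x g h) (θ.action_snd x g h) _).trans ?_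
  exact θ.app_act _ _ (by simp [pullback.condition]) g ((θ.val_eq' _ _).trans h) _

end action

/-- The principal bundle `P ×_X Q` for the core of the arrow category. -/
def bundle (θ : Theta P Q) : PrincipalBundle 𝔸.arrow.core X where
  total := pullback P.proj Q.proj
  proj := pullback.fst _ _ ≫ P.proj
  anchor := θ.val
  action := θ.action
  action_proj := by simp [action]
  action_anchor := by
    have l : pullback.lift (pullback.fst θ.val 𝔸.arrow.core.dom)
      (pullback.snd θ.val 𝔸.arrow.core.dom) pullback.condition = 𝟙 _ := by
      apply pullback.hom_ext <;> simp
    exact θ.action_cod _ _ pullback.condition _ (by rw [l, Category.id_comp])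
  action_ident x h := by
    apply pullback.hom_ext
    · rw [action_fst]
      refine (act_congr rfl (g' := (x ≫ θ.val ≫ 𝔸.dom) ≫ 𝔸.core.ident) ?_ _).trans (act_ident ..)
      simp only [Category.assoc, (InternalFunctor.D₀ 𝔸).core.ident]; rfl
    · rw [action_snd]
      refine (act_congr rfl (g' := (x ≫ θ.val ≫ 𝔸.cod) ≫ 𝔸.core.ident) ?_ _).trans (act_ident ..)
      simp only [Category.assoc, (InternalFunctor.D₁ 𝔸).core.ident]; rfl
  action_comp x g k h₁ h₂ h₃ h₄ := by
    have c₀ : (g ≫ (InternalFunctor.D₀ 𝔸).core.arr) ≫ 𝔸.core.cod =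
        (k ≫ (InternalFunctor.D₀ 𝔸).core.arr) ≫ 𝔸.core.dom := by
      rw [Category.assoc, Category.assoc, (InternalFunctor.D₀ 𝔸).core.dom,
        (InternalFunctor.D₀ 𝔸).core.cod, ← Category.assoc, h₂, Category.assoc]
    have c₁ : (g ≫ (InternalFunctor.D₁ 𝔸).core.arr) ≫ 𝔸.core.cod =
        (k ≫ (InternalFunctor.D₁ 𝔸).core.arr) ≫ 𝔸.core.dom := by
      rw [Category.assoc, Category.assoc, (InternalFunctor.D₁ 𝔸).core.dom,
        (InternalFunctor.D₁ 𝔸).core.cod, ← Category.assoc, h₂, Category.assoc]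
    apply pullback.hom_ext
    · refine (θ.action_fst _ k h₃).trans (Eq.trans ?_ (θ.action_fst x _ h₄).symm)
      rw [act_congr (θ.action_fst x g h₁) rfl, act_act]
      exact act_congr rfl ((InternalFunctor.D₀ 𝔸).core.comp g k h₂ c₀).symm _
    · refine (θ.action_snd _ k h₃).trans (Eq.trans ?_ (θ.action_snd x _ h₄).symm)
      rw [act_congr (θ.action_snd x g h₁) rfl, act_act]
      exact act_congr rfl ((InternalFunctor.D₁ 𝔸).core.comp g k h₂ c₁).symm _
  isCover := IsCover.comp
    (IsCover.of_isPullback (IsPullback.of_hasPullback P.proj Q.proj).flip Q.isCover) P.isCover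
  isPullback := by
    refine isPullback_of_existsUnique (by simp [action]) ?_ ?_
    · intro T x y hxy
      have hx : (x ≫ pullback.fst _ _) ≫ P.proj = (y ≫ pullback.fst _ _) ≫ P.proj := by
        simpa only [Category.assoc] using hxy
      have hy : (x ≫ pullback.snd _ _) ≫ Q.proj = (y ≫ pullback.snd _ _) ≫ Q.proj := by
        simpa only [Category.assoc, ← pullback.condition] using hxy
      have hxx : (x ≫ pullback.fst _ _) ≫ P.proj = (x ≫ pullback.snd _ _) ≫ Q.proj := by
        simp only [Category.assoc, pullback.condition]
      have hyy : (y ≫ pullback.fst _ _) ≫ P.proj = (y ≫ pullback.snd _ _) ≫ Q.proj := by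
        simp only [Category.assoc, pullback.condition]
      obtain ⟨g, g₁, g₂, g₃, g₄⟩ := exists_coreSq (θ.app _ _ hxx) (θ.app _ _ hyy)
        (P.div _ _ hx) (Q.div _ _ hy) ((θ.app_cod _ _ _).trans (tr_dom _ _ _).symm)
        ((tr_cod _ _ _).trans (θ.app_dom _ _ _).symm)
        ((θ.app_mul_tr _ _ _ _ hy _).trans (θ.tr_mul_app _ _ _ _ hx _).symm)
      have e : x ≫ θ.val = g ≫ 𝔸.arrow.core.dom := (θ.val_eq' _ _).symm.trans g₁.symm
      refine ⟨g, e, ?_⟩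
      apply pullback.hom_ext
      · rw [action_fst, act_congr rfl g₃, act_div]
      · rw [action_snd, act_congr rfl g₄, act_div]
    · intro T x g g' h h' e
      apply coreSq_ext
      · exact h.symm.trans h'
      · exact (θ.action_cod x g h _ rfl).symm.trans (θ.action_cod x g' h' _ e.symm)
      · have := (θ.action_fst x g h).symm.trans
          ((congrArg (fun k => k ≫ pullback.fst _ _) e).trans (θ.action_fst x g' h'))
        rw [← div_eq_of_act _ this, div_act]
      · have := (θ.action_snd x g h).symm.trans
          ((congrArg (fun k => k ≫ pullback.snd _ _) e).trans (θ.action_snd x g' h'))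
        rw [← div_eq_of_act _ this, div_act]

end Theta
end LaxGeometric

end

noncomputable section

namespace LaxGeometric

variable {𝒞 : Type u} [Category.{v} 𝒞] [HasFiniteLimits 𝒞]

attribute [local simp] pullback.lift_fst pullback.lift_snd pullback.lift_fst_assoc
  pullback.lift_snd_assoc prod.lift_fst prod.lift_snd prod.lift_fst_assoc prod.lift_snd_assoc

attribute [local simp] InternalCategory.ident_dom InternalCategory.ident_cod

open InternalCategory PrincipalBundle

variable {𝔸 : InternalCategory 𝒞} {X T T' : 𝒞}
lemma PrincipalBundle.lift_cocycle {𝔾 : InternalCategory 𝒞} (P : PrincipalBundle 𝔾 X)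
    (x y : T ⟶ P.total) (h : x ≫ P.proj = y ≫ P.proj) :
    pullback.lift x y h ≫ P.cocycle.arr = P.div x y h :=
  (comp_div _ _ _ _).trans (div_congr (by simp) (by simp) _)

namespace Theta

variable {P Q R S : PrincipalBundle 𝔸.core X} (θ : Theta P Q)

lemma act_bundle_fst (x : T ⟶ θ.bundle.total) (g : T ⟶ 𝔸.arrow.core.arr) (h) (h') :
    θ.bundle.act x g h ≫ pullback.fst P.proj Q.proj =
      P.act (x ≫ pullback.fst P.proj Q.proj) (g ≫ (InternalFunctor.D₀ 𝔸).core.arr) h' :=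
  θ.action_fst x g h

lemma act_bundle_snd (x : T ⟶ θ.bundle.total) (g : T ⟶ 𝔸.arrow.core.arr) (h) (h') :
    θ.bundle.act x g h ≫ pullback.snd P.proj Q.proj =
      Q.act (x ≫ pullback.snd P.proj Q.proj) (g ≫ (InternalFunctor.D₁ 𝔸).core.arr) h' :=
  θ.action_snd x g h

/-- The representative of a morphism given by an equivariant family. -/
def preHom : PreHom P Q where
  bundle := θ.bundle
  S₀ := P
  S₁ := Q
  σ₀ :=
    { sec := pullback.fst P.proj Q.proj
      proj := rfl
      anchor := θ.dom.symm
      act := fun y z h h' => by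
        have e : pullback.lift y z h ≫ (θ.bundle.cocycle.andThen (InternalFunctor.D₀ 𝔸).core).arr =
            θ.bundle.div y z h ≫ (InternalFunctor.D₀ 𝔸).core.arr := by
          rw [← lift_cocycle, Category.assoc]; rfl
        rw [act_congr rfl e, ← θ.act_bundle_fst y _ (div_dom _ _ _).symm, act_div] }
  σ₁ :=
    { sec := pullback.snd P.proj Q.proj
      proj := pullback.condition.symm
      anchor := θ.cod.symm
      act := fun y z h h' => by
        have e : pullback.lift y z h ≫ (θ.bundle.cocycle.andThen (InternalFunctor.D₁ 𝔸).core).arr =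
            θ.bundle.div y z h ≫ (InternalFunctor.D₁ 𝔸).core.arr := by
          rw [← lift_cocycle, Category.assoc]; rfl
        rw [act_congr rfl e, ← θ.act_bundle_snd y _ (div_dom _ _ _).symm, act_div] }
  α₀ := Hom.id P
  α₁ := Hom.id Q

lemma preHom_src : θ.preHom.src = pullback.fst P.proj Q.proj := by
  have := (Hom.id P).hom_inv
  exact (congrArg (fun k => pullback.fst P.proj Q.proj ≫ k)
    ((Category.id_comp _).symm.trans this)).trans (Category.comp_id _)

lemma preHom_tgt : θ.preHom.tgt = pullback.snd P.proj Q.proj :=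
  Category.comp_id _

lemma preHom_theta : θ.preHom.theta = θ := by
  apply ext_app θ.preHom.bundle.isCover θ.preHom.src θ.preHom.tgt (by simp) (by simp)
  have := θ.preHom.theta_app (𝟙 _) (by simp)
  simp only [Category.id_comp] at this
  rw [this, app_congr _ θ.preHom_src θ.preHom_tgt]
  exact θ.val_eq

/-- The product of equivariant families. -/
lemma exists_mul (θ' : Theta Q R) : ∃ θ'' : Theta P R, ∀ {T : 𝒞} (x : T ⟶ P.total)
    (y : T ⟶ Q.total) (z : T ⟶ R.total) (h₁) (h₂) (h₃) (h₄),
    θ''.app x z h₃ = 𝔸.mul (θ.app x y h₁) (θ'.app y z h₂) h₄ := by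
  let e : pullback (pullback.fst P.proj Q.proj ≫ P.proj) R.proj ⟶ X :=
    pullback.fst _ _ ≫ pullback.fst _ _ ≫ P.proj
  have he : IsCover e := by
    refine IsCover.comp ?_ (IsCover.comp ?_ P.isCover)
    · exact IsCover.of_isPullback (IsPullback.of_hasPullback _ _).flip R.isCover
    · exact IsCover.of_isPullback (IsPullback.of_hasPullback _ _).flip Q.isCover
  let x : pullback (pullback.fst P.proj Q.proj ≫ P.proj) R.proj ⟶ P.total :=
    pullback.fst _ _ ≫ pullback.fst _ _
  let y : pullback (pullback.fst P.proj Q.proj ≫ P.proj) R.proj ⟶ Q.total :=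
    pullback.fst _ _ ≫ pullback.snd _ _
  let z : pullback (pullback.fst P.proj Q.proj ≫ P.proj) R.proj ⟶ R.total := pullback.snd _ _
  have hx : x ≫ P.proj = e := Category.assoc _ _ _
  have hy : y ≫ Q.proj = e := (Category.assoc _ _ _).trans
    (congrArg (fun k => pullback.fst _ _ ≫ k) pullback.condition.symm)
  have hz : z ≫ R.proj = e := pullback.condition.symm
  obtain ⟨θ'', h⟩ := exists_app he x z hx hz
    (𝔸.mul (θ.app x y (hx.trans hy.symm)) (θ'.app y z (hy.trans hz.symm)) (by simp)) (by simp)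
    (by simp) (by
      intro T w w' hw hx' hz' h₂ h₃
      simp only [comp_mul, comp_app, mul_mul_eq, app_mul_tr]
      rw [← mul_mul_eq _ _ _ (by simp) (by simp)]
      simp only [tr_mul_app]
      exact app_mul_app ..)
  refine ⟨θ'', ?_⟩
  intro T x' y' z' h₁ h₂ h₃ h₄
  have := congrArg (fun k => pullback.lift (pullback.lift x' y' h₁) z'
    (by rw [← Category.assoc, pullback.lift_fst, h₃]) ≫ k) h
  simp only [comp_mul, comp_app] at this
  refine Eq.trans ?_ (this.trans ?_)
  · exact app_congr _ (by simp [x]) (by simp [z]) _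
  · exact mul_congr (app_congr _ (by simp [x]) (by simp [y]) _)
      (app_congr _ (by simp [y]) (by simp [z]) _) _

/-- The product of equivariant families. -/
def mul (θ' : Theta Q R) : Theta P R := (θ.exists_mul θ').choose

lemma mul_app (θ' : Theta Q R) (x : T ⟶ P.total) (y : T ⟶ Q.total) (z : T ⟶ R.total)
    (h₁) (h₂) (h₃) :
    (θ.mul θ').app x z h₃ = 𝔸.mul (θ.app x y h₁) (θ'.app y z h₂) (by simp) :=
  (θ.exists_mul θ').choose_spec x y z h₁ h₂ h₃ _

/-- The equivariant family of a bundle map. -/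
def ofHom (φ : P.Hom Q) : Theta P Q where
  val := Q.tr (pullback.fst _ _ ≫ φ.hom) (pullback.snd _ _)
    (by rw [Category.assoc, φ.proj, pullback.condition])
  dom := by simp [φ.anchor]
  cod := by simp
  equivariant x x' y y' h h' hx hy h₁ h₂ := by
    simp only [comp_tr, pullback.lift_fst_assoc, pullback.lift_snd]
    rw [mul_congr (φ.tr x x' hx (by simp [φ.proj, hx])).symm rfl, tr_mul_tr, tr_mul_tr]

lemma ofHom_app (φ : P.Hom Q) (x : T ⟶ P.total) (y : T ⟶ Q.total) (h) (h') :
    (ofHom φ).app x y h = Q.tr (x ≫ φ.hom) y h' := by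
  rw [app, ofHom, comp_tr]
  exact tr_congr (by simp) (by simp) _

lemma ext' {θ θ' : Theta P Q} (H : ∀ {T : 𝒞} (x : T ⟶ P.total) (y : T ⟶ Q.total) (h),
    θ.app x y h = θ'.app x y h) : θ = θ' := by
  have : θ.val = θ'.val := by rw [val_eq, val_eq, H]
  cases θ; cases θ'; cases this; rfl

lemma exists_cover₂ (P : PrincipalBundle 𝔸.core X) (Q : PrincipalBundle 𝔸.core X) :
    ∃ (W : 𝒞) (e : W ⟶ X) (x : W ⟶ P.total) (y : W ⟶ Q.total), IsCover e ∧
      x ≫ P.proj = e ∧ y ≫ Q.proj = e :=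
  ⟨_, pullback.fst _ _ ≫ P.proj, pullback.fst P.proj Q.proj, pullback.snd _ _,
    IsCover.comp (IsCover.of_isPullback (IsPullback.of_hasPullback _ _).flip Q.isCover) P.isCover,
    rfl, pullback.condition.symm⟩

lemma ofHom_mul (φ : P.Hom Q) (θ : Theta Q R) (x : T ⟶ P.total) (z : T ⟶ R.total) (h) (h') :
    ((ofHom φ).mul θ).app x z h = θ.app (x ≫ φ.hom) z h' := by
  rw [mul_app _ _ x (x ≫ φ.hom) z (by simp [φ.proj]) h', mul_congr (ofHom_app φ _ _ _ (by simp)) rfl,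
    tr_self_mul]

lemma mul_ofHom (θ : Theta P Q) (φ : Q.Hom R) (x : T ⟶ P.total) (y : T ⟶ Q.total) (h) (h') :
    (θ.mul (ofHom φ)).app x (y ≫ φ.hom) h = θ.app x y h' := by
  rw [mul_app _ _ x y _ h' (by simp [φ.proj]), mul_congr rfl (ofHom_app φ _ _ _ (by simp)),
    mul_tr_self]

lemma mul_id (θ : Theta P Q) : θ.mul (ofHom (Hom.id Q)) = θ := by
  apply ext'
  intro T x y h
  have := mul_ofHom θ (Hom.id Q) x y (by simpa [Hom.id] using h) h
  rw [← this]
  exact app_congr _ rfl (by simp [Hom.id]) _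

lemma id_mul (θ : Theta P Q) : (ofHom (Hom.id P)).mul θ = θ := by
  apply ext'
  intro T x y h
  rw [ofHom_mul (Hom.id P) θ x y h (by simpa [Hom.id] using h)]
  exact app_congr _ (by simp [Hom.id]) rfl _

lemma mul_mul (θ : Theta P Q) (θ' : Theta Q R) (θ'' : Theta R S) :
    (θ.mul θ').mul θ'' = θ.mul (θ'.mul θ'') := by
  obtain ⟨W, e, y, z, he, hy, hz⟩ := exists_cover₂ Q R
  have c₁ : IsCover (pullback.fst e P.proj) :=
    IsCover.of_isPullback (IsPullback.of_hasPullback _ _).flip P.isCover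
  have c₂ : IsCover (pullback.fst (pullback.fst e P.proj ≫ e) S.proj) :=
    IsCover.of_isPullback (IsPullback.of_hasPullback _ _).flip S.isCover
  let k := pullback.fst (pullback.fst e P.proj ≫ e) S.proj ≫ pullback.fst e P.proj
  have hk : IsCover (k ≫ e) := (c₂.comp c₁).comp he
  have hP : (pullback.fst (pullback.fst e P.proj ≫ e) S.proj ≫ pullback.snd e P.proj) ≫ P.proj =
      k ≫ e := by simp only [k, Category.assoc, pullback.condition]
  have hS : pullback.snd (pullback.fst e P.proj ≫ e) S.proj ≫ S.proj = k ≫ e := by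
    simp only [k, Category.assoc, ← pullback.condition]
  have hQ : (k ≫ y) ≫ Q.proj = k ≫ e := by rw [Category.assoc, hy]
  have hR : (k ≫ z) ≫ R.proj = k ≫ e := by rw [Category.assoc, hz]
  apply ext_app hk _ _ hP hS
  rw [mul_app _ _ _ (k ≫ z) _ (hP.trans hR.symm) (hR.trans hS.symm),
    mul_app _ (θ'.mul θ'') _ (k ≫ y) _ (hP.trans hQ.symm) (hQ.trans hS.symm),
    mul_congr (mul_app _ _ _ (k ≫ y) _ (hP.trans hQ.symm) (hQ.trans hR.symm) _) rfl,
    mul_congr rfl (mul_app _ _ (k ≫ y) (k ≫ z) _ (hQ.trans hR.symm) (hR.trans hS.symm) _),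
    mul_mul_eq]

end Theta
end LaxGeometric

end

noncomputable section

namespace LaxGeometric

variable {𝒞 : Type u} [Category.{v} 𝒞] [HasFiniteLimits 𝒞]

attribute [local simp] pullback.lift_fst pullback.lift_snd pullback.lift_fst_assoc
  pullback.lift_snd_assoc prod.lift_fst prod.lift_snd prod.lift_fst_assoc prod.lift_snd_assoc

attribute [local simp] InternalCategory.ident_dom InternalCategory.ident_cod

open InternalCategory PrincipalBundle

variable {𝔸 : InternalCategory 𝒞} {X T T' : 𝒞}
namespace PreHom

variable {P₀ P₁ P₂ : PrincipalBundle 𝔸.core X} (m : PreHom P₀ P₁) (m' : PreHom P₁ P₂)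

lemma div_src (w w' : T ⟶ m.bundle.total) (h) (h') : P₀.div (w ≫ m.src) (w' ≫ m.src) h' =
    m.bundle.div w w' h ≫ (InternalFunctor.D₀ 𝔸).core.arr := by
  apply iso_ext
  refine (m.tr_src w w' h h').trans ?_
  rw [Category.assoc, Theta.D₀_hom, top]

lemma div_tgt (w w' : T ⟶ m.bundle.total) (h) (h') : P₁.div (w ≫ m.tgt) (w' ≫ m.tgt) h' =
    m.bundle.div w w' h ≫ (InternalFunctor.D₁ 𝔸).core.arr := by
  apply iso_ext
  refine (m.tr_tgt w w' h h').trans ?_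
  rw [Category.assoc, Theta.D₁_hom, bot]

lemma act_src (w : T ⟶ m.bundle.total) (g : T ⟶ 𝔸.arrow.core.arr) (h) (h') :
    P₀.act (w ≫ m.src) (g ≫ (InternalFunctor.D₀ 𝔸).core.arr) h' = m.bundle.act w g h ≫ m.src := by
  have := m.div_src w (m.bundle.act w g h) (by simp) (by simp)
  rw [div_act] at this
  rw [act_congr rfl this.symm, act_div]

lemma act_tgt (w : T ⟶ m.bundle.total) (g : T ⟶ 𝔸.arrow.core.arr) (h) (h') :
    P₁.act (w ≫ m.tgt) (g ≫ (InternalFunctor.D₁ 𝔸).core.arr) h' = m.bundle.act w g h ≫ m.tgt := by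
  have := m.div_tgt w (m.bundle.act w g h) (by simp) (by simp)
  rw [div_act] at this
  rw [act_congr rfl this.symm, act_div]

/-- The comparison of a representative with the one given by its equivariant family. -/
def toThetaBundle : m.bundle.Hom m.theta.bundle where
  hom := pullback.lift m.src m.tgt (by simp)
  proj := (pullback.lift_fst_assoc _ _ _ _).trans m.src_proj
  anchor := m.exists_theta.choose_spec
  act w g h h' := by
    have s : (w ≫ (pullback.lift m.src m.tgt (by simp) : m.bundle.total ⟶ m.theta.bundle.total)) ≫
        pullback.fst P₀.proj P₁.proj = w ≫ m.src := by
      rw [Category.assoc]; exact congrArg (fun k => w ≫ k) (pullback.lift_fst _ _ _)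
    have t : (w ≫ (pullback.lift m.src m.tgt (by simp) : m.bundle.total ⟶ m.theta.bundle.total)) ≫
        pullback.snd P₀.proj P₁.proj = w ≫ m.tgt := by
      rw [Category.assoc]; exact congrArg (fun k => w ≫ k) (pullback.lift_snd _ _ _)
    apply pullback.hom_ext
    · refine Eq.trans ?_ (m.theta.act_bundle_fst _ g h' (m.theta.action_aux₀ _ g h')).symm
      refine Eq.trans ?_ (act_congr s rfl _).symm
      refine ((Category.assoc _ _ _).trans (congrArg (fun k => m.bundle.act w g h ≫ k)
        (pullback.lift_fst _ _ _))).trans (m.act_src w g h _).symm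
    · refine Eq.trans ?_ (m.theta.act_bundle_snd _ g h' (m.theta.action_aux₁ _ g h')).symm
      refine Eq.trans ?_ (act_congr t rfl _).symm
      refine ((Category.assoc _ _ _).trans (congrArg (fun k => m.bundle.act w g h ≫ k)
        (pullback.lift_snd _ _ _))).trans (m.act_tgt w g h _).symm

lemma nonempty_twoCell : Nonempty (TwoCell m m.theta.preHom) :=
  ⟨{ ρ := m.toThetaBundle
     ρ₀ := m.α₀.inv
     ρ₁ := m.α₁
     sec₀ := (pullback.lift_fst _ _ _).symm
     sec₁ := (pullback.lift_snd _ _ _).symm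
     comm₀ := Hom.ext m.α₀.hom_inv
     comm₁ := Hom.ext (Category.comp_id _) }⟩

lemma inv_eq_of_comp {P Q R : PrincipalBundle 𝔸.core X} {φ : P.Hom Q} {ψ : Q.Hom R} {χ : P.Hom R}
    (h : φ.comp ψ = χ) : ψ.hom ≫ χ.inv.hom = φ.inv.hom := by
  subst h
  have := (φ.comp ψ).hom_inv
  rw [← Category.id_comp (ψ.hom ≫ _), ← φ.inv_hom, Category.assoc]
  refine (congrArg (fun k => φ.inv.hom ≫ k) ?_).trans (Category.comp_id _)
  exact (Category.assoc _ _ _).symm.trans this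

lemma theta_eq_of_twoCell {m n : PreHom P₀ P₁} (ρ : TwoCell m n) : m.theta = n.theta := by
  have e₀ : ρ.ρ.hom ≫ n.src = m.src := by
    rw [src, ← Category.assoc, ← ρ.sec₀, Category.assoc, inv_eq_of_comp ρ.comm₀, src]
  have e₁ : ρ.ρ.hom ≫ n.tgt = m.tgt := by
    rw [tgt, ← Category.assoc, ← ρ.sec₁, Category.assoc, tgt, ← ρ.comm₁]; rfl
  apply Theta.ext_app m.bundle.isCover m.src m.tgt (by simp) (by simp)
  have h₁ := m.theta_app (𝟙 _) (by simp)
  have h₂ := n.theta_app ρ.ρ.hom (by simp)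
  simp only [Category.id_comp] at h₁
  rw [h₁, Theta.app_congr _ e₀.symm e₁.symm, h₂, ρ.ρ.anchor]

lemma theta_eq_of_composite {m : PreHom P₀ P₁} {m' : PreHom P₁ P₂} {n : PreHom P₀ P₂}
    (c : m.Composite m' n) : n.theta = m.theta.mul m'.theta := by
  have e₀ : c.assoc.sec ≫ n.src = m.triple₁ m' ≫ m.src := by
    rw [src, ← Category.assoc, ← c.sec₀, src]
    simp only [Category.assoc, inv_eq_of_comp c.comm₀]
  have e₁ : c.assoc.sec ≫ n.tgt = m.triple₃ m' ≫ m'.tgt := by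
    rw [tgt, tgt, ← Category.assoc (m.triple₃ m'), ← c.sec₁, ← c.comm₁, Hom.comp]
    simp only [Category.assoc]
  apply Theta.ext_app (m.tripleProj_isCover m') (m.triple₁ m' ≫ m.src) (m.triple₃ m' ≫ m'.tgt)
    (by simp [triple₁_proj]) (by simp [triple₃_proj])
  have h₂ := n.theta_app c.assoc.sec (by simp)
  rw [Theta.app_congr _ e₀.symm e₁.symm, h₂, c.assoc.anchor, compCocycle_obj,
    Theta.mul_app _ _ _ (m.triple₃ m' ≫ m'.src) _ (by simp [triple₁_proj, triple₃_proj]) (by simp)]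
  have := m.compObj_eq m' (𝟙 _) (by simp [triple₁_proj, triple₃_proj]) (by simp) (by simp)
  simpa only [Category.id_comp] using this

lemma exists_composite : Nonempty (m.Composite m' (m.theta.mul m'.theta).preHom) := by
  have hp : (m.triple₁ m' ≫ m.src) ≫ P₀.proj = (m.triple₃ m' ≫ m'.tgt) ≫ P₂.proj := by
    simp [triple₁_proj, triple₃_proj]
  refine ⟨{ assoc := ⟨pullback.lift (m.triple₁ m' ≫ m.src) (m.triple₃ m' ≫ m'.tgt) hp, ?_, ?_, ?_⟩
            κ₀ := m.α₀.inv
            κ₁ := m'.α₁.inv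
            sec₀ := (pullback.lift_fst _ _ hp).symm
            sec₁ := ?_
            comm₀ := Hom.ext m.α₀.hom_inv
            comm₁ := Hom.ext m'.α₁.inv_hom }⟩
  · exact (pullback.lift_fst_assoc _ _ hp _).trans (by simp [triple₁_proj])
  · rw [compCocycle_obj]
    have := m.compObj_eq m' (𝟙 _) (by simp [triple₁_proj, triple₃_proj]) (by simp) (by simp)
    simp only [Category.id_comp] at this
    rw [this, ← Theta.mul_app _ _ _ _ _ _ _ hp]; rfl
  · intro T y z h h'
    have s : ∀ u : T ⟶ m.tripleTotal m', (u ≫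
        (pullback.lift (m.triple₁ m' ≫ m.src) (m.triple₃ m' ≫ m'.tgt) hp :
          m.tripleTotal m' ⟶ (m.theta.mul m'.theta).preHom.bundle.total)) ≫
        pullback.fst P₀.proj P₂.proj = (u ≫ m.triple₁ m') ≫ m.src := by
      intro u
      rw [Category.assoc, Category.assoc]
      exact congrArg (fun k => u ≫ k) (pullback.lift_fst _ _ _)
    have t : ∀ u : T ⟶ m.tripleTotal m', (u ≫
        (pullback.lift (m.triple₁ m' ≫ m.src) (m.triple₃ m' ≫ m'.tgt) hp :
          m.tripleTotal m' ⟶ (m.theta.mul m'.theta).preHom.bundle.total)) ≫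
        pullback.snd P₀.proj P₂.proj = (u ≫ m.triple₃ m') ≫ m'.tgt := by
      intro u
      rw [Category.assoc, Category.assoc]
      exact congrArg (fun k => u ≫ k) (pullback.lift_snd _ _ _)
    have q₁ : (y ≫ m.triple₁ m') ≫ m.bundle.proj = (z ≫ m.triple₁ m') ≫ m.bundle.proj := by
      simp [triple₁_proj, h]
    have q₃ : (y ≫ m.triple₃ m') ≫ m'.bundle.proj = (z ≫ m.triple₃ m') ≫ m'.bundle.proj := by
      simp [triple₃_proj, h]
    have d₀ : (pullback.lift y z h ≫ (m.compCocycle m').arr) ≫ (InternalFunctor.D₀ 𝔸).core.arr =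
        P₀.div ((y ≫ m.triple₁ m') ≫ m.src) ((z ≫ m.triple₁ m') ≫ m.src)
          (by simpa using q₁) := by
      rw [m.div_src _ _ q₁, Category.assoc, compCocycle_D₀,
        ← kernelPairMap_cocycle m.bundle _ (m.triple₁_proj m') y z h q₁]
      exact (Category.assoc _ _ _).symm
    have d₁ : (pullback.lift y z h ≫ (m.compCocycle m').arr) ≫ (InternalFunctor.D₁ 𝔸).core.arr =
        P₂.div ((y ≫ m.triple₃ m') ≫ m'.tgt) ((z ≫ m.triple₃ m') ≫ m'.tgt)
          (by simpa using q₃) := by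
      rw [m'.div_tgt _ _ q₃, Category.assoc, compCocycle_D₁,
        ← kernelPairMap_cocycle m'.bundle _ (m.triple₃_proj m') y z h q₃]
      exact (Category.assoc _ _ _).symm
    apply pullback.hom_ext
    · refine ((m.theta.mul m'.theta).act_bundle_fst _ _ h'
        ((m.theta.mul m'.theta).action_aux₀ _ _ h')).trans ?_
      exact (act_congr (s y) d₀ _).trans ((act_div _ _ _).trans (s z).symm)
    · refine ((m.theta.mul m'.theta).act_bundle_snd _ _ h'
        ((m.theta.mul m'.theta).action_aux₁ _ _ h')).trans ?_
      exact (act_congr (t y) d₁ _).trans ((act_div _ _ _).trans (t z).symm)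
  · refine (pullback.lift_snd_assoc _ _ hp _).trans ?_
    rw [Category.assoc, tgt, Category.assoc, Hom.hom_inv, Category.comp_id]

end PreHom

namespace Arrow

variable {P Q R S : PrincipalBundle 𝔸.core X}

/-- The equivariant family of a morphism. -/
def theta (a : Arrow P Q) : Theta P Q :=
  Quot.lift PreHom.theta (fun _ _ ⟨ρ⟩ => PreHom.theta_eq_of_twoCell ρ) a

/-- The morphism given by an equivariant family. -/
def ofTheta (θ : Theta P Q) : Arrow P Q := Quot.mk _ θ.preHom

lemma theta_ofTheta (θ : Theta P Q) : (ofTheta θ).theta = θ := θ.preHom_theta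

lemma ofTheta_theta (a : Arrow P Q) : ofTheta a.theta = a := by
  induction a using Quot.ind with
  | mk m => exact (Quot.sound m.nonempty_twoCell).symm

lemma ext {a b : Arrow P Q} (h : a.theta = b.theta) : a = b := by
  rw [← ofTheta_theta a, h, ofTheta_theta]

lemma exists_comp (a : Arrow P Q) (b : Arrow Q R) : ∃ (c : Arrow P R) (m : PreHom P Q)
    (m' : PreHom Q R) (n : PreHom P R), Quot.mk _ m = a ∧ Quot.mk _ m' = b ∧ Quot.mk _ n = c ∧
      Nonempty (m.Composite m' n) := by
  induction a using Quot.ind with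
  | mk m => induction b using Quot.ind with
    | mk m' => exact ⟨_, m, m', _, rfl, rfl, rfl, m.exists_composite m'⟩

/-- Composition: the class of any composite of representatives. -/
def comp (a : Arrow P Q) (b : Arrow Q R) : Arrow P R := (exists_comp a b).choose

lemma comp_theta (a : Arrow P Q) (b : Arrow Q R) : (a.comp b).theta = a.theta.mul b.theta := by
  obtain ⟨m, m', n, h₁, h₂, h₃, ⟨c⟩⟩ := (exists_comp a b).choose_spec
  rw [comp, ← h₃]
  subst h₁ h₂
  exact PreHom.theta_eq_of_composite c

/-- The composite does not depend on the choice of representatives. -/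
lemma comp_mk {m : PreHom P Q} {m' : PreHom Q R} {n : PreHom P R} (c : m.Composite m' n) :
    comp (Quot.mk _ m) (Quot.mk _ m') = Quot.mk _ n := by
  apply ext
  exact (comp_theta _ _).trans (PreHom.theta_eq_of_composite c).symm

/-- The morphism given by a bundle map. -/
def ofHom (φ : P.Hom Q) : Arrow P Q := ofTheta (Theta.ofHom φ)

lemma ofHom_theta (φ : P.Hom Q) : (ofHom φ).theta = Theta.ofHom φ := theta_ofTheta _

end Arrow

/-- The objects of the category of principal bundles over `X`: the principal bundles for the core of
`𝔸`. -/
structure PrinObj (𝔸 : InternalCategory 𝒞) (X : 𝒞) where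
  bundle : PrincipalBundle 𝔸.core X

/-- The category of principal bundles over `X`. Its morphisms are the principal bundles for the core
of the arrow category of `𝔸` with their two structure maps, up to 2-cells. -/
instance : Category (PrinObj 𝔸 X) where
  Hom P Q := Arrow P.bundle Q.bundle
  id P := Arrow.ofHom (Hom.id P.bundle)
  comp a b := Arrow.comp a b
  id_comp a := by
    apply Arrow.ext
    rw [Arrow.comp_theta, Arrow.ofHom_theta, Theta.id_mul]
  comp_id a := by
    apply Arrow.ext
    rw [Arrow.comp_theta, Arrow.ofHom_theta, Theta.mul_id]
  assoc a b c := by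
    apply Arrow.ext
    simp only [Arrow.comp_theta, Theta.mul_mul]

end LaxGeometric

end

noncomputable section

namespace LaxGeometric

variable {𝒞 : Type u} [Category.{v} 𝒞] [HasFiniteLimits 𝒞]

attribute [local simp] pullback.lift_fst pullback.lift_snd pullback.lift_fst_assoc
  pullback.lift_snd_assoc prod.lift_fst prod.lift_snd prod.lift_fst_assoc prod.lift_snd_assoc

attribute [local simp] InternalCategory.ident_dom InternalCategory.ident_cod

open InternalCategory PrincipalBundle

variable {𝔸 : InternalCategory 𝒞} {X T T' : 𝒞}
variable {Y Z : 𝒞}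

namespace PrincipalBundle

section

variable {𝔾 : InternalCategory 𝒞} (P Q R : PrincipalBundle 𝔾 X) (f : Y ⟶ X)

/-- The pullback of a principal bundle along `f`. -/
def pull : PrincipalBundle 𝔾 Y where
  total := pullback f P.proj
  proj := pullback.fst f P.proj
  anchor := pullback.snd f P.proj ≫ P.anchor
  action := pullback.lift (pullback.fst _ _ ≫ pullback.fst f P.proj)
    (P.act (pullback.fst (pullback.snd f P.proj ≫ P.anchor) 𝔾.dom ≫ pullback.snd f P.proj)
      (pullback.snd _ _) (by rw [Category.assoc, pullback.condition]))
    (by simp [pullback.condition])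
  action_proj := by simp
  action_anchor := by simp
  action_ident x h := by
    apply pullback.hom_ext
    · simp
    · simp only [Category.assoc, pullback.lift_snd, comp_act, pullback.lift_fst_assoc]
      refine (act_congr rfl (g' := (x ≫ pullback.snd f P.proj ≫ P.anchor) ≫ 𝔾.ident)
        (by simp) _).trans (act_ident ..)
  action_comp x g k h₁ h₂ h₃ h₄ := by
    apply pullback.hom_ext
    · simp
    · simp only [Category.assoc, pullback.lift_snd, comp_act, pullback.lift_fst_assoc, act_act]
  isCover := IsCover.of_isPullback (IsPullback.of_hasPullback f P.proj).flip P.isCover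
  isPullback := by
    refine isPullback_of_existsUnique (by simp) ?_ ?_
    · intro T x y h
      have h' : (x ≫ pullback.snd f P.proj) ≫ P.proj = (y ≫ pullback.snd f P.proj) ≫ P.proj := by
        simp only [Category.assoc, ← pullback.condition]
        rw [← Category.assoc, h, Category.assoc]
      refine ⟨P.div _ _ h', by simp, ?_⟩
      apply pullback.hom_ext
      · simpa using h
      · simp only [Category.assoc, pullback.lift_snd, comp_act, pullback.lift_fst_assoc, act_div]
    · intro T x g g' h h' e
      have := congrArg (fun k => k ≫ pullback.snd f P.proj) e
      simp only [Category.assoc, pullback.lift_snd, comp_act, pullback.lift_fst_assoc] at this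
      rw [← div_eq_of_act _ this, div_act]

variable {P Q R}

/-- The projection from a pulled back bundle. -/
def pullSnd : (P.pull f).total ⟶ P.total := pullback.snd f P.proj

/-- The element of a pulled back bundle given by its components. -/
def pullLift (t : T ⟶ Y) (x : T ⟶ P.total) (h : t ≫ f = x ≫ P.proj) : T ⟶ (P.pull f).total :=
  pullback.lift t x h

section

variable {f}

@[simp] lemma pullLift_proj (t : T ⟶ Y) (x : T ⟶ P.total) (h : t ≫ f = x ≫ P.proj) :
    pullLift f t x h ≫ (P.pull f).proj = t := pullback.lift_fst _ _ _

@[simp] lemma pullLift_snd (t : T ⟶ Y) (x : T ⟶ P.total) (h : t ≫ f = x ≫ P.proj) :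
    pullLift f t x h ≫ P.pullSnd f = x := pullback.lift_snd _ _ _

@[simp] lemma pullLift_proj' (t : T ⟶ Y) (x : T ⟶ P.total) (h : t ≫ f = x ≫ P.proj) (k : Y ⟶ T') :
    pullLift f t x h ≫ (P.pull f).proj ≫ k = t ≫ k := pullback.lift_fst_assoc _ _ _ _

@[simp] lemma pullLift_snd' (t : T ⟶ Y) (x : T ⟶ P.total) (h : t ≫ f = x ≫ P.proj)
    (k : P.total ⟶ T') : pullLift f t x h ≫ P.pullSnd f ≫ k = x ≫ k :=
  pullback.lift_snd_assoc _ _ _ _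

lemma pull_ext {x y : T ⟶ (P.pull f).total} (h₁ : x ≫ (P.pull f).proj = y ≫ (P.pull f).proj)
    (h₂ : x ≫ P.pullSnd f = y ≫ P.pullSnd f) : x = y := pullback.hom_ext h₁ h₂

end

@[simp] lemma pullSnd_proj : P.pullSnd f ≫ P.proj = (P.pull f).proj ≫ f :=
  pullback.condition.symm

@[simp] lemma pullSnd_anchor : P.pullSnd f ≫ P.anchor = (P.pull f).anchor := rfl

lemma act_pullSnd (x : T ⟶ (P.pull f).total) (g : T ⟶ 𝔾.arr) (h) (h') :
    (P.pull f).act x g h ≫ P.pullSnd f = P.act (x ≫ P.pullSnd f) g h' := by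
  refine (Category.assoc _ _ _).trans
    ((congrArg (fun k => pullback.lift x g h ≫ k) (pullback.lift_snd _ _ _)).trans ?_)
  refine (comp_act _ _ _ _).trans ?_
  refine act_congr ?_ ?_ _
  · exact pullback.lift_fst_assoc _ _ _ _
  · exact pullback.lift_snd _ _ _

lemma div_pull (x y : T ⟶ (P.pull f).total) (h) (h') :
    (P.pull f).div x y h = P.div (x ≫ P.pullSnd f) (y ≫ P.pullSnd f) h' := by
  symm
  refine div_eq_of_act (by simp) ?_
  rw [← act_pullSnd f x _ (by simp), act_div]

/-- The pullback of a bundle map. -/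
def Hom.pull (φ : P.Hom Q) : (P.pull f).Hom (Q.pull f) where
  hom := pullLift f (P.pull f).proj (P.pullSnd f ≫ φ.hom) (by simp [φ.proj])
  proj := by simp
  anchor := by
    rw [← pullSnd_anchor, pullLift_snd', Category.assoc, φ.anchor, pullSnd_anchor]
  act x g h h' := by
    apply pull_ext
    · simp
    · have e : (x ≫ pullLift f (P.pull f).proj (P.pullSnd f ≫ φ.hom) (by simp [φ.proj])) ≫
          Q.pullSnd f = (x ≫ P.pullSnd f) ≫ φ.hom := by simp
      have k : (x ≫ P.pullSnd f) ≫ P.anchor = g ≫ 𝔾.dom := by simpa using h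
      rw [act_pullSnd f _ _ _ (by rw [e]; simpa [φ.anchor] using h), act_congr e rfl,
        ← φ.act _ _ k, ← act_pullSnd f x g h]
      simp

@[simp] lemma Hom.pull_snd (φ : P.Hom Q) : (φ.pull f).hom ≫ Q.pullSnd f = P.pullSnd f ≫ φ.hom :=
  pullLift_snd ..

lemma Hom.pull_inv_snd (φ : P.Hom Q) :
    (φ.pull f).inv.hom ≫ P.pullSnd f = Q.pullSnd f ≫ φ.inv.hom := by
  have h : P.pullSnd f = (φ.pull f).hom ≫ Q.pullSnd f ≫ φ.inv.hom := by
    rw [← Category.assoc, Hom.pull_snd, Category.assoc, Hom.hom_inv, Category.comp_id]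
  rw [h, ← Category.assoc, Hom.inv_hom, Category.id_comp]

end

/-- The pullback of an associated bundle. -/
def Associated.pull {𝔾 ℍ : InternalCategory 𝒞} {P : PrincipalBundle 𝔾 X} {S : PrincipalBundle ℍ X}
    {F : InternalFunctor 𝔾 ℍ} (σ : S.Associated (P.cocycle.andThen F)) (f : Y ⟶ X) :
    (S.pull f).Associated ((P.pull f).cocycle.andThen F) where
  sec := pullLift f (P.pull f).proj (P.pullSnd f ≫ σ.sec) (by simp [σ.proj])
  proj := by simp
  anchor := by
    rw [← pullSnd_anchor, pullLift_snd', Category.assoc, σ.anchor]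
    exact (Category.assoc _ _ _).symm
  act {T} y z h h' := by
    have hyz : (y ≫ P.pullSnd f) ≫ P.proj = (z ≫ P.pullSnd f) ≫ P.proj := by
      simp [reassoc_of% h]
    have e : ∀ u : T ⟶ (P.pull f).total, (u ≫ pullLift f (P.pull f).proj (P.pullSnd f ≫ σ.sec)
        (by simp [σ.proj])) ≫ S.pullSnd f = (u ≫ P.pullSnd f) ≫ σ.sec := by intro u; simp
    have c : pullback.lift y z h ≫ ((P.pull f).cocycle.andThen F).arr =
        pullback.lift _ _ hyz ≫ (P.cocycle.andThen F).arr := by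
      simp only [InternalFunctor.andThen]
      rw [← Category.assoc, ← Category.assoc, lift_cocycle, lift_cocycle, div_pull f _ _ h hyz]
    apply pull_ext
    · simp [h]
    · rw [e z, act_pullSnd f _ _ h' ((Category.assoc _ _ _).trans h'), act_congr (e y) c, σ.act]

end PrincipalBundle

variable {P Q R S : PrincipalBundle 𝔸.core X}

lemma PrincipalBundle.tr_pull (f : Y ⟶ X) (x y : T ⟶ (P.pull f).total) (h) (h') :
    (P.pull f).tr x y h = P.tr (x ≫ P.pullSnd f) (y ≫ P.pullSnd f) h' := by
  rw [tr, tr, div_pull f x y h h']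

/-- The pullback of a representative of a morphism. -/
def PreHom.pull (m : PreHom P Q) (f : Y ⟶ X) : PreHom (P.pull f) (Q.pull f) where
  bundle := m.bundle.pull f
  S₀ := m.S₀.pull f
  S₁ := m.S₁.pull f
  σ₀ := m.σ₀.pull f
  σ₁ := m.σ₁.pull f
  α₀ := m.α₀.pull f
  α₁ := m.α₁.pull f

lemma PreHom.pull_src (m : PreHom P Q) (f : Y ⟶ X) :
    (m.pull f).src ≫ P.pullSnd f = m.bundle.pullSnd f ≫ m.src := by
  rw [src, Category.assoc]
  refine (congrArg (fun k => (m.σ₀.pull f).sec ≫ k) (m.α₀.pull_inv_snd f)).trans ?_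
  refine (pullLift_snd' _ _ _ _).trans ?_
  rw [Category.assoc, src]

lemma PreHom.pull_tgt (m : PreHom P Q) (f : Y ⟶ X) :
    (m.pull f).tgt ≫ Q.pullSnd f = m.bundle.pullSnd f ≫ m.tgt := by
  rw [tgt, Category.assoc]
  refine (congrArg (fun k => (m.σ₁.pull f).sec ≫ k) (m.α₁.pull_snd f)).trans ?_
  refine (pullLift_snd' _ _ _ _).trans ?_
  rw [Category.assoc, tgt]

namespace Theta

/-- The pullback of an equivariant family. -/
def pull (θ : Theta P Q) (f : Y ⟶ X) : Theta (P.pull f) (Q.pull f) where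
  val := θ.app (pullback.fst _ _ ≫ P.pullSnd f) (pullback.snd _ _ ≫ Q.pullSnd f)
    (by simp only [Category.assoc, pullSnd_proj, pullback.condition_assoc])
  dom := by simp
  cod := by simp
  equivariant x x' y y' h h' hx hy h₁ h₂ := by
    simp only [comp_app, pullback.lift_fst_assoc, pullback.lift_snd_assoc]
    rw [mul_congr (tr_pull f x x' hx (by simp [reassoc_of% hx])) rfl,
      mul_congr rfl (tr_pull f y y' hy (by simp [reassoc_of% hy])), tr_mul_app, app_mul_tr]

lemma pull_app (θ : Theta P Q) (f : Y ⟶ X) (x : T ⟶ (P.pull f).total) (y : T ⟶ (Q.pull f).total)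
    (h) (h') : (θ.pull f).app x y h = θ.app (x ≫ P.pullSnd f) (y ≫ Q.pullSnd f) h' := by
  rw [app, pull, comp_app]
  exact app_congr _ (by simp) (by simp) _

lemma pull_mul (θ : Theta P Q) (θ' : Theta Q R) (f : Y ⟶ X) :
    (θ.mul θ').pull f = (θ.pull f).mul (θ'.pull f) := by
  obtain ⟨W, e, x, z, he, hx, hz⟩ := exists_cover₂ (P.pull f) (R.pull f)
  obtain ⟨W', c, y, hc, hy⟩ := (Q.pull f).exists_local e
  have hx' : (c ≫ x) ≫ (P.pull f).proj = c ≫ e := by rw [Category.assoc, hx]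
  have hz' : (c ≫ z) ≫ (R.pull f).proj = c ≫ e := by rw [Category.assoc, hz]
  have kx : ((c ≫ x) ≫ P.pullSnd f) ≫ P.proj = (c ≫ e) ≫ f := by
    rw [Category.assoc, pullSnd_proj, ← Category.assoc, hx']
  have ky : (y ≫ Q.pullSnd f) ≫ Q.proj = (c ≫ e) ≫ f := by
    rw [Category.assoc, pullSnd_proj, ← Category.assoc, hy]
  have kz : ((c ≫ z) ≫ R.pullSnd f) ≫ R.proj = (c ≫ e) ≫ f := by
    rw [Category.assoc, pullSnd_proj, ← Category.assoc, hz']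
  apply ext_app (hc.comp he) _ _ hx' hz'
  rw [pull_app _ _ _ _ _ (kx.trans kz.symm), mul_app _ _ _ y _ (hx'.trans hy.symm)
    (hy.trans hz'.symm), mul_app _ _ _ (y ≫ Q.pullSnd f) _ (kx.trans ky.symm) (ky.trans kz.symm)]
  exact mul_congr (pull_app _ _ _ _ _ _).symm (pull_app _ _ _ _ _ _).symm _

lemma pull_ofHom (φ : P.Hom Q) (f : Y ⟶ X) : (ofHom φ).pull f = ofHom (φ.pull f) := by
  apply ext'
  intro T x y h
  have h' : (x ≫ P.pullSnd f) ≫ P.proj = (y ≫ Q.pullSnd f) ≫ Q.proj := by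
    simp [reassoc_of% h]
  rw [pull_app _ _ _ _ _ h', ofHom_app _ _ _ _ (by simpa [φ.proj] using h'),
    ofHom_app _ _ _ _ (by simpa [(φ.pull f).proj] using h),
    tr_pull f _ _ _ (by simpa [φ.proj] using h')]
  exact tr_congr (by simp) rfl _

end Theta

lemma PreHom.pull_theta (m : PreHom P Q) (f : Y ⟶ X) : (m.pull f).theta = m.theta.pull f := by
  have hp : ((m.pull f).src ≫ P.pullSnd f) ≫ P.proj = ((m.pull f).tgt ≫ Q.pullSnd f) ≫ Q.proj := by
    have : (m.pull f).src ≫ (P.pull f).proj = (m.pull f).tgt ≫ (Q.pull f).proj := by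
      rw [src_proj, tgt_proj]
    simp [reassoc_of% this]
  apply Theta.ext_app (m.pull f).bundle.isCover (m.pull f).src (m.pull f).tgt (by simp) (by simp)
  have := (m.pull f).theta_app (𝟙 _) (by simp)
  simp only [Category.id_comp] at this
  rw [this, Theta.pull_app _ _ _ _ _ hp, Theta.app_congr _ (m.pull_src f) (m.pull_tgt f)]
  exact (m.theta_app (m.bundle.pullSnd f) (by simp)).symm

namespace Arrow

/-- The pullback of a morphism. -/
def pull (a : Arrow P Q) (f : Y ⟶ X) : Arrow (P.pull f) (Q.pull f) :=
  Quot.lift (fun m : PreHom P Q => (Quot.mk _ (m.pull f) : Arrow (P.pull f) (Q.pull f)))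
    (fun m n ⟨ρ⟩ => ext ((m.pull_theta f).trans ((congrArg (fun θ => Theta.pull θ f)
      (PreHom.theta_eq_of_twoCell ρ)).trans (n.pull_theta f).symm))) a

lemma pull_theta (a : Arrow P Q) (f : Y ⟶ X) : (a.pull f).theta = a.theta.pull f := by
  induction a using Quot.ind with
  | mk m => exact m.pull_theta f

lemma pull_comp (a : Arrow P Q) (b : Arrow Q R) (f : Y ⟶ X) :
    (a.comp b).pull f = (a.pull f).comp (b.pull f) := by
  apply ext
  rw [pull_theta, comp_theta, comp_theta, pull_theta, pull_theta, Theta.pull_mul]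

lemma pull_ofHom (φ : P.Hom Q) (f : Y ⟶ X) : (ofHom φ).pull f = ofHom (φ.pull f) := by
  apply ext
  rw [pull_theta, ofHom_theta, ofHom_theta, Theta.pull_ofHom]

lemma ofHom_comp (φ : P.Hom Q) (ψ : Q.Hom R) :
    (ofHom φ).comp (ofHom ψ) = ofHom (φ.comp ψ) := by
  apply ext
  rw [comp_theta, ofHom_theta, ofHom_theta, ofHom_theta]
  apply Theta.ext'
  intro T x z h
  have h₁ : (x ≫ φ.hom) ≫ Q.proj = z ≫ R.proj := by simpa [φ.proj] using h
  have h₂ : ((x ≫ φ.hom) ≫ ψ.hom) ≫ R.proj = z ≫ R.proj := by simpa [φ.proj, ψ.proj] using h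
  rw [Theta.ofHom_mul _ _ _ _ _ h₁, Theta.ofHom_app _ _ _ _ h₂,
    Theta.ofHom_app _ _ _ _ (by simpa [Hom.comp] using h₂)]
  exact tr_congr (by simp [Hom.comp]) rfl _

/-- Bundle maps are natural with respect to a pair of morphisms if these have the same
equivariant family. -/
lemma ofHom_natural {P' Q' : PrincipalBundle 𝔸.core X} (a : Arrow P Q) (b : Arrow P' Q')
    (φ : P.Hom P') (ψ : Q.Hom Q')
    (H : ∀ {T : 𝒞} (x : T ⟶ P.total) (y : T ⟶ Q.total) (h) (h'),
      a.theta.app x y h = b.theta.app (x ≫ φ.hom) (y ≫ ψ.hom) h') :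
    a.comp (ofHom ψ) = (ofHom φ).comp b := by
  apply ext
  rw [comp_theta, comp_theta, ofHom_theta, ofHom_theta]
  obtain ⟨W, e, x, y, he, hx, hy⟩ := Theta.exists_cover₂ P Q
  have hy' : (y ≫ ψ.hom) ≫ Q'.proj = e := by rw [Category.assoc, ψ.proj, hy]
  have hx' : (x ≫ φ.hom) ≫ P'.proj = e := by rw [Category.assoc, φ.proj, hx]
  apply Theta.ext_app he x (y ≫ ψ.hom) hx hy'
  rw [Theta.mul_ofHom _ _ _ _ _ (hx.trans hy.symm), Theta.ofHom_mul _ _ _ _ _ (hx'.trans hy'.symm),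
    H _ _ _ (hx'.trans hy'.symm)]

end Arrow
end LaxGeometric

end

noncomputable section

namespace LaxGeometric

variable {𝒞 : Type u} [Category.{v} 𝒞] [HasFiniteLimits 𝒞]

attribute [local simp] pullback.lift_fst pullback.lift_snd pullback.lift_fst_assoc
  pullback.lift_snd_assoc prod.lift_fst prod.lift_snd prod.lift_fst_assoc prod.lift_snd_assoc

attribute [local simp] InternalCategory.ident_dom InternalCategory.ident_cod

open InternalCategory PrincipalBundle

variable {𝔸 : InternalCategory 𝒞} {X T T' : 𝒞}
variable {Y Z W : 𝒞}

namespace PrincipalBundle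

variable {𝔾 : InternalCategory 𝒞} (P : PrincipalBundle 𝔾 X)

lemma Hom.id_comp {P Q : PrincipalBundle 𝔾 X} (φ : P.Hom Q) : (Hom.id P).comp φ = φ :=
  Hom.ext (Category.id_comp _)

lemma Hom.comp_id {P Q : PrincipalBundle 𝔾 X} (φ : P.Hom Q) : φ.comp (Hom.id Q) = φ :=
  Hom.ext (Category.comp_id _)

/-- The bundle map to a pullback given by a map of total spaces. -/
def Hom.toPull {Q : PrincipalBundle 𝔾 Y} (f : Y ⟶ X) (k : Q.total ⟶ P.total)
    (h : Q.proj ≫ f = k ≫ P.proj) (ha : k ≫ P.anchor = Q.anchor)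
    (hact : ∀ {T : 𝒞} (x : T ⟶ Q.total) (g : T ⟶ 𝔾.arr) (h) (h'),
      Q.act x g h ≫ k = P.act (x ≫ k) g h') : Q.Hom (P.pull f) where
  hom := pullLift f Q.proj k h
  proj := by simp
  anchor := by rw [← pullSnd_anchor, pullLift_snd', ha]
  act x g h₁ h₂ := by
    have e : (x ≫ pullLift f Q.proj k h) ≫ P.pullSnd f = x ≫ k := by simp
    apply pull_ext
    · simp
    · rw [act_pullSnd f _ _ h₂ ((Category.assoc _ _ _).trans h₂), act_congr e rfl, ← hact x g h₁]
      simp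

/-- Pullback along the identity. -/
def pullId : (P.pull (𝟙 X)).Hom P where
  hom := P.pullSnd (𝟙 X)
  proj := by simp
  anchor := by simp
  act x g h h' := act_pullSnd _ x g h h'

/-- The inverse of `pullId`. -/
def pullId' : P.Hom (P.pull (𝟙 X)) :=
  Hom.toPull P (𝟙 X) (𝟙 _) (by simp) (by simp)
    (fun x g h h' => (Category.comp_id _).trans (act_congr (Category.comp_id _).symm rfl _))

/-- Pullback along a composite. -/
def pullComp (g : Z ⟶ Y) (f : Y ⟶ X) : (P.pull (g ≫ f)).Hom ((P.pull f).pull g) :=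
  Hom.toPull (P.pull f) g
    (pullLift f ((P.pull (g ≫ f)).proj ≫ g) (P.pullSnd (g ≫ f)) (by simp)) (by simp)
    (by rw [← pullSnd_anchor, pullLift_snd', pullSnd_anchor])
    (fun x a h h' => by
      have e : (x ≫ pullLift f ((P.pull (g ≫ f)).proj ≫ g) (P.pullSnd (g ≫ f)) (by simp)) ≫
        P.pullSnd f = x ≫ P.pullSnd (g ≫ f) := by simp
      apply pull_ext
      · rw [Category.assoc, pullLift_proj, act_proj, Category.assoc, pullLift_proj,
          ← Category.assoc, act_proj, Category.assoc]
      · rw [act_pullSnd f _ _ h' ((Category.assoc _ _ _).trans h'), act_congr e rfl,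
          Category.assoc, pullLift_snd, act_pullSnd _ _ _ h])

/-- The inverse of `pullComp`. -/
def pullComp' (g : Z ⟶ Y) (f : Y ⟶ X) : ((P.pull f).pull g).Hom (P.pull (g ≫ f)) :=
  Hom.toPull P (g ≫ f) ((P.pull f).pullSnd g ≫ P.pullSnd f)
    (by
      rw [Category.assoc, pullSnd_proj, ← Category.assoc, ← Category.assoc, pullSnd_proj])
    (by rw [Category.assoc, pullSnd_anchor, pullSnd_anchor])
    (fun x a h h' => by
      have k : (x ≫ (P.pull f).pullSnd g) ≫ (P.pull f).anchor = a ≫ 𝔾.dom := by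
        rw [Category.assoc, pullSnd_anchor, h]
      rw [← Category.assoc, act_pullSnd _ _ _ h k, act_pullSnd _ _ _ k (by simpa using k)]
      exact act_congr (Category.assoc _ _ _) rfl _)

/-- Pullbacks along equal morphisms. -/
def pullCongr {f f' : Y ⟶ X} (h : f = f') : (P.pull f).Hom (P.pull f') :=
  Hom.toPull P f' (P.pullSnd f) (by simp [h]) (by simp) (fun x g h h' => act_pullSnd f x g h h')

section

attribute [local simp] pullId pullId' pullComp pullComp' pullCongr Hom.toPull Hom.pull Hom.comp

lemma pullId_pullId' : P.pullId.hom ≫ P.pullId'.hom = 𝟙 _ := by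
  apply pull_ext <;> simp

lemma pullId'_pullId : P.pullId'.hom ≫ P.pullId.hom = 𝟙 _ := by
  simp

variable (f : Y ⟶ X) (g : Z ⟶ Y) (h : W ⟶ Z)

lemma pullComp_pullComp' : (P.pullComp g f).hom ≫ (P.pullComp' g f).hom = 𝟙 _ := by
  apply pull_ext <;> simp

lemma pullComp'_pullComp : (P.pullComp' g f).hom ≫ (P.pullComp g f).hom = 𝟙 _ := by
  apply pull_ext
  · simp
  · apply pull_ext <;> simp

lemma pullComp_snd_snd : ((P.pullComp g f).hom ≫ (P.pull f).pullSnd g) ≫ P.pullSnd f =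
    P.pullSnd (g ≫ f) := by simp

lemma pullCongr_rfl : P.pullCongr (rfl : f = f) = Hom.id _ := by
  apply Hom.ext
  apply pull_ext <;> simp [Hom.id]

lemma pull_assoc : (P.pullComp h (g ≫ f)).comp (((P.pullComp g f).pull h).comp
      (((P.pull f).pullComp' h g).comp (P.pullComp' (h ≫ g) f))) =
    P.pullCongr (Category.assoc h g f).symm := by
  apply Hom.ext
  apply pull_ext <;> simp

lemma pull_left_unit : (P.pullComp f (𝟙 X)).comp (P.pullId.pull f) =
    P.pullCongr (Category.comp_id f) := by
  apply Hom.ext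
  apply pull_ext <;> simp

lemma pull_right_unit : (P.pullComp (𝟙 Y) f).comp (P.pull f).pullId =
    P.pullCongr (Category.id_comp f) := by
  apply Hom.ext
  apply pull_ext <;> simp

end

end PrincipalBundle

lemma Arrow.pull_natural {P Q : PrincipalBundle 𝔸.core X} (a : Arrow P Q) (f : Y ⟶ X) (g : Z ⟶ Y) :
    (a.pull (g ≫ f)).comp (Arrow.ofHom (Q.pullComp g f)) =
      (Arrow.ofHom (P.pullComp g f)).comp ((a.pull f).pull g) := by
  refine Arrow.ofHom_natural _ _ _ _ (fun x y h h' => ?_)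
  have e : ∀ {T : 𝒞} {R : PrincipalBundle 𝔸.core X} (x : T ⟶ (R.pull (g ≫ f)).total),
      ((x ≫ (R.pullComp g f).hom) ≫ (R.pull f).pullSnd g) ≫ R.pullSnd f =
        x ≫ R.pullSnd (g ≫ f) := by
    intro T R x
    rw [← R.pullComp_snd_snd f g]
    simp only [Category.assoc]
  have k₁ : (x ≫ P.pullSnd (g ≫ f)) ≫ P.proj = (y ≫ Q.pullSnd (g ≫ f)) ≫ Q.proj := by
    simp [reassoc_of% h]
  have k₂ : ((x ≫ (P.pullComp g f).hom) ≫ (P.pull f).pullSnd g) ≫ (P.pull f).proj =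
      ((y ≫ (Q.pullComp g f).hom) ≫ (Q.pull f).pullSnd g) ≫ (Q.pull f).proj := by
    rw [Category.assoc, Category.assoc _ _ (Q.pull f).proj, pullSnd_proj, pullSnd_proj,
      ← Category.assoc, h', Category.assoc]
  rw [Arrow.pull_theta, Arrow.pull_theta, Arrow.pull_theta, Theta.pull_app _ _ _ _ _ k₁,
    Theta.pull_app _ _ _ _ _ k₂, Theta.pull_app _ _ _ _ _ (by rw [e, e, k₁])]
  exact Theta.app_congr _ (e x).symm (e y).symm _

lemma Arrow.pullId_natural {P Q : PrincipalBundle 𝔸.core X} (a : Arrow P Q) :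
    (a.pull (𝟙 X)).comp (Arrow.ofHom Q.pullId) = (Arrow.ofHom P.pullId).comp a :=
  Arrow.ofHom_natural _ _ _ _ (fun x y h h' => by
    rw [Arrow.pull_theta]
    exact Theta.pull_app _ _ _ _ _ _)

namespace PrinObj

/-- The isomorphism given by mutually inverse bundle maps. -/
def isoMk {P Q : PrinObj 𝔸 X} (φ : P.bundle.Hom Q.bundle) (ψ : Q.bundle.Hom P.bundle)
    (h₁ : φ.hom ≫ ψ.hom = 𝟙 _) (h₂ : ψ.hom ≫ φ.hom = 𝟙 _) : P ≅ Q where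
  hom := Arrow.ofHom φ
  inv := Arrow.ofHom ψ
  hom_inv_id := (Arrow.ofHom_comp φ ψ).trans (congrArg Arrow.ofHom (Hom.ext h₁))
  inv_hom_id := (Arrow.ofHom_comp ψ φ).trans (congrArg Arrow.ofHom (Hom.ext h₂))

variable (𝔸) in
/-- The pullback functor. -/
def pull (f : Y ⟶ X) : PrinObj 𝔸 X ⥤ PrinObj 𝔸 Y where
  obj P := ⟨P.bundle.pull f⟩
  map a := Arrow.pull a f
  map_id P := (Arrow.pull_ofHom (Hom.id P.bundle) f).trans
    (congrArg Arrow.ofHom (Hom.ext (pull_ext (by simp [Hom.id, Hom.pull])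
      (by simp [Hom.id, Hom.pull]))))
  map_comp a b := Arrow.pull_comp a b f

variable (𝔸 X) in
/-- Pullback along the identity. -/
def pullId : pull 𝔸 (𝟙 X) ≅ 𝟭 (PrinObj 𝔸 X) :=
  NatIso.ofComponents (fun P => isoMk P.bundle.pullId P.bundle.pullId'
    P.bundle.pullId_pullId' P.bundle.pullId'_pullId)
    (fun a => Arrow.pullId_natural a)

variable (𝔸) in
/-- Pullback along a composite. -/
def pullComp (g : Z ⟶ Y) (f : Y ⟶ X) : pull 𝔸 (g ≫ f) ≅ pull 𝔸 f ⋙ pull 𝔸 g :=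
  NatIso.ofComponents (fun P => isoMk (P.bundle.pullComp g f) (P.bundle.pullComp' g f)
    (P.bundle.pullComp_pullComp' f g) (P.bundle.pullComp'_pullComp f g))
    (fun a => Arrow.pull_natural a f g)

lemma eqToHom_app {f f' : Y ⟶ X} (h : f = f')
    (e : (pull 𝔸 f).toCatHom = (pull 𝔸 f').toCatHom) (P : PrinObj 𝔸 X) :
    (eqToHom e).toNatTrans.app P = Arrow.ofHom (P.bundle.pullCongr h) := by
  subst h
  exact congrArg Arrow.ofHom (P.bundle.pullCongr_rfl f).symm

end PrinObj

variable (𝔸) in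
/-- The pseudofunctor that sends `X` to the category of principal bundles over `X` for the core of
`𝔸`. -/
def Prin : LocallyDiscrete 𝒞ᵒᵖ ⥤ᵖ Cat.{max u v, max u v} :=
  LocallyDiscrete.mkPseudofunctor
    (fun X => Cat.of (PrinObj 𝔸 X.unop))
    (fun f => (PrinObj.pull 𝔸 f.unop).toCatHom)
    (fun X => Cat.Hom.isoMk (PrinObj.pullId 𝔸 X.unop))
    (fun f g => Cat.Hom.isoMk (PrinObj.pullComp 𝔸 g.unop f.unop))
    (fun f g h => by
      ext P
      refine Eq.trans ?_ (PrinObj.eqToHom_app (Category.assoc h.unop g.unop f.unop).symm _ P).symm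
      change Arrow.comp (Arrow.ofHom (P.bundle.pullComp h.unop (g.unop ≫ f.unop)))
        (Arrow.comp ((Arrow.ofHom (P.bundle.pullComp g.unop f.unop)).pull h.unop)
          (Arrow.comp (Arrow.ofHom (Hom.id _))
            (Arrow.comp (Arrow.ofHom ((P.bundle.pull f.unop).pullComp' h.unop g.unop))
              (Arrow.ofHom (P.bundle.pullComp' (h.unop ≫ g.unop) f.unop))))) = _
      simp only [Arrow.pull_ofHom, Arrow.ofHom_comp, Hom.id_comp, pull_assoc])
    (fun f => by
      ext P
      refine Eq.trans ?_ (PrinObj.eqToHom_app (Category.comp_id f.unop) _ P).symm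
      change Arrow.comp (Arrow.ofHom (P.bundle.pullComp f.unop (𝟙 _)))
        (Arrow.comp ((Arrow.ofHom P.bundle.pullId).pull f.unop) (Arrow.ofHom (Hom.id _))) = _
      simp only [Arrow.pull_ofHom, Arrow.ofHom_comp, Hom.comp_id, pull_left_unit])
    (fun f => by
      ext P
      refine Eq.trans ?_ (PrinObj.eqToHom_app (Category.id_comp f.unop) _ P).symm
      change Arrow.comp (Arrow.ofHom (P.bundle.pullComp (𝟙 _) f.unop))
        (Arrow.comp (Arrow.ofHom (P.bundle.pull f.unop).pullId) (Arrow.ofHom (Hom.id _))) = _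
      simp only [Arrow.ofHom_comp, Hom.comp_id, pull_right_unit])

end LaxGeometric

end

noncomputable section
namespace LaxGeometric

variable {𝒞 : Type u} [Category.{v} 𝒞]

/-- A natural equivalence of pseudofunctors `𝒞ᵒᵖ ⥤ Cat`: a pseudonatural transformation, all of
whose components are equivalences of categories. (The two pseudofunctors may take values in
categories of different universe levels.) -/
structure NatEquivalence (M : LocallyDiscrete 𝒞ᵒᵖ ⥤ᵖ Cat.{v₁, u₁})
    (N : LocallyDiscrete 𝒞ᵒᵖ ⥤ᵖ Cat.{v₂, u₂}) where
  /-- the components -/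
  app (X : 𝒞) : M.obj ⟨op X⟩ ⥤ N.obj ⟨op X⟩
  isEquivalence (X : 𝒞) : (app X).IsEquivalence
  /-- the naturality isomorphisms -/
  nat {X Y : 𝒞} (f : Y ⟶ X) :
    (M.map f.op.toLoc).toFunctor ⋙ app Y ≅ app X ⋙ (N.map f.op.toLoc).toFunctor
  nat_naturality_id (X : 𝒞) (A : M.obj ⟨op X⟩) :
    (nat (𝟙 X)).hom.app A ≫ (N.mapId ⟨op X⟩).hom.toNatTrans.app ((app X).obj A) =
      (app X).map ((M.mapId ⟨op X⟩).hom.toNatTrans.app A)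
  nat_naturality_comp {X Y Z : 𝒞} (f : Y ⟶ X) (g : Z ⟶ Y) (A : M.obj ⟨op X⟩) :
    (nat (g ≫ f)).hom.app A ≫
        (N.mapComp f.op.toLoc g.op.toLoc).hom.toNatTrans.app ((app X).obj A) =
      (app Z).map ((M.mapComp f.op.toLoc g.op.toLoc).hom.toNatTrans.app A) ≫
        (nat g).hom.app ((M.map f.op.toLoc).toFunctor.obj A) ≫
          (N.map g.op.toLoc).toFunctor.map ((nat f).hom.app A)

section

variable [HasFiniteLimits 𝒞]

/-- A pseudofunctor is a lax-geometric stack if it is naturally equivalent to the pseudofunctor of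
principal bundles of some internal category. -/
def IsLaxGeometric (M : LocallyDiscrete 𝒞ᵒᵖ ⥤ᵖ Cat.{v₁, u₁}) : Prop :=
  ∃ 𝔸 : InternalCategory 𝒞, Nonempty (NatEquivalence M (Prin 𝔸))

/-- A pseudofunctor is a stack if, for every cover `p : Y ⟶ X`, the comparison functor from `M(X)`
to the category of objects of `M(Y)` with descent data along `p` is an equivalence. -/
def IsStack (M : LocallyDiscrete 𝒞ᵒᵖ ⥤ᵖ Cat.{v₁, u₁}) : Prop :=
  ∀ ⦃X Y : 𝒞⦄ (p : Y ⟶ X), IsCover p →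
    (M.toDescentData (fun _ : PUnit.{1} => p)).IsEquivalence

/-- Every object of `M`, over any base, becomes isomorphic to a pullback of `C` after passing to a
cover of that base. -/
def LocallyPullbackOf (M : LocallyDiscrete 𝒞ᵒᵖ ⥤ᵖ Cat.{v₁, u₁}) {C₀ : 𝒞}
    (C : M.obj ⟨op C₀⟩) : Prop :=
  ∀ (X : 𝒞) (A : M.obj ⟨op X⟩), ∃ (Y : 𝒞) (p : Y ⟶ X) (q : Y ⟶ C₀), IsCover p ∧
    Nonempty ((M.map p.op.toLoc).toFunctor.obj A ≅ (M.map q.op.toLoc).toFunctor.obj C)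

end

/-- The triples `(f, θ, g)` with `f, g : X ⟶ C₀` and `θ : M(f)(C) ⟶ M(g)(C)`. -/
structure Triple (M : LocallyDiscrete 𝒞ᵒᵖ ⥤ᵖ Cat.{v₁, u₁}) {C₀ : 𝒞} (C : M.obj ⟨op C₀⟩)
    (X : 𝒞) where
  f : X ⟶ C₀
  g : X ⟶ C₀
  θ : (M.map f.op.toLoc).toFunctor.obj C ⟶ (M.map g.op.toLoc).toFunctor.obj C

/-- Restriction of a triple along `h : Y ⟶ X`: it consists of `h ≫ f`, `h ≫ g` and
`M(h)(θ)`, transported along the coherence isomorphisms `M(h ≫ f)(C) ≅ M(h)(M(f)(C))` and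
`M(h)(M(g)(C)) ≅ M(h ≫ g)(C)`. -/
def Triple.restrict {M : LocallyDiscrete 𝒞ᵒᵖ ⥤ᵖ Cat.{v₁, u₁}} {C₀ : 𝒞} {C : M.obj ⟨op C₀⟩}
    {X Y : 𝒞} (t : Triple M C X) (h : Y ⟶ X) : Triple M C Y where
  f := h ≫ t.f
  g := h ≫ t.g
  θ := (M.mapComp t.f.op.toLoc h.op.toLoc).hom.toNatTrans.app C ≫
    (M.map h.op.toLoc).toFunctor.map t.θ ≫
    (M.mapComp t.g.op.toLoc h.op.toLoc).inv.toNatTrans.app C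

/-- The object `C₁` represents the triples `(f, θ, g)`: there are bijections between the morphisms
`X ⟶ C₁` and the triples over `X`, natural in `X`. -/
def RepresentsTriples (M : LocallyDiscrete 𝒞ᵒᵖ ⥤ᵖ Cat.{v₁, u₁}) {C₀ : 𝒞} (C : M.obj ⟨op C₀⟩)
    (C₁ : 𝒞) : Prop :=
  ∃ e : ∀ X : 𝒞, (X ⟶ C₁) ≃ Triple M C X,
    ∀ ⦃X Y : 𝒞⦄ (h : Y ⟶ X) (k : X ⟶ C₁), e Y (h ≫ k) = (e X k).restrict h

end LaxGeometric

end

/-! Both directions rest on one description of morphisms. A morphism of bundles amounts to an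
equivariant family of arrows of `𝔸` (`Theta`); such a family is determined by its value at one pair
of local points, and every arrow compatible with the transition arrows of the two bundles occurs as
such a value.

Suppose that `M` is lax-geometric. The conditions on the right are invariant under natural
equivalence, so they need only be checked for `Prin 𝔸`. It is a stack (`prin_hasDescent`): morphisms
descend because they are given by local values. For an object with descent data along `p : Y ⟶ X`,
the total space `P` of its bundle over `Y` also covers `X`, the data become a cocycle on `P`, and
the bundle over `X` associated with this cocycle is the descended object. Associated bundles exist
(`exists_associated`) because the trivial bundle `Y ×_{𝔾₀} 𝔾₁`, with the cocycle acting on it, is an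
algebra for the monad of the cover and so descends. The generic object is a bundle over `𝔸.obj` with
a section anchored by the identity (`UniversalBundle`). Any bundle, pulled back to its own total
space, is the pullback of the generic one along its anchor, and morphisms from its pullback along
`f` to its pullback along `g` are the arrows from `f` to `g`.

Conversely, Yoneda applied to `C₁` gives a generic morphism between pullbacks of `C` (`Classifier`),
and `C₀`, `C₁` form an internal category whose laws are those of composition in the fibres of `M`.
Objects and bundles are compared by framings: a `Framing` of `A` by `P` identifies the pullback of
`A` to the total space of `P` with the pullback of `C` along the anchor, compatibly with the action.
Every bundle frames an object (`exists_framing_of_bundle`), every object is framed by a bundle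
(`exists_framing_of_iso`), and morphisms of framed objects correspond bijectively to equivariant
families (`Corr`). A choice of framings is therefore an equivalence on each fibre. Its naturality
and coherence follow because the correspondence is functorial between arbitrary framings, and the
pullback of a framing is again a framing. -/

noncomputable section

namespace LaxGeometric

variable {𝒞 : Type u} [Category.{v} 𝒞] [HasFiniteLimits 𝒞]

attribute [local simp] pullback.lift_fst pullback.lift_snd pullback.lift_fst_assoc
  pullback.lift_snd_assoc

/-! ### Covers: cancellation, split epimorphisms, and morphisms given locally -/

namespace IsCover

/-- If `f` and `f ≫ g` are covers, then so is `g`. -/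
lemma of_comp {X Y Z : 𝒞} {f : Z ⟶ Y} {g : Y ⟶ X} (hf : IsCover f) (hfg : IsCover (f ≫ g)) :
    IsCover g := by
  -- Beck's criterion for `g`. A pair split by pullback along `g` is also split by pullback along `f
  -- ≫ g`, hence has a coequalizer that the composite preserves and reflects. Pullback along `f`
  -- preserves and reflects the coequalizer of the image pair: its reflecting gives preservation for
  -- `g`, its preserving gives reflection for `g`.
  have key : ∀ {A B : Over X} (a b : A ⟶ B) [(Over.pullback g).IsSplitPair a b],
      HasCoequalizer a b ∧ PreservesColimit (parallelPair a b) (Over.pullback g) ∧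
      ReflectsColimit (parallelPair a b) (Over.pullback g) := by
    intro A B a b _
    have : (Over.pullback g ⋙ Over.pullback f).IsSplitPair a b :=
      map_is_split_pair (Over.pullback f) _ _
    have := isSplitPair_of_iso (Over.pullbackComp f g).symm a b
    obtain ⟨k₁, k₂, k₃⟩ := preserves_reflects hfg a b
    have : (Over.pullback f).IsSplitPair ((Over.pullback g).map a) ((Over.pullback g).map b) :=
      map_is_split_pair (Over.pullback f) _ _
    obtain ⟨l₁, l₂, l₃⟩ :=
      preserves_reflects hf ((Over.pullback g).map a) ((Over.pullback g).map b)
    let e : parallelPair a b ⋙ Over.pullback g ≅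
      parallelPair ((Over.pullback g).map a) ((Over.pullback g).map b) := diagramIsoParallelPair _
    have : ReflectsColimit (parallelPair a b ⋙ Over.pullback g) (Over.pullback f) :=
      reflectsColimit_of_iso_diagram _ e.symm
    have : PreservesColimit (parallelPair a b ⋙ Over.pullback g) (Over.pullback f) :=
      preservesColimit_of_iso_diagram _ e.symm
    have : PreservesColimit (parallelPair a b) (Over.pullback g ⋙ Over.pullback f) :=
      preservesColimit_of_natIso _ (Over.pullbackComp f g)
    have : ReflectsColimit (parallelPair a b) (Over.pullback g ⋙ Over.pullback f) :=
      reflectsColimit_of_natIso _ (Over.pullbackComp f g)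
    exact ⟨k₁, preservesColimit_of_reflects_of_preserves (Over.pullback g) (Over.pullback f),
      reflects_of_comp _ (Over.pullback g) (Over.pullback f)⟩
  exact of_beck (fun f g _ => (key f g).1) (fun f g _ => (key f g).2.1)
    (fun f g _ => (key f g).2.2)

/-- Split coequalizers are absolute: the equations of a splitting survive any functor. -/
lemma preserves_of_split {D₁ D₂ : Type*} [Category D₁] [Category D₂] (F : D₁ ⥤ D₂) {A B : D₁}
    (a b : A ⟶ B) [HasSplitCoequalizer a b] : PreservesColimit (parallelPair a b) F :=
  preservesColimit_of_preserves_colimit_cocone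
    (HasSplitCoequalizer.isSplitCoequalizer a b).isCoequalizer
    ((isColimitMapCoconeCoforkEquiv F _).symm
      ((HasSplitCoequalizer.isSplitCoequalizer a b).map F).isCoequalizer)

/-- Split epimorphisms are covers. -/
lemma of_section {X Y : 𝒞} {p : Y ⟶ X} (s : X ⟶ Y) (hs : s ≫ p = 𝟙 X) : IsCover p := by
  -- Pulling back along `p` and then along `s` changes nothing, so a pair split after pullback along
  -- `p` is already split over `X`. Its coequalizer is then absolute, and pullback along `s` shows
  -- that pullback along `p` reflects it.
  have e : Over.pullback p ⋙ Over.pullback s ≅ 𝟭 (Over X) :=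
    (Over.pullbackComp s p).symm ≪≫ pullbackCongr hs ≪≫ Over.pullbackId
  have key : ∀ {A B : Over X} (a b : A ⟶ B) [(Over.pullback p).IsSplitPair a b],
      HasCoequalizer a b ∧ PreservesColimit (parallelPair a b) (Over.pullback p) ∧
      ReflectsColimit (parallelPair a b) (Over.pullback p) := by
    intro A B a b _
    have : (Over.pullback p ⋙ Over.pullback s).IsSplitPair a b :=
      map_is_split_pair (Over.pullback s) _ _
    have : HasSplitCoequalizer a b := isSplitPair_of_iso e a b
    have : HasSplitCoequalizer ((Over.pullback p).map a) ((Over.pullback p).map b) :=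
      inferInstance
    have := preserves_of_split (Over.pullback s) ((Over.pullback p).map a)
      ((Over.pullback p).map b)
    let e' : parallelPair a b ⋙ Over.pullback p ≅
      parallelPair ((Over.pullback p).map a) ((Over.pullback p).map b) := diagramIsoParallelPair _
    have : PreservesColimit (parallelPair a b ⋙ Over.pullback p) (Over.pullback s) :=
      preservesColimit_of_iso_diagram _ e'.symm
    have : ReflectsColimit (parallelPair a b) (Over.pullback p ⋙ Over.pullback s) :=
      reflectsColimit_of_natIso _ e.symm
    exact ⟨inferInstance, preserves_of_split _ a b,
      reflects_of_comp _ (Over.pullback p) (Over.pullback s)⟩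
  exact of_beck (fun f g _ => (key f g).1) (fun f g _ => (key f g).2.1)
    (fun f g _ => (key f g).2.2)

lemma id (X : 𝒞) : IsCover (𝟙 X) := of_section (𝟙 X) (Category.id_comp _)

lemma fst {X Y T : 𝒞} {p : Y ⟶ X} (hp : IsCover p) (t : T ⟶ X) : IsCover (pullback.fst t p) :=
  of_isPullback (IsPullback.of_hasPullback t p).flip hp

/-- To give a morphism `T ⟶ Z`, for `T` over the target of a cover, it suffices to give it
locally, in a way that does not depend on the choice of local lifts to the cover. -/
lemma exists_local_desc {X Y T Z : 𝒞} {e : Y ⟶ X} (he : IsCover e) (t : T ⟶ X)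
    (F : ∀ {S : 𝒞} (k : S ⟶ T) (y : S ⟶ Y), k ≫ t = y ≫ e → (S ⟶ Z))
    (nat : ∀ {S S' : 𝒞} (a : S' ⟶ S) (k : S ⟶ T) (y : S ⟶ Y) (h) (h'),
      a ≫ F k y h = F (a ≫ k) (a ≫ y) h')
    (indep : ∀ {S : 𝒞} (k : S ⟶ T) (y y' : S ⟶ Y) (h) (h'), F k y h = F k y' h') :
    ∃ n : T ⟶ Z, ∀ {S : 𝒞} (k : S ⟶ T) (y : S ⟶ Y) (h), k ≫ n = F k y h := by
  have F_congr : ∀ {S : 𝒞} (k k' : S ⟶ T) (y y' : S ⟶ Y) (h) (h'), k = k' → y = y' →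
      F k y h = F k' y' h' := by
    rintro S k _ y _ h h' rfl rfl; rfl
  -- The universal local lift lives over `T ×_X Y`, which covers `T`. Two points of it with the same
  -- image in `T` differ only in the lift to `Y`, so `indep` is the condition for descending `F`
  -- along this cover.
  obtain ⟨n, hn, -⟩ := (he.fst t).existsUnique_desc
    (F (pullback.fst t e) (pullback.snd t e) pullback.condition) (by
      intro S a b hab
      have ha : (a ≫ pullback.fst t e) ≫ t = (a ≫ pullback.snd t e) ≫ e := by
        simp [pullback.condition]
      have hb : (b ≫ pullback.fst t e) ≫ t = (b ≫ pullback.snd t e) ≫ e := by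
        simp [pullback.condition]
      rw [nat a _ _ _ ha, nat b _ _ _ hb]
      exact (F_congr _ _ _ _ _ (hab ▸ ha) hab rfl).trans (indep _ _ _ _ _))
  refine ⟨n, fun k y h => ?_⟩
  have : k = pullback.lift k y h ≫ pullback.fst t e := by simp
  conv_lhs => rw [this]
  rw [Category.assoc, hn, nat _ _ _ _ (by simp [h])]
  exact F_congr _ _ _ _ _ _ (by simp) (by simp)

end IsCover
end LaxGeometric

end

/-! ### Descent of objects along a cover -/

noncomputable section

namespace LaxGeometric

variable {𝒞 : Type u} [Category.{v} 𝒞] [HasFiniteLimits 𝒞]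

attribute [local simp] pullback.lift_fst pullback.lift_snd pullback.lift_fst_assoc
  pullback.lift_snd_assoc

/-- Objects over the source of a cover descend along the cover, if they carry descent data,
given here as an action of the kernel pair. -/
lemma IsCover.exists_descent {X Y E : 𝒞} {e : Y ⟶ X} (he : IsCover e) (π : E ⟶ Y)
    (α : pullback (π ≫ e) e ⟶ E) (hα : α ≫ π = pullback.snd _ _)
    (unit : pullback.lift (𝟙 E) π (by simp) ≫ α = 𝟙 E)
    (assoc : ∀ {T : 𝒞} (x : T ⟶ E) (y z : T ⟶ Y) (h₁ : x ≫ π ≫ e = y ≫ e)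
      (h₂ : x ≫ π ≫ e = z ≫ e) (h₃ : (pullback.lift x y h₁ ≫ α) ≫ π ≫ e = z ≫ e),
      pullback.lift (pullback.lift x y h₁ ≫ α) z h₃ ≫ α = pullback.lift x z h₂ ≫ α) :
    ∃ (Q : 𝒞) (r : Q ⟶ X) (m : E ⟶ Q), IsPullback m π r e ∧
      ∀ {T : 𝒞} (x : T ⟶ E) (y : T ⟶ Y) (h : x ≫ π ≫ e = y ≫ e),
        pullback.lift x y h ≫ α ≫ m = x ≫ m := by
  let adj := Over.mapPullbackAdj e
  have eL : ∀ w, (adj.counit.app w).left = pullback.fst w.hom e := fun w => by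
    simp [adj]
  have eR₁ : ∀ {U V : Over X} (k : U ⟶ V), ((Over.pullback e).map k).left ≫
      pullback.fst V.hom e = pullback.fst U.hom e ≫ k.left := fun k => pullback.lift_fst _ _ _
  have eR₂ : ∀ {U V : Over X} (k : U ⟶ V), ((Over.pullback e).map k).left ≫
      pullback.snd V.hom e = pullback.snd U.hom e := fun k => pullback.lift_snd _ _ _
  -- The monad of `Over.mapPullbackAdj e` sends `π` to the projection `E ×_X Y ⟶ Y`, so `α` is a
  -- candidate structure map and the hypotheses are the algebra laws. What remains is to identify
  -- the components of the unit and of `μ` with explicit lifts into pullbacks.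
  let A : adj.toMonad.Algebra :=
    { A := Over.mk π
      a := Over.homMk α hα
      unit := by
        ext1
        refine Eq.trans ?_ unit
        refine congrArg (fun k => k ≫ α) ?_
        simp [adj]
      assoc := by
        ext1
        have c : (pullback.fst (pullback.snd (π ≫ e) e ≫ e) e ≫ pullback.fst (π ≫ e) e) ≫ π ≫ e =
            pullback.snd (pullback.snd (π ≫ e) e ≫ e) e ≫ e := by
          rw [Category.assoc, pullback.condition, pullback.condition]
        have c' : (pullback.fst (pullback.snd (π ≫ e) e ≫ e) e ≫ α) ≫ π ≫ e =
            pullback.snd (pullback.snd (π ≫ e) e ≫ e) e ≫ e := by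
          rw [Category.assoc, reassoc_of% hα, pullback.condition]
        have h₁ : (adj.toMonad.μ.app (Over.mk π)).left = pullback.lift _ _ c := by
          apply pullback.hom_ext
          · refine (eR₁ (adj.counit.app ((Over.map e).obj (Over.mk π)))).trans ?_
            rw [eL]
            exact (pullback.lift_fst _ _ c).symm
          · exact (eR₂ (adj.counit.app ((Over.map e).obj (Over.mk π)))).trans
              (pullback.lift_snd _ _ c).symm
        have h₂ : (adj.toMonad.map (Over.homMk α hα :
            Over.mk (pullback.snd (π ≫ e) e) ⟶ Over.mk π)).left = pullback.lift _ _ c' := rfl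
        refine (congrArg (fun k => k ≫ α) h₁).trans (Eq.trans ?_
          (congrArg (fun k => k ≫ α) h₂).symm)
        have h := assoc (pullback.fst (pullback.snd (π ≫ e) e ≫ e) e ≫ pullback.fst (π ≫ e) e)
          (pullback.fst (pullback.snd (π ≫ e) e ≫ e) e ≫ pullback.snd (π ≫ e) e)
          (pullback.snd (pullback.snd (π ≫ e) e ≫ e) e) (by simp [pullback.condition]) c
        have l : pullback.lift (pullback.fst (pullback.snd (π ≫ e) e ≫ e) e ≫
            pullback.fst (π ≫ e) e) (pullback.fst (pullback.snd (π ≫ e) e ≫ e) e ≫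
            pullback.snd (π ≫ e) e) (by simp [pullback.condition]) =
            pullback.fst (pullback.snd (π ≫ e) e ≫ e) e := by
          apply pullback.hom_ext <;> simp
        simp only [l] at h
        exact (h c').symm }
  -- Monadicity enters here: the algebra is isomorphic to the one carried by the pullback of some
  -- object `O` over `X`.
  have := he.essSurj
  let O := (Monad.comparison adj).objPreimage A
  let i : (Monad.comparison adj).obj O ≅ A := (Monad.comparison adj).objObjPreimageIso A
  let f : pullback O.hom e ⟶ E := i.hom.f.left
  let g : E ⟶ pullback O.hom e := i.inv.f.left
  have fg : f ≫ g = 𝟙 _ := congrArg (fun k => k.f.left) i.hom_inv_id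
  have gf : g ≫ f = 𝟙 _ := congrArg (fun k => k.f.left) i.inv_hom_id
  have fπ : f ≫ π = pullback.snd O.hom e := Over.w i.hom.f
  have gπ : g ≫ pullback.snd O.hom e = π := Over.w i.inv.f
  refine ⟨O.left, O.hom, g ≫ pullback.fst O.hom e, ?_, ?_⟩
  · refine IsPullback.of_iso (IsPullback.of_hasPullback O.hom e) ⟨f, g, fg, gf⟩ (Iso.refl _)
      (Iso.refl _) (Iso.refl _) ?_ ?_ ?_ ?_
    · simp [reassoc_of% fg]
    · simpa using fπ.symm
    · simp
    · simp
  · intro T x y h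
    -- The action on the pullback of `O` is the pulled-back counit, which leaves the component in
    -- `O` fixed. Since `i.inv` is a map of algebras, `α` does not change the image in `O` either.
    let β : pullback (pullback.snd O.hom e ≫ e) e ⟶ pullback O.hom e :=
      ((Monad.comparison adj).obj O).a.left
    let γ : pullback (π ≫ e) e ⟶ pullback (pullback.snd O.hom e ≫ e) e :=
      (adj.toMonad.map i.inv.f).left
    have h₁ : β ≫ pullback.fst O.hom e =
        pullback.fst (pullback.snd O.hom e ≫ e) e ≫ pullback.fst O.hom e := by
      refine (eR₁ (adj.counit.app O)).trans ?_
      rw [eL]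
      rfl
    have h₂ : α ≫ g = γ ≫ β := (congrArg (fun k => k.left) i.inv.h).symm
    have h₄ : γ ≫ pullback.fst (pullback.snd O.hom e ≫ e) e =
        pullback.fst (π ≫ e) e ≫ g := eR₁ ((Over.map e).map i.inv.f)
    rw [reassoc_of% h₂, h₁, reassoc_of% h₄, pullback.lift_fst_assoc]

end LaxGeometric

end

/-! ### Principal bundles from cocycles, by local coordinates -/

noncomputable section

namespace LaxGeometric

variable {𝒞 : Type u} [Category.{v} 𝒞] [HasFiniteLimits 𝒞]

attribute [local simp] pullback.lift_fst pullback.lift_snd pullback.lift_fst_assoc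
  pullback.lift_snd_assoc InternalCategory.ident_dom InternalCategory.ident_cod

open InternalCategory

namespace InternalFunctor

variable {𝔾 : InternalCategory 𝒞} {X Y T T' : 𝒞} {e : Y ⟶ X}
  (ψ : InternalFunctor (kernelPair e) 𝔾)

/-- The value of a cocycle at a pair of generalised elements. -/
def at₂ (y z : T ⟶ Y) (h : y ≫ e = z ≫ e) : T ⟶ 𝔾.arr := pullback.lift y z h ≫ ψ.arr

@[simp] lemma at₂_dom (y z : T ⟶ Y) (h) : ψ.at₂ y z h ≫ 𝔾.dom = y ≫ ψ.obj := by
  rw [at₂, Category.assoc, ψ.dom]; simp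

@[simp] lemma at₂_cod (y z : T ⟶ Y) (h) : ψ.at₂ y z h ≫ 𝔾.cod = z ≫ ψ.obj := by
  rw [at₂, Category.assoc, ψ.cod]; simp

lemma comp_at₂ (k : T' ⟶ T) (y z : T ⟶ Y) (h) :
    k ≫ ψ.at₂ y z h = ψ.at₂ (k ≫ y) (k ≫ z) (by simp [h]) := by
  rw [at₂, at₂, ← Category.assoc]
  congr 1
  apply pullback.hom_ext <;> simp

lemma at₂_congr {y z y' z' : T ⟶ Y} (hy : y = y') (hz : z = z') (h) :
    ψ.at₂ y z h = ψ.at₂ y' z' (by rw [← hy, ← hz, h]) := by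
  subst hy hz; rfl

lemma at₂_self (y : T ⟶ Y) (h) : ψ.at₂ y y h = (y ≫ ψ.obj) ≫ 𝔾.ident := by
  rw [Category.assoc, ← ψ.ident, at₂, ← Category.assoc]
  congr 1
  apply pullback.hom_ext <;> simp

lemma at₂_mul_at₂ (x y z : T ⟶ Y) (h₁ h₂) (h₃) :
    𝔾.mul (ψ.at₂ x y h₁) (ψ.at₂ y z h₂) h₃ = ψ.at₂ x z (h₁.trans h₂) := by
  have := ψ.comp (pullback.lift x y h₁) (pullback.lift y z h₂) (by simp) h₃
  refine this.symm.trans ?_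
  rw [at₂]
  congr 1
  apply pullback.hom_ext <;> simp [mul]

/-- A description of the total space of the bundle associated with a cocycle `ψ` by its local
coordinates: a point `q` over the image of `y : T ⟶ Y` is the same as an arrow of `𝔾` out of
`ψ.obj y`. -/
structure Coordinates where
  /-- the total space -/
  total : 𝒞
  /-- the projection -/
  proj : total ⟶ X
  isCover : IsCover proj
  /-- the local coordinates -/
  coord {T : 𝒞} (q : T ⟶ total) (y : T ⟶ Y) (h : q ≫ proj = y ≫ e) : T ⟶ 𝔾.arr
  coord_dom {T : 𝒞} (q : T ⟶ total) (y : T ⟶ Y) (h) : coord q y h ≫ 𝔾.dom = y ≫ ψ.obj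
  comp_coord {T T' : 𝒞} (k : T' ⟶ T) (q : T ⟶ total) (y : T ⟶ Y) (h) (h') :
    k ≫ coord q y h = coord (k ≫ q) (k ≫ y) h'
  coord_change {T : 𝒞} (q : T ⟶ total) (y z : T ⟶ Y) (h) (h') (hz : z ≫ e = y ≫ e) (k) :
    coord q z h' = 𝔾.mul (ψ.at₂ z y hz) (coord q y h) k
  coord_injective {T : 𝒞} {q q' : T ⟶ total} (y : T ⟶ Y) (h) (h') :
    coord q y h = coord q' y h' → q = q'
  exists_coord {T : 𝒞} (y : T ⟶ Y) (g : T ⟶ 𝔾.arr) (hg : g ≫ 𝔾.dom = y ≫ ψ.obj) :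
    ∃ (q : T ⟶ total) (h : q ≫ proj = y ≫ e), coord q y h = g

/-- Over `Y` the bundle should be trivial, with points the pairs `(y, g)` where `g` starts at `ψ.obj
y`. The cocycle transports `(y, g)` to `(z, ψ(z, y) · g)`; the cocycle laws make this descent data,
so `exists_descent` gives the total space over `X`. -/
lemma nonempty_coordinates (he : IsCover e) : Nonempty ψ.Coordinates := by
  let π : pullback ψ.obj 𝔾.dom ⟶ Y := pullback.fst _ _
  have hπ : IsCover π := IsCover.of_section (pullback.lift (𝟙 Y) (ψ.obj ≫ 𝔾.ident) (by simp))
    (by simp [π])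
  have c : pullback.snd (π ≫ e) e ≫ e = (pullback.fst (π ≫ e) e ≫ π) ≫ e := by
    simp [pullback.condition]
  let α : pullback (π ≫ e) e ⟶ pullback ψ.obj 𝔾.dom := pullback.lift (pullback.snd (π ≫ e) e)
    (𝔾.mul (ψ.at₂ (pullback.snd (π ≫ e) e) (pullback.fst (π ≫ e) e ≫ π) c)
      (pullback.fst (π ≫ e) e ≫ pullback.snd ψ.obj 𝔾.dom) (by simp [π, pullback.condition]))
    (by simp)
  have hα : α ≫ π = pullback.snd _ _ := by simp [α, π]
  have hα' : ∀ {T : 𝒞} (x : T ⟶ pullback ψ.obj 𝔾.dom) (y : T ⟶ Y) (h : x ≫ π ≫ e = y ≫ e),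
      (pullback.lift x y h ≫ α) ≫ pullback.snd ψ.obj 𝔾.dom =
        𝔾.mul (ψ.at₂ y (x ≫ π) (by simp [h])) (x ≫ pullback.snd ψ.obj 𝔾.dom)
          (by simp [π, pullback.condition]) := by
    intro T x y h
    simp only [α, Category.assoc, pullback.lift_snd, comp_mul, comp_at₂]
    exact mul_congr (ψ.at₂_congr (by simp) (by simp) _) (by simp) _
  have hα'' : ∀ {T : 𝒞} (x : T ⟶ pullback ψ.obj 𝔾.dom) (y : T ⟶ Y) (h : x ≫ π ≫ e = y ≫ e),
      (pullback.lift x y h ≫ α) ≫ π = y := by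
    intro T x y h
    rw [Category.assoc, hα, pullback.lift_snd]
  obtain ⟨Q, r, m, sq, hm⟩ := he.exists_descent π α hα
    (by
      apply pullback.hom_ext
      · refine (hα'' _ _ _).trans ?_
        simp [π]
      · rw [hα', mul_congr ((ψ.at₂_congr rfl (Category.id_comp _) _).trans (ψ.at₂_self π rfl))
          (Category.id_comp _), ident_mul, Category.id_comp])
    (by
      intro T x y z h₁ h₂ h₃
      apply pullback.hom_ext
      · exact (hα'' _ _ _).trans (hα'' _ _ _).symm
      · rw [hα', mul_congr (ψ.at₂_congr rfl (hα'' _ _ _) _) (hα' _ _ _),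
          ← mul_mul_eq _ _ _ (by simp) (by simp [π, pullback.condition]),
          mul_congr (ψ.at₂_mul_at₂ _ _ _ _ _ _) rfl, hα'])
  -- `m` is a cover, being a pullback of `e`, and `m ≫ r` equals the composite `π ≫ e` of covers;
  -- `π` is one because identity arrows give it a section.
  have hr : IsCover r := by
    refine IsCover.of_comp (IsCover.of_isPullback sq.flip he) ?_
    rw [sq.w]
    exact hπ.comp he
  -- The pair `(q, y)` is a point of `Q ×_X Y`, hence a pair of a point of `Y` and an arrow; the
  -- arrow is the coordinate of `q` at `y`.
  refine ⟨⟨Q, r, hr, fun q y h => sq.lift q y h ≫ pullback.snd ψ.obj 𝔾.dom, ?_, ?_, ?_, ?_, ?_⟩⟩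
  · intro T q y h
    rw [Category.assoc, ← pullback.condition]
    exact sq.lift_snd_assoc _ _ _ _
  · intro T T' k q y h h'
    rw [← Category.assoc]
    congr 1
    apply sq.hom_ext <;> simp
  · intro T q y z h h' hz k
    have k₁ : sq.lift q y h ≫ π ≫ e = z ≫ e := by rw [sq.lift_snd_assoc, hz]
    have : sq.lift q z h' = pullback.lift (sq.lift q y h) z k₁ ≫ α := by
      apply sq.hom_ext
      · rw [sq.lift_fst, Category.assoc, hm, sq.lift_fst]
      · rw [sq.lift_snd, hα'']
    rw [this, hα']
    exact mul_congr (ψ.at₂_congr rfl (sq.lift_snd _ _ _) _) rfl _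
  · intro T q q' y h h' hq
    have : sq.lift q y h = sq.lift q' y h' := by
      apply pullback.hom_ext _ hq
      exact (sq.lift_snd _ _ _).trans (sq.lift_snd _ _ _).symm
    rw [← sq.lift_fst q y h, this, sq.lift_fst]
  · intro T y g hg
    have k : (pullback.lift y g hg.symm ≫ m) ≫ r = y ≫ e := by
      rw [Category.assoc, sq.w, ← Category.assoc, pullback.lift_fst]
    refine ⟨pullback.lift y g hg.symm ≫ m, k, ?_⟩
    have : sq.lift _ _ k = pullback.lift y g hg.symm := by
      apply sq.hom_ext
      · rw [sq.lift_fst]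
      · rw [sq.lift_snd, pullback.lift_fst]
    rw [this, pullback.lift_snd]

namespace Coordinates

variable {ψ} (K : ψ.Coordinates)

lemma coord_congr {q q' : T ⟶ K.total} {y y' : T ⟶ Y} (hq : q = q') (hy : y = y') (h) :
    K.coord q y h = K.coord q' y' (by rw [← hq, ← hy, h]) := by
  subst hq hy; rfl

/-- The point with given coordinates. -/
def pt (y : T ⟶ Y) (g : T ⟶ 𝔾.arr) (hg : g ≫ 𝔾.dom = y ≫ ψ.obj) : T ⟶ K.total :=
  (K.exists_coord y g hg).choose

@[simp] lemma pt_proj (y : T ⟶ Y) (g : T ⟶ 𝔾.arr) (hg) : K.pt y g hg ≫ K.proj = y ≫ e :=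
  (K.exists_coord y g hg).choose_spec.choose

@[simp] lemma coord_pt (y : T ⟶ Y) (g : T ⟶ 𝔾.arr) (hg) (h) : K.coord (K.pt y g hg) y h = g :=
  (K.exists_coord y g hg).choose_spec.choose_spec

lemma comp_pt (k : T' ⟶ T) (y : T ⟶ Y) (g : T ⟶ 𝔾.arr) (hg) (hg') :
    k ≫ K.pt y g hg = K.pt (k ≫ y) (k ≫ g) hg' := by
  refine K.coord_injective (k ≫ y) (by simp) (by simp) ?_
  rw [← K.comp_coord k _ _ (by simp), coord_pt, coord_pt]

lemma pt_eq_of_change (y z : T ⟶ Y) (g g' : T ⟶ 𝔾.arr) (hg) (hg') (hz : z ≫ e = y ≫ e) (h)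
    (H : g' = 𝔾.mul (ψ.at₂ z y hz) g h) : K.pt z g' hg' = K.pt y g hg := by
  refine K.coord_injective z (by simp) (by simp [hz]) ?_
  rw [coord_pt, K.coord_change _ y z (by simp) _ hz (by simp [hg]), H]
  exact mul_congr rfl (K.coord_pt _ _ _ _).symm _

lemma eq_of_local (he : IsCover e) {q q' : T ⟶ K.total} (h : q ≫ K.proj = q' ≫ K.proj)
    (H : ∀ {S : 𝒞} (k : S ⟶ T) (y : S ⟶ Y) (h₁) (h₂),
      K.coord (k ≫ q) y h₁ = K.coord (k ≫ q') y h₂) : q = q' := by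
  apply (he.fst (q ≫ K.proj)).cancel
  have c := pullback.condition (f := q ≫ K.proj) (g := e)
  have h₁ := (Category.assoc _ _ _).trans c
  have h₂ : (pullback.fst (q ≫ K.proj) e ≫ q') ≫ K.proj = pullback.snd (q ≫ K.proj) e ≫ e := by
    rw [Category.assoc, ← h, c]
  exact K.coord_injective _ h₁ h₂ (H _ _ h₁ h₂)

/-- A change of local lift multiplies the coordinate on the left, so the codomain of the coordinate
does not depend on the lift and descends. -/
lemma exists_anchor (he : IsCover e) : ∃ a : K.total ⟶ 𝔾.obj, ∀ {T : 𝒞} (q : T ⟶ K.total)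
    (y : T ⟶ Y) (h), K.coord q y h ≫ 𝔾.cod = q ≫ a := by
  obtain ⟨a, ha⟩ := he.exists_local_desc K.proj (fun k y h => K.coord k y h ≫ 𝔾.cod)
    (fun a k y h h' => by rw [← Category.assoc, K.comp_coord _ _ _ _ h'])
    (fun k y y' h h' => by
      rw [K.coord_change k y' y h' h (h.symm.trans h') (by simp [K.coord_dom]), mul_cod])
  exact ⟨a, fun q y h => (ha q y h).symm⟩

/-- Right multiplication of coordinates commutes with the change of coordinates, which is a left
multiplication; hence it descends from local lifts to the total space. -/
lemma exists_action (he : IsCover e) {a : K.total ⟶ 𝔾.obj} (ha : ∀ {T : 𝒞} (q : T ⟶ K.total)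
    (y : T ⟶ Y) (h), K.coord q y h ≫ 𝔾.cod = q ≫ a) :
    ∃ b : pullback a 𝔾.dom ⟶ K.total, b ≫ K.proj = pullback.fst a 𝔾.dom ≫ K.proj ∧
      ∀ {T : 𝒞} (q : T ⟶ K.total) (g : T ⟶ 𝔾.arr) (h : q ≫ a = g ≫ 𝔾.dom) (y : T ⟶ Y) (h₁) (h₂)
        (h₃), K.coord (pullback.lift q g h ≫ b) y h₁ = 𝔾.mul (K.coord q y h₂) g h₃ := by
  have hF : ∀ {S : 𝒞} (k : S ⟶ pullback a 𝔾.dom) (y : S ⟶ Y)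
      (h : k ≫ pullback.fst a 𝔾.dom ≫ K.proj = y ≫ e),
      K.coord (k ≫ pullback.fst a 𝔾.dom) y (by simp [h]) ≫ 𝔾.cod =
        (k ≫ pullback.snd a 𝔾.dom) ≫ 𝔾.dom := by
    intro S k y h
    rw [ha, Category.assoc, pullback.condition, Category.assoc]
  obtain ⟨b, hb⟩ := he.exists_local_desc (pullback.fst a 𝔾.dom ≫ K.proj)
    (fun k y h => K.pt y (𝔾.mul (K.coord (k ≫ pullback.fst a 𝔾.dom) y (by simp [h]))
      (k ≫ pullback.snd a 𝔾.dom) (hF k y h)) (by simp [K.coord_dom]))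
    (by
      intro S S' c k y h h'
      have h₁ : c ≫ K.coord (k ≫ pullback.fst a 𝔾.dom) y (by simp [h]) =
          K.coord ((c ≫ k) ≫ pullback.fst a 𝔾.dom) (c ≫ y) (by simpa using h') :=
        (K.comp_coord _ _ _ _ (by simpa using h')).trans
          (K.coord_congr (Category.assoc _ _ _).symm rfl _)
      rw [K.comp_pt _ _ _ _ (by simp [K.coord_dom])]
      congr 1
      rw [comp_mul]
      exact mul_congr h₁ (Category.assoc _ _ _).symm _)
    (by
      intro S k y y' h h'
      have hy : y ≫ e = y' ≫ e := h.symm.trans h'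
      refine K.pt_eq_of_change _ _ _ _ _ _ hy (by simp [K.coord_dom]) ?_
      rw [← mul_mul_eq _ _ _ (by simp [K.coord_dom]) (by simpa using hF k y' h')]
      exact mul_congr (K.coord_change _ _ _ _ _ hy (by simp [K.coord_dom])) rfl _)
  refine ⟨b, ?_, ?_⟩
  · apply (he.fst (pullback.fst a 𝔾.dom ≫ K.proj)).cancel
    rw [← Category.assoc, hb _ _ pullback.condition, pt_proj, pullback.condition]
  · intro T q g h y h₁ h₂ h₃
    rw [K.coord_congr (hb _ y (by simpa using h₂)) rfl, coord_pt]
    exact mul_congr (K.coord_congr (by simp) rfl _) (by simp) _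

end Coordinates

end InternalFunctor

/-- An internal category is a groupoid if its generalised arrows are invertible. -/
def InternalCategory.IsGroupoid (𝔾 : InternalCategory 𝒞) : Prop :=
  ∀ {T : 𝒞} (g : T ⟶ 𝔾.arr), ∃ g' : T ⟶ 𝔾.arr, 𝔾.Inverse g g'

/-- An arrow of the core is a pair of mutually inverse arrows; swapping the pair inverts it. -/
lemma InternalCategory.core_isGroupoid (𝔸 : InternalCategory 𝒞) : 𝔸.core.IsGroupoid := by
  intro T g
  have h := 𝔸.isoInverse.precomp g
  refine ⟨isoLift _ _ h.symm, ?_⟩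
  have e₁ : isoLift _ _ h.symm ≫ 𝔸.isoHom = g ≫ 𝔸.isoInv := isoLift_hom _ _ _
  have e₂ : 𝔸.core.ident ≫ 𝔸.isoHom = 𝔸.ident := isoLift_hom _ _ 𝔸.inverse_ident
  have hd : g ≫ 𝔸.core.dom = isoLift _ _ h.symm ≫ 𝔸.core.cod := by
    change g ≫ 𝔸.isoHom ≫ 𝔸.dom = isoLift _ _ h.symm ≫ 𝔸.isoHom ≫ 𝔸.cod
    rw [← Category.assoc, ← Category.assoc, e₁, h.dom]
  have hc : g ≫ 𝔸.core.cod = isoLift _ _ h.symm ≫ 𝔸.core.dom := by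
    change g ≫ 𝔸.isoHom ≫ 𝔸.cod = isoLift _ _ h.symm ≫ 𝔸.isoHom ≫ 𝔸.dom
    rw [← Category.assoc, ← Category.assoc, e₁, h.cod]
  refine ⟨hd, hc, ?_, ?_⟩
  · apply iso_ext
    rw [core_mul_isoHom, mul_congr rfl e₁, h.mul_inv, Category.assoc, Category.assoc,
      Category.assoc, e₂]
    exact congrArg (fun k => g ≫ k) (Category.assoc _ _ _).symm
  · apply iso_ext
    rw [core_mul_isoHom, mul_congr e₁ rfl, h.inv_mul, Category.assoc, Category.assoc,
      Category.assoc, e₂]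
    exact congrArg (fun k => g ≫ k) (Category.assoc _ _ _).symm

namespace InternalCategory.Inverse

variable {𝔾 : InternalCategory 𝒞} {T : 𝒞} {u u' : T ⟶ 𝔾.arr}

lemma mul_mul_cancel (h : 𝔾.Inverse u u') (w : T ⟶ 𝔾.arr) (h₁ : u' ≫ 𝔾.cod = w ≫ 𝔾.dom) (h₂) :
    𝔾.mul u (𝔾.mul u' w h₁) h₂ = w := by
  rw [← mul_mul_eq _ _ _ h.cod (by simpa using h₁),
    mul_congr (h.mul_inv.trans (Category.assoc _ _ _).symm) rfl, ident_mul]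

lemma eq_of_mul_eq (h : 𝔾.Inverse u u') {v w : T ⟶ 𝔾.arr} {h₁} (h₂ : u' ≫ 𝔾.cod = w ≫ 𝔾.dom)
    (H : 𝔾.mul u v h₁ = w) : v = 𝔾.mul u' w h₂ := by
  subst H
  exact (h.symm.mul_mul_cancel v h₁ h₂).symm

end InternalCategory.Inverse

namespace PrincipalBundle

open InternalFunctor

variable {𝔾 : InternalCategory 𝒞} {X Y T : 𝒞} {e : Y ⟶ X}

/-- Every cocycle has an associated principal bundle. -/
lemma exists_associated (h𝔾 : 𝔾.IsGroupoid) (he : IsCover e)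
    (ψ : InternalFunctor (kernelPair e) 𝔾) :
    ∃ Q : PrincipalBundle 𝔾 X, Nonempty (Q.Associated ψ) := by
  obtain ⟨K⟩ := ψ.nonempty_coordinates he
  obtain ⟨a, ha⟩ := K.exists_anchor he
  obtain ⟨b, hb, hb'⟩ := K.exists_action he ha
  choose inv hinv using @h𝔾
  -- Inverses are chosen separately for each generalised arrow, but their uniqueness makes the
  -- choice stable under precomposition.
  have comp_inv : ∀ {T T' : 𝒞} (k : T' ⟶ T) (g : T ⟶ 𝔾.arr), k ≫ inv g = inv (k ≫ g) :=
    fun k g => Inverse.ext ((hinv g).precomp k) (hinv _)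
  have bproj : ∀ {T : 𝒞} (q : T ⟶ K.total) (g : T ⟶ 𝔾.arr) (h : q ≫ a = g ≫ 𝔾.dom),
      (pullback.lift q g h ≫ b) ≫ K.proj = q ≫ K.proj := by
    intro T q g h
    rw [Category.assoc, hb, pullback.lift_fst_assoc]
  have comp_b : ∀ {T T' : 𝒞} (k : T' ⟶ T) (q : T ⟶ K.total) (g : T ⟶ 𝔾.arr)
      (h : q ≫ a = g ≫ 𝔾.dom) (h' : (k ≫ q) ≫ a = (k ≫ g) ≫ 𝔾.dom),
      k ≫ pullback.lift q g h ≫ b = pullback.lift (k ≫ q) (k ≫ g) h' ≫ b := by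
    intro T T' k q g h h'
    rw [← Category.assoc]
    congr 1
    apply pullback.hom_ext <;> simp
  have coord_b : ∀ {S T : 𝒞} (k : S ⟶ T) (q : T ⟶ K.total) (g : T ⟶ 𝔾.arr)
      (h : q ≫ a = g ≫ 𝔾.dom) (y : S ⟶ Y) (h₁) (h₂) (h₃),
      K.coord (k ≫ pullback.lift q g h ≫ b) y h₁ = 𝔾.mul (K.coord (k ≫ q) y h₂) (k ≫ g) h₃ := by
    intro S T k q g h y h₁ h₂ h₃
    have h' : (k ≫ q) ≫ a = (k ≫ g) ≫ 𝔾.dom := by simp [h]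
    rw [K.coord_congr (comp_b k q g h h') rfl, hb']
  -- Checked after lifting locally to `Y`, where `a` is the codomain of the coordinate and the
  -- action is right multiplication.
  have banchor : b ≫ a = pullback.snd a 𝔾.dom ≫ 𝔾.cod := by
    apply (he.fst (pullback.fst a 𝔾.dom ≫ K.proj)).cancel
    have c := pullback.condition (f := pullback.fst a 𝔾.dom ≫ K.proj) (g := e)
    have hl : pullback.lift (pullback.fst a 𝔾.dom) (pullback.snd a 𝔾.dom) pullback.condition ≫ b =
        b := by
      rw [← Category.id_comp b, ← Category.assoc]
      congr 1
      apply pullback.hom_ext <;> simp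
    have h₁ : (pullback.fst (pullback.fst a 𝔾.dom ≫ K.proj) e ≫ pullback.lift (pullback.fst a 𝔾.dom)
        (pullback.snd a 𝔾.dom) pullback.condition ≫ b) ≫ K.proj = pullback.snd _ _ ≫ e := by
      rw [hl, Category.assoc, hb, c]
    have h₂ := (Category.assoc _ _ _).trans c
    have := coord_b _ _ _ _ _ h₁ h₂ (by rw [ha]; simp [pullback.condition])
    have := congrArg (fun k => k ≫ 𝔾.cod) this
    simp only [ha, mul_cod, hl] at this
    simpa using this
  -- Points with the same projection are equal as soon as their coordinates at local lifts agree, so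
  -- the unit and associativity laws of the action reduce to those of `𝔾`.
  let Q : PrincipalBundle 𝔾 X :=
    { total := K.total
      proj := K.proj
      anchor := a
      action := b
      action_proj := hb
      action_anchor := banchor
      action_ident := by
        intro T x h
        refine K.eq_of_local he (bproj _ _ _) (fun k y h₁ h₂ => ?_)
        rw [coord_b k _ _ _ _ _ h₂ (by rw [ha]; simp),
          mul_congr (g' := ((k ≫ x) ≫ a) ≫ 𝔾.ident) rfl (by simp), mul_ident]
      action_comp := by
        intro T x g k h₁ h₂ h₃ h₄
        refine K.eq_of_local he (by simp only [bproj]) (fun c y k₁ k₂ => ?_)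
        have k₃ : (c ≫ x) ≫ K.proj = y ≫ e := by
          rw [← k₂, Category.assoc, Category.assoc, bproj]
        have k₄ : (c ≫ pullback.lift x g h₁ ≫ b) ≫ K.proj = y ≫ e := by
          rw [← k₃, Category.assoc, bproj, Category.assoc]
        refine (coord_b c _ _ _ _ _ k₄ (by rw [ha, Category.assoc, h₃, Category.assoc])).trans
          (Eq.trans ?_ (coord_b c _ _ h₄ _ _ k₃ (by
            rw [ha, Category.assoc, h₄, Category.assoc])).symm)
        rw [mul_congr (coord_b c _ _ h₁ _ _ k₃ (by rw [ha, Category.assoc, h₁, Category.assoc]))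
          rfl,
          mul_mul_eq _ _ _ _ (by rw [mul_cod, Category.assoc, h₂, Category.assoc])]
        exact mul_congr rfl (comp_mul _ _ _ _).symm _
      isCover := K.isCover
      isPullback := by
        refine isPullback_of_existsUnique hb ?_ ?_
        · intro T x x' h
          have hk : ∀ {S : 𝒞} (k : S ⟶ T) (y : S ⟶ Y), k ≫ x ≫ K.proj = y ≫ e →
              (k ≫ x) ≫ K.proj = y ≫ e ∧ (k ≫ x') ≫ K.proj = y ≫ e :=
            fun k y hy => ⟨by simpa using hy, by simpa [← h] using hy⟩
          have hd : ∀ {S : 𝒞} (k : S ⟶ T) (y : S ⟶ Y) (hy),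
              inv (K.coord (k ≫ x) y (hk k y hy).1) ≫ 𝔾.cod =
                K.coord (k ≫ x') y (hk k y hy).2 ≫ 𝔾.dom := by
            intro S k y hy
            rw [← (hinv _).dom, K.coord_dom, K.coord_dom]
          -- The arrow from `x` to `x'` is the inverse of the coordinate of `x` times the coordinate
          -- of `x'`. A change of lift multiplies both coordinates on the left by the same value of
          -- `ψ`, which cancels in this quotient.
          obtain ⟨g, hg⟩ := he.exists_local_desc (x ≫ K.proj)
            (fun k y hy => 𝔾.mul (inv (K.coord (k ≫ x) y (hk k y hy).1))
              (K.coord (k ≫ x') y (hk k y hy).2) (hd k y hy))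
            (by
              intro S S' c k y hy hy'
              rw [comp_mul]
              refine mul_congr ?_ ?_ _
              · rw [comp_inv, K.comp_coord _ _ _ _ (by simpa using (hk _ _ hy').1)]
                congr 1
                exact K.coord_congr (Category.assoc _ _ _).symm rfl _
              · rw [K.comp_coord _ _ _ _ (by simpa using (hk _ _ hy').2)]
                exact K.coord_congr (Category.assoc _ _ _).symm rfl _)
            (by
              intro S k y y' hy hy'
              have hyy : y' ≫ e = y ≫ e := hy'.symm.trans hy
              refine (hinv _).eq_of_mul_eq (h₁ := ?_) _ ?_
              · rw [mul_dom, ← (hinv _).cod, ha, ha]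
              · rw [mul_congr (K.coord_change (k ≫ x) y y' (hk k y hy).1 _ hyy
                  (by simp [K.coord_dom])) rfl, mul_mul_eq,
                  mul_congr rfl ((hinv _).mul_mul_cancel _ _ _)]
                exact (K.coord_change (k ≫ x') y y' _ _ hyy _).symm)
          have hgd : x ≫ a = g ≫ 𝔾.dom := by
            apply (he.fst (x ≫ K.proj)).cancel
            rw [← Category.assoc _ g, hg _ _ pullback.condition, mul_dom, ← (hinv _).cod, ha,
              Category.assoc]
          refine ⟨g, hgd, K.eq_of_local he ((bproj _ _ _).trans h) (fun k y h₁ h₂ => ?_)⟩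
          have h₃ : k ≫ x ≫ K.proj = y ≫ e := by rw [h, ← Category.assoc, h₂]
          rw [coord_b k _ _ _ _ _ (hk k y h₃).1 (by simp [ha, ← hgd]),
            mul_congr rfl (hg k y h₃), (hinv _).mul_mul_cancel]
        -- In coordinates at a local lift, both sides of `H` are right multiples of the coordinate
        -- of `x`, which can be cancelled because it is invertible.
        · intro T x g g' h h' H
          apply (he.fst (x ≫ K.proj)).cancel
          have c : (pullback.fst (x ≫ K.proj) e ≫ x) ≫ K.proj = pullback.snd _ _ ≫ e :=
            (Category.assoc _ _ _).trans pullback.condition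
          have c' : ∀ g h, (pullback.fst (x ≫ K.proj) e ≫ pullback.lift x g h ≫ b) ≫ K.proj =
              pullback.snd _ _ ≫ e := by
            intro g h
            rw [← c, Category.assoc, bproj, Category.assoc]
          have h₁ := coord_b _ _ _ _ _ (c' g h) c (by simp [ha, ← h])
          have h₂ := coord_b _ _ _ _ _ (c' g' h') c (by simp [ha, ← h'])
          have h₃ := h₁.symm.trans ((K.coord_congr (congrArg (fun k => _ ≫ k) H) rfl _).trans h₂)
          have h₄ := (hinv _).eq_of_mul_eq (by
            rw [mul_dom, ← (hinv _).dom]) h₃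
          rw [h₄]
          exact (hinv _).symm.mul_mul_cancel _ _ _ }
  -- The section has an identity as its coordinate at `y`. By the change of coordinates, `z ≫ s`
  -- then has coordinate `ψ(y, z)` at `y`, which is the required transition law.
  let s : Y ⟶ K.total := K.pt (𝟙 Y) (ψ.obj ≫ 𝔾.ident) (by simp)
  have hs : ∀ {T : 𝒞} (y : T ⟶ Y) (h), K.coord (y ≫ s) y h = (y ≫ ψ.obj) ≫ 𝔾.ident := by
    intro T y h
    have := K.comp_coord y s (𝟙 Y) (by simp [s]) (by simpa using h)
    rw [K.coord_congr rfl (Category.comp_id y).symm, ← this, K.coord_pt, Category.assoc]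
  refine ⟨Q, ⟨⟨s, ?_, ?_, ?_⟩⟩⟩
  · simp [Q, s]
  · have := (ha s (𝟙 Y) (by simp [s])).symm
    refine this.trans ?_
    simp [s]
  · intro T y z h h'
    have hz : (z ≫ s) ≫ K.proj = y ≫ e := by simp [s, h]
    refine K.coord_injective y ((act_proj _ _ _).trans (by simp [Q, s])) hz ?_
    refine (hb' _ _ _ _ _ (by simp [s]) (by rw [ha]; exact h')).trans ?_
    rw [mul_congr (hs y _) rfl, ident_mul, K.coord_change _ z y (by simp [s]) _ h
      (by simp [hs]), mul_congr rfl (hs z _), mul_ident]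
    rfl

end PrincipalBundle
end LaxGeometric

end

/-! ### Calculus of pullbacks in a pseudofunctor -/

noncomputable section
namespace LaxGeometric

variable {𝒞 : Type u} [Category.{v} 𝒞]

/-- The pullback functor of a pseudofunctor along `f`. -/
abbrev pb (M : LocallyDiscrete 𝒞ᵒᵖ ⥤ᵖ Cat.{v₁, u₁}) {X Y : 𝒞} (f : Y ⟶ X) :
    M.obj ⟨op X⟩ ⥤ M.obj ⟨op Y⟩ :=
  (M.map f.op.toLoc).toFunctor

section Calculus

variable {M : LocallyDiscrete 𝒞ᵒᵖ ⥤ᵖ Cat.{v₁, u₁}} {X Y Z W S T T' T'' : 𝒞}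

/-- Composites are carried as a separate variable `k` with a proof of `t ≫ f = k`, here and in
everything that follows. Pullbacks along equal but differently written morphisms then never need to
be transported along an equality of types. -/
lemma op_comp_eq {f : Y ⟶ X} {t : T ⟶ Y} {k : T ⟶ X} (h : t ≫ f = k) :
    f.op.toLoc ≫ t.op.toLoc = k.op.toLoc := by
  subst h; rfl

/-- The coherence isomorphism between an iterated pullback and the pullback along a composite. -/
def compIso (f : Y ⟶ X) (t : T ⟶ Y) (k : T ⟶ X) (h : t ≫ f = k) (A : M.obj ⟨op X⟩) :
    (pb M t).obj ((pb M f).obj A) ≅ (pb M k).obj A :=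
  ((Cat.Hom.toNatIso (M.mapComp' f.op.toLoc t.op.toLoc k.op.toLoc (op_comp_eq h))).app A).symm

lemma compIso_naturality (f : Y ⟶ X) (t : T ⟶ Y) (k : T ⟶ X) (h : t ≫ f = k)
    {A B : M.obj ⟨op X⟩} (a : A ⟶ B) :
    (pb M t).map ((pb M f).map a) ≫ (compIso f t k h B).hom =
      (compIso f t k h A).hom ≫ (pb M k).map a :=
  M.mapComp'_inv_naturality f.op.toLoc t.op.toLoc k.op.toLoc (op_comp_eq h) a

/-- The associativity coherence of `M`: the two ways of collapsing a threefold pullback agree. -/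
lemma map_compIso_comp (f : Y ⟶ X) (g : Z ⟶ Y) (t : T ⟶ Z) (u : Z ⟶ X) (v : T ⟶ Y) (w : T ⟶ X)
    (hu : g ≫ f = u) (hv : t ≫ g = v) (hw : t ≫ u = w) (hw' : v ≫ f = w) (A : M.obj ⟨op X⟩) :
    (pb M t).map (compIso f g u hu A).hom ≫ (compIso u t w hw A).hom =
      (compIso g t v hv ((pb M f).obj A)).hom ≫ (compIso f v w hw' A).hom :=
  M.mapComp'_inv_whiskerRight_mapComp'₀₂₃_inv_app f.op.toLoc g.op.toLoc t.op.toLoc u.op.toLoc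
    v.op.toLoc w.op.toLoc (op_comp_eq hu) (op_comp_eq hv) (op_comp_eq hw) A

lemma compIso_rfl_inv (f : Y ⟶ X) (t : T ⟶ Y) (A : M.obj ⟨op X⟩) :
    (compIso f t (t ≫ f) rfl A).inv =
      (M.mapComp f.op.toLoc t.op.toLoc).hom.toNatTrans.app A := by
  have e : M.mapComp' f.op.toLoc t.op.toLoc (t ≫ f).op.toLoc (op_comp_eq rfl) =
      M.mapComp f.op.toLoc t.op.toLoc := M.mapComp'_eq_mapComp _ _
  rw [← e]
  rfl

lemma compIso_rfl_hom (f : Y ⟶ X) (t : T ⟶ Y)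
    (A : M.obj ⟨op X⟩) : (compIso f t (t ≫ f) rfl A).hom =
      (M.mapComp f.op.toLoc t.op.toLoc).inv.toNatTrans.app A := by
  have e : M.mapComp' f.op.toLoc t.op.toLoc (t ≫ f).op.toLoc (op_comp_eq rfl) =
      M.mapComp f.op.toLoc t.op.toLoc := M.mapComp'_eq_mapComp _ _
  rw [← e]
  rfl

/-- The counit of the pullback along the identity. -/
def unitIso (A : M.obj ⟨op X⟩) : (pb M (𝟙 X)).obj A ≅ A :=
  (Cat.Hom.toNatIso (M.mapId ⟨op X⟩)).app A

lemma map_unitIso (t : T ⟶ X) (A : M.obj ⟨op X⟩) :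
    (pb M t).map (unitIso A).hom = (compIso (𝟙 X) t t (Category.comp_id t) A).hom :=
  (M.mapComp'_id_comp_inv_app t.op.toLoc A).symm

variable {A : M.obj ⟨op X⟩} {B : M.obj ⟨op Y⟩} {C : M.obj ⟨op Z⟩}

/-- Restriction of a morphism between pullbacks. -/
def rst {x : T ⟶ X} {y : T ⟶ Y} (φ : (pb M x).obj A ⟶ (pb M y).obj B) (k : T' ⟶ T)
    (x' : T' ⟶ X) (y' : T' ⟶ Y) (hx : k ≫ x = x') (hy : k ≫ y = y') :
    (pb M x').obj A ⟶ (pb M y').obj B :=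
  (compIso x k x' hx A).inv ≫ (pb M k).map φ ≫ (compIso y k y' hy B).hom

/-- Identifies `rst` with the operation used in the definition of descent data, which makes the two
formalisms interchangeable and supplies the functoriality of `rst`. -/
lemma rst_eq_pullHom {x : T ⟶ X} {y : T ⟶ Y} (φ : (pb M x).obj A ⟶ (pb M y).obj B) (k : T' ⟶ T)
    (x' : T' ⟶ X) (y' : T' ⟶ Y) (hx : k ≫ x = x') (hy : k ≫ y = y') :
    rst φ k x' y' hx hy =
      Pseudofunctor.LocallyDiscreteOpToCat.pullHom φ k x' y' hx hy := rfl

lemma map_eq_rst {x : T ⟶ X} {y : T ⟶ Y} (φ : (pb M x).obj A ⟶ (pb M y).obj B) (k : T' ⟶ T)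
    (x' : T' ⟶ X) (y' : T' ⟶ Y) (hx : k ≫ x = x') (hy : k ≫ y = y') :
    (pb M k).map φ = (compIso x k x' hx A).hom ≫ rst φ k x' y' hx hy ≫
      (compIso y k y' hy B).inv := by
  simp [rst]

lemma rst_id (x : T ⟶ X) (k : T' ⟶ T) (x' : T' ⟶ X) (hx : k ≫ x = x') :
    rst (𝟙 ((pb M x).obj A)) k x' x' hx hx = 𝟙 _ := by
  simp [rst]

lemma rst_comp {x : T ⟶ X} {y : T ⟶ Y} {z : T ⟶ Z} (φ : (pb M x).obj A ⟶ (pb M y).obj B)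
    (ψ : (pb M y).obj B ⟶ (pb M z).obj C) (k : T' ⟶ T) (x' : T' ⟶ X) (y' : T' ⟶ Y) (z' : T' ⟶ Z)
    (hx : k ≫ x = x') (hy : k ≫ y = y') (hz : k ≫ z = z') :
    rst (φ ≫ ψ) k x' z' hx hz = rst φ k x' y' hx hy ≫ rst ψ k y' z' hy hz := by
  simp [rst]

lemma rst_rst {x : T ⟶ X} {y : T ⟶ Y} (φ : (pb M x).obj A ⟶ (pb M y).obj B) (k : T' ⟶ T)
    (x' : T' ⟶ X) (y' : T' ⟶ Y) (hx : k ≫ x = x') (hy : k ≫ y = y') (l : T'' ⟶ T') (m : T'' ⟶ T)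
    (hm : l ≫ k = m)
    (x'' : T'' ⟶ X) (y'' : T'' ⟶ Y) (hx' : l ≫ x' = x'') (hy' : l ≫ y' = y'') :
    rst (rst φ k x' y' hx hy) l x'' y'' hx' hy' =
      rst φ m x'' y'' (by rw [← hm, Category.assoc, hx, hx'])
        (by rw [← hm, Category.assoc, hy, hy']) := by
  subst hm
  exact Pseudofunctor.LocallyDiscreteOpToCat.pullHom_pullHom φ k x' y' l x'' y'' hx hy hx' hy'

lemma rst_self {x : T ⟶ X} {y : T ⟶ Y} (φ : (pb M x).obj A ⟶ (pb M y).obj B) (h) (h') :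
    rst φ (𝟙 T) x y h h' = φ :=
  Pseudofunctor.LocallyDiscreteOpToCat.pullHom_id φ

lemma rst_map (x : T ⟶ X) {A B : M.obj ⟨op X⟩} (a : A ⟶ B) (k : T' ⟶ T) (x' : T' ⟶ X)
    (hx : k ≫ x = x') : rst ((pb M x).map a) k x' x' hx hx = (pb M x').map a := by
  rw [rst, compIso_naturality, Iso.inv_hom_id_assoc]

/-- By associativity coherence, restricting a coherence isomorphism gives a coherence isomorphism.
The objects are given explicitly because the source must be read as the pullback of `(pb M f).obj A`
along `t`, not as an iterated pullback of `A`. -/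
lemma rst_compIso_hom (f : Y ⟶ X) (t : T ⟶ Y) (u : T ⟶ X) (h : t ≫ f = u) (A : M.obj ⟨op X⟩)
    (k : T' ⟶ T) (t' : T' ⟶ Y) (u' : T' ⟶ X) (ht : k ≫ t = t') (hu : k ≫ u = u') :
    rst (A := (pb M f).obj A) (B := A) (compIso f t u h A).hom k t' u' ht hu =
      (compIso f t' u' (by rw [← ht, ← hu, Category.assoc, h]) A).hom := by
  rw [rst, map_compIso_comp f t k u t' u' h ht hu (by rw [← ht, ← hu, Category.assoc, h]),
    Iso.inv_hom_id_assoc]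

lemma rst_compIso_inv (f : Y ⟶ X) (t : T ⟶ Y) (u : T ⟶ X) (h : t ≫ f = u) (A : M.obj ⟨op X⟩)
    (k : T' ⟶ T) (t' : T' ⟶ Y) (u' : T' ⟶ X) (ht : k ≫ t = t') (hu : k ≫ u = u') :
    rst (A := A) (B := (pb M f).obj A) (compIso f t u h A).inv k u' t' hu ht =
      (compIso f t' u' (by rw [← ht, ← hu, Category.assoc, h]) A).inv := by
  rw [← cancel_epi (compIso f t' u' (by rw [← ht, ← hu, Category.assoc, h]) A).hom,
    ← rst_compIso_hom f t u h A k t' u' ht hu,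
    ← rst_comp (A := (pb M f).obj A) (B := A) (C := (pb M f).obj A), Iso.hom_inv_id, rst_id,
    rst_compIso_hom, Iso.hom_inv_id]

/-- Restriction of an isomorphism between pullbacks. -/
@[simps hom]
def rstIso {x : T ⟶ X} {y : T ⟶ Y} (φ : (pb M x).obj A ≅ (pb M y).obj B) (k : T' ⟶ T)
    (x' : T' ⟶ X) (y' : T' ⟶ Y) (hx : k ≫ x = x') (hy : k ≫ y = y') :
    (pb M x').obj A ≅ (pb M y').obj B where
  hom := rst φ.hom k x' y' hx hy
  inv := rst φ.inv k y' x' hy hx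
  hom_inv_id := by rw [← rst_comp, φ.hom_inv_id, rst_id]
  inv_hom_id := by rw [← rst_comp, φ.inv_hom_id, rst_id]

/-- Lets the calculus of `rst` be applied to condition (ii). -/
lemma Triple.restrict_eq {C : M.obj ⟨op Z⟩} (t : Triple M C X) (h : Y ⟶ X) :
    t.restrict h = ⟨h ≫ t.f, h ≫ t.g, rst t.θ h _ _ rfl rfl⟩ := by
  have e : ∀ f : X ⟶ Z, M.mapComp' f.op.toLoc h.op.toLoc (h ≫ f).op.toLoc (op_comp_eq rfl) =
      M.mapComp f.op.toLoc h.op.toLoc := fun f => M.mapComp'_eq_mapComp _ _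
  simp only [Triple.restrict, rst_eq_pullHom, Pseudofunctor.LocallyDiscreteOpToCat.pullHom]
  rw [e t.f, e t.g]

end Calculus

/-! ### Descent in terms of generalised elements -/

section Descent

variable {M : LocallyDiscrete 𝒞ᵒᵖ ⥤ᵖ Cat.{v₁, u₁}}

/-- Objects and morphisms of `M` descend along `p`, in terms of generalised elements. -/
structure HasDescent (M : LocallyDiscrete 𝒞ᵒᵖ ⥤ᵖ Cat.{v₁, u₁}) {X Y : 𝒞} (p : Y ⟶ X) : Prop where
  faithful {A B : M.obj ⟨op X⟩} {a b : A ⟶ B} (h : (pb M p).map a = (pb M p).map b) : a = b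
  full {A B : M.obj ⟨op X⟩} (b : (pb M p).obj A ⟶ (pb M p).obj B)
    (h : ∀ {T : 𝒞} (x y : T ⟶ Y) (k : T ⟶ X) (hx : x ≫ p = k) (hy : y ≫ p = k),
      rst b x k k hx hx = rst b y k k hy hy) : ∃ a : A ⟶ B, (pb M p).map a = b
  effective {Z : 𝒞} (a : Y ⟶ Z) (C : M.obj ⟨op Z⟩)
    (φ : ∀ {T : 𝒞} (x y : T ⟶ Y), x ≫ p = y ≫ p →
      ((pb M (x ≫ a)).obj C ⟶ (pb M (y ≫ a)).obj C))
    (rst_φ : ∀ {T T' : 𝒞} (k : T' ⟶ T) (x y : T ⟶ Y) (h : x ≫ p = y ≫ p)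
      (h' : (k ≫ x) ≫ p = (k ≫ y) ≫ p),
      rst (φ x y h) k ((k ≫ x) ≫ a) ((k ≫ y) ≫ a) (Category.assoc _ _ _).symm
        (Category.assoc _ _ _).symm = φ (k ≫ x) (k ≫ y) h')
    (φ_self : ∀ {T : 𝒞} (x : T ⟶ Y), φ x x rfl = 𝟙 _)
    (φ_comp : ∀ {T : 𝒞} (x y z : T ⟶ Y) (h : x ≫ p = y ≫ p) (h' : y ≫ p = z ≫ p),
      φ x y h ≫ φ y z h' = φ x z (h.trans h')) :
    ∃ (B : M.obj ⟨op X⟩) (b : (pb M p).obj B ≅ (pb M a).obj C),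
      ∀ {T : 𝒞} (x y : T ⟶ Y) (k : T ⟶ X) (hx : x ≫ p = k) (hy : y ≫ p = k),
        rst b.hom x k (x ≫ a) hx rfl ≫ φ x y (hx.trans hy.symm) = rst b.hom y k (y ≫ a) hy rfl

/-- The left side is the compatibility required of a morphism of descent data; moving the coherence
isomorphisms across it gives the equality of two restrictions. -/
lemma comm_iff {X Y T : 𝒞} (p : Y ⟶ X) {A B : M.obj ⟨op X⟩}
    (b : (pb M p).obj A ⟶ (pb M p).obj B) (x y : T ⟶ Y) (k : T ⟶ X)
    (hx : x ≫ p = k) (hy : y ≫ p = k) :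
    ((pb M x).map b ≫ (compIso p x k hx B).hom ≫ (compIso p y k hy B).inv =
      ((compIso p x k hx A).hom ≫ (compIso p y k hy A).inv) ≫ (pb M y).map b) ↔
    rst b x k k hx hx = rst b y k k hy hy := by
  rw [rst, rst, Iso.inv_comp_eq, ← Category.assoc, Iso.comp_inv_eq]
  simp only [Category.assoc]

/-- In `HasDescent`, effectiveness is only asked for descent data on an object of the form `(pb M
a).obj C`. This is the form in which data given by arrows of an internal category arise, and the
converse `HasDescent.isEquivalence` shows that nothing is lost. -/
lemma HasDescent.of_isEquivalence {X Y : 𝒞} {p : Y ⟶ X}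
    (h : (M.toDescentData (fun _ : PUnit.{1} => p)).IsEquivalence) : HasDescent M p where
  faithful {A B a b} hab := by
    apply (M.toDescentData (fun _ : PUnit.{1} => p)).map_injective
    exact Pseudofunctor.DescentData.hom_ext (fun _ => hab)
  full {A B} b hb := by
    obtain ⟨a, ha⟩ := (M.toDescentData (fun _ : PUnit.{1} => p)).map_surjective
      (X := A) (Y := B) ⟨fun _ => b, fun T k _ _ x y hx hy =>
        (comm_iff p b x y k hx hy).2 (hb x y k hx hy)⟩
    exact ⟨a, congrArg (fun f => f.hom ⟨⟩) ha⟩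
  effective {Z} a C φ rst_φ φ_self φ_comp := by
    -- The transition maps are those of `φ`, conjugated by the coherence isomorphisms so as to go
    -- between pullbacks of `(pb M a).obj C`.
    let D : M.DescentData (fun _ : PUnit.{1} => p) :=
      { obj _ := (pb M a).obj C
        hom T k _ _ x y hx hy := (compIso a x (x ≫ a) rfl C).hom ≫ φ x y (hx.trans hy.symm) ≫
          (compIso a y (y ≫ a) rfl C).inv
        pullHom_hom T' T g q q' hq _ _ x y hx hy x' y' hx' hy' := by
          subst hx' hy'
          rw [← rst_eq_pullHom,
            rst_comp (A := (pb M a).obj C) (B := C) (C := (pb M a).obj C) _ _ g _ _ _ rfl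
              (Category.assoc g x a).symm rfl,
            rst_comp (A := C) (B := C) (C := (pb M a).obj C) _ _ g _ _ _ (Category.assoc g x a).symm
              (Category.assoc g y a).symm rfl, rst_compIso_hom, rst_compIso_inv, rst_φ]
        hom_self T k _ x hx := by rw [φ_self, Category.id_comp, Iso.hom_inv_id]
        hom_comp T k _ _ _ x y z hx hy hz := by
          simp only [Category.assoc, Iso.inv_hom_id_assoc]
          rw [← φ_comp x y z (hx.trans hy.symm) (hy.trans hz.symm), Category.assoc] }
    let B := (M.toDescentData (fun _ : PUnit.{1} => p)).objPreimage D
    let i := (M.toDescentData (fun _ : PUnit.{1} => p)).objObjPreimageIso D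
    refine ⟨B, ⟨i.hom.hom ⟨⟩, i.inv.hom ⟨⟩, congrArg (fun f => f.hom ⟨⟩) i.hom_inv_id,
      congrArg (fun f => f.hom ⟨⟩) i.inv_hom_id⟩, fun x y k hx hy => ?_⟩
    have H := i.hom.comm k (i₁ := ⟨⟩) (i₂ := ⟨⟩) x y hx hy
    have H' : (pb M x).map (i.hom.hom ⟨⟩) ≫ (compIso a x (x ≫ a) rfl C).hom ≫
        φ x y (hx.trans hy.symm) ≫ (compIso a y (y ≫ a) rfl C).inv =
        ((compIso p x k hx B).hom ≫ (compIso p y k hy B).inv) ≫ (pb M y).map (i.hom.hom ⟨⟩) := H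
    simp only [rst, Category.assoc]
    rw [Iso.inv_comp_eq]
    rw [← cancel_mono (compIso a y (y ≫ a) rfl C).inv]
    simp only [Category.assoc, Iso.hom_inv_id, Category.comp_id] at H' ⊢
    exact H'

lemma HasDescent.isEquivalence {X Y : 𝒞} {p : Y ⟶ X} (h : HasDescent M p) :
    (M.toDescentData (fun _ : PUnit.{1} => p)).IsEquivalence where
  faithful := ⟨fun {A B a b} hab => h.faithful (congrArg (fun f => f.hom ⟨⟩) hab)⟩
  full := ⟨fun {A B} f => by
    obtain ⟨a, ha⟩ := h.full (f.hom ⟨⟩) (fun x y k hx hy =>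
      (comm_iff p _ x y k hx hy).1 (f.comm k (i₁ := ⟨⟩) (i₂ := ⟨⟩) x y hx hy))
    exact ⟨a, Pseudofunctor.DescentData.hom_ext (fun _ => ha)⟩⟩
  essSurj := ⟨fun D => by
    -- With `a = 𝟙 Y`, an arbitrary object over `Y` is a pullback of the allowed form, up to
    -- `unitIso`.
    obtain ⟨B, b, hb⟩ := h.effective (𝟙 Y) (D.obj ⟨⟩)
      (fun x y hxy => D.hom (x ≫ p) (i₁ := ⟨⟩) (i₂ := ⟨⟩) (x ≫ 𝟙 Y) (y ≫ 𝟙 Y)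
        (by rw [Category.comp_id]) (by rw [Category.comp_id, hxy]))
      (fun k x y h h' => D.pullHom_hom k _ _ (Category.assoc _ _ _).symm _ _
        (by simp) (by simp [h]) _ _ (by simp) (by simp))
      (fun x => D.hom_self _ _ (by simp)) (fun x y z h h' => by
        have : ∀ k (hk : y ≫ p = k), D.hom k (i₁ := ⟨⟩) (i₂ := ⟨⟩) (x ≫ 𝟙 Y) (y ≫ 𝟙 Y)
            (by rw [Category.comp_id, h, hk]) (by rw [Category.comp_id, hk]) ≫
              D.hom (y ≫ p) (i₁ := ⟨⟩) (i₂ := ⟨⟩) (y ≫ 𝟙 Y) (z ≫ 𝟙 Y)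
              (by rw [Category.comp_id]) (by rw [Category.comp_id, h']) =
            D.hom k (i₁ := ⟨⟩) (i₂ := ⟨⟩) (x ≫ 𝟙 Y) (z ≫ 𝟙 Y)
              (by rw [Category.comp_id, h, hk]) (by rw [Category.comp_id, ← h', hk]) := by
          intro k hk
          subst hk
          exact D.hom_comp _ _ _ _ _ _ _
        exact this _ h.symm)
    refine ⟨B, ⟨Pseudofunctor.DescentData.isoMk (fun _ => b ≪≫ unitIso _) ?_⟩⟩
    rintro T k ⟨⟩ ⟨⟩ x y hx hy
    -- The composites `x ≫ 𝟙 Y` and `y ≫ 𝟙 Y` are replaced by variables, so that the relation can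
    -- afterwards be read at `x` and `y` themselves.
    have key : ∀ x' y' (hx' : x ≫ 𝟙 Y = x') (hy' : y ≫ 𝟙 Y = y'),
        rst b.hom x k x' hx hx' ≫ D.hom k x' y' (by rw [← hx', Category.comp_id, hx])
          (by rw [← hy', Category.comp_id, hy]) = rst b.hom y k y' hy hy' := by
      intro x' y' hx' hy'
      subst hx' hy' hx
      exact hb x y _ _ hy
    have key' := key x y (Category.comp_id x) (Category.comp_id y)
    simp only [rst, ← map_unitIso, ← Functor.map_comp, Category.assoc] at key'
    rw [Iso.inv_comp_eq, ← Category.assoc] at key'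
    exact key'⟩

lemma isStack_iff [HasFiniteLimits 𝒞] :
    IsStack M ↔ ∀ ⦃X Y : 𝒞⦄ (p : Y ⟶ X), IsCover p → HasDescent M p :=
  ⟨fun h _ _ p hp => .of_isEquivalence (h p hp), fun h _ _ p hp => (h p hp).isEquivalence⟩

lemma HasDescent.rst_injective {W Z X Y : 𝒞} {e : W ⟶ Z} (he : HasDescent M e)
    {A : M.obj ⟨op X⟩} {B : M.obj ⟨op Y⟩} {x : Z ⟶ X} {y : Z ⟶ Y} {x' : W ⟶ X} {y' : W ⟶ Y}
    {a b : (pb M x).obj A ⟶ (pb M y).obj B} {hx : e ≫ x = x'} {hy : e ≫ y = y'}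
    (h : rst a e x' y' hx hy = rst b e x' y' hx hy) : a = b := by
  apply he.faithful
  rw [map_eq_rst a e x' y' hx hy, h, ← map_eq_rst]

/-- Morphisms between pullbacks descend. -/
lemma HasDescent.exists_rst_eq {W Z X Y : 𝒞} {e : W ⟶ Z} (he : HasDescent M e)
    {A : M.obj ⟨op X⟩} {B : M.obj ⟨op Y⟩} (x : Z ⟶ X) (y : Z ⟶ Y) (x' : W ⟶ X) (y' : W ⟶ Y)
    (hx : e ≫ x = x') (hy : e ≫ y = y') (b : (pb M x').obj A ⟶ (pb M y').obj B)
    (h : ∀ {T : 𝒞} (k l : T ⟶ W) (u : T ⟶ X) (v : T ⟶ Y) (hu : k ≫ x' = u) (hv : k ≫ y' = v)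
      (hu' : l ≫ x' = u) (hv' : l ≫ y' = v), k ≫ e = l ≫ e →
      rst b k u v hu hv = rst b l u v hu' hv') :
    ∃ a : (pb M x).obj A ⟶ (pb M y).obj B, rst a e x' y' hx hy = b := by
  -- `full` concerns morphisms between pullbacks along `e`, so `b` is first conjugated by the
  -- coherence isomorphisms; these commute with restriction, and the compatibility of `b` is
  -- unaffected.
  obtain ⟨a, ha⟩ := he.full ((compIso x e x' hx A).hom ≫ b ≫ (compIso y e y' hy B).inv)
    (fun {T} k l m hk hl => by
      have hu : ∀ (k : T ⟶ W), k ≫ e = m → k ≫ x' = m ≫ x :=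
        fun k hk => by rw [← hk, Category.assoc, hx]
      have hv : ∀ (k : T ⟶ W), k ≫ e = m → k ≫ y' = m ≫ y :=
        fun k hk => by rw [← hk, Category.assoc, hy]
      have key : ∀ (k : T ⟶ W) (hk : k ≫ e = m),
          rst ((compIso x e x' hx A).hom ≫ b ≫ (compIso y e y' hy B).inv) k m m hk hk =
          (compIso x m (m ≫ x) rfl A).hom ≫ rst b k _ _ (hu k hk) (hv k hk) ≫
            (compIso y m (m ≫ y) rfl B).inv := by
        intro k hk
        rw [rst_comp (A := (pb M x).obj A) (B := A) (C := (pb M y).obj B) _ _ k m _ m hk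
          (hu k hk) hk, rst_comp (A := A) (B := B) (C := (pb M y).obj B) _ _ k _ _ m
          (hu k hk) (hv k hk) hk, rst_compIso_hom, rst_compIso_inv]
      rw [key k hk, key l hl, h k l _ _ _ _ (hu l hl) (hv l hl) (hk.trans hl.symm)])
  refine ⟨a, ?_⟩
  rw [rst, ha]
  simp

/-- The inverse of `b` is compatible with restriction because `b` is, so it descends too. That the
descended morphisms are mutually inverse can be tested after restriction along `e`. -/
lemma HasDescent.isIso_of_rst {W X Y Z : 𝒞} {e : W ⟶ Z} (he : HasDescent M e) {A : M.obj ⟨op X⟩}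
    {B : M.obj ⟨op Y⟩} {x : Z ⟶ X} {y : Z ⟶ Y} (a : (pb M x).obj A ⟶ (pb M y).obj B)
    (x' : W ⟶ X) (y' : W ⟶ Y) (hx : e ≫ x = x') (hy : e ≫ y = y')
    (b : (pb M x').obj A ≅ (pb M y').obj B) (h : rst a e x' y' hx hy = b.hom) : IsIso a := by
  obtain ⟨c, hc⟩ := he.exists_rst_eq y x y' x' hy hx b.inv (by
    intro T k l u v hu hv hu' hv' hkl
    have : rstIso b k v u hv hu = rstIso b l v u hv' hu' := by
      ext
      rw [rstIso_hom, rstIso_hom, ← h, rst_rst _ _ _ _ _ _ _ _ rfl, rst_rst _ _ _ _ _ _ _ _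
        hkl.symm]
    exact congrArg Iso.inv this)
  refine ⟨c, he.rst_injective (x' := x') (y' := x') (hx := hx) (hy := hx) ?_,
    he.rst_injective (x' := y') (y' := y') (hx := hy) (hy := hy) ?_⟩
  · rw [rst_comp a c e x' y' x' hx hy hx, h, hc, rst_id, b.hom_inv_id]
  · rw [rst_comp c a e y' x' y' hy hx hy, h, hc, rst_id, b.inv_hom_id]

end Descent

end LaxGeometric

end

/-! ### Invariance of the conditions under natural equivalence -/

noncomputable section
namespace LaxGeometric

variable {𝒞 : Type u} [Category.{v} 𝒞]

namespace NatEquivalence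

variable {M : LocallyDiscrete 𝒞ᵒᵖ ⥤ᵖ Cat.{v₁, u₁}} {N : LocallyDiscrete 𝒞ᵒᵖ ⥤ᵖ Cat.{v₂, u₂}}
  (e : NatEquivalence M N) {X Y Z T T' : 𝒞}
  {A : M.obj ⟨op X⟩} {B : M.obj ⟨op Y⟩} {C : M.obj ⟨op Z⟩}

/-- The components of the naturality isomorphisms. -/
def natIso (x : T ⟶ X) (A : M.obj ⟨op X⟩) :
    (e.app T).obj ((pb M x).obj A) ≅ (pb N x).obj ((e.app X).obj A) :=
  (e.nat x).app A

lemma natIso_naturality (x : T ⟶ X) {A B : M.obj ⟨op X⟩} (a : A ⟶ B) :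
    (e.app T).map ((pb M x).map a) ≫ (e.natIso x B).hom =
      (e.natIso x A).hom ≫ (pb N x).map ((e.app X).map a) :=
  (e.nat x).hom.naturality a

lemma app_compIso_inv (x : T ⟶ X) (k : T' ⟶ T) (x' : T' ⟶ X) (h : k ≫ x = x') (A : M.obj ⟨op X⟩) :
    (e.natIso x' A).hom ≫ (compIso x k x' h ((e.app X).obj A)).inv =
      (e.app T').map (compIso x k x' h A).inv ≫ (e.natIso k ((pb M x).obj A)).hom ≫
        (pb N k).map (e.natIso x A).hom := by
  subst h
  rw [compIso_rfl_inv, compIso_rfl_inv]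
  exact e.nat_naturality_comp x k A

lemma app_compIso_hom (x : T ⟶ X) (k : T' ⟶ T) (x' : T' ⟶ X) (h : k ≫ x = x') (A : M.obj ⟨op X⟩) :
    (e.app T').map (compIso x k x' h A).hom ≫ (e.natIso x' A).hom =
      (e.natIso k ((pb M x).obj A)).hom ≫ (pb N k).map (e.natIso x A).hom ≫
        (compIso x k x' h ((e.app X).obj A)).hom := by
  rw [← Functor.mapIso_hom, ← Iso.eq_inv_comp, ← Category.assoc, ← Category.assoc,
    ← Iso.comp_inv_eq, app_compIso_inv, Category.assoc]
  rfl

/-- The action of a natural equivalence on morphisms between pullbacks. -/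
def tr {x : T ⟶ X} {y : T ⟶ Y} (φ : (pb M x).obj A ⟶ (pb M y).obj B) :
    (pb N x).obj ((e.app X).obj A) ⟶ (pb N y).obj ((e.app Y).obj B) :=
  (e.natIso x A).inv ≫ (e.app T).map φ ≫ (e.natIso y B).hom

lemma tr_id (x : T ⟶ X) : e.tr (𝟙 ((pb M x).obj A)) = 𝟙 _ := by
  simp [tr]

lemma tr_comp {x : T ⟶ X} {y : T ⟶ Y} {z : T ⟶ Z} (φ : (pb M x).obj A ⟶ (pb M y).obj B)
    (ψ : (pb M y).obj B ⟶ (pb M z).obj C) : e.tr (φ ≫ ψ) = e.tr φ ≫ e.tr ψ := by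
  simp [tr]

lemma tr_map (x : T ⟶ X) {A B : M.obj ⟨op X⟩} (a : A ⟶ B) :
    e.tr ((pb M x).map a) = (pb N x).map ((e.app X).map a) := by
  rw [tr, natIso_naturality, Iso.inv_hom_id_assoc]

/-- A consequence of the compatibility of the naturality isomorphisms with composition. Together
with the bijectivity of `tr`, it carries statements about morphisms between pullbacks from `M` to
`N` and back. -/
lemma tr_rst {x : T ⟶ X} {y : T ⟶ Y} (φ : (pb M x).obj A ⟶ (pb M y).obj B) (k : T' ⟶ T)
    (x' : T' ⟶ X) (y' : T' ⟶ Y) (hx : k ≫ x = x') (hy : k ≫ y = y') :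
    e.tr (rst φ k x' y' hx hy) = rst (e.tr φ) k x' y' hx hy := by
  have h : (pb N k).map (e.natIso x A).hom ≫ (pb N k).map (e.tr φ) =
      (pb N k).map ((e.app T).map φ) ≫ (pb N k).map (e.natIso y B).hom := by
    rw [← Functor.map_comp, ← Functor.map_comp, tr, Iso.hom_inv_id_assoc]
  rw [tr, Iso.inv_comp_eq, rst, rst, ← Category.assoc (e.natIso x' A).hom, app_compIso_inv]
  simp only [Functor.map_comp, Category.assoc, app_compIso_hom]
  rw [reassoc_of% h, reassoc_of% e.natIso_naturality k φ]

lemma tr_injective {x : T ⟶ X} {y : T ⟶ Y} {φ ψ : (pb M x).obj A ⟶ (pb M y).obj B}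
    (h : e.tr φ = e.tr ψ) : φ = ψ := by
  have := e.isEquivalence T
  apply (e.app T).map_injective
  rwa [tr, tr, cancel_epi, cancel_mono] at h

lemma tr_surjective {x : T ⟶ X} {y : T ⟶ Y}
    (ψ : (pb N x).obj ((e.app X).obj A) ⟶ (pb N y).obj ((e.app Y).obj B)) :
    ∃ φ : (pb M x).obj A ⟶ (pb M y).obj B, e.tr φ = ψ := by
  have := e.isEquivalence T
  obtain ⟨φ, hφ⟩ := (e.app T).map_surjective ((e.natIso x A).hom ≫ ψ ≫ (e.natIso y B).inv)
  refine ⟨φ, ?_⟩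
  rw [tr, hφ]
  simp

/-- The inverse of `tr` on isomorphisms. -/
lemma exists_iso_tr {x : T ⟶ X} {y : T ⟶ Y}
    (ψ : (pb N x).obj ((e.app X).obj A) ≅ (pb N y).obj ((e.app Y).obj B)) :
    ∃ φ : (pb M x).obj A ≅ (pb M y).obj B, e.tr φ.hom = ψ.hom := by
  obtain ⟨φ, hφ⟩ := e.tr_surjective ψ.hom
  obtain ⟨φ', hφ'⟩ := e.tr_surjective ψ.inv
  exact ⟨⟨φ, φ', e.tr_injective (by rw [tr_comp, hφ, hφ', ψ.hom_inv_id, tr_id]),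
    e.tr_injective (by rw [tr_comp, hφ, hφ', ψ.inv_hom_id, tr_id])⟩, hφ⟩

/-- Each clause is sent to `N` by `tr`, solved there, and brought back by the bijectivity of `tr`.
An object of `N` descended from the data is replaced by a preimage up to isomorphism under `e.app
X`. -/
lemma hasDescent (e : NatEquivalence M N) {p : Y ⟶ X} (h : HasDescent N p) : HasDescent M p where
  faithful {A B a b} hab := by
    have := e.isEquivalence X
    apply (e.app X).map_injective
    apply h.faithful
    rw [← tr_map, ← tr_map, hab]
  full {A B} b hb := by
    have := e.isEquivalence X
    obtain ⟨a, ha⟩ := h.full (e.tr b) (fun x y k hx hy => by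
      rw [← tr_rst, ← tr_rst, hb x y k hx hy])
    obtain ⟨a, rfl⟩ := (e.app X).map_surjective a
    exact ⟨a, e.tr_injective (by rw [tr_map, ha])⟩
  effective {Z} a C φ rst_φ φ_self φ_comp := by
    have := e.isEquivalence X
    obtain ⟨B, b, hb⟩ := h.effective a ((e.app Z).obj C) (fun x y hxy => e.tr (φ x y hxy))
      (fun k x y h h' => by rw [← tr_rst, rst_φ k x y h h'])
      (fun x => by rw [φ_self, tr_id]) (fun x y z h h' => by rw [← tr_comp, φ_comp])
    let i := (e.app X).objObjPreimageIso B
    obtain ⟨c, hc⟩ := e.exists_iso_tr ((pb N p).mapIso i ≪≫ b)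
    refine ⟨_, c, fun x y k hx hy => e.tr_injective ?_⟩
    have key : ∀ (x : _ ⟶ Y) (hx : x ≫ p = k), e.tr (rst c.hom x k (x ≫ a) hx rfl) =
        (pb N k).map i.hom ≫ rst b.hom x k (x ≫ a) hx rfl := by
      intro x hx
      rw [tr_rst, hc]
      refine (rst_comp ((pb N p).map i.hom) b.hom x k k (x ≫ a) hx hx rfl).trans ?_
      rw [rst_map]
    rw [tr_comp, key x hx, key y hy, Category.assoc, hb x y k hx hy]

section

variable [HasFiniteLimits 𝒞]

lemma isStack (e : NatEquivalence M N) (h : IsStack N) : IsStack M :=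
  isStack_iff.2 (fun _ _ p hp => e.hasDescent (isStack_iff.1 h p hp))

end

variable {C₀ : 𝒞} {C : M.obj ⟨op C₀⟩} {U : N.obj ⟨op C₀⟩}

lemma locallyPullbackOf [HasFiniteLimits 𝒞] (i : (e.app C₀).obj C ≅ U)
    (h : LocallyPullbackOf N U) : LocallyPullbackOf M C := by
  intro X A
  obtain ⟨Y, p, q, hp, ⟨j⟩⟩ := h X ((e.app X).obj A)
  obtain ⟨φ, -⟩ := e.exists_iso_tr (j ≪≫ (pb N q).mapIso i.symm)
  exact ⟨Y, p, q, hp, ⟨φ⟩⟩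

/-- Transport of triples. -/
def triple (i : (e.app C₀).obj C ≅ U) (t : Triple M C X) : Triple N U X :=
  ⟨t.f, t.g, (pb N t.f).map i.inv ≫ e.tr t.θ ≫ (pb N t.g).map i.hom⟩

/-- `tr` is bijective, and conjugation by the pullbacks of `i` is invertible. -/
lemma triple_bijective (i : (e.app C₀).obj C ≅ U) :
    Function.Bijective (e.triple (X := X) i) := by
  constructor
  · rintro ⟨f, g, θ⟩ ⟨f', g', θ'⟩ h
    have hf : f = f' := congrArg Triple.f h
    have hg : g = g' := congrArg Triple.g h
    subst hf hg
    have h' := h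
    simp only [triple, Triple.mk.injEq, heq_eq_eq, true_and] at h'
    rw [cancel_epi, cancel_mono] at h'
    rw [e.tr_injective h']
  · rintro ⟨f, g, θ⟩
    obtain ⟨φ, hφ⟩ := e.tr_surjective ((pb N f).map i.hom ≫ θ ≫ (pb N g).map i.inv)
    refine ⟨⟨f, g, φ⟩, ?_⟩
    simp only [triple, hφ]
    simp

lemma triple_restrict (i : (e.app C₀).obj C ≅ U) (t : Triple M C X) (h : Y ⟶ X) :
    e.triple i (t.restrict h) = (e.triple i t).restrict h := by
  rw [Triple.restrict_eq, Triple.restrict_eq]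
  simp only [triple]
  rw [rst_comp _ _ h _ (h ≫ t.f) _ rfl rfl rfl, rst_comp _ _ h _ (h ≫ t.g) _ rfl rfl rfl,
    rst_map, rst_map, tr_rst]

lemma representsTriples (i : (e.app C₀).obj C ≅ U) {C₁ : 𝒞} (h : RepresentsTriples N U C₁) :
    RepresentsTriples M C C₁ := by
  obtain ⟨r, hr⟩ := h
  let j (X : 𝒞) := Equiv.ofBijective _ (e.triple_bijective (X := X) i)
  refine ⟨fun X => (r X).trans (j X).symm, fun X Y h k => ?_⟩
  apply (j Y).injective
  have hj : ∀ t, j Y (t.restrict h) = (j X t).restrict h := fun t => e.triple_restrict i t h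
  simp only [Equiv.trans_apply, hj, Equiv.apply_symm_apply, hr]

end NatEquivalence

end LaxGeometric

end

/-! ### Principal bundles form a stack -/

noncomputable section
namespace LaxGeometric

variable {𝒞 : Type u} [Category.{v} 𝒞] [HasFiniteLimits 𝒞]

attribute [local simp] pullback.lift_fst pullback.lift_snd pullback.lift_fst_assoc
  pullback.lift_snd_assoc InternalCategory.ident_dom InternalCategory.ident_cod

open InternalCategory PrincipalBundle

variable {𝔸 : InternalCategory 𝒞} {X Y Z S S' T T' : 𝒞}

/-- A cocycle with values in the core, given by arrows of `𝔸`, defines a principal bundle. -/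
lemma PrincipalBundle.exists_of_cocycle {e : Y ⟶ X} (he : IsCover e) (a : Y ⟶ 𝔸.obj)
    (c : ∀ {T : 𝒞} (x y : T ⟶ Y), x ≫ e = y ≫ e → (T ⟶ 𝔸.arr))
    (dom : ∀ {T : 𝒞} (x y : T ⟶ Y) (h), c x y h ≫ 𝔸.dom = x ≫ a)
    (cod : ∀ {T : 𝒞} (x y : T ⟶ Y) (h), c x y h ≫ 𝔸.cod = y ≫ a)
    (nat : ∀ {T T' : 𝒞} (k : T' ⟶ T) (x y : T ⟶ Y) (h) (h'),
      k ≫ c x y h = c (k ≫ x) (k ≫ y) h')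
    (self : ∀ {T : 𝒞} (x : T ⟶ Y) (h), c x x h = (x ≫ a) ≫ 𝔸.ident)
    (mul : ∀ {T : 𝒞} (x y z : T ⟶ Y) (h₁) (h₂) (h₃) (h₄),
      𝔸.mul (c x y h₁) (c y z h₂) h₃ = c x z h₄) :
    ∃ (Q : PrincipalBundle 𝔸.core X) (s : Y ⟶ Q.total), s ≫ Q.proj = e ∧ s ≫ Q.anchor = a ∧
      ∀ {T : 𝒞} (x y : T ⟶ Y) (h) (h'), Q.tr (x ≫ s) (y ≫ s) h' = c x y h := by
  -- The cocycle laws make `c y x` inverse to `c x y`, so the values of `c` are isomorphisms and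
  -- define arrows of the core.
  have inv : ∀ {T : 𝒞} (x y : T ⟶ Y) (h), 𝔸.Inverse (c x y h) (c y x h.symm) := fun x y h =>
    { dom := by rw [dom, cod]
      cod := by rw [cod, dom]
      mul_inv := by rw [mul _ _ _ _ _ _ rfl, self, ← Category.assoc, dom]
      inv_mul := by rw [mul _ _ _ _ _ _ rfl, self, ← Category.assoc, cod] }
  have congr : ∀ {T : 𝒞} {x x' y y' : T ⟶ Y} (hx : x = x') (hy : y = y') (h),
      c x y h = c x' y' (by rw [← hx, ← hy, h]) := by
    intro T x x' y y' hx hy h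
    subst hx hy
    rfl
  have hom_assoc : ∀ {T Z : 𝒞} {f g : T ⟶ 𝔸.arr} {h : 𝔸.Inverse f g} (k : 𝔸.arr ⟶ Z),
      isoLift f g h ≫ 𝔸.isoHom ≫ k = f ≫ k := fun k => by rw [← Category.assoc, isoLift_hom]
  -- On arrows `F` is the value of `c` at the universal pair of points with the same image; `nat`
  -- recovers all other values from it.
  let F : InternalFunctor (kernelPair e) 𝔸.core :=
    { obj := a
      arr := isoLift _ _ (inv (pullback.fst e e) (pullback.snd e e) pullback.condition)
      dom := (hom_assoc _).trans (dom _ _ _)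
      cod := (hom_assoc _).trans (cod _ _ _)
      ident := by
        apply iso_ext
        rw [Category.assoc, isoLift_hom, nat _ _ _ _ (by simp)]
        refine (congr (x' := 𝟙 Y) (y' := 𝟙 Y) (by simp) (by simp) _).trans ?_
        rw [self, Category.id_comp, Category.assoc]
        exact congrArg (fun k => a ≫ k) (isoLift_hom _ _ 𝔸.inverse_ident).symm
      comp := by
        intro T f g h h'
        apply iso_ext
        have hf : ∀ f : T ⟶ pullback e e, (f ≫ pullback.fst e e) ≫ e = (f ≫ pullback.snd e e) ≫ e :=
          fun f => by rw [Category.assoc, pullback.condition, Category.assoc]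
        have hF : ∀ f : T ⟶ pullback e e, (f ≫ isoLift _ _
            (inv (pullback.fst e e) (pullback.snd e e) pullback.condition)) ≫ 𝔸.isoHom =
            c (f ≫ pullback.fst e e) (f ≫ pullback.snd e e) (hf f) := by
          intro f
          rw [Category.assoc, isoLift_hom, nat _ _ _ _ (hf f)]
        have h₀ : f ≫ pullback.snd e e = g ≫ pullback.fst e e := h
        have h₁ : (f ≫ pullback.snd e e) ≫ e = (g ≫ pullback.snd e e) ≫ e := by
          rw [h₀, hf]
        rw [core_mul_isoHom, mul_congr (hF f) ((hF g).trans (congr h₀.symm rfl _)),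
          mul _ _ _ _ _ _ ((hf f).trans h₁)]
        refine (hF _).trans (congr ?_ ?_ _)
        · exact mul_dom (𝔸 := kernelPair e) f g h
        · exact mul_cod (𝔸 := kernelPair e) f g h }
  obtain ⟨Q, ⟨σ⟩⟩ := exists_associated 𝔸.core_isGroupoid he F
  refine ⟨Q, σ.sec, σ.proj, σ.anchor, fun x y h h' => ?_⟩
  rw [tr, σ.div x y h h', Category.assoc]
  refine (congrArg (fun k => pullback.lift x y h ≫ k) (isoLift_hom _ _
    (inv (pullback.fst e e) (pullback.snd e e) pullback.condition))).trans ?_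
  rw [nat _ _ _ _ (by simpa using h)]
  exact congr (by simp) (by simp) _

/-- Points of two bundles exist locally. -/
lemma PrincipalBundle.exists_cover_points {𝔾 : InternalCategory 𝒞} (P : PrincipalBundle 𝔾 X)
    (Q : PrincipalBundle 𝔾 Y) (x : T ⟶ X) (y : T ⟶ Y) :
    ∃ (S : 𝒞) (e : S ⟶ T) (a : S ⟶ P.total) (b : S ⟶ Q.total), IsCover e ∧
      e ≫ x = a ≫ P.proj ∧ e ≫ y = b ≫ Q.proj :=
  ⟨_, pullback.fst (pullback.fst x P.proj ≫ y) Q.proj ≫ pullback.fst x P.proj,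
    pullback.fst _ _ ≫ pullback.snd x P.proj, pullback.snd _ _,
    (Q.isCover.fst _).comp (P.isCover.fst _), by simp [pullback.condition],
    (Category.assoc _ _ _).trans pullback.condition⟩

/-- The bundle of an object of `Prin 𝔸`. -/
def bun (A : (Prin 𝔸).obj ⟨op X⟩) : PrincipalBundle 𝔸.core X := PrinObj.bundle A

/-- The object of `Prin 𝔸` given by a bundle. -/
def ofBun (P : PrincipalBundle 𝔸.core X) : (Prin 𝔸).obj ⟨op X⟩ := (⟨P⟩ : PrinObj 𝔸 X)

/-- The equivariant family of a morphism of `Prin 𝔸`. -/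
def th {A B : (Prin 𝔸).obj ⟨op X⟩} (f : A ⟶ B) : Theta (bun A) (bun B) := Arrow.theta f

variable {A : (Prin 𝔸).obj ⟨op X⟩} {B : (Prin 𝔸).obj ⟨op Y⟩} {C : (Prin 𝔸).obj ⟨op Z⟩}

section

variable {x : T ⟶ X} {y : T ⟶ Y} {z : T ⟶ Z}

/-- The equivariant family of a morphism between pullbacks. -/
def thp (φ : (pb (Prin 𝔸) x).obj A ⟶ (pb (Prin 𝔸) y).obj B) :
    Theta ((bun A).pull x) ((bun B).pull y) :=
  Arrow.theta φ

lemma thp_ext {φ ψ : (pb (Prin 𝔸) x).obj A ⟶ (pb (Prin 𝔸) y).obj B} (h : thp φ = thp ψ) :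
    φ = ψ := Arrow.ext h

lemma exists_thp_eq (θ : Theta ((bun A).pull x) ((bun B).pull y)) :
    ∃ φ : (pb (Prin 𝔸) x).obj A ⟶ (pb (Prin 𝔸) y).obj B, thp φ = θ :=
  ⟨Arrow.ofTheta θ, Arrow.theta_ofTheta θ⟩

lemma thp_id (x : T ⟶ X) (A : (Prin 𝔸).obj ⟨op X⟩) :
    thp (𝟙 ((pb (Prin 𝔸) x).obj A)) = Theta.ofHom (Hom.id ((bun A).pull x)) :=
  Arrow.ofHom_theta _

lemma thp_comp (φ : (pb (Prin 𝔸) x).obj A ⟶ (pb (Prin 𝔸) y).obj B)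
    (ψ : (pb (Prin 𝔸) y).obj B ⟶ (pb (Prin 𝔸) z).obj C) : thp (φ ≫ ψ) = (thp φ).mul (thp ψ) :=
  Arrow.comp_theta _ _

lemma thp_map {A' : (Prin 𝔸).obj ⟨op X⟩} (f : A ⟶ A') (x : Y ⟶ X) :
    thp ((pb (Prin 𝔸) x).map f) = (th f).pull x := Arrow.pull_theta _ _

/-- The composition isomorphisms of `Prin` come from the bundle maps `pullComp`, so a restriction is
a product of three equivariant families, the outer two given by bundle maps. -/
lemma thp_rst_rfl (φ : (pb (Prin 𝔸) x).obj A ⟶ (pb (Prin 𝔸) y).obj B) (l : T' ⟶ T) :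
    thp (rst φ l (l ≫ x) (l ≫ y) rfl rfl) = (Theta.ofHom ((bun A).pullComp l x)).mul
      (((thp φ).pull l).mul (Theta.ofHom ((bun B).pullComp' l y))) := by
  rw [rst, compIso_rfl_inv, compIso_rfl_hom]
  refine (Arrow.comp_theta _ _).trans (congrArg₂ Theta.mul (Arrow.ofHom_theta _) ?_)
  exact (Arrow.comp_theta _ _).trans (congrArg₂ Theta.mul (Arrow.pull_theta _ _)
    (Arrow.ofHom_theta _))

/-- The value of a morphism between pullbacks at generalised elements. -/
def ev (φ : (pb (Prin 𝔸) x).obj A ⟶ (pb (Prin 𝔸) y).obj B) (k : S ⟶ T) (a : S ⟶ (bun A).total)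
    (b : S ⟶ (bun B).total) (ha : k ≫ x = a ≫ (bun A).proj) (hb : k ≫ y = b ≫ (bun B).proj) :
    S ⟶ 𝔸.arr :=
  (thp φ).app (pullLift x k a ha) (pullLift y k b hb) (by rw [pullLift_proj, pullLift_proj])

variable (φ : (pb (Prin 𝔸) x).obj A ⟶ (pb (Prin 𝔸) y).obj B)

lemma ev_dom (k : S ⟶ T) (a : S ⟶ (bun A).total) (b : S ⟶ (bun B).total) (ha) (hb) :
    ev φ k a b ha hb ≫ 𝔸.dom = a ≫ (bun A).anchor := by
  rw [ev, Theta.app_dom, ← pullSnd_anchor, pullLift_snd']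

lemma ev_cod (k : S ⟶ T) (a : S ⟶ (bun A).total) (b : S ⟶ (bun B).total) (ha) (hb) :
    ev φ k a b ha hb ≫ 𝔸.cod = b ≫ (bun B).anchor := by
  rw [ev, Theta.app_cod, ← pullSnd_anchor, pullLift_snd']

lemma comp_ev (l : S' ⟶ S) (k : S ⟶ T) (a : S ⟶ (bun A).total) (b : S ⟶ (bun B).total)
    (ha) (hb) (ha') (hb') :
    l ≫ ev φ k a b ha hb = ev φ (l ≫ k) (l ≫ a) (l ≫ b) ha' hb' := by
  rw [ev, ev, Theta.comp_app]
  exact Theta.app_congr _ (pull_ext (by simp) (by simp)) (pull_ext (by simp) (by simp)) _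

lemma ev_congr {k k' : S ⟶ T} {a a' : S ⟶ (bun A).total} {b b' : S ⟶ (bun B).total}
    (hk : k = k') (hₐ : a = a') (h_b : b = b') (ha) (hb) :
    ev φ k a b ha hb = ev φ k' a' b' (by rw [← hk, ← hₐ, ha]) (by rw [← hk, ← h_b, hb]) := by
  subst hk hₐ h_b
  rfl

lemma ev_id (k : S ⟶ T) (a a' : S ⟶ (bun A).total) (ha) (ha') (h) :
    ev (𝟙 ((pb (Prin 𝔸) x).obj A)) k a a' ha ha' = (bun A).tr a a' h := by
  rw [ev, thp_id, Theta.ofHom_app (Hom.id ((bun A).pull x)) _ _ _ (by simp [Hom.id]),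
    tr_pull _ _ _ _ (by simpa [Hom.id] using h)]
  exact tr_congr (by simp [Hom.id]) (by simp) _

/-- The value of a composite can be computed through any middle point; no descent is needed as long
as such a point is at hand. -/
lemma ev_comp (ψ : (pb (Prin 𝔸) y).obj B ⟶ (pb (Prin 𝔸) z).obj C) (k : S ⟶ T)
    (a : S ⟶ (bun A).total) (b : S ⟶ (bun B).total) (c : S ⟶ (bun C).total) (ha) (hb) (hc) (h) :
    ev (φ ≫ ψ) k a c ha hc = 𝔸.mul (ev φ k a b ha hb) (ev ψ k b c hb hc) h := by
  rw [ev, thp_comp, Theta.mul_app _ _ _ (pullLift y k b hb) _ (by simp) (by simp)]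
  rfl

/-- Equivariance is the case of `ev_comp` with an identity on the left, since the values of an
identity are the transition arrows. -/
lemma tr_mul_ev (k : S ⟶ T) (a a' : S ⟶ (bun A).total) (b : S ⟶ (bun B).total) (ha) (ha') (hb)
    (h) (h') : 𝔸.mul ((bun A).tr a a' h) (ev φ k a' b ha' hb) h' = ev φ k a b ha hb := by
  have := ev_comp (𝟙 _) φ k a a' b ha ha' hb (by rw [ev_cod, ev_dom])
  rw [Category.id_comp] at this
  rw [this]
  exact mul_congr (ev_id _ _ _ _ _ _).symm rfl _

lemma ev_mul_tr (k : S ⟶ T) (a : S ⟶ (bun A).total) (b b' : S ⟶ (bun B).total) (ha) (hb) (hb')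
    (h) (h') : 𝔸.mul (ev φ k a b ha hb) ((bun B).tr b b' h) h' = ev φ k a b' ha hb' := by
  have := ev_comp φ (𝟙 _) k a b b' ha hb hb' (by rw [ev_cod, ev_dom])
  rw [Category.comp_id] at this
  rw [this]
  exact mul_congr rfl (ev_id _ _ _ _ _ _).symm _

lemma ev_map {A' : (Prin 𝔸).obj ⟨op X⟩} (f : A ⟶ A') (k : S ⟶ T) (a : S ⟶ (bun A).total)
    (a' : S ⟶ (bun A').total) (ha) (ha') (h) :
    ev ((pb (Prin 𝔸) x).map f) k a a' ha ha' = (th f).app a a' h := by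
  rw [ev, thp_map, Theta.pull_app _ _ _ _ _ (by simpa using h)]
  exact Theta.app_congr _ (by simp) (by simp) _

/-- A point of the pullback along `l ≫ x` lying over `k` corresponds, under `pullComp`, to the point
of the pullback along `x` lying over `k ≫ l` with the same component in the bundle. In terms of
`ev`, restriction is thus just a change of base point. -/
lemma ev_rst (l : T' ⟶ T) (x' : T' ⟶ X) (y' : T' ⟶ Y) (hx : l ≫ x = x') (hy : l ≫ y = y')
    (k : S ⟶ T') (a : S ⟶ (bun A).total) (b : S ⟶ (bun B).total) (ha) (hb) (ha') (hb') :
    ev (rst φ l x' y' hx hy) k a b ha hb = ev φ (k ≫ l) a b ha' hb' := by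
  subst hx hy
  have e : ∀ {U : 𝒞} {D : PrincipalBundle 𝔸.core U} {u : T ⟶ U} (d : S ⟶ D.total)
      (h : k ≫ l ≫ u = d ≫ D.proj) (h' : (k ≫ l) ≫ u = d ≫ D.proj),
      (pullLift (l ≫ u) k d h ≫ (D.pullComp l u).hom) ≫ (D.pull u).pullSnd l =
        pullLift u (k ≫ l) d h' := by
    intro U D u d h h'
    apply pull_ext <;> simp [pullComp, Hom.toPull]
  have e' : ∀ {U : 𝒞} {D : PrincipalBundle 𝔸.core U} {u : T ⟶ U} (d : S ⟶ D.total)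
      (h : k ≫ l ≫ u = d ≫ D.proj), (pullLift (l ≫ u) k d h ≫ (D.pullComp l u).hom) ≫
        (D.pullComp' l u).hom = pullLift (l ≫ u) k d h := by
    intro U D u d h
    rw [Category.assoc, pullComp_pullComp', Category.comp_id]
  have p₁ : (pullLift (l ≫ x) k a ha ≫ ((bun A).pullComp l x).hom) ≫ _ = k :=
    (Category.assoc _ _ _).trans ((congrArg (fun t => _ ≫ t) (Hom.proj _)).trans
      (pullLift_proj _ _ _))
  have p₂ : (pullLift (l ≫ y) k b hb ≫ ((bun B).pullComp l y).hom) ≫ _ = k :=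
    (Category.assoc _ _ _).trans ((congrArg (fun t => _ ≫ t) (Hom.proj _)).trans
      (pullLift_proj _ _ _))
  rw [ev, ev, thp_rst_rfl, Theta.ofHom_mul _ _ _ _ _ (p₁.trans (pullLift_proj _ _ _).symm),
    Theta.app_congr _ rfl (e' b hb).symm, Theta.mul_ofHom _ _ _ _ _ (p₁.trans p₂.symm),
    Theta.pull_app _ _ _ _ _ (by rw [e a _ ha', e b _ hb', pullLift_proj, pullLift_proj])]
  exact Theta.app_congr _ (e a _ ha') (e b _ hb') _

/-- Equivariance determines all values from the value at one pair of points defined over a cover. -/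
lemma ev_ext {φ ψ : (pb (Prin 𝔸) x).obj A ⟶ (pb (Prin 𝔸) y).obj B} {e : S ⟶ T} (he : IsCover e)
    (a : S ⟶ (bun A).total) (b : S ⟶ (bun B).total) (ha) (hb)
    (h : ev φ e a b ha hb = ev ψ e a b ha hb) : φ = ψ :=
  thp_ext (Theta.ext_app he _ _ (pullLift_proj _ _ _) (pullLift_proj _ _ _) h)

/-- This is `Theta.exists_app` for the pulled-back bundles, with their transition arrows rewritten
as those of `A` and `B`. -/
lemma exists_ev_eq {e : S ⟶ T} (he : IsCover e) (a : S ⟶ (bun A).total) (b : S ⟶ (bun B).total)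
    (ha : e ≫ x = a ≫ (bun A).proj) (hb : e ≫ y = b ≫ (bun B).proj)
    (t : S ⟶ 𝔸.arr) (h₀ : t ≫ 𝔸.dom = a ≫ (bun A).anchor) (h₁ : t ≫ 𝔸.cod = b ≫ (bun B).anchor)
    (H : ∀ {S' : 𝒞} (w w' : S' ⟶ S) (_ : w ≫ e = w' ≫ e) (hx') (hy') (h₂) (h₃),
      𝔸.mul ((bun A).tr (w ≫ a) (w' ≫ a) hx') (w' ≫ t) h₂ =
        𝔸.mul (w ≫ t) ((bun B).tr (w ≫ b) (w' ≫ b) hy') h₃) :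
    ∃ φ : (pb (Prin 𝔸) x).obj A ⟶ (pb (Prin 𝔸) y).obj B, ev φ e a b ha hb = t := by
  obtain ⟨θ, hθ⟩ := Theta.exists_app (P := (bun A).pull x) (Q := (bun B).pull y) he
    (pullLift x e a ha) (pullLift y e b hb) (pullLift_proj _ _ _) (pullLift_proj _ _ _) t
    (by rw [h₀, ← pullSnd_anchor, pullLift_snd']) (by rw [h₁, ← pullSnd_anchor, pullLift_snd'])
    (by
      intro S' w w' hw hx' hy' h₂ h₃
      have k₁ : (w ≫ a) ≫ (bun A).proj = (w' ≫ a) ≫ (bun A).proj := by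
        simp only [Category.assoc, ← ha, reassoc_of% hw]
      have k₂ : (w ≫ b) ≫ (bun B).proj = (w' ≫ b) ≫ (bun B).proj := by
        simp only [Category.assoc, ← hb, reassoc_of% hw]
      have e₁ : ((bun A).pull x).tr _ _ hx' = (bun A).tr (w ≫ a) (w' ≫ a) k₁ := by
        rw [tr_pull _ _ _ _ (by simpa using k₁)]
        exact tr_congr (by simp) (by simp) _
      have e₂ : ((bun B).pull y).tr _ _ hy' = (bun B).tr (w ≫ b) (w' ≫ b) k₂ := by
        rw [tr_pull _ _ _ _ (by simpa using k₂)]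
        exact tr_congr (by simp) (by simp) _
      rw [mul_congr e₁ rfl, mul_congr rfl e₂, H w w' hw])
  obtain ⟨φ, hφ⟩ := exists_thp_eq θ
  refine ⟨φ, ?_⟩
  rw [ev, hφ]
  exact hθ

/-- Points of two bundles with the same transition arrows define an isomorphism. -/
lemma exists_iso_ev_eq {e : S ⟶ T} (he : IsCover e) (a : S ⟶ (bun A).total)
    (b : S ⟶ (bun B).total) (ha : e ≫ x = a ≫ (bun A).proj) (hb : e ≫ y = b ≫ (bun B).proj)
    (h : a ≫ (bun A).anchor = b ≫ (bun B).anchor)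
    (H : ∀ {S' : 𝒞} (w w' : S' ⟶ S) (_ : w ≫ e = w' ≫ e) (h₁) (h₂),
      (bun A).tr (w ≫ a) (w' ≫ a) h₁ = (bun B).tr (w ≫ b) (w' ≫ b) h₂) :
    ∃ φ : (pb (Prin 𝔸) x).obj A ≅ (pb (Prin 𝔸) y).obj B,
      ev φ.hom e a b ha hb = (a ≫ (bun A).anchor) ≫ 𝔸.ident := by
  -- The value is an identity arrow, so equivariance reduces to the equality `H` of transition
  -- arrows. The same value in the opposite direction gives the inverse.
  obtain ⟨φ, hφ⟩ := exists_ev_eq he a b ha hb ((a ≫ (bun A).anchor) ≫ 𝔸.ident) (by simp)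
    (by simp [h]) (by
      intro S' w w' hw h₁ h₂ h₃ h₄
      refine Eq.trans ((mul_congr (g' := ((bun A).tr _ _ h₁ ≫ 𝔸.cod) ≫ 𝔸.ident) rfl (by simp)
        _).trans
        (mul_ident _ _ _)) ((H w w' hw h₁ h₂).trans (Eq.symm ?_))
      exact (mul_congr (f' := ((bun B).tr _ _ h₂ ≫ 𝔸.dom) ≫ 𝔸.ident) (by simp [h]) rfl _).trans
        (ident_mul _ _ _))
  obtain ⟨ψ, hψ⟩ := exists_ev_eq he b a hb ha ((a ≫ (bun A).anchor) ≫ 𝔸.ident) (by simp [h])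
    (by simp) (by
      intro S' w w' hw h₁ h₂ h₃ h₄
      refine Eq.trans ((mul_congr (g' := ((bun B).tr _ _ h₁ ≫ 𝔸.cod) ≫ 𝔸.ident) rfl
        (by simp [h]) _).trans (mul_ident _ _ _)) ((H w w' hw h₂ h₁).symm.trans (Eq.symm ?_))
      exact (mul_congr (f' := ((bun A).tr _ _ h₂ ≫ 𝔸.dom) ≫ 𝔸.ident) (by simp) rfl _).trans
        (ident_mul _ _ _))
  refine ⟨⟨φ, ψ, ev_ext he a a ha ha ?_, ev_ext he b b hb hb ?_⟩, hφ⟩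
  · rw [ev_comp φ ψ e a b a ha hb ha (by rw [ev_cod, ev_dom]), mul_congr hφ hψ, ident_mul,
      ev_id _ _ _ _ _ rfl, tr_self]
  · rw [ev_comp ψ φ e b a b hb ha hb (by rw [ev_cod, ev_dom]), mul_congr hψ hφ, ident_mul,
      ev_id _ _ _ _ _ rfl, tr_self, h]

end

/-- Morphisms are handled through their values at points of the two bundles, which exist over a
cover. For objects, the total space of a bundle over `Y` is itself a cover of `X`, so the descent
data can be rewritten as a cocycle there and the descended bundle is the associated one. -/
lemma prin_hasDescent {p : Y ⟶ X} (hp : IsCover p) : HasDescent (Prin 𝔸) p where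
  faithful {A B f g} hfg := by
    obtain ⟨W, e, x, y, he, hx, hy⟩ := Theta.exists_cover₂ (bun A) (bun B)
    have hc : (pullback.fst p e) ≫ p = pullback.snd p e ≫ e := pullback.condition
    have hx' : (pullback.snd p e ≫ x) ≫ (bun A).proj = pullback.fst p e ≫ p := by
      rw [Category.assoc, hx, hc]
    have hy' : (pullback.snd p e ≫ y) ≫ (bun B).proj = pullback.fst p e ≫ p := by
      rw [Category.assoc, hy, hc]
    refine Arrow.ext (Theta.ext_app ((he.fst p).comp hp) _ _ hx' hy' ?_)
    refine (ev_map f _ _ _ hx'.symm hy'.symm _).symm.trans (Eq.trans ?_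
      (ev_map g _ _ _ hx'.symm hy'.symm _))
    rw [hfg]
  full {A B} b hb := by
    obtain ⟨W, e, x, y, he, hx, hy⟩ := Theta.exists_cover₂ (bun A) (bun B)
    have hc : (pullback.fst p e) ≫ p = pullback.snd p e ≫ e := pullback.condition
    have hx' : (pullback.snd p e ≫ x) ≫ (bun A).proj = pullback.fst p e ≫ p := by
      rw [Category.assoc, hx, hc]
    have hy' : (pullback.snd p e ≫ y) ≫ (bun B).proj = pullback.fst p e ≫ p := by
      rw [Category.assoc, hy, hc]
    -- Points of `A` and `B` over the cover `W` of `X` are pulled back to `Y ×_X W`, where `b` has a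
    -- value. This is the value of the sought morphism over a cover of `X`.
    obtain ⟨θ, hθ⟩ := Theta.exists_app ((he.fst p).comp hp) _ _ hx' hy'
      (ev b _ _ _ hx'.symm hy'.symm) (ev_dom _ _ _ _ _ _) (ev_cod _ _ _ _ _ _) (by
        intro T w w' hw h₁ h₂ h₃ h₄
        have k₁ : ∀ w : T ⟶ pullback p e, (w ≫ pullback.fst p e) ≫ p =
            (w ≫ pullback.snd p e ≫ x) ≫ (bun A).proj := fun w => by
          rw [Category.assoc, Category.assoc, hx']
        have k₂ : ∀ w : T ⟶ pullback p e, (w ≫ pullback.fst p e) ≫ p =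
            (w ≫ pullback.snd p e ≫ y) ≫ (bun B).proj := fun w => by
          rw [Category.assoc, Category.assoc, hy']
        have k₃ : (w' ≫ pullback.fst p e) ≫ p = (w ≫ pullback.fst p e) ≫ p := by simpa using hw.symm
        rw [mul_congr rfl (comp_ev b w' _ _ _ _ _ (k₁ w') (k₂ w')),
          mul_congr (comp_ev b w _ _ _ _ _ (k₁ w) (k₂ w)) rfl,
          tr_mul_ev b _ _ _ _ (k₃.trans (k₁ w)), ev_mul_tr b _ _ _ _ _ _ (k₃.symm.trans (k₂ w'))]
        -- Once the transition arrows are absorbed, both sides are values of `b` at the same two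
        -- points over different maps to `Y`; these agree because the restrictions of `b` along the
        -- two maps do.
        have key := hb (w' ≫ pullback.fst p e) (w ≫ pullback.fst p e) _ rfl k₃.symm
        have e₁ := ev_rst b (w' ≫ pullback.fst p e) _ _ rfl rfl (𝟙 T) (w ≫ pullback.snd p e ≫ x)
          (w' ≫ pullback.snd p e ≫ y) (by rw [Category.id_comp, k₃, k₁])
            (by rw [Category.id_comp, k₂])
          (by rw [Category.id_comp, k₃, k₁]) (by rw [Category.id_comp, k₂])
        have e₂ := ev_rst b (w ≫ pullback.fst p e) _ _ k₃.symm k₃.symm (𝟙 T)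
          (w ≫ pullback.snd p e ≫ x) (w' ≫ pullback.snd p e ≫ y)
          (by rw [Category.id_comp, k₃, k₁]) (by rw [Category.id_comp, k₂])
          (by rw [Category.id_comp, k₁]) (by rw [Category.id_comp, ← k₃, k₂])
        rw [← key, e₁] at e₂
        rw [ev_congr b (Category.id_comp _).symm rfl rfl, e₂]
        exact ev_congr b (Category.id_comp _) rfl rfl _ _)
    refine ⟨Arrow.ofTheta θ, ev_ext (he.fst p) _ _ hx'.symm hy'.symm ?_⟩
    refine (ev_map (A' := B) (Arrow.ofTheta θ) _ _ _ hx'.symm hy'.symm (hx'.trans hy'.symm)).trans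
      ?_
    refine Eq.trans ?_ hθ
    exact congrArg (fun θ => Theta.app θ _ _ _) (Arrow.theta_ofTheta θ)
  effective {Z} a C φ rst_φ φ_self φ_comp := by
    -- A point of `P` is a point of `Y` with a point of `C` above it, so the descent morphism
    -- between two such points in the same fibre over `X` has a definite value in `𝔸`. These values
    -- will form the cocycle.
    let P := (bun C).pull a
    let σ : P.total ⟶ (bun C).total := (bun C).pullSnd a
    have hσ : σ ≫ (bun C).proj = P.proj ≫ a := pullSnd_proj _
    have hσa : σ ≫ (bun C).anchor = P.anchor := pullSnd_anchor _
    have he : IsCover (P.proj ≫ p) := P.isCover.comp hp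
    have hu : ∀ {T : 𝒞} (w : T ⟶ P.total), 𝟙 T ≫ (w ≫ P.proj) ≫ a = (w ≫ σ) ≫ (bun C).proj :=
      fun w => by simp [hσ]
    have congr : ∀ {T : 𝒞} {x x' y y' : T ⟶ Y} {u u' v v' : T ⟶ (bun C).total} (_ : x = x')
        (_ : y = y') (_ : u = u') (_ : v = v') (h) (h') (h₁) (h₂) (h₁') (h₂'),
        ev (φ x y h) (𝟙 T) u v h₁ h₂ = ev (φ x' y' h') (𝟙 T) u' v' h₁' h₂' := by
      intro T x x' y y' u u' v v' hx hy hu hv h h' h₁ h₂ h₁' h₂'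
      subst hx hy hu hv
      rfl
    have hp' : ∀ {T : 𝒞} {w w' : T ⟶ P.total}, w ≫ P.proj ≫ p = w' ≫ P.proj ≫ p →
        (w ≫ P.proj) ≫ p = (w' ≫ P.proj) ≫ p := fun h => by simpa using h
    -- For two points over the same point of `Y`, the descent morphism is an identity by `φ_self`,
    -- and its value is the transition arrow of `C`.
    have diag : ∀ {T : 𝒞} (w w' : T ⟶ P.total) (_ : w ≫ P.proj = w' ≫ P.proj) (h) (h₁) (h₂) (h₃),
        ev (φ (w ≫ P.proj) (w' ≫ P.proj) h) (𝟙 T) (w ≫ σ) (w' ≫ σ) h₁ h₂ =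
          (bun C).tr (w ≫ σ) (w' ≫ σ) h₃ := by
      intro T w w' hw h h₁ h₂ h₃
      rw [congr rfl hw.symm rfl rfl h rfl h₁ h₂ h₁ (by rw [hw, h₂]), φ_self, ev_id]
    obtain ⟨Q, s, hs, hsa, hst⟩ := exists_of_cocycle (𝔸 := 𝔸) he P.anchor
      (fun {T} w w' h => ev (φ (w ≫ P.proj) (w' ≫ P.proj) (hp' h)) (𝟙 T) (w ≫ σ) (w' ≫ σ)
        (hu w) (hu w'))
      (fun w w' h => by rw [ev_dom, Category.assoc, hσa])
      (fun w w' h => by rw [ev_cod, Category.assoc, hσa])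
      (fun {T T'} k w w' h h' => by
        have r := rst_φ k (w ≫ P.proj) (w' ≫ P.proj) (hp' h) (by simpa using h')
        rw [comp_ev _ _ _ _ _ _ _ (by simp [hσ]) (by simp [hσ]),
          congr (Category.assoc k w _) (Category.assoc k w' _) (Category.assoc k w _)
            (Category.assoc k w' _) _ (by simpa using h') _ _ (by simp [hσ]) (by simp [hσ]), ← r,
          ev_rst _ _ _ _ _ _ _ _ _ _ _ (by simp [hσ]) (by simp [hσ])]
        exact ev_congr _ (by simp) rfl rfl _ _)
      (fun w h => by rw [diag w w rfl _ _ _ rfl, tr_self, Category.assoc w σ, hσa])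
      (fun w w' w'' h₁ h₂ h₃ h₄ => by rw [← ev_comp, φ_comp])
    obtain ⟨U, rfl⟩ : ∃ U : (Prin 𝔸).obj ⟨op X⟩, bun U = Q := ⟨ofBun Q, rfl⟩
    have hsp : ∀ {T : 𝒞} (w : T ⟶ P.total), (w ≫ P.proj) ≫ p = (w ≫ s) ≫ (bun U).proj :=
      fun w => by rw [Category.assoc, Category.assoc, hs]
    -- By `diag`, the section `s` of `Q` and the tautological point `σ` of `C` have the same
    -- transition arrows on the kernel pair of `P ⟶ Y`, which gives an isomorphism over `Y` with
    -- identity value there.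
    obtain ⟨b, hb⟩ := exists_iso_ev_eq (A := U) (B := C) (x := p) (y := a) P.isCover s σ
      hs.symm hσ.symm (hsa.trans hσa.symm) (by
        intro T w w' hw h₁ h₂
        have hw' : w ≫ P.proj ≫ p = w' ≫ P.proj ≫ p := by rw [reassoc_of% hw]
        exact (hst w w' hw' h₁).trans (diag w w' hw _ _ _ h₂))
    refine ⟨U, b, fun {T} x y k hx hy => ?_⟩
    obtain ⟨S, e, w, w', he', hw, hw'⟩ := exists_cover_points P P x y
    have hxy := hx.trans hy.symm
    have hww : w ≫ P.proj ≫ p = w' ≫ P.proj ≫ p := by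
      rw [← Category.assoc, ← Category.assoc, ← hw, ← hw', Category.assoc, hxy, Category.assoc]
    have hb' : ∀ {S : 𝒞} (w : S ⟶ P.total) (r : S ⟶ Y) (_ : r = w ≫ P.proj) (h) (h'),
        ev b.hom r (w ≫ s) (w ≫ σ) h h' = (w ≫ P.anchor) ≫ 𝔸.ident := by
      intro S w r hr h h'
      subst hr
      rw [← comp_ev b.hom w P.proj s σ hs.symm hσ.symm, hb]
      refine (congrArg (fun k => w ≫ k ≫ 𝔸.ident) hsa).trans (Category.assoc _ _ _).symm
    have h₁ : e ≫ k = (w ≫ s) ≫ (bun U).proj := by rw [← hx, ← Category.assoc, hw, hsp]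
    have h₂ : (e ≫ x) ≫ a = (w ≫ σ) ≫ (bun C).proj := by
      rw [hw, Category.assoc, Category.assoc, hσ]
    have h₃ : (e ≫ y) ≫ a = (w' ≫ σ) ≫ (bun C).proj := by
      rw [hw', Category.assoc, Category.assoc, hσ]
    have h₄ : (e ≫ y) ≫ p = (w ≫ s) ≫ (bun U).proj := by rw [Category.assoc, hy, h₁]
    have h₅ : (e ≫ y) ≫ p = (w' ≫ s) ≫ (bun U).proj := by rw [hw', hsp]
    -- The relation is tested at the section above `w` and the point of `C` above `w'`. The left
    -- side reduces to the value of `φ`, as `b` has an identity value; the right side is the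
    -- transition arrow of `Q` from `w` to `w'`, which is that same value by construction.
    refine ev_ext he' (w ≫ s) (w' ≫ σ) h₁
      (by rw [← h₃, Category.assoc]) ?_
    rw [ev_comp _ _ _ (w ≫ s) (w ≫ σ) (w' ≫ σ) _
        (by rw [← h₂, Category.assoc]) _ (by rw [ev_cod, ev_dom]),
      mul_congr ((ev_rst b.hom x _ _ _ _ _ _ _ _ _ (by rw [hw, hsp]) h₂).trans
        (hb' w _ hw _ _)) rfl, ident_mul,
      ev_rst b.hom y _ _ _ _ _ _ _ _ _ h₄ h₃,
      ← tr_mul_ev b.hom _ (w ≫ s) (w' ≫ s) (w' ≫ σ) h₄ h₅ h₃ (h₄.symm.trans h₅)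
        (by rw [ev_dom, tr_cod]),
      mul_congr rfl (hb' w' _ hw' _ _)]
    refine Eq.trans ?_ ((hst w w' hww (h₄.symm.trans h₅)).symm.trans (mul_ident _ _ _).symm)
    rw [congr hw.symm hw'.symm rfl rfl (hp' hww) (by rw [Category.assoc, hxy, Category.assoc])
      _ _ (by rw [Category.id_comp, h₂]) (by rw [Category.id_comp, h₃]), ← rst_φ e x y hxy,
      ev_rst _ _ _ _ _ _ _ _ _ _ _ (by rw [Category.id_comp, ← Category.assoc, h₂])
        (by rw [Category.id_comp, ← Category.assoc, h₃])]
    exact ev_congr _ (Category.id_comp _).symm rfl rfl _ _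

lemma prin_isStack (𝔸 : InternalCategory 𝒞) : IsStack (Prin 𝔸) :=
  isStack_iff.2 (fun _ _ _ hp => prin_hasDescent hp)

end LaxGeometric

end

/-! ### The universal bundle, and the conditions for a lax-geometric stack -/

noncomputable section
namespace LaxGeometric

variable {𝒞 : Type u} [Category.{v} 𝒞] [HasFiniteLimits 𝒞]

attribute [local simp] InternalCategory.ident_dom InternalCategory.ident_cod

open InternalCategory PrincipalBundle

/-- A bundle over the object of objects with a global section, anchored by the identity. -/
structure UniversalBundle (𝔸 : InternalCategory 𝒞) where
  obj : (Prin 𝔸).obj ⟨op 𝔸.obj⟩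
  sec : 𝔸.obj ⟶ (bun obj).total
  proj : sec ≫ (bun obj).proj = 𝟙 _
  anchor : sec ≫ (bun obj).anchor = 𝟙 _

/-- Points identified by the identity cover are equal, so identity arrows form a cocycle on it; its
associated bundle has the required section. -/
lemma nonempty_universalBundle (𝔸 : InternalCategory 𝒞) : Nonempty (UniversalBundle 𝔸) := by
  obtain ⟨Q, s, hs, hsa, -⟩ := exists_of_cocycle (𝔸 := 𝔸) (IsCover.id 𝔸.obj) (𝟙 _)
    (fun x y _ => x ≫ 𝔸.ident) (fun x y h => by simp)
    (fun x y h => by simpa using h) (fun k x y h h' => (Category.assoc _ _ _).symm)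
    (fun x h => by rw [Category.comp_id]) (fun x y z h₁ h₂ h₃ h₄ => by
      obtain rfl : x = y := by simpa using h₁
      exact ident_mul _ _ _)
  exact ⟨⟨ofBun Q, s, hs, hsa⟩⟩

namespace UniversalBundle

variable {𝔸 : InternalCategory 𝒞} (U : UniversalBundle 𝔸) {X Y : 𝒞}

lemma comp_sec_proj (f : X ⟶ 𝔸.obj) : 𝟙 X ≫ f = (f ≫ U.sec) ≫ (bun U.obj).proj := by
  rw [Category.id_comp, Category.assoc, U.proj, Category.comp_id]

lemma comp_sec_anchor (f : X ⟶ 𝔸.obj) : (f ≫ U.sec) ≫ (bun U.obj).anchor = f := by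
  rw [Category.assoc, U.anchor, Category.comp_id]

/-- Pulled back to its own total space, `A` has a tautological point, and the pullback of `U.obj`
along the anchor has the point given by the section. Both have the same anchor. Over the identity
cover all transition arrows involved are identities, so the two points define an isomorphism. -/
lemma locallyPullbackOf : LocallyPullbackOf (Prin 𝔸) U.obj := by
  intro X A
  have hA : 𝟙 _ ≫ (bun A).anchor = ((bun A).anchor ≫ U.sec) ≫ (bun U.obj).anchor :=
    (Category.id_comp _).trans (U.comp_sec_anchor (X := (bun A).total) (bun A).anchor).symm
  obtain ⟨φ, -⟩ := exists_iso_ev_eq (A := A) (B := U.obj) (x := (bun A).proj)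
    (y := (bun A).anchor) (IsCover.id (bun A).total) (𝟙 _) ((bun A).anchor ≫ U.sec)
    rfl (U.comp_sec_proj _) hA
    (by
      intro S w w' h h₁ h₂
      obtain rfl : w = w' := by simpa using h
      rw [tr_self, tr_self]
      exact congrArg (fun k => k ≫ 𝔸.ident) ((Category.assoc _ _ _).trans
        ((congrArg (fun k => w ≫ k) hA).trans (Category.assoc _ _ _).symm)))
  exact ⟨_, _, _, (bun A).isCover, ⟨φ⟩⟩

/-- The arrow of a triple. -/
def arrow (t : Triple (Prin 𝔸) U.obj X) : X ⟶ 𝔸.arr :=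
  ev t.θ (𝟙 X) (t.f ≫ U.sec) (t.g ≫ U.sec) (U.comp_sec_proj _) (U.comp_sec_proj _)

lemma arrow_dom (t : Triple (Prin 𝔸) U.obj X) : U.arrow t ≫ 𝔸.dom = t.f := by
  rw [arrow, ev_dom, comp_sec_anchor]

lemma arrow_cod (t : Triple (Prin 𝔸) U.obj X) : U.arrow t ≫ 𝔸.cod = t.g := by
  rw [arrow, ev_cod, comp_sec_anchor]

/-- The section supplies global points of all pullbacks of the universal bundle. A morphism is
determined by its value there, and over the identity cover compatibility with transition arrows is
automatic, so every arrow is a value. -/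
lemma arrow_bijective : Function.Bijective (U.arrow (X := X)) := by
  constructor
  · intro t t' h
    have hf : t.f = t'.f := by rw [← arrow_dom, h, arrow_dom]
    have hg : t.g = t'.g := by rw [← arrow_cod, h, arrow_cod]
    obtain ⟨f, g, θ⟩ := t
    obtain ⟨f', g', θ'⟩ := t'
    dsimp only at hf hg
    subst hf hg
    exact congrArg (Triple.mk f g) (ev_ext (IsCover.id X) _ _ _ _ h)
  · intro k
    obtain ⟨θ, hθ⟩ := exists_ev_eq (A := U.obj) (B := U.obj) (IsCover.id X)
      ((k ≫ 𝔸.dom) ≫ U.sec) ((k ≫ 𝔸.cod) ≫ U.sec) (U.comp_sec_proj _) (U.comp_sec_proj _) k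
      (U.comp_sec_anchor _).symm (U.comp_sec_anchor _).symm (by
        intro S w w' h h₁ h₂ h₃ h₄
        obtain rfl : w = w' := by simpa using h
        rw [mul_congr (tr_self _ _) rfl, mul_congr rfl (tr_self _ _), ident_mul, mul_ident])
    exact ⟨⟨_, _, θ⟩, hθ⟩

lemma arrow_restrict (t : Triple (Prin 𝔸) U.obj X) (h : Y ⟶ X) :
    U.arrow (t.restrict h) = h ≫ U.arrow t := by
  rw [Triple.restrict_eq]
  have e : ∀ f : X ⟶ 𝔸.obj, (h ≫ 𝟙 X) ≫ f = (h ≫ f ≫ U.sec) ≫ (bun U.obj).proj := fun f => by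
    rw [Category.assoc, Category.assoc, ← U.comp_sec_proj]
  have e' : ∀ f : X ⟶ 𝔸.obj, (𝟙 Y ≫ h) ≫ f = ((h ≫ f) ≫ U.sec) ≫ (bun U.obj).proj := fun f => by
    rw [Category.assoc, ← U.comp_sec_proj]
  rw [arrow, arrow, ev_rst _ _ _ _ _ _ _ _ _ _ _ (e' _) (e' _), comp_ev _ _ _ _ _ _ _ (e _) (e _)]
  exact ev_congr _ (by simp) (by simp) (by simp) _ _

lemma representsTriples : RepresentsTriples (Prin 𝔸) U.obj 𝔸.arr := by
  refine ⟨fun X => (Equiv.ofBijective _ U.arrow_bijective).symm, fun X Y h k => ?_⟩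
  rw [Equiv.symm_apply_eq]
  refine Eq.trans ?_ (U.arrow_restrict _ h).symm
  exact congrArg (fun l => h ≫ l)
    ((Equiv.ofBijective _ (U.arrow_bijective (X := X))).apply_symm_apply k).symm

end UniversalBundle

/-- A lax-geometric stack is a stack with a generic object. -/
lemma IsLaxGeometric.exists_generic {M : LocallyDiscrete 𝒞ᵒᵖ ⥤ᵖ Cat.{v₁, u₁}}
    (h : IsLaxGeometric M) : IsStack M ∧ ∃ (C₀ : 𝒞) (C : M.obj ⟨op C₀⟩),
      LocallyPullbackOf M C ∧ ∃ C₁ : 𝒞, RepresentsTriples M C C₁ := by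
  obtain ⟨𝔸, ⟨e⟩⟩ := h
  obtain ⟨U⟩ := nonempty_universalBundle 𝔸
  have := e.isEquivalence 𝔸.obj
  -- The generic object of `M` is a preimage, up to isomorphism, of the universal bundle.
  let i := (e.app 𝔸.obj).objObjPreimageIso U.obj
  exact ⟨e.isStack (prin_isStack 𝔸), 𝔸.obj, _, e.locallyPullbackOf i U.locallyPullbackOf,
    𝔸.arr, e.representsTriples i U.representsTriples⟩

end LaxGeometric

end

/-! ### The internal category of morphisms between pullbacks of a generic object -/

noncomputable section
namespace LaxGeometric

variable {𝒞 : Type u} [Category.{v} 𝒞]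

attribute [local simp] pullback.lift_fst pullback.lift_snd pullback.lift_fst_assoc
  pullback.lift_snd_assoc

/-- A family of arrows that represents the morphisms between pullbacks of an object `C`. -/
structure Classifier (M : LocallyDiscrete 𝒞ᵒᵖ ⥤ᵖ Cat.{v₁, u₁}) {C₀ : 𝒞} (C : M.obj ⟨op C₀⟩)
    (C₁ : 𝒞) where
  dom : C₁ ⟶ C₀
  cod : C₁ ⟶ C₀
  /-- the generic morphism -/
  gen : (pb M dom).obj C ⟶ (pb M cod).obj C
  ext {T : 𝒞} {a b : T ⟶ C₁} (x y : T ⟶ C₀) (hx : a ≫ dom = x) (hy : a ≫ cod = y)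
    (hx' : b ≫ dom = x) (hy' : b ≫ cod = y) (h : rst gen a x y hx hy = rst gen b x y hx' hy') : a =
      b
  exists_eq {T : 𝒞} {x y : T ⟶ C₀} (φ : (pb M x).obj C ⟶ (pb M y).obj C) :
    ∃ (a : T ⟶ C₁) (hx : a ≫ dom = x) (hy : a ≫ cod = y), rst gen a x y hx hy = φ

/-- Yoneda: the generic triple is the one that corresponds to the identity of `C₁`, and every other
triple is its restriction along a unique morphism. -/
lemma RepresentsTriples.nonempty_classifier {M : LocallyDiscrete 𝒞ᵒᵖ ⥤ᵖ Cat.{v₁, u₁}} {C₀ C₁ : 𝒞}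
    {C : M.obj ⟨op C₀⟩} (h : RepresentsTriples M C C₁) : Nonempty (Classifier M C C₁) := by
  obtain ⟨e, he⟩ := h
  let t := e C₁ (𝟙 C₁)
  have key : ∀ {T : 𝒞} (a : T ⟶ C₁), e T a = ⟨a ≫ t.f, a ≫ t.g, rst t.θ a _ _ rfl rfl⟩ := by
    intro T a
    rw [← Triple.restrict_eq, ← he, Category.comp_id]
  refine ⟨⟨t.f, t.g, t.θ, ?_, ?_⟩⟩
  · intro T a b x y hx hy hx' hy' h
    apply (e T).injective
    have : ∀ (a : T ⟶ C₁) (hx : a ≫ t.f = x) (hy : a ≫ t.g = y),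
        e T a = ⟨x, y, rst t.θ a x y hx hy⟩ := by
      intro a hx hy
      subst hx hy
      exact key a
    rw [this a hx hy, this b hx' hy', h]
  · intro T x y φ
    have h := key ((e T).symm ⟨x, y, φ⟩)
    rw [Equiv.apply_symm_apply] at h
    generalize (e T).symm ⟨x, y, φ⟩ = a at h
    have hx : a ≫ t.f = x := (congrArg Triple.f h).symm
    have hy : a ≫ t.g = y := (congrArg Triple.g h).symm
    refine ⟨a, hx, hy, ?_⟩
    subst hx hy
    exact eq_of_heq (Triple.mk.inj h.symm).2.2

namespace Classifier

variable {M : LocallyDiscrete 𝒞ᵒᵖ ⥤ᵖ Cat.{v₁, u₁}} {C₀ C₁ : 𝒞} {C : M.obj ⟨op C₀⟩}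
  (K : Classifier M C C₁) {T T' : 𝒞}

/-- The morphism between pullbacks that corresponds to a generalised arrow. -/
def el (a : T ⟶ C₁) (x y : T ⟶ C₀) (hx : a ≫ K.dom = x) (hy : a ≫ K.cod = y) :
    (pb M x).obj C ⟶ (pb M y).obj C :=
  rst K.gen a x y hx hy

lemma rst_el (a : T ⟶ C₁) (x y : T ⟶ C₀) (hx : a ≫ K.dom = x) (hy : a ≫ K.cod = y) (k : T' ⟶ T)
    (x' y' : T' ⟶ C₀) (hx' : k ≫ x = x') (hy' : k ≫ y = y') :
    rst (K.el a x y hx hy) k x' y' hx' hy' =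
      K.el (k ≫ a) x' y' (by rw [Category.assoc, hx, hx']) (by rw [Category.assoc, hy, hy']) :=
  rst_rst _ _ _ _ _ _ _ _ rfl _ _ _ _

lemma el_congr {a b : T ⟶ C₁} (h : a = b) (x y : T ⟶ C₀) (hx : a ≫ K.dom = x)
    (hy : a ≫ K.cod = y) :
    K.el a x y hx hy = K.el b x y (by rw [← h, hx]) (by rw [← h, hy]) := by
  subst h; rfl

lemma ext_el {a b : T ⟶ C₁} (x y : T ⟶ C₀) (hx : a ≫ K.dom = x) (hy : a ≫ K.cod = y)
    (hx' : b ≫ K.dom = x) (hy' : b ≫ K.cod = y) (h : K.el a x y hx hy = K.el b x y hx' hy') :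
    a = b := K.ext x y hx hy hx' hy' h

/-- The generalised arrow that corresponds to a morphism between pullbacks. -/
def arrowOf {x y : T ⟶ C₀} (φ : (pb M x).obj C ⟶ (pb M y).obj C) : T ⟶ C₁ := (K.exists_eq φ).choose

section

variable {x y z : T ⟶ C₀} (φ : (pb M x).obj C ⟶ (pb M y).obj C)

lemma arrowOf_dom : K.arrowOf φ ≫ K.dom = x := (K.exists_eq φ).choose_spec.choose

lemma arrowOf_cod : K.arrowOf φ ≫ K.cod = y := (K.exists_eq φ).choose_spec.choose_spec.choose

lemma el_arrowOf (h : K.arrowOf φ ≫ K.dom = x) (h' : K.arrowOf φ ≫ K.cod = y) :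
    K.el (K.arrowOf φ) x y h h' = φ :=
  (K.exists_eq φ).choose_spec.choose_spec.choose_spec

end

/-- The identity arrows. -/
def ident : C₀ ⟶ C₁ := K.arrowOf (𝟙 ((pb M (𝟙 C₀)).obj C))

lemma el_ident (x : T ⟶ C₀) (h₁ : (x ≫ K.ident) ≫ K.dom = x) (h₂ : (x ≫ K.ident) ≫ K.cod = x) :
    K.el (x ≫ K.ident) x x h₁ h₂ = 𝟙 _ := by
  have := K.rst_el K.ident _ _ (K.arrowOf_dom _) (K.arrowOf_cod _) x x x (Category.comp_id x)
    (Category.comp_id x)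
  rw [← this]
  exact (congrArg (fun φ => rst φ x x x (Category.comp_id x) (Category.comp_id x))
    (K.el_arrowOf _ _ _)).trans (rst_id _ _ _ _)

variable [HasFiniteLimits 𝒞]

/-- Composition of generalised arrows. -/
def comp : pullback K.cod K.dom ⟶ C₁ :=
  K.arrowOf (K.el (pullback.fst K.cod K.dom) _ (pullback.fst K.cod K.dom ≫ K.cod) rfl rfl ≫
    K.el (pullback.snd K.cod K.dom) _ _ pullback.condition.symm rfl)

/-- Composition is defined on the universal composable pair; stability of `el` under restriction
extends the formula to all generalised pairs. -/
lemma el_comp (f g : T ⟶ C₁) (h : f ≫ K.cod = g ≫ K.dom) (x y z : T ⟶ C₀) (hx : f ≫ K.dom = x)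
    (hy : f ≫ K.cod = y) (hz : g ≫ K.cod = z) (h₁) (h₂) :
    K.el (pullback.lift f g h ≫ K.comp) x z h₁ h₂ =
      K.el f x y hx hy ≫ K.el g y z (by rw [← h, hy]) hz := by
  have e₁ : pullback.lift f g h ≫ pullback.fst K.cod K.dom ≫ K.dom = x := by simpa using hx
  have e₂ : pullback.lift f g h ≫ pullback.fst K.cod K.dom ≫ K.cod = y := by simpa using hy
  have e₃ : pullback.lift f g h ≫ pullback.snd K.cod K.dom ≫ K.cod = z := by simpa using hz
  have := K.rst_el K.comp _ _ (K.arrowOf_dom _) (K.arrowOf_cod _) (pullback.lift f g h) x z e₁ e₃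
  rw [← this]
  refine (congrArg (fun φ => rst φ (pullback.lift f g h) x z e₁ e₃) (K.el_arrowOf _ _ _)).trans ?_
  rw [rst_comp _ _ _ x y z e₁ e₂ e₃, rst_el, rst_el, K.el_congr (pullback.lift_fst f g h),
    K.el_congr (pullback.lift_snd f g h)]

lemma comp_dom : K.comp ≫ K.dom = pullback.fst K.cod K.dom ≫ K.dom := K.arrowOf_dom _

lemma comp_cod : K.comp ≫ K.cod = pullback.snd K.cod K.dom ≫ K.cod := K.arrowOf_cod _

/-- The internal category of arrows between pullbacks of `C`. -/
def internalCategory : InternalCategory 𝒞 where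
  obj := C₀
  arr := C₁
  dom := K.dom
  cod := K.cod
  ident := K.ident
  comp := K.comp
  ident_dom := K.arrowOf_dom _
  ident_cod := K.arrowOf_cod _
  comp_dom := K.comp_dom
  comp_cod := K.comp_cod
  id_comp {T} f h := by
    have h₁ : (pullback.lift (f ≫ K.dom ≫ K.ident) f h ≫ K.comp) ≫ K.dom = f ≫ K.dom := by
      rw [Category.assoc, comp_dom, pullback.lift_fst_assoc, Category.assoc, Category.assoc]
      exact congrArg (fun k => f ≫ k) ((congrArg (fun k => K.dom ≫ k) (K.arrowOf_dom _)).trans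
        (Category.comp_id _))
    have h₂ : (pullback.lift (f ≫ K.dom ≫ K.ident) f h ≫ K.comp) ≫ K.cod = f ≫ K.cod := by
      rw [Category.assoc, comp_cod, pullback.lift_snd_assoc]
    -- `el` is injective and takes `comp` and `ident` to composition and identities in a fibre of
    -- `M`, so each law of the internal category becomes the corresponding law there.
    apply K.ext_el (f ≫ K.dom) (f ≫ K.cod) h₁ h₂ rfl rfl
    have h₃ : (f ≫ K.dom ≫ K.ident) ≫ K.dom = f ≫ K.dom := by
      simpa [comp_dom] using h₁
    rw [K.el_comp _ _ _ _ (f ≫ K.dom) _ h₃ h rfl, K.el_congr (Category.assoc f K.dom K.ident).symm,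
      el_ident, Category.id_comp]
  comp_id {T} f h := by
    have h₁ : (pullback.lift f (f ≫ K.cod ≫ K.ident) h ≫ K.comp) ≫ K.dom = f ≫ K.dom := by
      rw [Category.assoc, comp_dom, pullback.lift_fst_assoc]
    have h₂ : (pullback.lift f (f ≫ K.cod ≫ K.ident) h ≫ K.comp) ≫ K.cod = f ≫ K.cod := by
      rw [Category.assoc, comp_cod, pullback.lift_snd_assoc, Category.assoc, Category.assoc]
      exact congrArg (fun k => f ≫ k) ((congrArg (fun k => K.cod ≫ k) (K.arrowOf_cod _)).trans
        (Category.comp_id _))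
    apply K.ext_el (f ≫ K.dom) (f ≫ K.cod) h₁ h₂ rfl rfl
    have h₃ : (f ≫ K.cod ≫ K.ident) ≫ K.cod = f ≫ K.cod := by
      simpa [comp_cod] using h₂
    rw [K.el_comp _ _ _ _ (f ≫ K.cod) _ rfl rfl h₃, K.el_congr
      (Category.assoc f K.cod K.ident).symm,
      el_ident, Category.comp_id]
  assoc {T} f g k h₁ h₂ h₃ h₄ := by
    apply K.ext_el (f ≫ K.dom) (k ≫ K.cod) (by simp [comp_dom]) (by simp [comp_cod])
      (by simp [comp_dom]) (by simp [comp_cod])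
    rw [K.el_comp _ k h₃ _ (g ≫ K.cod) _ (by simp [comp_dom]) (by simp [comp_cod]) rfl,
      K.el_comp f g h₁ _ (f ≫ K.cod) _ rfl rfl rfl,
      K.el_comp f _ h₄ _ (f ≫ K.cod) _ rfl rfl (by simp [comp_cod]),
      K.el_comp g k h₂ _ (g ≫ K.cod) _ h₁.symm rfl rfl, Category.assoc]

end Classifier

/-- An object of `M` whose morphisms between pullbacks are the arrows of `𝔸`. -/
structure Realization [HasFiniteLimits 𝒞] (M : LocallyDiscrete 𝒞ᵒᵖ ⥤ᵖ Cat.{v₁, u₁})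
    (𝔸 : InternalCategory 𝒞) (C : M.obj ⟨op 𝔸.obj⟩) where
  el {T : 𝒞} (a : T ⟶ 𝔸.arr) (x y : T ⟶ 𝔸.obj) (hx : a ≫ 𝔸.dom = x) (hy : a ≫ 𝔸.cod = y) :
    (pb M x).obj C ⟶ (pb M y).obj C
  rst_el {T T' : 𝒞} (a : T ⟶ 𝔸.arr) (x y : T ⟶ 𝔸.obj) (hx : a ≫ 𝔸.dom = x) (hy : a ≫ 𝔸.cod = y)
    (k : T' ⟶ T) (x' y' : T' ⟶ 𝔸.obj) (hx' : k ≫ x = x') (hy' : k ≫ y = y') :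
    rst (el a x y hx hy) k x' y' hx' hy' =
      el (k ≫ a) x' y' (by rw [Category.assoc, hx, hx']) (by rw [Category.assoc, hy, hy'])
  el_ident {T : 𝒞} (x : T ⟶ 𝔸.obj) (h₁) (h₂) : el (x ≫ 𝔸.ident) x x h₁ h₂ = 𝟙 _
  el_mul {T : 𝒞} (a b : T ⟶ 𝔸.arr) (h) (x y z : T ⟶ 𝔸.obj) (hx : a ≫ 𝔸.dom = x)
    (hy : a ≫ 𝔸.cod = y) (hy' : b ≫ 𝔸.dom = y) (hz : b ≫ 𝔸.cod = z) (h₁) (h₂) :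
    el (𝔸.mul a b h) x z h₁ h₂ = el a x y hx hy ≫ el b y z hy' hz
  ext_el {T : 𝒞} {a b : T ⟶ 𝔸.arr} (x y : T ⟶ 𝔸.obj) (hx : a ≫ 𝔸.dom = x) (hy : a ≫ 𝔸.cod = y)
    (hx' : b ≫ 𝔸.dom = x) (hy' : b ≫ 𝔸.cod = y) (h : el a x y hx hy = el b x y hx' hy') : a = b
  exists_el_eq {T : 𝒞} {x y : T ⟶ 𝔸.obj} (φ : (pb M x).obj C ⟶ (pb M y).obj C) :
    ∃ (a : T ⟶ 𝔸.arr) (hx : a ≫ 𝔸.dom = x) (hy : a ≫ 𝔸.cod = y), el a x y hx hy = φ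

/-- The realization of the internal category of a classifier. -/
def Classifier.realization [HasFiniteLimits 𝒞] {M : LocallyDiscrete 𝒞ᵒᵖ ⥤ᵖ Cat.{v₁, u₁}}
    {C₀ C₁ : 𝒞} {C : M.obj ⟨op C₀⟩} (K : Classifier M C C₁) :
    Realization M K.internalCategory C where
  el a x y hx hy := K.el a x y hx hy
  rst_el a x y hx hy k x' y' hx' hy' := K.rst_el a x y hx hy k x' y' hx' hy'
  el_ident x h₁ h₂ := K.el_ident x h₁ h₂
  el_mul a b h x y z hx hy _ hz h₁ h₂ := K.el_comp a b h x y z hx hy hz h₁ h₂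
  ext_el x y hx hy hx' hy' h := K.ext_el x y hx hy hx' hy' h
  exists_el_eq φ := K.exists_eq φ

end LaxGeometric

end

/-! ### Framings of objects by bundles, and the correspondence on morphisms -/

noncomputable section
namespace LaxGeometric

variable {𝒞 : Type u} [Category.{v} 𝒞] [HasFiniteLimits 𝒞]

attribute [local simp] pullback.lift_fst pullback.lift_snd pullback.lift_fst_assoc
  pullback.lift_snd_assoc InternalCategory.ident_dom InternalCategory.ident_cod

open InternalCategory PrincipalBundle

variable {M : LocallyDiscrete 𝒞ᵒᵖ ⥤ᵖ Cat.{v₁, u₁}} {X Y Z T T' : 𝒞}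

lemma IsStack.hasDescent (hM : IsStack M) {p : Y ⟶ X} (hp : IsCover p) : HasDescent M p :=
  isStack_iff.1 hM p hp

variable {𝔸 : InternalCategory 𝒞} {C : M.obj ⟨op 𝔸.obj⟩}

/-- The anchor of a bundle for the core, as a morphism to the object of objects of `𝔸`. -/
def PrincipalBundle.anc (P : PrincipalBundle 𝔸.core X) : P.total ⟶ 𝔸.obj := P.anchor

section

variable {P : PrincipalBundle 𝔸.core X}

lemma PrincipalBundle.tr_dom_anc (x y : T ⟶ P.total) (h) : P.tr x y h ≫ 𝔸.dom = x ≫ P.anc :=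
  tr_dom x y h

lemma PrincipalBundle.tr_cod_anc (x y : T ⟶ P.total) (h) : P.tr x y h ≫ 𝔸.cod = y ≫ P.anc :=
  tr_cod x y h

variable (P) in
lemma PrincipalBundle.pullSnd_anc (f : Y ⟶ X) : P.pullSnd f ≫ P.anc = (P.pull f).anc := rfl

lemma PrincipalBundle.Hom.hom_anc {Q : PrincipalBundle 𝔸.core X} (φ : P.Hom Q) :
    φ.hom ≫ Q.anc = P.anc := φ.anchor

end

namespace Realization

variable (R : Realization M 𝔸 C)

lemma el_congr {a b : T ⟶ 𝔸.arr} (h : a = b) (x y : T ⟶ 𝔸.obj) (hx : a ≫ 𝔸.dom = x)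
    (hy : a ≫ 𝔸.cod = y) :
    R.el a x y hx hy = R.el b x y (by rw [← h, hx]) (by rw [← h, hy]) := by
  subst h; rfl

section

variable (P : PrincipalBundle 𝔸.core X)

/-- The morphism given by the transition arrow between two points of a bundle. -/
def elTr (x y : T ⟶ P.total) (h : x ≫ P.proj = y ≫ P.proj) (u v : T ⟶ 𝔸.obj) (hu : x ≫ P.anc = u)
    (hv : y ≫ P.anc = v) : (pb M u).obj C ⟶ (pb M v).obj C :=
  R.el (P.tr x y h) u v ((tr_dom x y h).trans hu) ((tr_cod x y h).trans hv)

lemma rst_elTr (x y : T ⟶ P.total) (h) (u v : T ⟶ 𝔸.obj) (hu) (hv) (k : T' ⟶ T) (u' v' : T' ⟶ 𝔸.obj)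
    (hu') (hv') (h') (h₁) (h₂) : rst (R.elTr P x y h u v hu hv) k u' v' hu' hv' =
      R.elTr P (k ≫ x) (k ≫ y) h' u' v' h₁ h₂ := by
  rw [elTr, R.rst_el]
  exact R.el_congr (comp_tr _ _ _ _) _ _ _ _

lemma elTr_congr {x x' y y' : T ⟶ P.total} (hx : x = x') (hy : y = y') (h) (u v : T ⟶ 𝔸.obj)
    (hu) (hv) (h') (hu') (hv') : R.elTr P x y h u v hu hv = R.elTr P x' y' h' u v hu' hv' := by
  subst hx hy
  rfl

lemma elTr_self (x : T ⟶ P.total) (h) (u : T ⟶ 𝔸.obj) (hu) (hv) :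
    R.elTr P x x h u u hu hv = 𝟙 _ := by
  subst hu
  exact (R.el_congr (tr_self x h) _ _ _ _).trans (R.el_ident _ _ _)

lemma elTr_comp (x y z : T ⟶ P.total) (h₁) (h₂) (h₃) (u v w : T ⟶ 𝔸.obj) (hu) (hv) (hv') (hw) (hu')
    (hw') : R.elTr P x y h₁ u v hu hv ≫ R.elTr P y z h₂ v w hv' hw =
      R.elTr P x z h₃ u w hu' hw' := by
  have h := tr_mul_tr x y z h₁ h₂ (by rw [tr_cod, tr_dom])
  exact (R.el_mul _ _ (by rw [tr_cod, tr_dom]) u v w _ _ _ _ (by rw [h, tr_dom]; exact hu)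
    (by rw [h, tr_cod]; exact hw)).symm.trans (R.el_congr h _ _ _ _)

/-- The transition morphism as an isomorphism. -/
@[simps hom]
def elTrIso (x y : T ⟶ P.total) (h : x ≫ P.proj = y ≫ P.proj) (u v : T ⟶ 𝔸.obj)
    (hu : x ≫ P.anc = u) (hv : y ≫ P.anc = v) : (pb M u).obj C ≅ (pb M v).obj C where
  hom := R.elTr P x y h u v hu hv
  inv := R.elTr P y x h.symm v u hv hu
  hom_inv_id := by rw [R.elTr_comp P x y x _ _ rfl _ _ _ _ _ _ _ hu hu, elTr_self]
  inv_hom_id := by rw [R.elTr_comp P y x y _ _ rfl _ _ _ _ _ _ _ hv hv, elTr_self]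

end

section

variable {P Q S : PrincipalBundle 𝔸.core X} (t : Theta P Q)

/-- The morphism given by the value of an equivariant family. -/
def elTheta (x : T ⟶ P.total) (y : T ⟶ Q.total) (h : x ≫ P.proj = y ≫ Q.proj) (u v : T ⟶ 𝔸.obj)
    (hu : x ≫ P.anc = u) (hv : y ≫ Q.anc = v) : (pb M u).obj C ⟶ (pb M v).obj C :=
  R.el (t.app x y h) u v ((t.app_dom x y h).trans hu) ((t.app_cod x y h).trans hv)

lemma rst_elTheta (x : T ⟶ P.total) (y : T ⟶ Q.total) (h) (u v : T ⟶ 𝔸.obj) (hu) (hv) (k : T' ⟶ T)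
    (u' v' : T' ⟶ 𝔸.obj) (hu') (hv') (h') (h₁) (h₂) :
    rst (R.elTheta t x y h u v hu hv) k u' v' hu' hv' =
      R.elTheta t (k ≫ x) (k ≫ y) h' u' v' h₁ h₂ := by
  rw [elTheta, R.rst_el]
  exact R.el_congr (t.comp_app _ _ _ _) _ _ _ _

lemma elTr_elTheta (x x' : T ⟶ P.total) (y : T ⟶ Q.total) (h₁) (h₂) (h₃) (u v w : T ⟶ 𝔸.obj) (hu)
    (hv) (hv') (hw) (hu') (hw') :
    R.elTr P x x' h₁ u v hu hv ≫ R.elTheta t x' y h₂ v w hv' hw =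
      R.elTheta t x y h₃ u w hu' hw' := by
  have e : P.tr x x' h₁ ≫ 𝔸.cod = t.app x' y h₂ ≫ 𝔸.dom := by rw [tr_cod, t.app_dom]
  have h := t.tr_mul_app x x' y h₂ h₁ e
  exact (R.el_mul _ _ e u v w _ _ _ _ (by rw [h, t.app_dom]; exact hu)
    (by rw [h, t.app_cod]; exact hw)).symm.trans (R.el_congr h _ _ _ _)

lemma elTheta_elTr (x : T ⟶ P.total) (y y' : T ⟶ Q.total) (h₁) (h₂) (h₃) (u v w : T ⟶ 𝔸.obj) (hu)
    (hv) (hv') (hw) (hu') (hw') :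
    R.elTheta t x y h₁ u v hu hv ≫ R.elTr Q y y' h₂ v w hv' hw =
      R.elTheta t x y' h₃ u w hu' hw' := by
  have e : t.app x y h₁ ≫ 𝔸.cod = Q.tr y y' h₂ ≫ 𝔸.dom := by rw [tr_dom, t.app_cod]
  have h := t.app_mul_tr x y y' h₁ h₂ e
  exact (R.el_mul _ _ e u v w _ _ _ _ (by rw [h, t.app_dom]; exact hu)
    (by rw [h, t.app_cod]; exact hw)).symm.trans (R.el_congr h _ _ _ _)

lemma elTheta_mul (s : Theta Q S) (x : T ⟶ P.total) (y : T ⟶ Q.total) (z : T ⟶ S.total) (h₁) (h₂)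
    (h₃) (u v w : T ⟶ 𝔸.obj) (hu) (hv) (hv') (hw) (hu') (hw') :
    R.elTheta (t.mul s) x z h₃ u w hu' hw' =
      R.elTheta t x y h₁ u v hu hv ≫ R.elTheta s y z h₂ v w hv' hw := by
  have h := t.mul_app s x y z h₁ h₂ h₃
  exact (R.el_congr h _ _ _ _).trans (R.el_mul _ _ _ _ _ _ _ _ _ _ _ _)

end

end Realization

/-- A framing of `A` by a bundle `P`: a trivialization of `A` over the total space of `P` that is
compatible with the action. -/
structure Framing (R : Realization M 𝔸 C) (A : M.obj ⟨op X⟩) (P : PrincipalBundle 𝔸.core X) where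
  iso : (pb M P.proj).obj A ≅ (pb M P.anc).obj C
  equivariant {T : 𝒞} (x y : T ⟶ P.total) (k : T ⟶ X) (hx : x ≫ P.proj = k) (hy : y ≫ P.proj = k) :
    rst iso.hom x k (x ≫ P.anc) hx rfl ≫
        R.elTr P x y (hx.trans hy.symm) (x ≫ P.anc) (y ≫ P.anc) rfl rfl =
      rst iso.hom y k (y ≫ P.anc) hy rfl

namespace Framing

variable {R : Realization M 𝔸 C} {A B D : M.obj ⟨op X⟩} {P Q S : PrincipalBundle 𝔸.core X}
  (F : Framing R A P) (G : Framing R B Q) (H : Framing R D S)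

/-- The trivialization at a point of the bundle. -/
def triv (x : T ⟶ P.total) (k : T ⟶ X) (u : T ⟶ 𝔸.obj) (hx : x ≫ P.proj = k) (hu : x ≫ P.anc = u) :
    (pb M k).obj A ≅ (pb M u).obj C :=
  rstIso F.iso x k u hx hu

lemma rst_triv (x : T ⟶ P.total) (k : T ⟶ X) (u : T ⟶ 𝔸.obj) (hx) (hu) (l : T' ⟶ T) (k' : T' ⟶ X)
    (u' : T' ⟶ 𝔸.obj) (hk') (hu') (h₁) (h₂) :
    rst (F.triv x k u hx hu).hom l k' u' hk' hu' = (F.triv (l ≫ x) k' u' h₁ h₂).hom :=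
  rst_rst _ _ _ _ _ _ _ _ rfl _ _ _ _

lemma rst_triv_inv (x : T ⟶ P.total) (k : T ⟶ X) (u : T ⟶ 𝔸.obj) (hx) (hu) (l : T' ⟶ T)
    (k' : T' ⟶ X) (u' : T' ⟶ 𝔸.obj) (hk') (hu') (h₁) (h₂) :
    rst (F.triv x k u hx hu).inv l u' k' hu' hk' = (F.triv (l ≫ x) k' u' h₁ h₂).inv :=
  rst_rst _ _ _ _ _ _ _ _ rfl _ _ _ _

lemma triv_congr {x x' : T ⟶ P.total} (h : x = x') (k : T ⟶ X) (u : T ⟶ 𝔸.obj) (hx) (hu) (hx')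
    (hu') :
    F.triv x k u hx hu = F.triv x' k u hx' hu' := by
  subst h
  rfl

lemma triv_elTr (x y : T ⟶ P.total) (k : T ⟶ X) (u v : T ⟶ 𝔸.obj) (hx) (hu) (hy) (hv) (h) (hu')
    (hv') : (F.triv x k u hx hu).hom ≫ R.elTr P x y h u v hu' hv' = (F.triv y k v hy hv).hom := by
  subst hu hv
  exact F.equivariant x y k hx hy

lemma elTr_triv_inv (x y : T ⟶ P.total) (k : T ⟶ X) (u v : T ⟶ 𝔸.obj) (hx) (hu) (hy) (hv) (h) (hu')
    (hv') : R.elTr P x y h u v hu' hv' ≫ (F.triv y k v hy hv).inv = (F.triv x k u hx hu).inv := by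
  rw [Iso.comp_inv_eq, Iso.eq_inv_comp, triv_elTr]

/-- The morphism given locally by an equivariant family. -/
def localHom (t : Theta P Q) (x : T ⟶ P.total) (y : T ⟶ Q.total) (k : T ⟶ X) (hx : x ≫ P.proj = k)
    (hy : y ≫ Q.proj = k) : (pb M k).obj A ⟶ (pb M k).obj B :=
  (F.triv x k (x ≫ P.anc) hx rfl).hom ≫ R.elTheta t x y (hx.trans hy.symm) _ _ rfl rfl ≫
    (G.triv y k (y ≫ Q.anc) hy rfl).inv

/-- Changing the points inserts transition morphisms, by equivariance of the two framings; the
equivariance of `t` absorbs them. -/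
lemma localHom_eq (t : Theta P Q) (x x' : T ⟶ P.total) (y y' : T ⟶ Q.total) (k : T ⟶ X) (hx) (hy)
    (hx') (hy') : F.localHom G t x y k hx hy = F.localHom G t x' y' k hx' hy' := by
  rw [localHom, localHom, ← F.triv_elTr x x' k (x ≫ P.anc) _ hx rfl hx' rfl (hx.trans hx'.symm) rfl
    rfl,
    ← G.elTr_triv_inv y' y k _ (y ≫ Q.anc) hy' rfl hy rfl (hy'.trans hy.symm) rfl rfl]
  simp only [Category.assoc]
  rw [← Category.assoc (R.elTheta t x' y' _ _ _ _ _), R.elTheta_elTr t x' y' y _ _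
    (hx'.trans hy.symm) _ _ _ _ _ _ _ rfl rfl, ← Category.assoc (R.elTr P _ _ _ _ _ _ _),
    R.elTr_elTheta t x x' y _ _ (hx.trans hy.symm) _ _ _ _ _ _ _ rfl rfl]

lemma rst_localHom (t : Theta P Q) (x : T ⟶ P.total) (y : T ⟶ Q.total) (k : T ⟶ X) (hx) (hy)
    (l : T' ⟶ T) (k' : T' ⟶ X) (h) (h₁) (h₂) :
    rst (F.localHom G t x y k hx hy) l k' k' h h = F.localHom G t (l ≫ x) (l ≫ y) k' h₁ h₂ := by
  rw [localHom, rst_comp _ _ l k' ((l ≫ x) ≫ P.anc) k' h (Category.assoc _ _ _).symm h,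
    rst_comp _ _ l _ ((l ≫ y) ≫ Q.anc) k' _ (Category.assoc _ _ _).symm h,
    F.rst_triv _ _ _ _ _ _ _ _ _ _ h₁ rfl, G.rst_triv_inv _ _ _ _ _ _ _ _ _ _ h₂ rfl,
    R.rst_elTheta _ _ _ _ _ _ _ _ _ _ _ _ _ (h₁.trans h₂.symm) rfl rfl]
  rfl

lemma localHom_mul (t : Theta P Q) (s : Theta Q S) (x : T ⟶ P.total) (y : T ⟶ Q.total)
    (z : T ⟶ S.total) (k : T ⟶ X) (hx) (hy) (hz) :
    F.localHom H (t.mul s) x z k hx hz = F.localHom G t x y k hx hy ≫ G.localHom H s y z k hy hz :=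
      by
  rw [localHom, localHom, localHom, R.elTheta_mul t s x y z (hx.trans hy.symm) (hy.trans hz.symm) _
    _ (y ≫ Q.anc) _ rfl rfl rfl rfl]
  simp only [Category.assoc, Iso.inv_hom_id_assoc]

/-- The equivariant family `t` is locally equal to `a`. -/
def Corr (a : A ⟶ B) (t : Theta P Q) : Prop :=
  ∀ ⦃T : 𝒞⦄ (x : T ⟶ P.total) (y : T ⟶ Q.total) (k : T ⟶ X) (hx : x ≫ P.proj = k)
    (hy : y ≫ Q.proj = k), F.localHom G t x y k hx hy = (pb M k).map a

variable {F G H}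

/-- `localHom` does not depend on the points and commutes with restriction, so the relation at
arbitrary points can be checked after pulling back the given cover, where the given points are
available. Faithfulness of restriction along a cover concludes. -/
lemma Corr.of_cover (hM : IsStack M) {W : 𝒞} {e : W ⟶ X} (he : IsCover e) {a : A ⟶ B}
    {t : Theta P Q} (x : W ⟶ P.total) (y : W ⟶ Q.total) (hx : x ≫ P.proj = e) (hy : y ≫ Q.proj = e)
    (h : F.localHom G t x y e hx hy = (pb M e).map a) : F.Corr G a t := by
  intro T x' y' k hx' hy'
  have c : pullback.fst k e ≫ k = pullback.snd k e ≫ e := pullback.condition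
  refine (hM.hasDescent (he.fst k)).rst_injective (x' := pullback.fst k e ≫ k)
    (y' := pullback.fst k e ≫ k) (hx := rfl) (hy := rfl) ?_
  rw [F.rst_localHom G t x' y' k hx' hy' _ _ rfl (by rw [Category.assoc, hx'])
    (by rw [Category.assoc, hy']), F.localHom_eq G t _ (pullback.snd k e ≫ x) _
      (pullback.snd k e ≫ y)
    _ _ _ (by rw [Category.assoc, hx, c]) (by rw [Category.assoc, hy, c]),
    ← F.rst_localHom G t x y e hx hy _ _ c.symm, h, rst_map, rst_map]

variable (F G) in
-- Written in the two trivializations at the universal pair of points of `P` and `Q`, `a` becomes a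
-- morphism between pullbacks of `C`, and so comes from an arrow of `𝔸`.
lemma exists_corr_theta (a : A ⟶ B) : ∃ t : Theta P Q, F.Corr G a t := by
  have hy₀ : pullback.snd P.proj Q.proj ≫ Q.proj = pullback.fst P.proj Q.proj ≫ P.proj :=
    pullback.condition.symm
  obtain ⟨val, hd, hc, hval⟩ := R.exists_el_eq
    ((F.triv (pullback.fst P.proj Q.proj) _ _ rfl rfl).inv ≫
      (pb M (pullback.fst P.proj Q.proj ≫ P.proj)).map a ≫
        (G.triv (pullback.snd P.proj Q.proj) _ _ hy₀ rfl).hom)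
  -- By restriction, the description of `val` at the universal pair holds at every pair of
  -- generalised points.
  have hl : ∀ {T : 𝒞} (x : T ⟶ P.total) (y : T ⟶ Q.total) (k : T ⟶ X) (hx : x ≫ P.proj = k)
      (hy : y ≫ Q.proj = k) (h : x ≫ P.proj = y ≫ Q.proj) (h₁) (h₂),
      R.el (pullback.lift x y h ≫ val) (x ≫ P.anc) (y ≫ Q.anc) h₁ h₂ =
        (F.triv x k _ hx rfl).inv ≫ (pb M k).map a ≫ (G.triv y k _ hy rfl).hom := by
    intro T x y k hx hy h h₁ h₂
    have e₁ : pullback.lift x y h ≫ pullback.fst P.proj Q.proj ≫ P.proj = k := by simpa using hx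
    have e₂ : pullback.lift x y h ≫ pullback.fst P.proj Q.proj ≫ P.anc = x ≫ P.anc := by simp
    have e₃ : pullback.lift x y h ≫ pullback.snd P.proj Q.proj ≫ Q.anc = y ≫ Q.anc := by simp
    rw [← R.rst_el val _ _ hd hc (pullback.lift x y h) _ _ e₂ e₃, hval,
      rst_comp _ _ _ _ k _ e₂ e₁ e₃, rst_comp _ _ _ _ k _ e₁ e₁ e₃, rst_map,
      F.rst_triv_inv _ _ _ _ _ _ _ _ _ _ (by simpa using hx) (by simp),
      G.rst_triv _ _ _ _ _ _ _ _ _ _ (by simpa using hy) (by simp),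
      F.triv_congr (pullback.lift_fst x y h) _ _ _ _ hx rfl,
      G.triv_congr (pullback.lift_snd x y h) _ _ _ _ hy rfl]
  have hd' : ∀ {T : 𝒞} (x : T ⟶ P.total) (y : T ⟶ Q.total) (h : x ≫ P.proj = y ≫ Q.proj),
      (pullback.lift x y h ≫ val) ≫ 𝔸.dom = x ≫ P.anc := fun x y h => by
    rw [Category.assoc, hd, pullback.lift_fst_assoc]
  have hc' : ∀ {T : 𝒞} (x : T ⟶ P.total) (y : T ⟶ Q.total) (h : x ≫ P.proj = y ≫ Q.proj),
      (pullback.lift x y h ≫ val) ≫ 𝔸.cod = y ≫ Q.anc := fun x y h => by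
    rw [Category.assoc, hc, pullback.lift_snd_assoc]
  refine ⟨⟨val, hd, hc, fun x x' y y' h h' hx hy h₁ h₂ => ?_⟩, fun T x y k hx hy => ?_⟩
  -- Equivariance is an equality of arrows, so it may be checked on the morphisms they realize;
  -- there it is the equivariance of the two framings.
  · refine R.ext_el (x ≫ P.anc) (y' ≫ Q.anc) ((mul_dom _ _ _).trans (tr_dom_anc _ _ _))
      ((mul_cod _ _ _).trans (hc' _ _ _)) ((mul_dom _ _ _).trans (hd' _ _ _))
      ((mul_cod _ _ _).trans (tr_cod_anc _ _ _)) ?_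
    rw [R.el_mul _ _ h₁ _ (x' ≫ P.anc) _ (tr_dom_anc _ _ _) (tr_cod_anc _ _ _) (hd' _ _ _)
      (hc' _ _ _),
      R.el_mul _ _ h₂ _ (y ≫ Q.anc) _ (hd' _ _ _) (hc' _ _ _) (tr_dom_anc _ _ _) (tr_cod_anc _ _ _)]
    rw [hl x' y' (x ≫ P.proj) hx.symm (h'.symm.trans hx.symm), hl x y _ rfl h.symm]
    have q₁ := F.elTr_triv_inv x x' (x ≫ P.proj) _ _ rfl rfl hx.symm rfl hx rfl rfl
    have q₂ := G.triv_elTr y y' (x ≫ P.proj) _ _ h.symm rfl (h'.symm.trans hx.symm) rfl hy rfl rfl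
    rw [← q₂, ← q₁]
    simp only [Category.assoc]
    rfl
  · rw [localHom]
    refine (congrArg (fun k => _ ≫ k ≫ _) (hl x y k hx hy _ _ _)).trans ?_
    simp

/-- With `exists_corr_theta`, `Corr.hom_eq` and `exists_corr_hom`, this makes `Corr` the graph of a
bijection between morphisms of framed objects and equivariant families. Here the trivializations
cancel and `el` is injective. -/
lemma Corr.theta_eq {a : A ⟶ B} {t t' : Theta P Q} (h : F.Corr G a t) (h' : F.Corr G a t') :
    t = t' := by
  apply Theta.ext'
  intro T x y hxy
  have e := (h x y _ rfl hxy.symm).trans (h' x y _ rfl hxy.symm).symm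
  rw [localHom, localHom, cancel_epi, cancel_mono] at e
  exact R.ext_el _ _ _ _ _ _ e

variable (P Q) in
lemma isCover_fst_proj : IsCover (pullback.fst P.proj Q.proj ≫ P.proj) :=
  (Q.isCover.fst _).comp P.isCover

/-- The pullbacks of `a` and `b` to the cover `P ×_X Q` of `X` both equal the local morphism given
by `t`. -/
lemma Corr.hom_eq (hM : IsStack M) {a b : A ⟶ B} {t : Theta P Q} (h : F.Corr G a t)
    (h' : F.Corr G b t) : a = b :=
  (hM.hasDescent (isCover_fst_proj P Q)).faithful
    ((h _ _ _ rfl pullback.condition.symm).symm.trans (h' _ _ _ rfl pullback.condition.symm))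

variable (F G) in
-- The local morphism at the universal pair of points lives over the cover `P ×_X Q` of `X`. It
-- descends because `localHom` does not depend on the points.
lemma exists_corr_hom (hM : IsStack M) (t : Theta P Q) : ∃ a : A ⟶ B, F.Corr G a t := by
  have hy₀ : pullback.snd P.proj Q.proj ≫ Q.proj = pullback.fst P.proj Q.proj ≫ P.proj :=
    pullback.condition.symm
  obtain ⟨a, ha⟩ := (hM.hasDescent (isCover_fst_proj P Q)).full
    (F.localHom G t (pullback.fst _ _) (pullback.snd _ _) _ rfl hy₀)
    (fun x y k hx hy => by
      rw [F.rst_localHom G t _ _ _ _ _ x k hx (by rw [Category.assoc, hx])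
          (by rw [Category.assoc, hy₀, hx]), F.rst_localHom G t _ _ _ _ _ y k hy
          (by rw [Category.assoc, hy]) (by rw [Category.assoc, hy₀, hy])]
      exact F.localHom_eq G t _ _ _ _ _ _ _ _ _)
  exact ⟨a, Corr.of_cover hM (isCover_fst_proj P Q) _ _ rfl hy₀ ha.symm⟩

/-- Over a cover carrying points of all three bundles, the local morphism of a product of families
is the composite of the local morphisms. -/
lemma Corr.comp (hM : IsStack M) {a : A ⟶ B} {b : B ⟶ D} {t : Theta P Q} {s : Theta Q S}
    (h : F.Corr G a t) (h' : G.Corr H b s) : F.Corr H (a ≫ b) (t.mul s) := by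
  obtain ⟨W, e, x, z, he, hx, hz⟩ := Theta.exists_cover₂ P S
  obtain ⟨W', c, y, hc, hy⟩ := Q.exists_local e
  refine Corr.of_cover hM (hc.comp he) (c ≫ x) (c ≫ z) (by rw [Category.assoc, hx])
    (by rw [Category.assoc, hz]) ?_
  rw [F.localHom_mul G H t s _ y _ _ _ hy, h, h', Functor.map_comp]

/-- At a point of `P` and its image under `φ`, the family of `φ` has an identity value, so its local
morphism just compares the two trivializations; `h` says that this comparison is `a`. -/
lemma Corr.ofHom (hM : IsStack M) (φ : P.Hom Q) (a : A ⟶ B)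
    (h : F.iso.hom = (pb M P.proj).map a ≫ (G.triv φ.hom P.proj P.anc φ.proj φ.hom_anc).hom) :
    F.Corr G a (Theta.ofHom φ) := by
  refine Corr.of_cover hM P.isCover (𝟙 _) φ.hom (Category.id_comp _) φ.proj ?_
  have e : (Theta.ofHom φ).app (𝟙 _) φ.hom ((Category.id_comp _).trans φ.proj.symm) =
      Q.tr φ.hom φ.hom rfl :=
    (Theta.ofHom_app _ _ _ _ (by rw [Category.id_comp])).trans (tr_congr (Category.id_comp _) rfl _)
  have k : 𝟙 _ ≫ P.anc = φ.hom ≫ Q.anc := (Category.id_comp _).trans φ.hom_anc.symm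
  have e' : ∀ u (hu : 𝟙 _ ≫ P.anc = u) (hv : φ.hom ≫ Q.anc = u), R.elTheta (Theta.ofHom φ) (𝟙 _)
      φ.hom ((Category.id_comp _).trans φ.proj.symm) u u hu hv = 𝟙 _ := fun u hu hv =>
    (R.el_congr e _ _ _ _).trans (R.elTr_self Q φ.hom rfl u hv hv)
  -- The two anchors are only propositionally equal to `P.anc`; as variables they can be
  -- substituted, after which the middle factor is an identity.
  have key : ∀ u v (hu : 𝟙 _ ≫ P.anc = u) (hv : φ.hom ≫ Q.anc = v), u = P.anc → v = P.anc →
      (F.triv (𝟙 _) P.proj u (Category.id_comp _) hu).hom ≫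
        R.elTheta (Theta.ofHom φ) (𝟙 _) φ.hom ((Category.id_comp _).trans φ.proj.symm) u v hu hv ≫
        (G.triv φ.hom P.proj v φ.proj hv).inv = (pb M P.proj).map a := by
    rintro u v hu hv rfl rfl
    rw [e', Category.id_comp, Iso.comp_inv_eq, ← h]
    exact rst_self _ _ _
  exact key _ _ rfl rfl (Category.id_comp _) φ.hom_anc

variable (F) in
lemma corr_id (hM : IsStack M) : F.Corr F (𝟙 A) (Theta.ofHom (Hom.id P)) := by
  refine Corr.ofHom hM _ _ ?_
  rw [CategoryTheory.Functor.map_id, Category.id_comp]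
  exact (rst_self _ _ _).symm

variable (F)

/-- The pullback of a framing. -/
def pull (f : Y ⟶ X) : Framing R ((pb M f).obj A) (P.pull f) where
  iso := compIso f (P.pull f).proj _ rfl A ≪≫
    F.triv (P.pullSnd f) ((P.pull f).proj ≫ f) (P.pull f).anc (pullSnd_proj f) (P.pullSnd_anc f)
  equivariant {T} x y k hx hy := by
    have kx : ∀ x : _ ⟶ (P.pull f).total, x ≫ (P.pull f).proj = k →
        (x ≫ P.pullSnd f) ≫ P.proj = k ≫ f := fun x hx => by
      rw [Category.assoc, pullSnd_proj, ← Category.assoc, hx]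
    have ax : ∀ x : T ⟶ (P.pull f).total, (x ≫ P.pullSnd f) ≫ P.anc = x ≫ (P.pull f).anc :=
      fun x => Category.assoc _ _ _
    have key : ∀ x (hx : x ≫ (P.pull f).proj = k), rst (A := (pb M f).obj A) (B := C)
        ((compIso f (P.pull f).proj _ rfl A).hom ≫
          (F.triv (P.pullSnd f) ((P.pull f).proj ≫ f) (P.pull f).anc (pullSnd_proj f)
            (P.pullSnd_anc f)).hom) x k _ hx rfl = (compIso f k (k ≫ f) rfl A).hom ≫
          (F.triv (x ≫ P.pullSnd f) (k ≫ f) (x ≫ (P.pull f).anc) (kx x hx) (ax x)).hom := by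
      intro x hx
      rw [rst_comp (A := (pb M f).obj A) (B := A) (C := C) _ _ x k (k ≫ f) _ hx
        (by rw [← Category.assoc, hx]) rfl, rst_compIso_hom,
        F.rst_triv _ _ _ _ _ _ _ _ _ _ (kx x hx) (ax x)]
    rw [Iso.trans_hom, key x hx, key y hy, Category.assoc]
    congr 1
    have hxy : (x ≫ P.pullSnd f) ≫ P.proj = (y ≫ P.pullSnd f) ≫ P.proj := by rw [kx x hx, kx y hy]
    refine Eq.trans ?_ (F.triv_elTr (x ≫ P.pullSnd f) (y ≫ P.pullSnd f) (k ≫ f) _ _ (kx x hx) (ax x)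
      (kx y hy) (ax y) hxy (ax x) (ax y))
    exact congrArg (fun k => _ ≫ k) (R.el_congr (tr_pull f x y _ hxy) _ _ _ _)

/-- Reduces the pulled-back framing at a point to the original framing at the underlying point, up
to coherence. -/
lemma pull_triv (f : Y ⟶ X) (x : T ⟶ (P.pull f).total) (k : T ⟶ Y) (m : T ⟶ X) (u : T ⟶ 𝔸.obj)
    (hm : k ≫ f = m) (hx) (hu) (hx') (hu') :
    (F.pull f).triv x k u hx hu = compIso f k m hm A ≪≫ F.triv (x ≫ P.pullSnd f) m u hx' hu' := by
  ext
  have : x ≫ (P.pull f).proj ≫ f = m := by rw [← Category.assoc, hx, hm]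
  refine (rst_comp (A := (pb M f).obj A) (B := A) (C := C) _ _ x k m u hx this hu).trans ?_
  rw [rst_compIso_hom, F.rst_triv _ _ _ _ _ _ _ _ _ _ hx' hu']
  rfl

variable {F}

lemma Corr.pull {a : A ⟶ B} {t : Theta P Q} (h : F.Corr G a t) (f : Y ⟶ X) :
    (F.pull f).Corr (G.pull f) ((pb M f).map a) (t.pull f) := by
  intro T x y k hx hy
  have hx' : (x ≫ P.pullSnd f) ≫ P.proj = k ≫ f := by
    rw [Category.assoc, pullSnd_proj, ← Category.assoc, hx]
  have hy' : (y ≫ Q.pullSnd f) ≫ Q.proj = k ≫ f := by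
    rw [Category.assoc, pullSnd_proj, ← Category.assoc, hy]
  have hxy := hx'.trans hy'.symm
  have ex : (x ≫ P.pullSnd f) ≫ P.anc = x ≫ (P.pull f).anc := Category.assoc _ _ _
  have ey : (y ≫ Q.pullSnd f) ≫ Q.anc = y ≫ (Q.pull f).anc := Category.assoc _ _ _
  rw [localHom, F.pull_triv f x k (k ≫ f) _ rfl hx rfl hx' ex,
    G.pull_triv f y k (k ≫ f) _ rfl hy rfl hy' ey]
  have e : R.elTheta (t.pull f) x y (hx.trans hy.symm) _ _ rfl rfl =
      R.elTheta t (x ≫ P.pullSnd f) (y ≫ Q.pullSnd f) hxy _ _ ex ey :=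
    R.el_congr (t.pull_app f x y _ hxy) _ _ _ _
  rw [e]
  -- The hypothesis `h`, with anchors as variables so that it also applies with those of the
  -- pulled-back bundles.
  have key : ∀ u v (hu : (x ≫ P.pullSnd f) ≫ P.anc = u) (hv : (y ≫ Q.pullSnd f) ≫ Q.anc = v),
      (F.triv _ (k ≫ f) u hx' hu).hom ≫ R.elTheta t _ _ hxy u v hu hv ≫
        (G.triv _ (k ≫ f) v hy' hv).inv = (pb M (k ≫ f)).map a := by
    rintro u v rfl rfl
    exact h _ _ _ hx' hy'
  have key' := key _ _ ex ey
  simp only [Iso.trans_hom, Iso.trans_inv, Category.assoc]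
  rw [reassoc_of% key', ← Category.assoc, Iso.comp_inv_eq, compIso_naturality]

variable (F)

/-- Shows that the unit isomorphisms of `M` and of `Prin` correspond, as the unit law of the natural
equivalence will require. -/
lemma corr_pullId (hM : IsStack M) :
    (F.pull (𝟙 X)).Corr F (unitIso A).hom (Theta.ofHom P.pullId) := by
  refine Corr.ofHom hM _ _ ?_
  have h := F.pull_triv (𝟙 X) (𝟙 _) (P.pull (𝟙 X)).proj (P.pull (𝟙 X)).proj (P.pull (𝟙 X)).anc
    (Category.comp_id _) (Category.id_comp _) (Category.id_comp _)
    (by rw [Category.id_comp, pullSnd_proj, Category.comp_id])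
      (by rw [Category.id_comp, pullSnd_anc])
  rw [map_unitIso, F.triv_congr (x := P.pullId.hom) (x' := 𝟙 _ ≫ P.pullSnd (𝟙 X))
    (Category.id_comp _).symm _ _ _ _
    (by rw [Category.id_comp, pullSnd_proj, Category.comp_id])
      (by rw [Category.id_comp, pullSnd_anc])]
  refine Eq.trans ?_ (congrArg Iso.hom h)
  exact (rst_self _ _ _).symm

/-- The analogue for composition: after both framings are written at the underlying point of `P`,
the statement is the associativity coherence `map_compIso_comp`. -/
lemma corr_pullComp (hM : IsStack M) (f : Y ⟶ X) (g : Z ⟶ Y) :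
    (F.pull (g ≫ f)).Corr ((F.pull f).pull g) (compIso f g (g ≫ f) rfl A).inv
      (Theta.ofHom (P.pullComp g f)) := by
  refine Corr.ofHom hM _ _ ?_
  have h := F.pull_triv (g ≫ f) (𝟙 _) (P.pull (g ≫ f)).proj ((P.pull (g ≫ f)).proj ≫ g ≫ f)
    (P.pull (g ≫ f)).anc rfl (Category.id_comp _) (Category.id_comp _)
    (by rw [Category.id_comp, pullSnd_proj]) (by rw [Category.id_comp, pullSnd_anc])
  have e : 𝟙 _ ≫ P.pullSnd (g ≫ f) = ((P.pullComp g f).hom ≫ (P.pull f).pullSnd g) ≫ P.pullSnd f :=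
    (Category.id_comp _).trans (P.pullComp_snd_snd f g).symm
  have k₁ : (((P.pullComp g f).hom ≫ (P.pull f).pullSnd g) ≫ P.pullSnd f) ≫ P.proj =
      (P.pull (g ≫ f)).proj ≫ g ≫ f := by rw [← e, Category.id_comp, pullSnd_proj]
  have k₂ : (((P.pullComp g f).hom ≫ (P.pull f).pullSnd g) ≫ P.pullSnd f) ≫ P.anc =
      (P.pull (g ≫ f)).anc := by rw [← e, Category.id_comp]; rfl
  have k₃ : ((P.pullComp g f).hom ≫ (P.pull f).pullSnd g) ≫ (P.pull f).proj =
      (P.pull (g ≫ f)).proj ≫ g := by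
    rw [Category.assoc, pullSnd_proj, ← Category.assoc, (P.pullComp g f).proj]
  have k₄ : ((P.pullComp g f).hom ≫ (P.pull f).pullSnd g) ≫ (P.pull f).anc =
      (P.pull (g ≫ f)).anc := by rw [← P.pullSnd_anc f, ← Category.assoc, k₂]
  rw [(F.pull f).pull_triv g _ (P.pull (g ≫ f)).proj _ _ rfl _ _ k₃ k₄,
    F.pull_triv f _ _ ((P.pull (g ≫ f)).proj ≫ g ≫ f) _ (Category.assoc _ _ _) _ _ k₁ k₂]
  have h' := congrArg Iso.hom h
  rw [F.triv_congr e _ _ _ _ k₁ k₂] at h'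
  refine ((rst_self _ _ _).symm.trans h').trans ?_
  simp only [Iso.trans_hom]
  rw [← Category.assoc ((compIso g _ _ _ _).hom), ← map_compIso_comp f g _ (g ≫ f) _ _ rfl rfl rfl]
  simp

end Framing

end LaxGeometric

end

/-! ### Existence of framings, and the equivalence with principal bundles -/

noncomputable section
namespace LaxGeometric

variable {𝒞 : Type u} [Category.{v} 𝒞] [HasFiniteLimits 𝒞]

attribute [local simp] pullback.lift_fst pullback.lift_snd pullback.lift_fst_assoc
  pullback.lift_snd_assoc

open InternalCategory PrincipalBundle

variable {M : LocallyDiscrete 𝒞ᵒᵖ ⥤ᵖ Cat.{v₁, u₁}} {X Y Z T T' : 𝒞} {𝔸 : InternalCategory 𝒞}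
  {C : M.obj ⟨op 𝔸.obj⟩} (R : Realization M 𝔸 C)

/-- Every bundle frames an object. -/
lemma Realization.exists_framing_of_bundle (hM : IsStack M) (P : PrincipalBundle 𝔸.core X) :
    ∃ A : M.obj ⟨op X⟩, Nonempty (Framing R A P) := by
  -- The transition arrows of `P` realize descent data on the pullback of `C` along the anchor. The
  -- comparison isomorphism of the descended object is the trivialization, and its compatibility
  -- with the data is equivariance.
  obtain ⟨A, b, hb⟩ := (hM.hasDescent P.isCover).effective P.anc C
    (fun x y h => R.elTr P x y h _ _ rfl rfl)
    (fun k x y h h' => R.rst_elTr P _ _ _ _ _ _ _ _ _ _ _ _ _ _ _)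
    (fun x => R.elTr_self P _ _ _ _ _)
    (fun x y z h h' => R.elTr_comp P _ _ _ _ _ _ _ _ _ _ _ _ _ _ _)
  exact ⟨A, ⟨⟨b, fun x y k hx hy => hb x y k hx hy⟩⟩⟩

/-- A trivialization of `A` over a cover defines a bundle. -/
lemma Realization.exists_bundle_of_iso {p : Y ⟶ X} (hp : IsCover p) (q : Y ⟶ 𝔸.obj)
    {A : M.obj ⟨op X⟩} (i : (pb M p).obj A ≅ (pb M q).obj C) :
    ∃ (Q : PrincipalBundle 𝔸.core X) (s : Y ⟶ Q.total), s ≫ Q.proj = p ∧ s ≫ Q.anc = q ∧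
      ∀ {T : 𝒞} (x y : T ⟶ Y) (k : T ⟶ X) (u v : T ⟶ 𝔸.obj) (hx : x ≫ p = k) (hy : y ≫ p = k)
        (hu : x ≫ q = u) (hv : y ≫ q = v) (h) (hu') (hv'),
        rst i.hom x k u hx hu ≫ R.elTr Q (x ≫ s) (y ≫ s) h u v hu' hv' =
          rst i.hom y k v hy hv := by
  -- The cocycle compares two trivializations of the same pullback of `A`: `c x y` is the arrow that
  -- realizes the inverse of `i` at `x` followed by `i` at `y`.
  choose c hd hc hval using fun {T : 𝒞} (x y : T ⟶ Y) (h : x ≫ p = y ≫ p) =>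
    R.exists_el_eq (rst i.inv x (x ≫ q) (x ≫ p) rfl rfl ≫ rst i.hom y (x ≫ p) (y ≫ q) h.symm rfl)
  have key : ∀ {T : 𝒞} (x y : T ⟶ Y) (h : x ≫ p = y ≫ p) (k : T ⟶ X) (u v : T ⟶ 𝔸.obj)
      (hx : x ≫ p = k) (hy : y ≫ p = k) (hu : x ≫ q = u) (hv : y ≫ q = v) (h₁) (h₂),
      R.el (c x y h) u v h₁ h₂ = rst i.inv x u k hu hx ≫ rst i.hom y k v hy hv := by
    intro T x y h k u v hx hy hu hv h₁ h₂
    subst hx hu hv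
    exact hval x y h
  -- Each cocycle law is checked on realized morphisms, where the inner factors `i` and its inverse
  -- cancel.
  obtain ⟨Q, s, hs, hsa, hst⟩ := exists_of_cocycle (𝔸 := 𝔸) hp q c hd hc
    (fun {T T'} k x y h h' => by
      refine R.ext_el ((k ≫ x) ≫ q) ((k ≫ y) ≫ q) (by simp [hd]) (by simp [hc]) (hd _ _ _)
        (hc _ _ _) ?_
      rw [hval, ← R.rst_el (c x y h) _ _ (hd _ _ _) (hc _ _ _) k _ _ (Category.assoc _ _ _).symm
        (Category.assoc _ _ _).symm, hval,
        rst_comp _ _ k _ ((k ≫ x) ≫ p) _ _ (Category.assoc _ _ _).symm,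
        rst_rst _ _ _ _ _ _ _ _ rfl, rst_rst _ _ _ _ _ _ _ _ rfl])
    (fun x h => by
      refine R.ext_el (x ≫ q) (x ≫ q) (hd _ _ _) (hc _ _ _) (by simp [𝔸.ident_dom])
        (by simp [𝔸.ident_cod]) ?_
      rw [hval, R.el_ident, ← rst_comp, i.inv_hom_id, rst_id])
    (fun x y z h₁ h₂ h₃ h₄ => by
      refine R.ext_el (x ≫ q) (z ≫ q) ((mul_dom _ _ _).trans (hd _ _ _))
        ((mul_cod _ _ _).trans (hc _ _ _)) (hd _ _ _) (hc _ _ _) ?_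
      rw [R.el_mul _ _ h₃ _ (y ≫ q) _ (hd _ _ _) (hc _ _ _) (hd _ _ _) (hc _ _ _),
        key x y h₁ (x ≫ p) _ _ rfl h₁.symm rfl rfl,
        key y z h₂ (x ≫ p) _ _ h₁.symm h₄.symm rfl rfl, key x z h₄ (x ≫ p) _ _ rfl h₄.symm rfl rfl,
        Category.assoc, ← Category.assoc (rst i.hom y _ _ _ _), ← rst_comp, i.hom_inv_id, rst_id,
        Category.id_comp])
  refine ⟨Q, s, hs, hsa, fun x y k u v hx hy hu hv h hu' hv' => ?_⟩
  rw [elTr, R.el_congr (hst x y (hx.trans hy.symm) h), key x y _ k u v hx hy hu hv,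
    ← Category.assoc, ← rst_comp, i.hom_inv_id, rst_id, Category.id_comp]

/-- Every object that is locally a pullback of `C` is framed by a bundle. -/
lemma Realization.exists_framing_of_iso (hM : IsStack M) {p : Y ⟶ X} (hp : IsCover p)
    (q : Y ⟶ 𝔸.obj) {A : M.obj ⟨op X⟩} (i : (pb M p).obj A ≅ (pb M q).obj C) :
    ∃ P : PrincipalBundle 𝔸.core X, Nonempty (Framing R A P) := by
  obtain ⟨Q, s, hs, hsa, H⟩ := R.exists_bundle_of_iso hp q i
  have hsp : ∀ {T : 𝒞} (z : T ⟶ Y) (k : T ⟶ X), z ≫ p = k → (z ≫ s) ≫ Q.proj = k :=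
    fun z k hz => by rw [Category.assoc, hs, hz]
  have hsq : ∀ {T : 𝒞} (z : T ⟶ Y), (z ≫ s) ≫ Q.anc = z ≫ q :=
    fun z => by rw [Category.assoc, hsa]
  -- The framing at a point `x` of `Q`, given a point `z` of `Y` in the same fibre: trivialize `A`
  -- by `i` at `z`, then move from the section at `z` to `x` by the transition of `Q`.
  let Φ : ∀ {T : 𝒞} (x : T ⟶ Q.total) (z : T ⟶ Y) (k : T ⟶ X) (u : T ⟶ 𝔸.obj)
      (_ : x ≫ Q.proj = k) (_ : z ≫ p = k) (_ : x ≫ Q.anc = u),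
      ((pb M k).obj A ≅ (pb M u).obj C) := fun x z k u hx hz hu =>
    rstIso i z k (z ≫ q) hz rfl ≪≫
      R.elTrIso Q (z ≫ s) x ((hsp z k hz).trans hx.symm) (z ≫ q) u (hsq z) hu
  -- Replacing `z` by `z'` changes `i` by the transition between the two values of the section
  -- (`H`), which the second factor absorbs.
  have Φ_eq : ∀ {T : 𝒞} (x : T ⟶ Q.total) (z z' : T ⟶ Y) (k : T ⟶ X) (u : T ⟶ 𝔸.obj) (hx) (hz)
      (hz') (hu), (Φ x z k u hx hz hu).hom = (Φ x z' k u hx hz' hu).hom := by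
    intro T x z z' k u hx hz hz' hu
    have h' : (z' ≫ s) ≫ Q.proj = (z ≫ s) ≫ Q.proj := by rw [hsp z k hz, hsp z' k hz']
    simp only [Φ, Iso.trans_hom, rstIso_hom, elTrIso_hom]
    rw [← H z' z k _ _ hz' hz rfl rfl h' (hsq _) (hsq _), Category.assoc, R.elTr_comp]
  have rst_Φ : ∀ {T T' : 𝒞} (x : T ⟶ Q.total) (z : T ⟶ Y) (k : T ⟶ X) (u : T ⟶ 𝔸.obj) (hx) (hz)
      (hu) (l : T' ⟶ T) (k' : T' ⟶ X) (u' : T' ⟶ 𝔸.obj) (hk') (hu') (h₁) (h₂) (h₃),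
      rst (Φ x z k u hx hz hu).hom l k' u' hk' hu' =
        (Φ (l ≫ x) (l ≫ z) k' u' h₁ h₂ h₃).hom := by
    intro T T' x z k u hx hz hu l k' u' hk' hu' h₁ h₂ h₃
    refine (rst_comp (A := A) (B := C) (C := C) _ _ l k' ((l ≫ z) ≫ q) u' hk'
      (Category.assoc _ _ _).symm hu').trans ?_
    rw [rstIso_hom, rst_rst _ _ _ _ _ _ _ _ rfl, elTrIso_hom, R.rst_elTr Q _ _ _ _ _ _ _ _ _ _ _ _
      (by rw [Category.assoc, hsp z k hz, h₁, hk']) (by rw [Category.assoc, hsq, Category.assoc])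
        h₃]
    exact congrArg (fun t => _ ≫ t)
      (R.elTr_congr Q (Category.assoc _ _ _).symm rfl _ _ _ _ _ ((hsp _ _ h₂).trans h₁.symm)
        (hsq _) h₃)
  have Φ_congr : ∀ {T : 𝒞} {x x' : T ⟶ Q.total} {z z' : T ⟶ Y} (_ : x = x') (_ : z = z') (k : T ⟶ X)
      (u : T ⟶ 𝔸.obj) (hx) (hz) (hu) (hx') (hz') (hu'),
      (Φ x z k u hx hz hu).hom = (Φ x' z' k u hx' hz' hu').hom := by
    intro T x x' z z' h h' k u hx hz hu hx' hz' hu'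
    subst h h'
    rfl
  have he : IsCover (pullback.fst Q.proj p) := hp.fst _
  have hc : pullback.snd Q.proj p ≫ p = pullback.fst Q.proj p ≫ Q.proj := pullback.condition.symm
  -- Auxiliary points `z` exist over the cover `Q ×_X Y` of the total space; being independent of
  -- them, `Φ` descends to the total space.
  obtain ⟨a, ha⟩ := (hM.hasDescent he).exists_rst_eq Q.proj Q.anc _ _ rfl rfl
    (Φ (pullback.fst Q.proj p) (pullback.snd Q.proj p) _ _ rfl hc rfl).hom (by
      intro T k l u v hu hv hu' hv' hkl
      have e : ∀ k : T ⟶ pullback Q.proj p, k ≫ pullback.fst Q.proj p ≫ Q.proj = u →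
          (k ≫ pullback.snd Q.proj p) ≫ p = u := fun k hk => by rw [Category.assoc, hc, hk]
      have e₁ : ∀ k : T ⟶ pullback Q.proj p, k ≫ pullback.fst Q.proj p ≫ Q.proj = u →
          (k ≫ pullback.fst Q.proj p) ≫ Q.proj = u := fun k hk => by rw [Category.assoc, hk]
      have e₂ : ∀ k : T ⟶ pullback Q.proj p, k ≫ pullback.fst Q.proj p ≫ Q.anc = v →
          (k ≫ pullback.fst Q.proj p) ≫ Q.anc = v := fun k hk => by rw [Category.assoc, hk]
      rw [rst_Φ _ _ _ _ rfl hc rfl k u v hu hv (e₁ k hu) (e k hu) (e₂ k hv),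
        rst_Φ _ _ _ _ rfl hc rfl l u v hu' hv' (e₁ l hu') (e l hu') (e₂ l hv')]
      exact (Φ_congr hkl rfl u v (e₁ k hu) (e k hu) (e₂ k hv) (e₁ l hu') (e k hu) (e₂ l hv')).trans
        (Φ_eq _ _ _ u v (e₁ l hu') (e k hu) (e l hu') (e₂ l hv')))
  have rst_a : ∀ {T : 𝒞} (x : T ⟶ Q.total) (z : T ⟶ Y) (k : T ⟶ X) (u : T ⟶ 𝔸.obj) (hx) (hz) (hu),
      rst a x k u hx hu = (Φ x z k u hx hz hu).hom := by
    intro T x z k u hx hz hu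
    have l₁ : pullback.lift x z (hx.trans hz.symm) ≫ pullback.fst Q.proj p = x :=
      pullback.lift_fst _ _ _
    have l₂ : pullback.lift x z (hx.trans hz.symm) ≫ pullback.snd Q.proj p = z :=
      pullback.lift_snd _ _ _
    rw [← rst_rst a (pullback.fst Q.proj p) _ _ rfl rfl _ _ l₁ k u
      (by rw [← Category.assoc, l₁, hx]) (by rw [← Category.assoc, l₁, hu]), ha,
      rst_Φ _ _ _ _ rfl _ _ _ _ _ _ _ (by rw [l₁, hx]) (by rw [l₂, hz]) (by rw [l₁, hu])]
    exact Φ_congr l₁ l₂ _ _ (by rw [l₁, hx]) _ _ hx _ _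
  -- The descended morphism is invertible because its restriction `Φ` to a cover is.
  have := (hM.hasDescent he).isIso_of_rst a _ _ rfl rfl _ ha
  refine ⟨Q, ⟨⟨asIso a, fun {T} x y k hx hy => ?_⟩⟩⟩
  have hc' : pullback.snd k p ≫ p = pullback.fst k p ≫ k := pullback.condition.symm
  have hx' : (pullback.fst k p ≫ x) ≫ Q.proj = pullback.fst k p ≫ k := by rw [Category.assoc, hx]
  have hy' : (pullback.fst k p ≫ y) ≫ Q.proj = pullback.fst k p ≫ k := by rw [Category.assoc, hy]
  -- Equivariance is checked over a cover where a point `z` of `Y` is available. There both sides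
  -- trivialize at the same `z`, and the transitions from the section to `x` and from `x` to `y`
  -- compose.
  refine (hM.hasDescent (hp.fst k)).rst_injective (x' := pullback.fst k p ≫ k)
    (y' := (pullback.fst k p ≫ y) ≫ Q.anc) (hx := rfl) (hy := (Category.assoc _ _ _).symm) ?_
  rw [rst_comp (A := A) (B := C) (C := C) _ _ _ _ ((pullback.fst k p ≫ x) ≫ Q.anc) _ rfl
      (Category.assoc _ _ _).symm, rst_rst _ _ _ _ _ _ _ _ rfl, rst_rst _ _ _ _ _ _ _ _ rfl,
    R.rst_elTr Q _ _ _ _ _ _ _ _ _ _ _ _ (hx'.trans hy'.symm) rfl rfl, asIso_hom,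
    rst_a _ (pullback.snd k p) _ _ hx' hc' rfl, rst_a _ (pullback.snd k p) _ _ hy' hc' rfl]
  simp only [Φ, Iso.trans_hom, rstIso_hom, elTrIso_hom, Category.assoc]
  rw [R.elTr_comp]

namespace Framing

variable {R} {A B D : M.obj ⟨op X⟩} {P Q S : PrincipalBundle 𝔸.core X}

/-- The morphism of bundles that corresponds to a morphism of framed objects. -/
def arrow (F : Framing R A P) (G : Framing R B Q) (a : A ⟶ B) : Arrow P Q :=
  Arrow.ofTheta (F.exists_corr_theta G a).choose

lemma corr_arrow (F : Framing R A P) (G : Framing R B Q) (a : A ⟶ B) :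
    F.Corr G a (F.arrow G a).theta := by
  rw [arrow, Arrow.theta_ofTheta]
  exact (F.exists_corr_theta G a).choose_spec

variable {F : Framing R A P} {G : Framing R B Q} {H : Framing R D S}

/-- The definition of `arrow` involves a choice; this characterizes it by `Corr`, and the properties
below follow from those of `Corr`. -/
lemma arrow_eq {a : A ⟶ B} {f : Arrow P Q} (h : F.Corr G a f.theta) : F.arrow G a = f :=
  Arrow.ext ((F.corr_arrow G a).theta_eq h)

variable (F G H)

/-- Holds for arbitrary framings, so that different framings of one object can be compared through
its identity morphism. -/
lemma arrow_comp (hM : IsStack M) (a : A ⟶ B) (b : B ⟶ D) :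
    (F.arrow G a).comp (G.arrow H b) = F.arrow H (a ≫ b) := by
  refine (arrow_eq ?_).symm
  rw [Arrow.comp_theta]
  exact (F.corr_arrow G a).comp hM (G.corr_arrow H b)

lemma arrow_id (hM : IsStack M) : F.arrow F (𝟙 A) = Arrow.ofHom (Hom.id P) := by
  refine arrow_eq ?_
  rw [Arrow.ofHom_theta]
  exact F.corr_id hM

lemma arrow_pull (a : A ⟶ B) (f : Y ⟶ X) :
    (F.arrow G a).pull f = (F.pull f).arrow (G.pull f) ((pb M f).map a) := by
  refine (arrow_eq ?_).symm
  rw [Arrow.pull_theta]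
  exact (F.corr_arrow G a).pull f

lemma arrow_pullId (hM : IsStack M) :
    (F.pull (𝟙 X)).arrow F (unitIso A).hom = Arrow.ofHom P.pullId := by
  refine arrow_eq ?_
  rw [Arrow.ofHom_theta]
  exact F.corr_pullId hM

lemma arrow_pullComp (hM : IsStack M) (f : Y ⟶ X) (g : Z ⟶ Y) :
    (F.pull (g ≫ f)).arrow ((F.pull f).pull g) (compIso f g (g ≫ f) rfl A).inv =
      Arrow.ofHom (P.pullComp g f) := by
  refine arrow_eq ?_
  rw [Arrow.ofHom_theta]
  exact F.corr_pullComp hM f g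

lemma arrow_bijective (hM : IsStack M) : Function.Bijective (F.arrow G) := by
  refine ⟨fun a b h => ?_, fun f => ?_⟩
  · have h₁ := F.corr_arrow G a
    rw [h] at h₁
    exact h₁.hom_eq hM (F.corr_arrow G b)
  · obtain ⟨a, ha⟩ := F.exists_corr_hom G hM f.theta
    exact ⟨a, arrow_eq ha⟩

/-- The isomorphism of bundles given by two framings of the same object. -/
def isoOfFramings (hM : IsStack M) {P Q : PrincipalBundle 𝔸.core X} (F : Framing R A P)
    (G : Framing R A Q) : ofBun P ≅ ofBun Q where
  hom := F.arrow G (𝟙 A)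
  inv := G.arrow F (𝟙 A)
  hom_inv_id := (F.arrow_comp G F hM _ _).trans
    ((congrArg (F.arrow F) (Category.id_comp _)).trans (F.arrow_id hM))
  inv_hom_id := (G.arrow_comp F G hM _ _).trans
    ((congrArg (G.arrow G) (Category.id_comp _)).trans (G.arrow_id hM))

end Framing

/-- A choice of framings gives an equivalence with the pseudofunctor of principal bundles. -/
def Realization.natEquivalence {R : Realization M 𝔸 C} (hM : IsStack M)
    (P : ∀ {X : 𝒞}, M.obj ⟨op X⟩ → PrincipalBundle 𝔸.core X)
    (F : ∀ {X : 𝒞} (A : M.obj ⟨op X⟩), Framing R A (P A)) : NatEquivalence M (Prin 𝔸) where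
  app X :=
    { obj A := ofBun (P A)
      map {A B} a := (F A).arrow (F B) a
      map_id A := (F A).arrow_id hM
      map_comp {A B D} a b := ((F A).arrow_comp (F B) (F D) hM a b).symm }
  isEquivalence X :=
    { faithful := ⟨fun {A B} _ _ h => ((F A).arrow_bijective (F B) hM).1 h⟩
      full := ⟨fun {A B} f => ((F A).arrow_bijective (F B) hM).2 f⟩
      essSurj := ⟨fun U => by
        -- The bundle of `U` frames some `A`, and two bundles that frame the same object are
        -- isomorphic.
        obtain ⟨A, ⟨G⟩⟩ := R.exists_framing_of_bundle hM (bun U)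
        exact ⟨A, ⟨Framing.isoOfFramings hM (F A) G⟩⟩⟩ }
  nat {X Y} f := NatIso.ofComponents
    -- The chosen framing of the pullback of `A` and the pullback of the chosen framing of `A` frame
    -- the same object. All components are thus instances of `arrow` at an identity, and naturality
    -- follows from `arrow_comp` and `arrow_pull`.
    (fun A => Framing.isoOfFramings hM (F ((pb M f).obj A)) ((F A).pull f))
    (fun {A B} a => by
      refine (Framing.arrow_comp _ (F ((pb M f).obj B)) ((F B).pull f) hM _ _).trans (Eq.trans ?_
        (Eq.trans (Framing.arrow_comp (F ((pb M f).obj A)) ((F A).pull f) ((F B).pull f) hM _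
          ((pb M f).map a)).symm (congrArg (fun t => Arrow.comp _ t)
            ((F A).arrow_pull (F B) a f).symm)))
      rw [Category.comp_id, Category.id_comp]
      rfl)
  nat_naturality_id X A := by
    -- The coherence isomorphism of `Prin` is replaced by the `arrow` of the one of `M`; both sides
    -- then become `arrow` of the same morphism between the same framings.
    refine (congrArg (fun t => Arrow.comp _ t) ((F A).arrow_pullId hM).symm).trans ?_
    refine (Framing.arrow_comp _ _ _ hM _ _).trans ?_
    rw [Category.id_comp]
    rfl
  nat_naturality_comp {X Y Z} f g A := by
    -- As for the unit law: every factor is an `arrow`, so each side collapses to the `arrow` of the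
    -- inverse of `compIso`.
    refine (congrArg (fun t => Arrow.comp _ t) ((F A).arrow_pullComp hM f g).symm).trans ?_
    refine (Framing.arrow_comp _ _ _ hM _ _).trans (Eq.symm ?_)
    rw [← compIso_rfl_inv]
    refine (congrArg (fun t => Arrow.comp _ (Arrow.comp _ t))
      ((F ((pb M f).obj A)).arrow_pull ((F A).pull f) (𝟙 _) g)).trans ?_
    refine (congrArg (fun t => Arrow.comp _ t) (Framing.arrow_comp _ _ _ hM _ _)).trans ?_
    refine (Framing.arrow_comp _ _ _ hM _ _).trans ?_
    simp only [CategoryTheory.Functor.map_id, Category.id_comp]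
    exact congrArg (Framing.arrow _ _) (Category.comp_id _)

/-- A stack with a generic object whose morphisms are representable is lax-geometric. -/
lemma IsLaxGeometric.of_generic (hM : IsStack M) {C₀ C₁ : 𝒞} {C : M.obj ⟨op C₀⟩}
    (hC : LocallyPullbackOf M C) (h : RepresentsTriples M C C₁) : IsLaxGeometric M := by
  obtain ⟨K⟩ := h.nonempty_classifier
  have hF : ∀ {X : 𝒞} (A : M.obj ⟨op X⟩), ∃ P : PrincipalBundle K.internalCategory.core X,
      Nonempty (Framing K.realization A P) := by
    intro X A
    obtain ⟨Y, p, q, hp, ⟨i⟩⟩ := hC X A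
    exact K.realization.exists_framing_of_iso hM hp q i
  exact ⟨K.internalCategory, ⟨Realization.natEquivalence hM (fun A => (hF A).choose)
    (fun A => (hF A).choose_spec.some)⟩⟩

end LaxGeometric

end

theorem mainTheorem3 {𝒞 : Type u} [Category.{v} 𝒞] [HasFiniteLimits 𝒞]
    (M : LocallyDiscrete 𝒞ᵒᵖ ⥤ᵖ Cat.{v₁, u₁}) :
    LaxGeometric.IsLaxGeometric M ↔
      LaxGeometric.IsStack M ∧
        ∃ (C₀ : 𝒞) (C : M.obj ⟨op C₀⟩),
          LaxGeometric.LocallyPullbackOf M C ∧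
            ∃ C₁ : 𝒞, LaxGeometric.RepresentsTriples M C C₁ := by
  exact ⟨LaxGeometric.IsLaxGeometric.exists_generic, fun ⟨hM, _, _, hC, _, h⟩ =>
    LaxGeometric.IsLaxGeometric.of_generic hM hC h⟩
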